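/- All graphs are finite and simple. A graph is \emph{$4$-critical} if it is not $3$-colorable but all of its proper subgraphs are. For a graph $G$, let $T(G)$ be the maximum number of pairwise vertex-disjoint cycles of length at most four in $G$, and let $$p(G) = 5|V(G)| - 3|E(G)| - T(G).$$ An \emph{Ore-composition} of disjoint graphs $G_1$ and $G_2$ is a graph obtained as follows: delete an edge $xy$ from $G_1$; split some vertex $z$ of $G_2$ into two vertices $z_1, z_2$ of positive degree (each edge at $z$ becomes an edge at exactly one of $z_1, z_2$); identify $x$ with $z_1$ and $y$ with $z_2$. A graph is \emph{$4$-Ore} if it can be obtained from copies of $K_4$ by repeated Ore-compositions. Let $H_7$ be the $4$-Ore graph on seven vertices (the Moser spindle), and let $W_5$ be the graph obtained from the $5$-cycle by adding one vertex adjacent to all other vertices. Let $T_8$ be the graph on $\{0,\dots,7\}$ with edges $$01,\ 12,\ 20,\ 03,\ 14,\ 25,\ 36,\ 37,\ 46,\ 47,\ 56,\ 57,\ 67,$$ and let $T_{11}$ be the graph on $\{0,\dots,10\}$ obtained from $T_8$ by deleting the edge $01$ and adding the vertices $8, 9, 10$ and the edges $\{0,8\}, \{8,9\}, \{8,10\},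 \{9,10\}, \{9,1\}, \{10,1\}$. \textbf{Theorem.} Let $G$ be a $4$-critical graph. Then, with graphs identified up to isomorphism, \begin{enumerate} \item $p(G) = 1$ if $G = K_4$; \item $p(G) = 0$ if $G = H_7$; \item $p(G) = -1$ if $G$ is $W_5$, $T_8$ or $T_{11}$, or if $G$ is $4$-Ore with $T(G) = 3$; \item $p(G) \le -2$ otherwise. \end{enumerate} -/

import Mathlib

universe u

/-- A graph is `4`-critical if it is not `3`-colorable but all of its proper subgraphs are. -/
def IsFourCritical {V : Type u} (G : SimpleGraph V) : Prop :=
  ¬ G.Colorable 3 ∧ ∀ H : G.Subgraph, H ≠ ⊤ → H.coe.Colorable 3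

/-- `G` contains `n` pairwise vertex-disjoint cycles, each of length at most four. -/
def HasDisjointShortCycles {V : Type u} (G : SimpleGraph V) (n : ℕ) : Prop :=
  ∃ (v : Fin n → V) (c : ∀ i, G.Walk (v i) (v i)),
    (∀ i, (c i).IsCycle ∧ (c i).length ≤ 4) ∧
    ∀ i j, i ≠ j → (c i).support.Disjoint (c j).support

/-- `T(G)`: the maximum number of vertex-disjoint cycles of length at most four in `G`
(a maximum whenever `G` is finite, see `isGreatest_shortCyclePacking`). -/
noncomputable def shortCyclePacking {V : Type u} (G : SimpleGraph V) : ℕ :=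
  sSup {n | HasDisjointShortCycles G n}

theorem isGreatest_shortCyclePacking {V : Type u} [Finite V] (G : SimpleGraph V) :
    IsGreatest {n | HasDisjointShortCycles G n} (shortCyclePacking G) := by
  have hb : BddAbove {n | HasDisjointShortCycles G n} := by
    refine ⟨Nat.card V, ?_⟩
    rintro n ⟨v, c, -, hd⟩
    have hv : Function.Injective v := by
      intro i j hij
      by_contra hne
      refine hd i j hne (c i).start_mem_support ?_
      rw [hij]
      exact (c j).start_mem_support
    simpa using Nat.card_le_card_of_injective v hv
  have hne : {n | HasDisjointShortCycles G n}.Nonempty :=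
    ⟨0, fun i => i.elim0, fun i => i.elim0, fun i => i.elim0, fun i => i.elim0⟩
  exact ⟨Nat.sSup_mem hne hb, fun n hn => le_csSup hb hn⟩

/-- The potential `p(G) = 5|V(G)| - 3|E(G)| - T(G)`. -/
noncomputable def potential {V : Type u} (G : SimpleGraph V) : ℤ :=
  5 * (Nat.card V : ℤ) - 3 * (G.edgeSet.ncard : ℤ) - (shortCyclePacking G : ℤ)

/-- The graph obtained from the disjoint graphs `G₁` and `G₂` as follows: delete the edge `xy` of
`G₁`; split the vertex `z` of `G₂` into `z₁`, which receives the neighbours of `z` in `S`, and `z₂`,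
which receives the other neighbours of `z`; identify `x` with `z₁` and `y` with `z₂`.
Its vertices are those of `G₁` and those of `G₂` other than `z`. -/
def oreComposition {V₁ V₂ : Type u} (G₁ : SimpleGraph V₁) (x y : V₁)
    (G₂ : SimpleGraph V₂) (z : V₂) (S : Set V₂) : SimpleGraph (V₁ ⊕ {w : V₂ // w ≠ z}) where
  Adj
    | .inl a, .inl b => G₁.Adj a b ∧ s(a, b) ≠ s(x, y)
    | .inr a, .inr b => G₂.Adj a b
    | .inl a, .inr b => G₂.Adj z b ∧ ((a = x ∧ (b : V₂) ∈ S) ∨ (a = y ∧ (b : V₂) ∉ S))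
    | .inr b, .inl a => G₂.Adj z b ∧ ((a = x ∧ (b : V₂) ∈ S) ∨ (a = y ∧ (b : V₂) ∉ S))
  symm := ⟨by
    rintro (a | a) (b | b) h
    · exact ⟨h.1.symm, by rw [Sym2.eq_swap]; exact h.2⟩
    · exact h
    · exact h
    · exact G₂.adj_symm h⟩
  loopless := ⟨by
    rintro (a | a) h
    · exact G₁.irrefl h.1
    · exact G₂.irrefl h⟩

/-- `G` is a `k`-Ore graph: it is obtained from copies of `K_k` by repeated Ore-compositions,
in each of which `xy` is an edge of `G₁` and both parts of the split of `z` have positive degree. -/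
inductive IsOre (k : ℕ) : {V : Type u} → SimpleGraph V → Prop
  | complete {V : Type u} (G : SimpleGraph V)
      (e : G ≃g (⊤ : SimpleGraph (Fin k))) : IsOre k G
  | composition {V V₁ V₂ : Type u} (G : SimpleGraph V)
      (G₁ : SimpleGraph V₁) (G₂ : SimpleGraph V₂) (x y : V₁) (z : V₂) (S : Set V₂)
      (h₁ : IsOre k G₁) (h₂ : IsOre k G₂) (hxy : G₁.Adj x y)
      (hz₁ : ∃ w ∈ S, G₂.Adj z w) (hz₂ : ∃ w ∉ S, G₂.Adj z w)
      (e : G ≃g oreComposition G₁ x y G₂ z S) : IsOre k G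

/-- The `4`-Ore graph on seven vertices (the Moser spindle): the Ore-composition of two copies of
`K₄`, with edge-side `{0, 1, 2, 3}`, replaced edge `01`, and `4, 5, 6` the vertices of the
split-side other than the split vertex. -/
def graphH7 : SimpleGraph (Fin 7) :=
  SimpleGraph.fromEdgeSet
    {s(0, 2), s(0, 3), s(1, 2), s(1, 3), s(2, 3), s(4, 5), s(4, 6), s(5, 6),
      s(0, 4), s(1, 5), s(1, 6)}

/-- The wheel `W₅`: the `5`-cycle `0 1 2 3 4` and a vertex `5` adjacent to all its vertices. -/
def graphW5 : SimpleGraph (Fin 6) :=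
  SimpleGraph.fromEdgeSet
    {s(0, 1), s(1, 2), s(2, 3), s(3, 4), s(4, 0),
      s(5, 0), s(5, 1), s(5, 2), s(5, 3), s(5, 4)}

/-- The graph `T₈`: a triangle `0 1 2`, an edge `67` whose two ends are both adjacent to each of
`3, 4, 5`, and the matching `03, 14, 25`. -/
def graphT8 : SimpleGraph (Fin 8) :=
  SimpleGraph.fromEdgeSet
    {s(0, 1), s(1, 2), s(2, 0), s(0, 3), s(1, 4), s(2, 5),
      s(3, 6), s(3, 7), s(4, 6), s(4, 7), s(5, 6), s(5, 7), s(6, 7)}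

/-- The graph `T₁₁`: the graph `T₈` with the edge `01` of its triangle replaced by the edge `0 8`
and a copy of `K₄` minus an edge on `8, 9, 10, 1`, in which `8` and `1` are not adjacent. -/
def graphT11 : SimpleGraph (Fin 11) :=
  SimpleGraph.fromEdgeSet
    {s(0, 8), s(8, 9), s(8, 10), s(9, 10), s(9, 1), s(10, 1), s(1, 2), s(2, 0),
      s(0, 3), s(1, 4), s(2, 5),
      s(3, 6), s(3, 7), s(4, 6), s(4, 7), s(5, 6), s(5, 7), s(6, 7)}

/-!
For a set `A` of vertices let `q A = 5|A| - 3e(A)` be its weight (the potential of Kostochka and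
Yancey) and `pk A` the largest number of disjoint cycles of length at most four inside `A`, so that
the potential of the whole graph is `q - pk`. The theorem follows from two extremal statements,
each proved by examining a smallest counterexample `G`.

**`q ≤ 2`, with equality only for `4`-Ore graphs** (`crit_q_le`). The main tool replaces a proper
subset `R` of `G`, coloured properly, by a triangle of colours: the resulting graph is not
`3`-colourable, so it contains a smaller critical graph `W`, and adding the vertices of `W` to `R`
changes the weight by at most `q W - kap k`, where `k` is the number of colours in `W`
(`Lift.q_le`). Iterating, a set of small weight grows until it fills `G`, which bounds the weight
of every proper subset from below. A set of two vertices does not separate `G`, as otherwise `G` is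
an Ore-composition of two smaller critical graphs (`MinNotOre.two_cut`); together with the
structure of `4`-Ore graphs (`isOre_edge`, `isOre_goodTri_disjoint`) this raises the lower bound to
six (`MinNotOre.six_le_q`) and describes the sets of weight six. Consequently `G` has no diamond,
no triangle with two cubic vertices, and no path of three cubic vertices whose ends both avoid all
triangles. By discharging (`discharge`, `two_mul_cubicTri_le`) such a graph has `q ≤ 0`.

**`4`-Ore graphs.** By induction on the composition, a `4`-Ore graph is `K₄`, the Moser spindle, or
has three disjoint short cycles (`isOre_cases`); this settles `q = 2`.

**`q ≤ 1` and potential at least `-1` only for `W₅`, `T₈` and `T₁₁`** (`MinDense.false`). The same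
replacement is now used with `pt R = q R - pk R`, whose change is controlled for each kind of
critical graph by `gain_one`, `gain_two` and `gain_three`. Proper subsets with at least four
vertices have `pt ≥ 3`, and an extension of a set with `pt ≤ 4` is tight: the edges of `G`
correspond to those of `W` (`MinDense.lift_tight`). A diamond has `pt ≤ 4`, so `G` arises from a
smaller critical graph by a very restricted operation, and the only results of it are the
exceptional graphs (`MinDense.noDiamond`). Triangles with two cubic vertices then disappear as
well, and a path of three cubic vertices with both ends outside all triangles would give two copies
of a split Moser spindle (`MinDense.path_pattern`), which overlap too much. Discharging leaves at
most two edges between vertices of degree at least four, and cubic vertices that induce a matching;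
such a graph is `3`-colourable (`no_coloring_of_big`), which is the final contradiction.
-/

namespace FourCritical
open Finset
open scoped Classical
set_option linter.unusedSectionVars false

/-! ### Edge counts and weights of vertex sets -/

section Counting
variable {V : Type*} (G : SimpleGraph V)

/-- The number of pairs `(a, b)` of adjacent vertices with `a ∈ A` and `b ∈ B`; in `ee G A A` every
edge counts twice. -/
noncomputable def ee (A B : Finset V) : ℤ := ∑ a ∈ A, ∑ b ∈ B, if G.Adj a b then 1 else 0

theorem ee_comm (A B : Finset V) : ee G A B = ee G B A := by
  unfold ee
  rw [Finset.sum_comm]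
  simp only [G.adj_comm]

theorem ee_union_left {A A' : Finset V} (h : Disjoint A A') (B : Finset V) :
    ee G (A ∪ A') B = ee G A B + ee G A' B := by
  unfold ee
  rw [Finset.sum_union h]

theorem ee_union_right (A : Finset V) {B B' : Finset V} (h : Disjoint B B') :
    ee G A (B ∪ B') = ee G A B + ee G A B' := by
  rw [ee_comm, ee_union_left G h, ee_comm, ee_comm G B']

theorem ee_nonneg (A B : Finset V) : 0 ≤ ee G A B :=
  Finset.sum_nonneg fun _ _ => Finset.sum_nonneg fun _ _ => by split_ifs <;> norm_num

theorem ee_singleton (a : V) (B : Finset V) :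
    ee G {a} B = ((B.filter (G.Adj a)).card : ℤ) := by
  simp [ee]

theorem ee_eq_sum (A B : Finset V) :
    ee G A B = ∑ a ∈ A, ((B.filter (G.Adj a)).card : ℤ) := by
  simp [ee]

theorem ee_self_even (A : Finset V) : Even (ee G A A) := by
  induction A using Finset.induction_on with
  | empty => simp [ee]
  | insert a A ha ih =>
    have hd : Disjoint {a} A := by simpa using ha
    rw [Finset.insert_eq, ee_union_left G hd, ee_union_right G _ hd, ee_union_right G _ hd,
      ee_comm G A {a}]
    have h0 : ee G {a} {a} = 0 := by simp [ee]
    obtain ⟨k, hk⟩ := ih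
    exact ⟨ee G {a} A + k, by rw [h0, hk]; ring⟩

/-- The number of edges of `G` with both ends in `A`. -/
noncomputable def ed (A : Finset V) : ℤ := ee G A A / 2

theorem two_mul_ed (A : Finset V) : 2 * ed G A = ee G A A :=
  Int.mul_ediv_cancel' (ee_self_even G A).two_dvd

theorem ed_nonneg (A : Finset V) : 0 ≤ ed G A := by
  have := two_mul_ed G A
  have := ee_nonneg G A A
  omega

theorem ed_union {A B : Finset V} (h : Disjoint A B) :
    ed G (A ∪ B) = ed G A + ed G B + ee G A B := by
  have h1 := two_mul_ed G (A ∪ B)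
  rw [ee_union_left G h, ee_union_right G _ h, ee_union_right G _ h, ee_comm G B A] at h1
  have h2 := two_mul_ed G A
  have h3 := two_mul_ed G B
  omega

/-- The weight `5|A| - 3e(A)` of the subgraph induced by `A`, called its potential by Kostochka and
Yancey. -/
noncomputable def q (A : Finset V) : ℤ := 5 * (A.card : ℤ) - 3 * ed G A

theorem q_union {A B : Finset V} (h : Disjoint A B) :
    q G (A ∪ B) = q G A + q G B - 3 * ee G A B := by
  unfold q
  rw [ed_union G h, Finset.card_union_of_disjoint h]
  push_cast
  ring

theorem ed_singleton (a : V) : ed G {a} = 0 := by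
  have : ee G {a} {a} = 0 := by simp [ee]
  simp [ed, this]

theorem q_insert {a : V} {A : Finset V} (h : a ∉ A) :
    q G (insert a A) = q G A + 5 - 3 * ((A.filter (G.Adj a)).card : ℤ) := by
  have hd : Disjoint {a} A := by simpa using h
  rw [Finset.insert_eq, q_union G hd, ee_singleton]
  simp [q, ed_singleton]
  ring

/-- A new vertex with at least `|S|` neighbours in `A` adds at most `5 - 3|S|` to the weight. -/
theorem q_insert_le {a : V} {A S : Finset V} (h : a ∉ A) (hS : S ⊆ A) (hadj : ∀ s ∈ S, G.Adj a s) :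
    q G (insert a A) ≤ q G A + 5 - 3 * (S.card : ℤ) := by
  rw [q_insert G h]
  have : S.card ≤ (A.filter (G.Adj a)).card :=
    Finset.card_le_card fun s hs => by simp [hS hs, hadj s hs]
  omega

theorem q_submodular (A B : Finset V) :
    q G (A ∪ B) + q G (A ∩ B) ≤ q G A + q G B := by
  have hd1 : Disjoint (A ∩ B) (A \ B) := by
    rw [Finset.disjoint_left]; intro x; simp; tauto
  have hd2 : Disjoint (A ∩ B) (B \ A) := by
    rw [Finset.disjoint_left]; intro x; simp; tauto
  have hd3 : Disjoint A (B \ A) := Finset.disjoint_sdiff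
  have e1 : A = (A ∩ B) ∪ (A \ B) := by ext x; simp; tauto
  have e2 : B = (A ∩ B) ∪ (B \ A) := by ext x; simp; tauto
  have e3 : A ∪ B = A ∪ (B \ A) := by simp
  have h1 : q G B = q G (A ∩ B) + q G (B \ A) - 3 * ee G (A ∩ B) (B \ A) := by
    conv_lhs => rw [e2]
    exact q_union G hd2
  have h2 : ee G A (B \ A) = ee G (A ∩ B) (B \ A) + ee G (A \ B) (B \ A) := by
    rw [← ee_union_left G hd1, ← e1]
  have := ee_nonneg G (A \ B) (B \ A)
  rw [e3, q_union G hd3, h1, h2]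
  linarith

/-- An injection that preserves adjacency on `A` does not decrease the number of edges. -/
theorem ee_image_le {U : Type*} (H : SimpleGraph U) (f : U → V) (A B : Finset U)
    (hA : Set.InjOn f A) (hB : Set.InjOn f B)
    (h : ∀ a ∈ A, ∀ b ∈ B, H.Adj a b → G.Adj (f a) (f b)) :
    ee H A B ≤ ee G (A.image f) (B.image f) := by
  unfold ee
  rw [Finset.sum_image hA]
  refine Finset.sum_le_sum fun a ha => ?_
  rw [Finset.sum_image hB]
  refine Finset.sum_le_sum fun b hb => ?_
  by_cases hab : H.Adj a b
  · simp [hab, h a ha b hb hab]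
  · simp only [hab, if_false]; split_ifs <;> norm_num

theorem ed_image_le {U : Type*} (H : SimpleGraph U) (f : U → V) (A : Finset U)
    (hA : Set.InjOn f A) (h : ∀ a ∈ A, ∀ b ∈ A, H.Adj a b → G.Adj (f a) (f b)) :
    ed H A ≤ ed G (A.image f) := by
  have h1 := ee_image_le G H f A A hA hA h
  have h2 := two_mul_ed G (A.image f)
  have h3 := two_mul_ed H A
  omega

theorem q_image_le {U : Type*} (H : SimpleGraph U) (f : U → V) (A : Finset U)
    (hA : Set.InjOn f A) (h : ∀ a ∈ A, ∀ b ∈ A, H.Adj a b → G.Adj (f a) (f b)) :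
    q G (A.image f) ≤ q H A := by
  unfold q
  rw [Finset.card_image_of_injOn hA]
  have := ed_image_le G H f A hA h
  omega

theorem ee_image_eq {U : Type*} (H : SimpleGraph U) (f : U → V) (A B : Finset U)
    (hA : Set.InjOn f A) (hB : Set.InjOn f B)
    (h : ∀ a ∈ A, ∀ b ∈ B, (H.Adj a b ↔ G.Adj (f a) (f b))) :
    ee H A B = ee G (A.image f) (B.image f) := by
  unfold ee
  rw [Finset.sum_image hA]
  refine Finset.sum_congr rfl fun a ha => ?_
  rw [Finset.sum_image hB]
  refine Finset.sum_congr rfl fun b hb => ?_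
  simp only [h a ha b hb]

theorem q_image_eq {U : Type*} (H : SimpleGraph U) (f : U → V) (A : Finset U)
    (hA : Set.InjOn f A) (h : ∀ a ∈ A, ∀ b ∈ A, (H.Adj a b ↔ G.Adj (f a) (f b))) :
    q G (A.image f) = q H A := by
  have h1 := ee_image_eq G H f A A hA hA h
  unfold q ed
  rw [Finset.card_image_of_injOn hA, h1]

/-- A graph on `n` vertices has at most `n(n-1)/2` edges. -/
theorem ee_self_le (A : Finset V) : ee G A A ≤ (A.card : ℤ) * (A.card - 1) := by
  rw [ee_eq_sum]
  calc ∑ a ∈ A, ((A.filter (G.Adj a)).card : ℤ) ≤ ∑ a ∈ A, ((A.card : ℤ) - 1) := by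
        refine Finset.sum_le_sum fun a ha => ?_
        have : (A.filter (G.Adj a)).card ≤ (A.erase a).card :=
          Finset.card_le_card fun b hb => by
            simp only [Finset.mem_filter] at hb
            exact Finset.mem_erase.2 ⟨hb.2.ne', hb.1⟩
        rw [Finset.card_erase_of_mem ha] at this
        have h1 : 1 ≤ A.card := Finset.card_pos.2 ⟨a, ha⟩
        omega
    _ = _ := by simp; ring

theorem ncard_edgeSet_eq [Fintype V] : (G.edgeSet.ncard : ℤ) = ed G univ := by
  have h1 := G.sum_degrees_eq_twice_card_edges
  have h2 : ee G univ univ = ∑ v, (G.degree v : ℤ) := by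
    rw [ee_eq_sum]
    refine Finset.sum_congr rfl fun v _ => ?_
    rw [← G.card_neighborFinset_eq_degree, G.neighborFinset_eq_filter]
  have h3 : G.edgeSet.ncard = G.edgeFinset.card := by
    rw [← SimpleGraph.coe_edgeFinset, Set.ncard_coe_finset]
  have h4 := two_mul_ed G univ
  rw [h2, ← Nat.cast_sum, h1] at h4
  rw [h3]
  push_cast at h4
  omega

end Counting

/-! ### Packings of short cycles -/

section Packing
variable {V : Type*} (G : SimpleGraph V)

/-- The vertex set of a cycle of length at most four. -/
def IsShort (s : Finset V) : Prop :=
  (∃ a b c, s = {a, b, c} ∧ G.Adj a b ∧ G.Adj b c ∧ G.Adj c a) ∨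
    ∃ a b c d, s = {a, b, c, d} ∧ a ≠ c ∧ b ≠ d ∧ G.Adj a b ∧ G.Adj b c ∧ G.Adj c d ∧ G.Adj d a

variable {G} in
theorem IsShort.three_le {s : Finset V} (h : IsShort G s) : 3 ≤ s.card := by
  rcases h with ⟨a, b, c, rfl, h1, h2, h3⟩ | ⟨a, b, c, d, rfl, h1, h2, h3, h4, h5, h6⟩
  · rw [Finset.card_eq_three.2 ⟨a, b, c, h1.ne, h3.ne', h2.ne, rfl⟩]
  · have : ({a, b, c} : Finset V) ⊆ {a, b, c, d} := by
      intro x; simp; tauto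
    calc 3 = ({a, b, c} : Finset V).card :=
          (Finset.card_eq_three.2 ⟨a, b, c, h3.ne, h1, h4.ne, rfl⟩).symm
      _ ≤ _ := Finset.card_le_card this

/-- `A` contains `n` pairwise disjoint vertex sets of cycles of length at most four. -/
def Packs (A : Finset V) (n : ℕ) : Prop :=
  ∃ F : Finset (Finset V), F.card = n ∧ (∀ s ∈ F, IsShort G s ∧ s ⊆ A) ∧
    (F : Set (Finset V)).PairwiseDisjoint id

theorem Packs.three_mul_le {A : Finset V} {n : ℕ} (h : Packs G A n) : 3 * n ≤ A.card := by
  obtain ⟨F, rfl, h1, h2⟩ := h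
  have h3 : (F.biUnion id).card = ∑ s ∈ F, s.card := Finset.card_biUnion h2
  have h4 : F.biUnion id ⊆ A := Finset.biUnion_subset.2 fun s hs => (h1 s hs).2
  have h5 : ∑ s ∈ F, 3 ≤ ∑ s ∈ F, s.card := Finset.sum_le_sum fun s hs => (h1 s hs).1.three_le
  have := Finset.card_le_card h4
  simp at h5
  omega

theorem Packs.mono_nat {A : Finset V} {n m : ℕ} (h : Packs G A n) (hm : m ≤ n) :
    Packs G A m := by
  obtain ⟨F, rfl, h1, h2⟩ := h
  obtain ⟨F', hF', rfl⟩ := Finset.exists_subset_card_eq hm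
  exact ⟨F', rfl, fun s hs => h1 s (hF' hs), h2.subset (by exact_mod_cast hF')⟩

/-- The maximum number of pairwise disjoint cycles of length at most four with all vertices in `A`.
-/
noncomputable def pk (A : Finset V) : ℕ := sSup {n | Packs G A n}

theorem packs_bddAbove (A : Finset V) : BddAbove {n | Packs G A n} :=
  ⟨A.card, fun n hn => by have := Packs.three_mul_le G hn; omega⟩

theorem packs_zero (A : Finset V) : Packs G A 0 := ⟨∅, by simp⟩

theorem packs_pk (A : Finset V) : Packs G A (pk G A) :=
  Nat.sSup_mem ⟨0, packs_zero G A⟩ (packs_bddAbove G A)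

variable {G}

theorem le_pk {A : Finset V} {n : ℕ} : n ≤ pk G A ↔ Packs G A n :=
  ⟨fun h => Packs.mono_nat G (packs_pk G A) h, fun h => le_csSup (packs_bddAbove G A) h⟩

theorem three_mul_pk_le (A : Finset V) : 3 * pk G A ≤ A.card :=
  Packs.three_mul_le G (packs_pk G A)

theorem pk_mono {A B : Finset V} (h : A ⊆ B) : pk G A ≤ pk G B := by
  obtain ⟨F, h0, h1, h2⟩ := packs_pk G A
  exact le_pk.2 ⟨F, h0, fun s hs => ⟨(h1 s hs).1, (h1 s hs).2.trans h⟩, h2⟩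

theorem pk_add {A B C : Finset V} (hA : A ⊆ C) (hB : B ⊆ C) (h : Disjoint A B) :
    pk G A + pk G B ≤ pk G C := by
  obtain ⟨F, h0, h1, h2⟩ := packs_pk G A
  obtain ⟨F', h0', h1', h2'⟩ := packs_pk G B
  have key : ∀ s ∈ F, ∀ t ∈ F', Disjoint s t := fun s hs t ht =>
    Finset.disjoint_of_subset_left (h1 s hs).2 (Finset.disjoint_of_subset_right (h1' t ht).2 h)
  have hFF : Disjoint F F' := by
    rw [Finset.disjoint_left]
    intro s hs ht
    have h3 := key s hs s ht
    have h4 := (h1 s hs).1.three_le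
    rw [disjoint_self.1 h3] at h4
    simp at h4
  refine le_pk.2 ⟨F ∪ F', ?_, ?_, ?_⟩
  · rw [Finset.card_union_of_disjoint hFF, h0, h0']
  · intro s hs
    rcases Finset.mem_union.1 hs with hs | hs
    · exact ⟨(h1 s hs).1, (h1 s hs).2.trans hA⟩
    · exact ⟨(h1' s hs).1, (h1' s hs).2.trans hB⟩
  · intro s hs t ht hst
    rcases Finset.mem_union.1 hs with hs | hs <;> rcases Finset.mem_union.1 ht with ht | ht
    · exact h2 hs ht hst
    · exact key s hs t ht
    · exact (key t ht s hs).symm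
    · exact h2' hs ht hst

theorem pk_erase (A : Finset V) (x : V) : pk G A ≤ pk G (A.erase x) + 1 := by
  obtain ⟨F, h0, h1, h2⟩ := packs_pk G A
  have hle : (F.filter (x ∈ ·)).card ≤ 1 := by
    rw [Finset.card_le_one]
    intro s hs t ht
    simp only [Finset.mem_filter] at hs ht
    by_contra hne
    exact Finset.disjoint_left.1 (h2 hs.1 ht.1 hne) hs.2 ht.2
  have h3 : (F.filter (x ∉ ·)).card ≤ pk G (A.erase x) := by
    refine le_pk.2 ⟨_, rfl, ?_, h2.subset fun s hs => (Finset.mem_filter.1 hs).1⟩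
    intro s hs
    simp only [Finset.mem_filter] at hs
    exact ⟨(h1 s hs.1).1, Finset.subset_erase.2 ⟨(h1 s hs.1).2, hs.2⟩⟩
  have := Finset.card_filter_add_card_filter_not (s := F) (x ∈ ·)
  omega

theorem pk_sdiff (A X : Finset V) : pk G A ≤ pk G (A \ X) + X.card := by
  induction X using Finset.induction_on with
  | empty => simp
  | insert x X hx ih =>
    have := pk_erase (G := G) (A \ X) x
    rw [Finset.card_insert_of_notMem hx, Finset.sdiff_insert]
    omega

/-- An injection that preserves adjacency on `A` carries packings in `A` to packings. -/
theorem pk_map {U : Type*} {H : SimpleGraph U} (f : U → V) {A : Finset U} {B : Finset V}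
    (hf : Set.InjOn f A) (hB : ∀ a ∈ A, f a ∈ B)
    (h : ∀ a ∈ A, ∀ b ∈ A, H.Adj a b → G.Adj (f a) (f b)) : pk H A ≤ pk G B := by
  obtain ⟨F, h0, h1, h2⟩ := packs_pk H A
  have himg : ∀ s ∈ F, IsShort G (s.image f) := by
    intro s hs
    obtain ⟨h3, h4⟩ := h1 s hs
    rcases h3 with ⟨a, b, c, rfl, h5, h6, h7⟩ | ⟨a, b, c, d, rfl, h5, h6, h7, h8, h9, h10⟩
    · have ha : a ∈ A := h4 (by simp)
      have hb : b ∈ A := h4 (by simp)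
      have hc : c ∈ A := h4 (by simp)
      exact Or.inl ⟨f a, f b, f c, by simp [Finset.image_insert], h _ ha _ hb h5, h _ hb _ hc h6,
        h _ hc _ ha h7⟩
    · have ha : a ∈ A := h4 (by simp)
      have hb : b ∈ A := h4 (by simp)
      have hc : c ∈ A := h4 (by simp)
      have hd : d ∈ A := h4 (by simp)
      exact Or.inr ⟨f a, f b, f c, f d, by simp [Finset.image_insert], fun e => h5 (hf ha hc e),
        fun e => h6 (hf hb hd e), h _ ha _ hb h7, h _ hb _ hc h8, h _ hc _ hd h9, h _ hd _ ha h10⟩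
  have hdis : ∀ s ∈ F, ∀ t ∈ F, s ≠ t → Disjoint (s.image f) (t.image f) := by
    intro s hs t ht hst
    rw [Finset.disjoint_left]
    intro x hx hx'
    obtain ⟨a, ha, rfl⟩ := Finset.mem_image.1 hx
    obtain ⟨b, hb, hab⟩ := Finset.mem_image.1 hx'
    have := hf ((h1 t ht).2 hb) ((h1 s hs).2 ha) hab
    subst this
    exact Finset.disjoint_left.1 (h2 hs ht hst) ha hb
  refine le_pk.2 ⟨F.image (Finset.image f), ?_, ?_, ?_⟩
  · rw [Finset.card_image_of_injOn, h0]
    intro s hs t ht hst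
    by_contra hne
    have h3 := hdis s hs t ht hne
    have h4 := (himg s hs).three_le
    rw [← hst, disjoint_self] at h3
    rw [h3] at h4
    simp at h4
  · intro s hs
    obtain ⟨t, ht, rfl⟩ := Finset.mem_image.1 hs
    refine ⟨himg t ht, ?_⟩
    intro x hx
    obtain ⟨a, ha, rfl⟩ := Finset.mem_image.1 hx
    exact hB a ((h1 t ht).2 ha)
  · intro s hs t ht hst
    obtain ⟨s', hs', rfl⟩ := Finset.mem_image.1 (Finset.mem_coe.1 hs)
    obtain ⟨t', ht', rfl⟩ := Finset.mem_image.1 (Finset.mem_coe.1 ht)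
    exact hdis s' hs' t' ht' (fun e => hst (by rw [e]))

theorem one_le_pk {A s : Finset V} (h : IsShort G s) (hs : s ⊆ A) : 1 ≤ pk G A :=
  le_pk.2 ⟨{s}, by simp, by simpa using ⟨h, hs⟩, by simp⟩

theorem pk_triangle {A : Finset V} {a b c : V} (ha : a ∈ A) (hb : b ∈ A) (hc : c ∈ A)
    (h1 : G.Adj a b) (h2 : G.Adj b c) (h3 : G.Adj c a) : 1 ≤ pk G A :=
  one_le_pk (Or.inl ⟨a, b, c, rfl, h1, h2, h3⟩) (by simp [Finset.insert_subset_iff, *])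

theorem pk_square {A : Finset V} {a b c d : V} (ha : a ∈ A) (hb : b ∈ A) (hc : c ∈ A) (hd : d ∈ A)
    (hac : a ≠ c) (hbd : b ≠ d)
    (h1 : G.Adj a b) (h2 : G.Adj b c) (h3 : G.Adj c d) (h4 : G.Adj d a) : 1 ≤ pk G A :=
  one_le_pk (Or.inr ⟨a, b, c, d, rfl, hac, hbd, h1, h2, h3, h4⟩)
    (by simp [Finset.insert_subset_iff, *])

theorem exists_isShort {A : Finset V} (h : 1 ≤ pk G A) : ∃ s, IsShort G s ∧ s ⊆ A := by
  obtain ⟨F, h0, h1, -⟩ := le_pk.1 h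
  obtain ⟨s, rfl⟩ := Finset.card_eq_one.1 h0
  exact ⟨s, h1 s (by simp)⟩

/-- A cycle of length at most four has the vertex set of a triangle or a quadrilateral. -/
theorem isShort_support {v : V} {c : G.Walk v v} (hc : c.IsCycle) (hl : c.length ≤ 4) :
    IsShort G c.support.toFinset := by
  have h3 := hc.three_le_length
  have hnd := hc.support_nodup
  match c, hl, h3, hnd with
  | .cons (v := b) h1 (.cons (v := d) h2 (.cons h3' .nil)), _, _, _ =>
    left
    refine ⟨v, b, d, ?_, h1, h2, h3'⟩
    ext x; simp; tauto
  | .cons (v := b) h1 (.cons (v := d) h2 (.cons (v := e) h3' (.cons h4 .nil))), _, _, hnd =>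
    right
    simp at hnd
    refine ⟨v, b, d, e, ?_, ?_, ?_, h1, h2, h3', h4⟩
    · ext x; simp; tauto
    · tauto
    · tauto

theorem exists_cycle_of_isShort {s : Finset V} (h : IsShort G s) :
    ∃ (v : V) (c : G.Walk v v), c.IsCycle ∧ c.length ≤ 4 ∧ ∀ x ∈ c.support, x ∈ s := by
  rcases h with ⟨a, b, c, rfl, h1, h2, h3⟩ | ⟨a, b, c, d, rfl, h1, h2, h3, h4, h5, h6⟩
  · refine ⟨a, .cons h1 (.cons h2 (.cons h3 .nil)), ?_, by simp, by simp⟩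
    have := h1.ne; have := h2.ne; have := h3.ne
    simp [SimpleGraph.Walk.isCycle_def, SimpleGraph.Walk.isTrail_def, h1.ne, h2.ne, h3.ne,
      h1.ne', h3.ne']
  · refine ⟨a, .cons h3 (.cons h4 (.cons h5 (.cons h6 .nil))), ?_, by simp, by simp⟩
    simp [SimpleGraph.Walk.isCycle_def, SimpleGraph.Walk.isTrail_def, h3.ne, h4.ne, h5.ne, h6.ne,
      h3.ne', h6.ne', h1, h2, h1.symm]

/-- Packings of short cycles as walks and packings of their vertex sets have the same size. -/
theorem shortCyclePacking_eq_pk {V : Type u} [Fintype V] (G : SimpleGraph V) :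
    shortCyclePacking G = pk G univ := by
  unfold shortCyclePacking pk
  congr 1
  ext n
  constructor
  · rintro ⟨v, c, h1, h2⟩
    have hinj : Function.Injective fun i => (c i).support.toFinset := by
      intro i j hij
      by_contra hne
      refine h2 i j hne (c i).start_mem_support ?_
      have : v i ∈ (c i).support.toFinset := by simp
      simp only at hij
      rw [hij] at this
      simpa using this
    refine ⟨univ.image fun i => (c i).support.toFinset, ?_, ?_, ?_⟩
    · rw [Finset.card_image_of_injective _ hinj]; simp
    · intro s hs
      obtain ⟨i, -, rfl⟩ := Finset.mem_image.1 hs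
      exact ⟨isShort_support (h1 i).1 (h1 i).2, by simp⟩
    · intro s hs t ht hst
      obtain ⟨i, -, rfl⟩ := Finset.mem_image.1 (Finset.mem_coe.1 hs)
      obtain ⟨j, -, rfl⟩ := Finset.mem_image.1 (Finset.mem_coe.1 ht)
      have hij : i ≠ j := fun e => hst (by rw [e])
      rw [Function.onFun, Finset.disjoint_left]
      intro x hx hx'
      exact h2 i j hij (by simpa using hx) (by simpa using hx')
  · rintro ⟨F, rfl, h1, h2⟩
    let e := F.equivFin.symm
    have h3 : ∀ i, ∃ (v : V) (c : G.Walk v v), c.IsCycle ∧ c.length ≤ 4 ∧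
        ∀ x ∈ c.support, x ∈ (e i).1 := fun i => exists_cycle_of_isShort (h1 _ (e i).2).1
    choose v c h4 h5 h6 using h3
    refine ⟨v, c, fun i => ⟨h4 i, h5 i⟩, fun i j hij => ?_⟩
    have hne : (e i).1 ≠ (e j).1 := fun h => hij (e.injective (Subtype.ext h))
    intro x hx hx'
    exact Finset.disjoint_left.1 (h2 (e i).2 (e j).2 hne) (h6 i x hx) (h6 j x hx')

theorem potential_eq {V : Type u} [Fintype V] (G : SimpleGraph V) :
    potential G = q G univ - pk G univ := by
  unfold potential q
  rw [shortCyclePacking_eq_pk, ncard_edgeSet_eq]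
  simp

end Packing

/-! ### Partial colourings -/

section Colouring
variable {V : Type*}

/-- `c` is a proper colouring of the subgraph of `G` induced by `A`. -/
def Proper (G : SimpleGraph V) (A : Finset V) (c : V → Fin 3) : Prop :=
  ∀ a ∈ A, ∀ b ∈ A, G.Adj a b → c a ≠ c b

theorem Proper.mono {G : SimpleGraph V} {A B : Finset V} {c : V → Fin 3} (h : Proper G B c)
    (hA : A ⊆ B) : Proper G A c := fun a ha b hb => h a (hA ha) b (hA hb)

theorem Proper.perm {G : SimpleGraph V} {A : Finset V} {c : V → Fin 3} (h : Proper G A c)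
    (σ : Equiv.Perm (Fin 3)) : Proper G A (σ ∘ c) :=
  fun a ha b hb hab e => h a ha b hb hab (σ.injective e)

/-- The degree of a vertex. -/
noncomputable def dg [Fintype V] (G : SimpleGraph V) (v : V) : ℕ := (univ.filter (G.Adj v)).card

theorem exists_color_notMem (S : Finset (Fin 3)) (h : S.card ≤ 2) : ∃ k, k ∉ S := by
  by_contra! h'
  have : (univ : Finset (Fin 3)) ⊆ S := fun k _ => h' k
  have := Finset.card_le_card this
  simp at this
  omega

/-- A proper colouring extends to a vertex that sees at most two colours. -/
theorem Proper.extend {G : SimpleGraph V} {A : Finset V} {c : V → Fin 3} (h : Proper G A c)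
    {v : V} (hv : v ∉ A) (S : Finset (Fin 3)) (hS : S.card ≤ 2)
    (hc : ∀ a ∈ A, G.Adj v a → c a ∈ S) :
    ∃ c', Proper G (insert v A) c' ∧ (∀ a, a ≠ v → c' a = c a) ∧ c' v ∉ S := by
  obtain ⟨k, hk⟩ := exists_color_notMem S hS
  have hne : ∀ a ∈ A, a ≠ v := fun a ha e => hv (e ▸ ha)
  refine ⟨Function.update c v k, ?_, fun a ha => by simp [ha], by simpa using hk⟩
  intro a ha b hb hab
  rcases Finset.mem_insert.1 ha with e1 | ha <;> rcases Finset.mem_insert.1 hb with e2 | hb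
  · rw [e1, e2] at hab
    exact absurd hab (G.irrefl)
  · rw [e1, Function.update_self, Function.update_of_ne (hne b hb)]
    intro e
    exact hk (e ▸ hc b hb (e1 ▸ hab))
  · rw [e2, Function.update_self, Function.update_of_ne (hne a ha)]
    intro e
    exact hk (e ▸ hc a ha (e2 ▸ hab.symm))
  · rw [Function.update_of_ne (hne a ha), Function.update_of_ne (hne b hb)]
    exact h a ha b hb hab

/-- The absence of a proper colouring of all vertices in terms of `Proper`. -/
theorem not_colorable_iff [Fintype V] {G : SimpleGraph V} :
    ¬ G.Colorable 3 ↔ ¬ ∃ c, Proper G univ c := by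
  refine not_congr ⟨?_, ?_⟩
  · rintro ⟨c⟩
    exact ⟨c, fun a _ b _ hab => c.valid hab⟩
  · rintro ⟨c, hc⟩
    exact ⟨SimpleGraph.Coloring.mk c fun {a b} hab => hc a (by simp) b (by simp) hab⟩

/-- Two colourings that agree up to a permutation on a set of at most two vertices: given two pairs
that are both equal or both distinct, a permutation carries one to the other. -/
theorem exists_perm_two (a b a' b' : Fin 3) (h : a = b ↔ a' = b') :
    ∃ σ : Equiv.Perm (Fin 3), σ a = a' ∧ σ b = b' := by
  revert a b a' b'
  decide

end Colouring

/-! ### Critical graphs -/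

section Critical
variable {V : Type u} [Fintype V] {G : SimpleGraph V}

theorem crit_not_proper (hG : IsFourCritical G) (c : V → Fin 3) : ¬ Proper G univ c :=
  fun h => not_colorable_iff.1 hG.1 ⟨c, h⟩

theorem crit_exists_proper (hG : IsFourCritical G) {A : Finset V} (hA : A ≠ univ) :
    ∃ c, Proper G A c := by
  have hne : (⊤ : G.Subgraph).induce (A : Set V) ≠ ⊤ := by
    intro e
    apply hA
    have := congrArg SimpleGraph.Subgraph.verts e
    simpa using this
  obtain ⟨c⟩ := hG.2 _ hne
  refine ⟨fun v => if h : v ∈ A then c ⟨v, by simpa using h⟩ else 0, ?_⟩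
  intro a ha b hb hab
  simp only [ha, hb, dif_pos]
  exact c.valid (by simp [ha, hb, hab])

/-- After the deletion of an edge, a critical graph has a colouring. -/
theorem crit_exists_edge (hG : IsFourCritical G) {a b : V} (hab : G.Adj a b) :
    ∃ c : V → Fin 3, ∀ u v, G.Adj u v → s(u, v) ≠ s(a, b) → c u ≠ c v := by
  have hne : (⊤ : G.Subgraph).deleteEdges {s(a, b)} ≠ ⊤ := by
    intro e
    have h1 : ((⊤ : G.Subgraph).deleteEdges {s(a, b)}).Adj a b := by rw [e]; exact hab
    simp at h1
  obtain ⟨c⟩ := hG.2 _ hne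
  refine ⟨fun v => c ⟨v, by simp⟩, ?_⟩
  intro u v huv hne'
  refine c.valid ?_
  simp only [SimpleGraph.Subgraph.coe_adj, SimpleGraph.Subgraph.deleteEdges_adj,
    SimpleGraph.Subgraph.top_adj, Set.mem_singleton_iff]
  exact ⟨huv, hne'⟩

/-- Every graph that is not `3`-colourable has a `4`-critical subgraph. -/
theorem exists_crit {U : Type u} [Fintype U] (H : SimpleGraph U) (h : ¬ ∃ c, Proper H univ c) :
    ∃ (U' : Type u) (_ : Fintype U') (W : SimpleGraph U') (f : U' → U), Function.Injective f ∧
      (∀ a b, W.Adj a b → H.Adj (f a) (f b)) ∧ IsFourCritical W := by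
  have hne : {K : H.Subgraph | ¬ K.coe.Colorable 3}.Nonempty := by
    refine ⟨⊤, ?_⟩
    rintro ⟨c⟩
    refine h ⟨fun v => c ⟨v, by simp⟩, fun a _ b _ hab => c.valid ?_⟩
    simpa using hab
  obtain ⟨K, hK, hmin⟩ := wellFounded_lt.has_min _ hne
  refine ⟨K.verts, inferInstance, K.coe, Subtype.val, Subtype.val_injective,
    fun a b hab => K.adj_sub hab, hK, fun L hL => ?_⟩
  by_contra hcol
  refine hmin (SimpleGraph.Subgraph.coeSubgraph L) ?_ ?_
  · rintro ⟨c⟩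
    refine hcol ⟨SimpleGraph.Coloring.mk
      (fun v => c ⟨v.1.1, by simp⟩) fun {a b} hab => c.valid ?_⟩
    simp only [SimpleGraph.Subgraph.coe_adj, SimpleGraph.Subgraph.coeSubgraph_adj]
    exact ⟨a.1.2, b.1.2, hab⟩
  · refine lt_of_le_of_ne (SimpleGraph.Subgraph.coeSubgraph_le L) fun e => hL ?_
    ext a b
    · simp only [SimpleGraph.Subgraph.verts_top, Set.mem_univ, iff_true]
      have : a.1 ∈ (SimpleGraph.Subgraph.coeSubgraph L).verts := by rw [e]; exact a.2
      simpa using this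
    · refine ⟨fun hab => L.adj_sub hab, fun hab => ?_⟩
      have : (SimpleGraph.Subgraph.coeSubgraph L).Adj a.1 b.1 := by rw [e]; exact hab
      simpa using this

theorem crit_deg (hG : IsFourCritical G) (v : V) : 3 ≤ dg G v := by
  by_contra! hlt
  have hne : univ.erase v ≠ (univ : Finset V) := fun e => by
    have := Finset.mem_univ v
    rw [← e] at this
    simp at this
  obtain ⟨c, hc⟩ := crit_exists_proper hG hne
  obtain ⟨c', h1, -⟩ := hc.extend (v := v) (by simp) ((univ.filter (G.Adj v)).image c)
    (by have := Finset.card_image_le (s := univ.filter (G.Adj v)) (f := c); unfold dg at hlt; omega)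
    (fun a _ hva => Finset.mem_image_of_mem _ (by simpa using hva))
  rw [Finset.insert_erase (by simp)] at h1
  exact crit_not_proper hG c' h1

theorem crit_nonempty (hG : IsFourCritical G) : Nonempty V := by
  by_contra hV
  rw [not_nonempty_iff] at hV
  exact crit_not_proper hG (fun _ => 0) fun a => isEmptyElim a

/-- A critical graph with a non-`3`-colourable subgraph equals this subgraph. -/
theorem crit_hom {U : Type*} [Fintype U] {W : SimpleGraph U} (hG : IsFourCritical G)
    (hW : ¬ ∃ c, Proper W univ c) (f : U → V) (hf : ∀ a b, W.Adj a b → G.Adj (f a) (f b)) :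
    Function.Surjective f ∧ (Function.Injective f → ∀ a b, G.Adj (f a) (f b) → W.Adj a b) := by
  constructor
  · intro v
    by_contra hv
    have hne : univ.image f ≠ univ := fun e => hv (by
      have : v ∈ univ.image f := by rw [e]; simp
      simpa using this)
    obtain ⟨c, hc⟩ := crit_exists_proper hG hne
    exact hW ⟨c ∘ f, fun a _ b _ hab => hc _ (by simp) _ (by simp) (hf a b hab)⟩
  · intro hinj a b hab
    by_contra hn
    obtain ⟨c, hc⟩ := crit_exists_edge hG hab
    refine hW ⟨c ∘ f, fun u _ v _ huv => hc _ _ (hf u v huv) fun e => hn ?_⟩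
    rcases Sym2.eq_iff.1 e with ⟨e1, e2⟩ | ⟨e1, e2⟩
    · rw [← hinj e1, ← hinj e2]; exact huv
    · rw [← hinj e1, ← hinj e2]; exact huv.symm

theorem crit_iso {U : Type*} [Fintype U] {W : SimpleGraph U} (hG : IsFourCritical G)
    (hW : ¬ ∃ c, Proper W univ c) (f : U → V) (hinj : Function.Injective f)
    (hf : ∀ a b, W.Adj a b → G.Adj (f a) (f b)) : Nonempty (G ≃g W) := by
  obtain ⟨h1, h2⟩ := crit_hom hG hW f hf
  exact ⟨(⟨Equiv.ofBijective f ⟨hinj, h1⟩,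
    fun {a b} => ⟨fun h => h2 hinj a b h, fun h => hf a b h⟩⟩ : W ≃g G).symm⟩

theorem crit_four_le (hG : IsFourCritical G) : 4 ≤ Fintype.card V := by
  obtain ⟨v⟩ := crit_nonempty hG
  have h := crit_deg hG v
  have : (univ.filter (G.Adj v)).card ≤ (univ.erase v).card :=
    Finset.card_le_card fun w hw => by
      have := (Finset.mem_filter.1 hw).2.ne'
      simpa using this
  rw [Finset.card_erase_of_mem (by simp), Finset.card_univ] at this
  unfold dg at h
  omega

end Critical

/-! ### Replacing a set of vertices by a triangle of colours -/

section Lift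
variable {V U : Type u}

/-- A subgraph `W` of the graph obtained from `G[D]` by replacing `R` by a triangle of colours,
where a vertex outside `R` is joined to each colour that `φ` uses on its neighbours in `R`. The set
`X` consists of the vertices of `W` that are colours; `g` and `col` say which vertices of `G` and
which colours the vertices of `W` are. -/
structure Lift (G : SimpleGraph V) (D R : Finset V) (φ : V → Fin 3) (W : SimpleGraph U)
    (X : Finset U) (g : U → V) (col : U → Fin 3) : Prop where
  crit : IsFourCritical W
  g_mem : ∀ s, s ∉ X → g s ∈ D ∧ g s ∉ R
  g_inj : ∀ s, s ∉ X → ∀ t, t ∉ X → g s = g t → s = t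
  col_inj : ∀ s ∈ X, ∀ t ∈ X, col s = col t → s = t
  adj : ∀ s, s ∉ X → ∀ t, t ∉ X → W.Adj s t → G.Adj (g s) (g t)
  adjX : ∀ s, s ∉ X → ∀ x ∈ X, W.Adj s x → ∃ r ∈ R, φ r = col x ∧ G.Adj (g s) r

/-- If no colouring of `G[D]` induces on `R` the same partition into colour classes as `φ`, then
replacing `R` by a triangle of colours gives a graph that is not `3`-colourable, and hence a lift.
-/
theorem exists_lift [Fintype V] (G : SimpleGraph V) (D R : Finset V) (φ : V → Fin 3)
    (hφ : Proper G R φ)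
    (hno : ∀ ψ, Proper G D ψ → (∀ r ∈ R, ∀ r' ∈ R, (ψ r = ψ r' ↔ φ r = φ r')) → False) :
    ∃ (U : Type u) (_ : Fintype U) (W : SimpleGraph U) (X : Finset U) (g : U → V)
      (col : U → Fin 3), Lift G D R φ W X g col := by
  -- the graph `G[D \ R]` together with a triangle on the colours
  let adjY : V ⊕ Fin 3 → V ⊕ Fin 3 → Prop := fun s t => match s, t with
    | .inl a, .inl b => a ∈ D \ R ∧ b ∈ D \ R ∧ G.Adj a b
    | .inl a, .inr c => a ∈ D \ R ∧ ∃ r ∈ R, φ r = c ∧ G.Adj a r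
    | .inr c, .inl a => a ∈ D \ R ∧ ∃ r ∈ R, φ r = c ∧ G.Adj a r
    | .inr c, .inr d => c ≠ d
  let Y : SimpleGraph (V ⊕ Fin 3) :=
    { Adj := adjY
      symm := ⟨by
        rintro (a | a) (b | b) h
        · exact ⟨h.2.1, h.1, h.2.2.symm⟩
        · exact h
        · exact h
        · exact Ne.symm h⟩
      loopless := ⟨by
        rintro (a | a) h
        · exact G.irrefl h.2.2
        · exact h rfl⟩ }
  have hY : ¬ ∃ c, Proper Y univ c := by
    rintro ⟨c, hc⟩
    have hinj : ∀ i j, c (.inr i) = c (.inr j) → i = j := by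
      intro i j hij
      by_contra hne
      exact hc _ (mem_univ _) _ (mem_univ _) (show Y.Adj (.inr i) (.inr j) from hne) hij
    -- pull back along `φ`: the three colours receive distinct colours under `c`
    refine hno (fun v => if v ∈ R then c (.inr (φ v)) else c (.inl v)) ?_ ?_
    · intro a ha b hb hab
      by_cases haR : a ∈ R <;> by_cases hbR : b ∈ R
      · simp only [haR, hbR, if_true]
        exact fun e => hφ a haR b hbR hab (hinj _ _ e)
      · simp only [haR, hbR, if_true, if_false]
        exact hc _ (mem_univ _) _ (mem_univ _) (show Y.Adj (.inr (φ a)) (.inl b) from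
          ⟨by simp [hb, hbR], a, haR, rfl, hab.symm⟩)
      · simp only [haR, hbR, if_true, if_false]
        exact hc _ (mem_univ _) _ (mem_univ _) (show Y.Adj (.inl a) (.inr (φ b)) from
          ⟨by simp [ha, haR], b, hbR, rfl, hab⟩)
      · simp only [haR, hbR, if_false]
        exact hc _ (mem_univ _) _ (mem_univ _) (show Y.Adj (.inl a) (.inl b) from
          ⟨by simp [ha, haR], by simp [hb, hbR], hab⟩)
    · intro r hr r' hr'
      simp only [hr, hr', if_true]
      exact ⟨hinj _ _, fun e => by rw [e]⟩
  obtain ⟨U, hU, W, f, hf, hfa, hcrit⟩ := exists_crit Y hY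
  have hV : Nonempty V := by
    by_contra hV
    rw [not_nonempty_iff] at hV
    exact hno (fun _ => 0) (fun a => isEmptyElim a) fun r => isEmptyElim r
  -- vertices outside `D \ R` are isolated in `Y`, so they do not occur in `W`
  have hmem : ∀ s a, f s = .inl a → a ∈ D \ R := by
    intro s a hs
    have h3 := crit_deg hcrit s
    obtain ⟨t, ht⟩ : (univ.filter (W.Adj s)).Nonempty := by
      rw [← Finset.card_pos]; unfold dg at h3; omega
    have h4 := hfa s t (Finset.mem_filter.1 ht).2
    rw [hs] at h4
    rcases hft : f t with b | b <;> rw [hft] at h4 <;> exact h4.1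
  let X : Finset U := univ.filter fun s => ∃ c, f s = .inr c
  have hX : ∀ s, s ∈ X ↔ ∃ c, f s = .inr c := by simp [X]
  have hX' : ∀ s, s ∉ X → ∃ a, f s = .inl a := by
    intro s hs
    rw [hX] at hs
    rcases hfs : f s with a | c
    · exact ⟨a, rfl⟩
    · exact absurd ⟨c, hfs⟩ hs
  let g : U → V := fun s => Sum.elim id (fun _ => hV.some) (f s)
  let col : U → Fin 3 := fun s => Sum.elim (fun _ => 0) id (f s)
  have hg : ∀ s a, f s = .inl a → g s = a := fun s a h => by simp [g, h]
  have hcol : ∀ s c, f s = .inr c → col s = c := fun s a h => by simp [col, h]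
  refine ⟨U, hU, W, X, g, col, hcrit, ?_, ?_, ?_, ?_, ?_⟩
  · intro s hs
    obtain ⟨a, ha⟩ := hX' s hs
    rw [hg s a ha]
    simpa using hmem s a ha
  · intro s hs t ht hst
    obtain ⟨a, ha⟩ := hX' s hs
    obtain ⟨b, hb⟩ := hX' t ht
    rw [hg s a ha, hg t b hb] at hst
    exact hf (by rw [ha, hb, hst])
  · intro s hs t ht hst
    obtain ⟨a, ha⟩ := (hX s).1 hs
    obtain ⟨b, hb⟩ := (hX t).1 ht
    rw [hcol s a ha, hcol t b hb] at hst
    exact hf (by rw [ha, hb, hst])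
  · intro s hs t ht hst
    obtain ⟨a, ha⟩ := hX' s hs
    obtain ⟨b, hb⟩ := hX' t ht
    rw [hg s a ha, hg t b hb]
    have := hfa s t hst
    rw [ha, hb] at this
    exact this.2.2
  · intro s hs t ht hst
    obtain ⟨a, ha⟩ := hX' s hs
    obtain ⟨b, hb⟩ := (hX t).1 ht
    rw [hg s a ha, hcol t b hb]
    have := hfa s t hst
    rw [ha, hb] at this
    exact this.2

variable {G : SimpleGraph V} {D R : Finset V} {φ : V → Fin 3} {W : SimpleGraph U}
  {X : Finset U} {g : U → V} {col : U → Fin 3}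

theorem Lift.card_le (L : Lift G D R φ W X g col) : X.card ≤ 3 := by
  have h := Finset.card_le_card (Finset.subset_univ (X.image col))
  rwa [Finset.card_image_of_injOn L.col_inj, Finset.card_univ, Fintype.card_fin] at h

variable [Fintype U]

/-- A colour in `W` has a neighbour in `W` that is not a colour, since `W` has minimum degree
three. -/
theorem Lift.exists_nbr (L : Lift G D R φ W X g col) {x : U} (hx : x ∈ X) :
    ∃ s, s ∉ X ∧ W.Adj s x := by
  by_contra! h
  have h3 := crit_deg L.crit x
  have : univ.filter (W.Adj x) ⊆ X.erase x := by
    intro t ht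
    have ht := (Finset.mem_filter.1 ht).2
    refine Finset.mem_erase.2 ⟨ht.ne', ?_⟩
    by_contra htX
    exact h t htX ht.symm
  have := Finset.card_le_card this
  rw [Finset.card_erase_of_mem hx] at this
  have := L.card_le
  unfold dg at h3
  omega

theorem Lift.exists_color (L : Lift G D R φ W X g col) {x : U} (hx : x ∈ X) :
    ∃ r ∈ R, φ r = col x := by
  obtain ⟨s, hs, h⟩ := L.exists_nbr hx
  obtain ⟨r, hr, h1, -⟩ := L.adjX s hs x hx h
  exact ⟨r, hr, h1⟩

/-- The vertices of `G` that are vertices of `W`. -/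
noncomputable def liftSet (X : Finset U) (g : U → V) : Finset V := Xᶜ.image g

theorem mem_liftSet {v : V} : v ∈ liftSet X g ↔ ∃ s, s ∉ X ∧ g s = v := by
  simp [liftSet]

theorem Lift.injOn (L : Lift G D R φ W X g col) : Set.InjOn g (Xᶜ : Finset U) := by
  intro s hs t ht h
  exact L.g_inj s (by simpa using hs) t (by simpa using ht) h

theorem Lift.disjoint (L : Lift G D R φ W X g col) : Disjoint R (liftSet X g) := by
  rw [Finset.disjoint_left]
  intro r hr hr'
  obtain ⟨s, hs, rfl⟩ := mem_liftSet.1 hr'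
  exact (L.g_mem s hs).2 hr

theorem Lift.card_liftSet (L : Lift G D R φ W X g col) :
    (liftSet X g).card + X.card = Fintype.card U := by
  rw [liftSet, Finset.card_image_of_injOn L.injOn, Finset.card_compl_add_card]

theorem Lift.liftSet_nonempty (L : Lift G D R φ W X g col) : (liftSet X g).Nonempty := by
  have := crit_four_le L.crit
  have := L.card_liftSet
  have := L.card_le
  rw [← Finset.card_pos]
  omega

/-- A lifted vertex sees at most as many colours in `W` as it has neighbours in `R`. -/
theorem Lift.nbr_card_le (L : Lift G D R φ W X g col) {s : U} (hs : s ∉ X) :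
    (X.filter (W.Adj s)).card ≤ (R.filter (G.Adj (g s))).card := by
  refine Finset.card_le_card_of_forall_subsingleton (fun x r => φ r = col x) ?_ ?_
  · intro x hx
    obtain ⟨hx, hsx⟩ := Finset.mem_filter.1 hx
    obtain ⟨r, hr, h1, h2⟩ := L.adjX s hs x hx hsx
    exact ⟨r, Finset.mem_filter.2 ⟨hr, h2⟩, h1⟩
  · rintro r - x ⟨hx, h1⟩ y ⟨hy, h2⟩
    exact L.col_inj x (Finset.mem_filter.1 hx).1 y (Finset.mem_filter.1 hy).1 (h1.symm.trans h2)

theorem Lift.ee_eq (L : Lift G D R φ W X g col) :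
    ee G (liftSet X g) R = ∑ s ∈ Xᶜ, ((R.filter (G.Adj (g s))).card : ℤ) := by
  rw [ee_eq_sum, liftSet, Finset.sum_image L.injOn]

theorem Lift.ee_le (L : Lift G D R φ W X g col) :
    ee W Xᶜ X ≤ ee G (liftSet X g) R := by
  rw [L.ee_eq, ee_eq_sum]
  exact Finset.sum_le_sum fun s hs => by exact_mod_cast L.nbr_card_le (by simpa using hs)

theorem Lift.ed_le (L : Lift G D R φ W X g col) : ed W Xᶜ ≤ ed G (liftSet X g) :=
  ed_image_le G W g _ L.injOn fun a ha b hb h =>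
    L.adj a (by simpa using ha) b (by simpa using hb) h

/-- The exact change of the weight when the vertices of `W` are added to `R`. -/
theorem Lift.q_eq (L : Lift G D R φ W X g col) :
    q G (R ∪ liftSet X g) = q G R + q W univ - q W X
      - 3 * (ed G (liftSet X g) - ed W Xᶜ) - 3 * (ee G (liftSet X g) R - ee W Xᶜ X) := by
  have h1 := q_union G L.disjoint
  have h2 : q W univ = q W Xᶜ + q W X - 3 * ee W Xᶜ X := by
    rw [← q_union W disjoint_compl_left, Finset.union_comm, Finset.union_compl]
  have h3 := Finset.card_image_of_injOn L.injOn
  rw [h1, h2, ee_comm G R]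
  unfold q
  have h4 : ((liftSet X g).card : ℤ) = (Xᶜ.card : ℤ) := by rw [liftSet, h3]
  rw [h4]
  ring

/-- The weight of a complete graph on `n` vertices; its values at `1, 2, 3` are `5, 7, 6`. -/
def kap (n : ℕ) : ℤ := 5 * n - 3 * (n * (n - 1) / 2)

theorem kap_le (X : Finset U) : kap X.card ≤ q W X := by
  unfold kap q
  have h1 := ee_self_le W X
  have h2 := two_mul_ed W X
  omega

/-- Extending `R` by a lift with `k` colours changes the weight by at most `q W - kap k`. -/
theorem Lift.q_le (L : Lift G D R φ W X g col) :
    q G (R ∪ liftSet X g) ≤ q G R + q W univ - kap X.card := by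
  have := L.q_eq
  have := L.ee_le
  have := L.ed_le
  have := kap_le (W := W) X
  omega

/-- The short cycles of `W` that avoid the colours are added to the packing of `R`. -/
theorem Lift.pk_le (L : Lift G D R φ W X g col) :
    pk G R + pk W Xᶜ ≤ pk G (R ∪ liftSet X g) := by
  refine le_trans (Nat.add_le_add_left ?_ _)
    (pk_add (A := R) (B := liftSet X g) (by simp) (by simp) L.disjoint)
  refine pk_map g L.injOn (fun a ha => ?_) fun a ha b hb h =>
    L.adj a (by simpa using ha) b (by simpa using hb) h
  exact mem_liftSet.2 ⟨a, by simpa using ha, rfl⟩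

/-- A lift without additional edges: every edge of `G` between lifted vertices, or between such a
vertex and `R`, comes from exactly one edge of `W`, and the colours in `W` are pairwise adjacent.
-/
structure Tight (G : SimpleGraph V) (R : Finset V) (φ : V → Fin 3) (W : SimpleGraph U)
    (X : Finset U) (g : U → V) (col : U → Fin 3) : Prop where
  adj_of : ∀ s, s ∉ X → ∀ t, t ∉ X → G.Adj (g s) (g t) → W.Adj s t
  clique : ∀ x ∈ X, ∀ y ∈ X, x ≠ y → W.Adj x y
  nbr : ∀ s, s ∉ X → ∀ r ∈ R, G.Adj (g s) r → ∃ x ∈ X, col x = φ r ∧ W.Adj s x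
  uniq : ∀ s, s ∉ X → ∀ r ∈ R, ∀ r' ∈ R, G.Adj (g s) r → G.Adj (g s) r' → φ r = φ r' → r = r'

/-- Each superfluous edge costs three units of weight, so a lift within two units of the bound of
`Lift.q_le` attains it and has no superfluous edge. -/
theorem Lift.tight (L : Lift G D R φ W X g col)
    (h : q G R + q W univ - kap X.card - 3 < q G (R ∪ liftSet X g)) :
    Tight G R φ W X g col ∧ q G (R ∪ liftSet X g) = q G R + q W univ - kap X.card := by
  have h1 := L.q_eq
  have h2 := L.ee_le
  have h3 := L.ed_le
  have h4 := kap_le (W := W) X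
  have h5 := ee_self_le W X
  have h6 := two_mul_ed W X
  have e1 : ed G (liftSet X g) = ed W Xᶜ := by omega
  have e2 : ee G (liftSet X g) R = ee W Xᶜ X := by omega
  have e3 : q W X < kap X.card + 3 := by omega
  have e0 := (Int.even_mul_pred_self (X.card : ℤ)).two_dvd
  have e4 : ee W X X = (X.card : ℤ) * (X.card - 1) := by
    unfold q kap at e3
    omega
  have e5 : q W X = kap X.card := by
    unfold q kap
    omega
  have hcard : ∀ s, s ∉ X → (X.filter (W.Adj s)).card = (R.filter (G.Adj (g s))).card := by
    rw [L.ee_eq, ee_eq_sum] at e2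
    have := (Finset.sum_eq_sum_iff_of_le (fun s hs => by
      exact_mod_cast L.nbr_card_le (by simpa using hs))).1 e2.symm
    intro s hs
    exact_mod_cast this s (by simpa using hs)
  have hfun : ∀ s, s ∉ X → ∃ ρ : U → V, (∀ x ∈ X.filter (W.Adj s),
      ρ x ∈ R.filter (G.Adj (g s)) ∧ φ (ρ x) = col x) ∧
      (X.filter (W.Adj s)).image ρ = R.filter (G.Adj (g s)) := by
    intro s hs
    have hx : ∀ x, ∃ r, x ∈ X.filter (W.Adj s) → r ∈ R.filter (G.Adj (g s)) ∧ φ r = col x := by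
      intro x
      by_cases hx : x ∈ X.filter (W.Adj s)
      · obtain ⟨hx, hsx⟩ := Finset.mem_filter.1 hx
        obtain ⟨r, hr, h1, h2⟩ := L.adjX s hs x hx hsx
        exact ⟨r, fun _ => ⟨Finset.mem_filter.2 ⟨hr, h2⟩, h1⟩⟩
      · exact ⟨g s, fun h => absurd h hx⟩
    choose ρ hρ using hx
    refine ⟨ρ, hρ, Finset.eq_of_subset_of_card_le ?_ ?_⟩
    · intro r hr
      obtain ⟨x, hx, rfl⟩ := Finset.mem_image.1 hr
      exact (hρ x hx).1
    · rw [Finset.card_image_of_injOn, hcard s hs]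
      intro x hx y hy hxy
      refine L.col_inj x (Finset.mem_filter.1 hx).1 y (Finset.mem_filter.1 hy).1 ?_
      rw [← (hρ x hx).2, ← (hρ y hy).2, hxy]
  refine ⟨⟨?_, ?_, ?_, ?_⟩, by omega⟩
  · have hle : ∀ s ∈ Xᶜ, ∑ t ∈ Xᶜ, (if W.Adj s t then (1 : ℤ) else 0) ≤
        ∑ t ∈ Xᶜ, if G.Adj (g s) (g t) then (1 : ℤ) else 0 := by
      intro s hs
      refine Finset.sum_le_sum fun t ht => ?_
      by_cases hst : W.Adj s t
      · simp [hst, L.adj s (by simpa using hs) t (by simpa using ht) hst]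
      · simp only [hst, if_false]; split_ifs <;> norm_num
    have hee : ee W Xᶜ Xᶜ = ee G (liftSet X g) (liftSet X g) := by
      rw [← two_mul_ed, ← two_mul_ed, e1]
    unfold ee liftSet at hee
    rw [Finset.sum_image L.injOn] at hee
    simp only [Finset.sum_image L.injOn] at hee
    have h7 := (Finset.sum_eq_sum_iff_of_le hle).1 hee
    intro s hs t ht hst
    have h8 := (Finset.sum_eq_sum_iff_of_le (fun t ht => by
      by_cases hst : W.Adj s t
      · simp [hst, L.adj s hs t (by simpa using ht) hst]
      · simp only [hst, if_false]; split_ifs <;> norm_num)).1 (h7 s (by simpa using hs)) t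
        (by simpa using ht)
    by_contra hn
    simp [hst, hn] at h8
  · have hle : ∀ x ∈ X, ((X.filter (W.Adj x)).card : ℤ) ≤ (X.card : ℤ) - 1 := by
      intro x hx
      have : (X.filter (W.Adj x)).card ≤ (X.erase x).card :=
        Finset.card_le_card fun b hb => by
          simp only [Finset.mem_filter] at hb
          exact Finset.mem_erase.2 ⟨hb.2.ne', hb.1⟩
      rw [Finset.card_erase_of_mem hx] at this
      have h1 : 1 ≤ X.card := Finset.card_pos.2 ⟨x, hx⟩
      omega
    rw [ee_eq_sum] at e4
    have h7 := (Finset.sum_eq_sum_iff_of_le hle).1 (by rw [e4]; simp; ring)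
    intro x hx y hy hxy
    have h8 := h7 x hx
    have h9 : X.filter (W.Adj x) = X.erase x := by
      refine Finset.eq_of_subset_of_card_le ?_ ?_
      · intro b hb
        simp only [Finset.mem_filter] at hb
        exact Finset.mem_erase.2 ⟨hb.2.ne', hb.1⟩
      · rw [Finset.card_erase_of_mem hx]; omega
    have : y ∈ X.erase x := Finset.mem_erase.2 ⟨hxy.symm, hy⟩
    rw [← h9] at this
    exact (Finset.mem_filter.1 this).2
  · intro s hs r hr hsr
    obtain ⟨ρ, h7, h8⟩ := hfun s hs
    have : r ∈ (X.filter (W.Adj s)).image ρ := by rw [h8]; simp [hr, hsr]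
    obtain ⟨x, hx, rfl⟩ := Finset.mem_image.1 this
    exact ⟨x, (Finset.mem_filter.1 hx).1, (h7 x hx).2.symm, (Finset.mem_filter.1 hx).2⟩
  · intro s hs r hr r' hr' hsr hsr' hφ
    obtain ⟨ρ, h7, h8⟩ := hfun s hs
    have h9 : r ∈ (X.filter (W.Adj s)).image ρ := by rw [h8]; simp [hr, hsr]
    have h10 : r' ∈ (X.filter (W.Adj s)).image ρ := by rw [h8]; simp [hr', hsr']
    obtain ⟨x, hx, rfl⟩ := Finset.mem_image.1 h9
    obtain ⟨y, hy, rfl⟩ := Finset.mem_image.1 h10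
    rw [(h7 x hx).2, (h7 y hy).2] at hφ
    rw [L.col_inj x (Finset.mem_filter.1 hx).1 y (Finset.mem_filter.1 hy).1 hφ]

end Lift

/-! ### The structure of `4`-Ore graphs -/

section OreStructure

/-- `G` is a complete graph on four vertices. -/
def IsK4 {V : Type*} [Fintype V] (G : SimpleGraph V) : Prop :=
  Fintype.card V = 4 ∧ ∀ a b, a ≠ b → G.Adj a b

/-- An Ore-composition described inside the composed graph `G`: the vertex set of `G` is the
disjoint union of the images of `i₁` and of the restriction of `i₂` to the vertices other than `z`.
-/
structure OreDecomp {V V₁ V₂ : Type u} (G : SimpleGraph V) (G₁ : SimpleGraph V₁) (x y : V₁)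
    (G₂ : SimpleGraph V₂) (z : V₂) (S : Set V₂) (i₁ : V₁ → V) (i₂ : V₂ → V) : Prop where
  ore₁ : IsOre 4 G₁
  ore₂ : IsOre 4 G₂
  hxy : G₁.Adj x y
  hz₁ : ∃ w ∈ S, G₂.Adj z w
  hz₂ : ∃ w ∉ S, G₂.Adj z w
  inj₁ : Function.Injective i₁
  inj₂ : ∀ b b', b ≠ z → b' ≠ z → i₂ b = i₂ b' → b = b'
  disj : ∀ a b, b ≠ z → i₁ a ≠ i₂ b
  cover : ∀ v, (∃ a, i₁ a = v) ∨ ∃ b, b ≠ z ∧ i₂ b = v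
  adj₁ : ∀ a a', G.Adj (i₁ a) (i₁ a') ↔ G₁.Adj a a' ∧ s(a, a') ≠ s(x, y)
  adj₂ : ∀ b b', b ≠ z → b' ≠ z → (G.Adj (i₂ b) (i₂ b') ↔ G₂.Adj b b')
  adj₁₂ : ∀ a b, b ≠ z → (G.Adj (i₁ a) (i₂ b) ↔ G₂.Adj z b ∧ ((a = x ∧ b ∈ S) ∨ (a = y ∧ b ∉ S)))

theorem isOre_finite {V : Type u} {G : SimpleGraph V} (h : IsOre 4 G) : Finite V := by
  induction h with
  | complete G e => exact Finite.of_equiv _ e.toEquiv.symm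
  | composition G G₁ G₂ x y z S h₁ h₂ hxy hz₁ hz₂ e ih₁ ih₂ =>
    exact Finite.of_equiv _ e.toEquiv.symm

/-- Induction over Ore-compositions. -/
theorem isOre_induction {P : ∀ (V : Type u) [Fintype V], SimpleGraph V → Prop}
    (hK : ∀ (V : Type u) [Fintype V] (G : SimpleGraph V), IsK4 G → P V G)
    (hC : ∀ (V V₁ V₂ : Type u) [Fintype V] [Fintype V₁] [Fintype V₂] (G : SimpleGraph V)
      (G₁ : SimpleGraph V₁) (x y : V₁) (G₂ : SimpleGraph V₂) (z : V₂) (S : Set V₂) (i₁ : V₁ → V)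
      (i₂ : V₂ → V), OreDecomp G G₁ x y G₂ z S i₁ i₂ → P V₁ G₁ → P V₂ G₂ → P V G)
    {V : Type u} [inst : Fintype V] {G : SimpleGraph V} (h : IsOre 4 G) : P V G := by
  revert inst
  induction h with
  | @complete V G e =>
    intro inst
    refine hK V G ⟨?_, fun a b hab => ?_⟩
    · simpa using Fintype.card_congr e.toEquiv
    · rw [← e.map_adj_iff]
      exact fun h => hab (e.injective h)
  | @composition V V₁ V₂ G G₁ G₂ x y z S h₁ h₂ hxy hz₁ hz₂ e ih₁ ih₂ =>
    intro inst
    have := isOre_finite h₁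
    have := isOre_finite h₂
    have := Fintype.ofFinite V₁
    have := Fintype.ofFinite V₂
    have hadj : ∀ s t, G.Adj (e.symm s) (e.symm t) ↔ (oreComposition G₁ x y G₂ z S).Adj s t :=
      fun s t => e.symm.map_adj_iff
    let i₂ : V₂ → V := fun b => if hb : b ≠ z then e.symm (.inr ⟨b, hb⟩) else e.symm (.inl x)
    have hi₂ : ∀ b (hb : b ≠ z), i₂ b = e.symm (.inr ⟨b, hb⟩) := fun b hb => by
      simp only [i₂, dif_pos hb]
    refine hC V V₁ V₂ G G₁ x y G₂ z S (fun a => e.symm (.inl a)) i₂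
      ⟨h₁, h₂, hxy, hz₁, hz₂, ?_, ?_, ?_, ?_, ?_, ?_, ?_⟩ ih₁ ih₂
    · intro a b hab
      simpa using e.symm.injective hab
    · intro b b' hb hb' h
      rw [hi₂ b hb, hi₂ b' hb'] at h
      simpa using e.symm.injective h
    · intro a b hb h
      rw [hi₂ b hb] at h
      simpa using e.symm.injective h
    · intro v
      rcases hv : e v with a | ⟨b, hb⟩
      · exact Or.inl ⟨a, by simp [← hv]⟩
      · exact Or.inr ⟨b, hb, by rw [hi₂ b hb]; simp [← hv]⟩
    · intro a a'
      exact hadj _ _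
    · intro b b' hb hb'
      rw [hi₂ b hb, hi₂ b' hb']
      exact hadj _ _
    · intro a b hb
      rw [hi₂ b hb]
      exact hadj _ _

theorem q_deleteEdge {V : Type*} (G : SimpleGraph V) {A : Finset V} {x y : V} (hx : x ∈ A)
    (hy : y ∈ A) (h : G.Adj x y) : q (G.deleteEdges {s(x, y)}) A = q G A + 3 := by
  have key : ee G A A = ee (G.deleteEdges {s(x, y)}) A A + 2 := by
    have h1 : ∀ a b, (if G.Adj a b then (1 : ℤ) else 0) =
        (if (G.deleteEdges {s(x, y)}).Adj a b then 1 else 0) +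
        ((if a = x then (if b = y then 1 else 0) else 0) +
          (if a = y then (if b = x then 1 else 0) else 0)) := by
      intro a b
      have hne := h.ne
      by_cases h1 : a = x ∧ b = y
      · obtain ⟨rfl, rfl⟩ := h1
        simp [h, hne]
      · by_cases h2 : a = y ∧ b = x
        · obtain ⟨rfl, rfl⟩ := h2
          simp [h.symm, Sym2.eq_swap, hne.symm]
        · have h3 : s(a, b) ≠ s(x, y) := by
            intro e
            rcases Sym2.eq_iff.1 e with e | e
            · exact h1 e
            · exact h2 e
          have h4 : (G.deleteEdges {s(x, y)}).Adj a b ↔ G.Adj a b := by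
            simp only [SimpleGraph.deleteEdges_adj, Set.mem_singleton_iff]
            tauto
          simp only [h4, ← ite_and, h1, h2, if_false, add_zero]
    unfold ee
    simp only [h1, Finset.sum_add_distrib]
    simp [hx, hy]
  have h1 := two_mul_ed G A
  have h2 := two_mul_ed (G.deleteEdges {s(x, y)}) A
  unfold q
  omega

namespace OreDecomp
variable {V V₁ V₂ : Type u} [Fintype V] [Fintype V₁] [Fintype V₂] {G : SimpleGraph V}
  {G₁ : SimpleGraph V₁} {x y : V₁} {G₂ : SimpleGraph V₂} {z : V₂} {S : Set V₂} {i₁ : V₁ → V}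
  {i₂ : V₂ → V}

theorem nbr_z (O : OreDecomp G G₁ x y G₂ z S i₁ i₂) {b : V₂} (hb : b ≠ z) :
    G₂.Adj z b ↔ G.Adj (i₁ x) (i₂ b) ∨ G.Adj (i₁ y) (i₂ b) := by
  rw [O.adj₁₂ x b hb, O.adj₁₂ y b hb]
  have := O.hxy.ne
  tauto

theorem injOn₂ (O : OreDecomp G G₁ x y G₂ z S i₁ i₂) :
    Set.InjOn i₂ (univ.erase z : Finset V₂) := by
  intro b hb b' hb' h
  exact O.inj₂ b b' (by simpa using hb) (by simpa using hb') h

/-- The vertices of the second graph other than the split vertex. -/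
noncomputable def right (_ : OreDecomp G G₁ x y G₂ z S i₁ i₂) : Finset V := (univ.erase z).image i₂

theorem mem_right (O : OreDecomp G G₁ x y G₂ z S i₁ i₂) {v : V} :
    v ∈ O.right ↔ ∃ b, b ≠ z ∧ i₂ b = v := by
  simp [right]

theorem disjoint_right (O : OreDecomp G G₁ x y G₂ z S i₁ i₂) (P : Finset V₁) :
    Disjoint (P.image i₁) O.right := by
  rw [Finset.disjoint_left]
  intro v hv hv'
  obtain ⟨a, -, rfl⟩ := Finset.mem_image.1 hv
  obtain ⟨b, hb, h⟩ := O.mem_right.1 hv'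
  exact O.disj a b hb h.symm

theorem univ_eq (O : OreDecomp G G₁ x y G₂ z S i₁ i₂) :
    (univ : Finset V) = univ.image i₁ ∪ O.right := by
  ext v
  simp only [Finset.mem_univ, Finset.mem_union, Finset.mem_image, true_and, true_iff, O.mem_right]
  exact O.cover v

theorem ee_right (O : OreDecomp G G₁ x y G₂ z S i₁ i₂) {P : Finset V₁} (hx : x ∈ P) (hy : y ∈ P) :
    ee G (P.image i₁) O.right = (dg G₂ z : ℤ) := by
  rw [ee_comm, ee_eq_sum, right, Finset.sum_image O.injOn₂]
  have h1 : ∀ b ∈ univ.erase z, (((P.image i₁).filter (G.Adj (i₂ b))).card : ℤ) =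
      if G₂.Adj z b then 1 else 0 := by
    intro b hb
    have hb : b ≠ z := by simpa using hb
    split_ifs with hzb
    · by_cases hS : b ∈ S
      · have : (P.image i₁).filter (G.Adj (i₂ b)) = {i₁ x} := by
          ext v
          simp only [Finset.mem_filter, Finset.mem_image, Finset.mem_singleton]
          constructor
          · rintro ⟨⟨a, -, rfl⟩, h⟩
            rcases ((O.adj₁₂ a b hb).1 h.symm).2 with h | h
            · rw [h.1]
            · exact absurd hS h.2
          · rintro rfl
            exact ⟨⟨x, hx, rfl⟩, ((O.adj₁₂ x b hb).2 ⟨hzb, Or.inl ⟨rfl, hS⟩⟩).symm⟩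
        rw [this]; simp
      · have : (P.image i₁).filter (G.Adj (i₂ b)) = {i₁ y} := by
          ext v
          simp only [Finset.mem_filter, Finset.mem_image, Finset.mem_singleton]
          constructor
          · rintro ⟨⟨a, -, rfl⟩, h⟩
            rcases ((O.adj₁₂ a b hb).1 h.symm).2 with h | h
            · exact absurd h.2 hS
            · rw [h.1]
          · rintro rfl
            exact ⟨⟨y, hy, rfl⟩, ((O.adj₁₂ y b hb).2 ⟨hzb, Or.inr ⟨rfl, hS⟩⟩).symm⟩
        rw [this]; simp
    · have : (P.image i₁).filter (G.Adj (i₂ b)) = ∅ := by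
        rw [Finset.filter_eq_empty_iff]
        intro v hv h
        obtain ⟨a, -, rfl⟩ := Finset.mem_image.1 hv
        exact hzb ((O.adj₁₂ a b hb).1 h.symm).1
      rw [this]; simp
  rw [Finset.sum_congr rfl h1, Finset.sum_boole]
  unfold dg
  congr 2
  ext b
  simp only [Finset.mem_filter, Finset.mem_erase, Finset.mem_univ, and_true, true_and,
    and_iff_right_iff_imp]
  exact fun h => h.ne'

/-- The second part loses the vertex `z` with its edges. -/
theorem q_right (O : OreDecomp G G₁ x y G₂ z S i₁ i₂) :
    q G O.right = q G₂ univ - 5 + 3 * (dg G₂ z : ℤ) := by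
  have h1 : q G O.right = q G₂ (univ.erase z) :=
    q_image_eq G G₂ i₂ _ O.injOn₂ fun a ha b hb =>
      (O.adj₂ a b (by simpa using ha) (by simpa using hb)).symm
  have h2 := q_insert G₂ (a := z) (A := univ.erase z) (by simp)
  rw [Finset.insert_erase (by simp)] at h2
  have h3 : (univ.erase z).filter (G₂.Adj z) = univ.filter (G₂.Adj z) := by
    ext b
    simp only [Finset.mem_filter, Finset.mem_erase, Finset.mem_univ, and_true, true_and,
      and_iff_right_iff_imp]
    exact fun h => h.ne'
  rw [h3] at h2
  unfold dg
  rw [h1]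
  linarith

theorem q_image₁ (O : OreDecomp G G₁ x y G₂ z S i₁ i₂) (P : Finset V₁) :
    q G (P.image i₁) = q (G₁.deleteEdges {s(x, y)}) P := by
  refine q_image_eq G _ i₁ P O.inj₁.injOn fun a _ b _ => ?_
  rw [O.adj₁]
  simp

/-- A set of the first graph that contains `x` and `y`, together with the whole second part, has
its weight in the first graph plus `q G₂ - 2`. -/
theorem q_union_right (O : OreDecomp G G₁ x y G₂ z S i₁ i₂) {P : Finset V₁} (hx : x ∈ P)
    (hy : y ∈ P) : q G (P.image i₁ ∪ O.right) = q G₁ P + q G₂ univ - 2 := by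
  rw [q_union G (O.disjoint_right P), O.ee_right hx hy, O.q_right, O.q_image₁,
    q_deleteEdge G₁ hx hy O.hxy]
  ring

theorem dg₁ (O : OreDecomp G G₁ x y G₂ z S i₁ i₂) {a : V₁} (hx : a ≠ x) (hy : a ≠ y) :
    dg G (i₁ a) = dg G₁ a := by
  unfold dg
  have : univ.filter (G.Adj (i₁ a)) = (univ.filter (G₁.Adj a)).image i₁ := by
    ext v
    simp only [Finset.mem_filter, Finset.mem_univ, true_and, Finset.mem_image]
    constructor
    · intro h
      rcases O.cover v with ⟨b, rfl⟩ | ⟨b, hb, rfl⟩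
      · exact ⟨b, ((O.adj₁ a b).1 h).1, rfl⟩
      · rcases ((O.adj₁₂ a b hb).1 h).2 with h | h
        · exact absurd h.1 hx
        · exact absurd h.1 hy
    · rintro ⟨b, hab, rfl⟩
      refine (O.adj₁ a b).2 ⟨hab, fun e => ?_⟩
      rcases Sym2.eq_iff.1 e with e | e
      · exact hx e.1
      · exact hy e.1
  rw [this, Finset.card_image_of_injective _ O.inj₁]

theorem dg₂ (O : OreDecomp G G₁ x y G₂ z S i₁ i₂) {b : V₂} (hb : b ≠ z) :
    dg G (i₂ b) = dg G₂ b := by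
  unfold dg
  let f : V₂ → V := fun c => if c = z then (if b ∈ S then i₁ x else i₁ y) else i₂ c
  have : univ.filter (G.Adj (i₂ b)) = (univ.filter (G₂.Adj b)).image f := by
    ext v
    simp only [Finset.mem_filter, Finset.mem_univ, true_and, Finset.mem_image]
    constructor
    · intro h
      rcases O.cover v with ⟨a, rfl⟩ | ⟨c, hc, rfl⟩
      · obtain ⟨h1, h2⟩ := (O.adj₁₂ a b hb).1 h.symm
        refine ⟨z, h1.symm, ?_⟩
        rcases h2 with ⟨rfl, h2⟩ | ⟨rfl, h2⟩ <;> simp [f, h2]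
      · exact ⟨c, (O.adj₂ b c hb hc).1 h, by simp [f, hc]⟩
    · rintro ⟨c, hbc, rfl⟩
      by_cases hc : c = z
      · subst hc
        by_cases hS : b ∈ S
        · simp only [f, if_true, hS]
          exact ((O.adj₁₂ x b hb).2 ⟨hbc.symm, Or.inl ⟨rfl, hS⟩⟩).symm
        · simp only [f, if_true, hS, if_false]
          exact ((O.adj₁₂ y b hb).2 ⟨hbc.symm, Or.inr ⟨rfl, hS⟩⟩).symm
      · simp only [f, hc, if_false]
        exact (O.adj₂ b c hb hc).2 hbc
  rw [this, Finset.card_image_of_injective]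
  intro c c' h
  by_cases hc : c = z <;> by_cases hc' : c' = z
  · rw [hc, hc']
  · exfalso
    simp only [f, hc, hc', if_true, if_false] at h
    split_ifs at h <;> exact O.disj _ _ hc' h
  · exfalso
    simp only [f, hc, hc', if_true, if_false] at h
    split_ifs at h <;> exact O.disj _ _ hc h.symm
  · simp only [f, hc, hc', if_false] at h
    exact O.inj₂ c c' hc hc' h

/-- The part of the composition that comes from the second graph separates `x` from `y` in every
colouring. -/
theorem ne_of_proper (O : OreDecomp G G₁ x y G₂ z S i₁ i₂) (hno : ¬ ∃ c, Proper G₂ univ c)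
    {c : V → Fin 3} (hc : ∀ m ∈ O.right, ∀ w, G.Adj m w → c m ≠ c w) : c (i₁ x) ≠ c (i₁ y) := by
  intro e
  have hm : ∀ b, b ≠ z → i₂ b ∈ O.right := fun b hb => O.mem_right.2 ⟨b, hb, rfl⟩
  refine hno ⟨fun b => if b = z then c (i₁ x) else c (i₂ b), ?_⟩
  have key : ∀ b, b ≠ z → G₂.Adj z b → c (i₁ x) ≠ c (i₂ b) := by
    intro b hb hzb
    rcases (O.nbr_z hb).1 hzb with h | h
    · exact (hc _ (hm b hb) _ h.symm).symm
    · rw [e]; exact (hc _ (hm b hb) _ h.symm).symm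
  intro a _ b _ hab
  by_cases ha : a = z <;> by_cases hb : b = z
  · rw [ha, hb] at hab; exact absurd hab G₂.irrefl
  · simp only [ha, hb, if_true, if_false]
    exact key b hb (ha ▸ hab)
  · simp only [ha, hb, if_true, if_false]
    exact (key a ha (hb ▸ hab.symm)).symm
  · simp only [ha, hb, if_false]
    exact hc _ (hm a ha) _ ((O.adj₂ a b ha hb).2 hab)

end OreDecomp

variable {V : Type u} [Fintype V] {G : SimpleGraph V}

theorem IsK4.dg_eq (h : IsK4 G) (v : V) : dg G v = 3 := by
  have : univ.filter (G.Adj v) = univ.erase v := by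
    ext w
    simp only [Finset.mem_filter, Finset.mem_univ, true_and, Finset.mem_erase, and_true]
    exact ⟨fun hw => hw.ne', fun hw => h.2 v w hw.symm⟩
  rw [dg, this, Finset.card_erase_of_mem (by simp), Finset.card_univ, h.1]

theorem IsK4.q_eq (h : IsK4 G) : q G univ = 2 := by
  have h1 : ee G univ univ = 12 := by
    rw [ee_eq_sum]
    have : ∀ v ∈ univ, ((univ.filter (G.Adj v)).card : ℤ) = 3 := fun v _ => by
      exact_mod_cast h.dg_eq v
    rw [Finset.sum_congr rfl this]
    simp [h.1]
  have h2 := two_mul_ed G univ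
  unfold q
  rw [Finset.card_univ, h.1]
  push_cast
  omega

theorem IsK4.exists_two (h : IsK4 G) {s t : V} (hst : s ≠ t) :
    ∃ a b, a ≠ b ∧ a ≠ s ∧ a ≠ t ∧ b ≠ s ∧ b ≠ t ∧ univ = ({s, t, a, b} : Finset V) := by
  have h1 : (univ \ ({s, t} : Finset V)).card = 2 := by
    rw [Finset.card_sdiff_of_subset (by simp), Finset.card_univ, h.1, Finset.card_pair hst]
  obtain ⟨a, b, hab, he⟩ := Finset.card_eq_two.1 h1
  have ha : a ∈ univ \ ({s, t} : Finset V) := by rw [he]; simp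
  have hb : b ∈ univ \ ({s, t} : Finset V) := by rw [he]; simp
  simp at ha hb
  refine ⟨a, b, hab, ha.1, ha.2, hb.1, hb.2, ?_⟩
  ext v
  have : v ∈ univ \ ({s, t} : Finset V) ↔ v ∈ ({a, b} : Finset V) := by rw [he]
  simp at this ⊢
  tauto

/-- An Ore-composition has weight `q G₁ + q G₂ - 2`, so all `4`-Ore graphs have the weight of `K₄`.
-/
theorem isOre_q (h : IsOre 4 G) : q G univ = 2 := by
  refine isOre_induction (P := fun V _ G => q G univ = 2) (fun V _ G h => h.q_eq) ?_ h
  intro V V₁ V₂ _ _ _ G G₁ x y G₂ z S i₁ i₂ O h₁ h₂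
  rw [O.univ_eq, O.q_union_right (by simp) (by simp), h₁, h₂]
  norm_num

theorem isOre_not_proper (h : IsOre 4 G) : ¬ ∃ c, Proper G univ c := by
  refine isOre_induction (P := fun V _ G => ¬ ∃ c, Proper G univ c) ?_ ?_ h
  · rintro V _ G h ⟨c, hc⟩
    have hinj : Function.Injective c := by
      intro a b hab
      by_contra hne
      exact hc a (by simp) b (by simp) (h.2 a b hne) hab
    have := Fintype.card_le_of_injective c hinj
    rw [h.1] at this
    simp at this
  · rintro V V₁ V₂ _ _ _ G G₁ x y G₂ z S i₁ i₂ O h₁ h₂ ⟨c, hc⟩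
    have hne := O.ne_of_proper h₂ (c := c) fun m _ w h => hc m (by simp) w (by simp) h
    refine h₁ ⟨c ∘ i₁, fun a _ b _ hab => ?_⟩
    by_cases e : s(a, b) = s(x, y)
    · rcases Sym2.eq_iff.1 e with ⟨rfl, rfl⟩ | ⟨rfl, rfl⟩
      · exact hne
      · exact hne.symm
    · exact hc _ (by simp) _ (by simp) ((O.adj₁ a b).2 ⟨hab, e⟩)

/-- A triangle `a, b, c` in which `a` and `b` have degree three. -/
structure GoodTri (G : SimpleGraph V) (a b c : V) : Prop where
  ab : G.Adj a b
  bc : G.Adj b c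
  ac : G.Adj a c
  da : dg G a = 3
  db : dg G b = 3

namespace OreDecomp
variable {V₁ V₂ : Type u} [Fintype V₁] [Fintype V₂]
  {G₁ : SimpleGraph V₁} {x y : V₁} {G₂ : SimpleGraph V₂} {z : V₂} {S : Set V₂} {i₁ : V₁ → V}
  {i₂ : V₂ → V}

theorem goodTri₂ (O : OreDecomp G G₁ x y G₂ z S i₁ i₂) {a b c : V₂} (h : GoodTri G₂ a b c)
    (ha : a ≠ z) (hb : b ≠ z) (hc : c ≠ z) : GoodTri G (i₂ a) (i₂ b) (i₂ c) :=
  ⟨(O.adj₂ _ _ ha hb).2 h.ab, (O.adj₂ _ _ hb hc).2 h.bc, (O.adj₂ _ _ ha hc).2 h.ac,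
    (O.dg₂ ha).trans h.da, (O.dg₂ hb).trans h.db⟩

theorem goodTri₁ (O : OreDecomp G G₁ x y G₂ z S i₁ i₂) {a b c : V₁} (h : GoodTri G₁ a b c)
    (hax : a ≠ x) (hay : a ≠ y) (hbx : b ≠ x) (hby : b ≠ y) :
    GoodTri G (i₁ a) (i₁ b) (i₁ c) := by
  refine ⟨(O.adj₁ _ _).2 ⟨h.ab, ?_⟩, (O.adj₁ _ _).2 ⟨h.bc, ?_⟩, (O.adj₁ _ _).2 ⟨h.ac, ?_⟩,
    (O.dg₁ hax hay).trans h.da, (O.dg₁ hbx hby).trans h.db⟩ <;>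
  · intro e
    rcases Sym2.eq_iff.1 e with e | e <;> simp_all

end OreDecomp

/-- In a `4`-Ore graph, every edge `st` leaves untouched a triangle with two vertices of degree
three: the triangle avoids `s`, and `t` is at most the third vertex. -/
theorem isOre_goodTri (h : IsOre 4 G) {s t : V} (hst : G.Adj s t) :
    ∃ a b c, GoodTri G a b c ∧ s ≠ a ∧ s ≠ b ∧ s ≠ c ∧ t ≠ a ∧ t ≠ b := by
  revert s t
  refine isOre_induction (P := fun V _ G => ∀ {s t : V}, G.Adj s t →
    ∃ a b c, GoodTri G a b c ∧ s ≠ a ∧ s ≠ b ∧ s ≠ c ∧ t ≠ a ∧ t ≠ b) ?_ ?_ h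
  · intro V _ G h s t hst
    obtain ⟨a, b, hab, h1, h2, h3, h4, -⟩ := h.exists_two hst.ne
    exact ⟨a, b, t, ⟨h.2 _ _ hab, h.2 _ _ h4, h.2 _ _ h2, h.dg_eq a, h.dg_eq b⟩,
      h1.symm, h3.symm, hst.ne, h2.symm, h4.symm⟩
  · intro V V₁ V₂ _ _ _ G G₁ x y G₂ z S i₁ i₂ O h₁ h₂ s t hst
    rcases O.cover s with ⟨s', rfl⟩ | ⟨s', hs', rfl⟩
    · rcases O.cover t with ⟨t', rfl⟩ | ⟨t', ht', rfl⟩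
      · obtain ⟨w, -, hw⟩ := O.hz₁
        obtain ⟨a, b, c, hT, ha, hb, hc, -, -⟩ := h₂ hw
        exact ⟨_, _, _, O.goodTri₂ hT ha.symm hb.symm hc.symm, O.disj _ _ ha.symm,
          O.disj _ _ hb.symm, O.disj _ _ hc.symm, O.disj _ _ ha.symm, O.disj _ _ hb.symm⟩
      · rcases ((O.adj₁₂ _ _ ht').1 hst).2 with ⟨rfl, -⟩ | ⟨rfl, -⟩
        · obtain ⟨a, b, c, hT, ha, hb, hc, ha', hb'⟩ := h₁ O.hxy
          exact ⟨_, _, _, O.goodTri₁ hT ha.symm ha'.symm hb.symm hb'.symm,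
            O.inj₁.ne ha, O.inj₁.ne hb, O.inj₁.ne hc, (O.disj _ _ ht').symm, (O.disj _ _ ht').symm⟩
        · obtain ⟨a, b, c, hT, ha, hb, hc, ha', hb'⟩ := h₁ O.hxy.symm
          exact ⟨_, _, _, O.goodTri₁ hT ha'.symm ha.symm hb'.symm hb.symm,
            O.inj₁.ne ha, O.inj₁.ne hb, O.inj₁.ne hc, (O.disj _ _ ht').symm, (O.disj _ _ ht').symm⟩
    · obtain ⟨a, b, c, hT, ha, hb, hc, ha', hb'⟩ := h₁ O.hxy
      refine ⟨_, _, _, O.goodTri₁ hT ha.symm ha'.symm hb.symm hb'.symm,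
        (O.disj _ _ hs').symm, (O.disj _ _ hs').symm, (O.disj _ _ hs').symm, ?_, ?_⟩
      · rcases O.cover t with ⟨t', rfl⟩ | ⟨t', ht', rfl⟩
        · rcases ((O.adj₁₂ _ _ hs').1 hst.symm).2 with ⟨rfl, -⟩ | ⟨rfl, -⟩
          · exact O.inj₁.ne ha
          · exact O.inj₁.ne ha'
        · exact (O.disj _ _ ht').symm
      · rcases O.cover t with ⟨t', rfl⟩ | ⟨t', ht', rfl⟩
        · rcases ((O.adj₁₂ _ _ hs').1 hst.symm).2 with ⟨rfl, -⟩ | ⟨rfl, -⟩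
          · exact O.inj₁.ne hb
          · exact O.inj₁.ne hb'
        · exact (O.disj _ _ ht').symm

/-- In a `4`-Ore graph other than `K₄`, every clique avoids a triangle with two vertices of degree
three. -/
theorem isOre_goodTri_disjoint (h : IsOre 4 G) (hK : ¬ IsK4 G) (X : Finset V)
    (hX : ∀ a ∈ X, ∀ b ∈ X, a ≠ b → G.Adj a b) :
    ∃ a b c, GoodTri G a b c ∧ a ∉ X ∧ b ∉ X ∧ c ∉ X := by
  revert hK X
  refine isOre_induction (P := fun V _ G => ¬ IsK4 G → ∀ X : Finset V,
    (∀ a ∈ X, ∀ b ∈ X, a ≠ b → G.Adj a b) →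
    ∃ a b c, GoodTri G a b c ∧ a ∉ X ∧ b ∉ X ∧ c ∉ X) (fun V _ G h hn => absurd h hn) ?_ h
  intro V V₁ V₂ _ _ _ G G₁ x y G₂ z S i₁ i₂ O _ _ _ X hX
  by_cases hr : ∃ b, b ≠ z ∧ i₂ b ∈ X
  · obtain ⟨b₀, hb₀, hb₀X⟩ := hr
    have key : ∀ a, i₁ a ∈ X → a = x ∨ a = y := by
      intro a ha
      rcases ((O.adj₁₂ a b₀ hb₀).1 (hX _ ha _ hb₀X (O.disj _ _ hb₀))).2 with h | h
      · exact Or.inl h.1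
      · exact Or.inr h.1
    have hnot : ¬ (i₁ x ∈ X ∧ i₁ y ∈ X) := by
      rintro ⟨h1, h2⟩
      exact ((O.adj₁ x y).1 (hX _ h1 _ h2 (O.inj₁.ne O.hxy.ne))).2 rfl
    by_cases hxX : i₁ x ∈ X
    · obtain ⟨a, b, c, hT, ha, hb, hc, ha', hb'⟩ := isOre_goodTri O.ore₁ O.hxy
      have hyX : i₁ y ∉ X := fun h => hnot ⟨hxX, h⟩
      refine ⟨_, _, _, O.goodTri₁ hT ha.symm ha'.symm hb.symm hb'.symm, ?_, ?_, ?_⟩ <;>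
      · intro hm
        rcases key _ hm with e | e
        · simp_all
        · rw [e] at hm; exact hyX hm
    · obtain ⟨a, b, c, hT, ha, hb, hc, ha', hb'⟩ := isOre_goodTri O.ore₁ O.hxy.symm
      refine ⟨_, _, _, O.goodTri₁ hT ha'.symm ha.symm hb'.symm hb.symm, ?_, ?_, ?_⟩ <;>
      · intro hm
        rcases key _ hm with e | e
        · rw [e] at hm; exact hxX hm
        · simp_all
  · push Not at hr
    obtain ⟨w, -, hw⟩ := O.hz₁
    obtain ⟨a, b, c, hT, ha, hb, hc, -, -⟩ := isOre_goodTri O.ore₂ hw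
    exact ⟨_, _, _, O.goodTri₂ hT ha.symm hb.symm hc.symm, hr _ ha.symm, hr _ hb.symm, hr _ hc.symm⟩

/-- An edge `uv` of a `4`-Ore graph has an end `u` of degree three, or some set of weight at most
five does not contain both ends, or `u` and some vertex `y₀` separate a set without `u` and `v`
that forces different colours at `u` and `y₀`. -/
theorem isOre_edge (h : IsOre 4 G) {u v : V} (huv : G.Adj u v) :
    dg G u = 3 ∨ (∃ P : Finset V, 4 ≤ P.card ∧ q G P ≤ 5 ∧ ¬ (u ∈ P ∧ v ∈ P)) ∨
    ∃ (M : Finset V) (y₀ : V), M.Nonempty ∧ u ∉ M ∧ v ∉ M ∧ y₀ ∉ M ∧ y₀ ≠ v ∧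
      (∀ m ∈ M, ∀ w, w ∉ M → G.Adj m w → w = u ∨ w = y₀) ∧
      ∀ c : V → Fin 3, (∀ m ∈ M, ∀ w, G.Adj m w → c m ≠ c w) → c u ≠ c y₀ := by
  revert u v
  refine isOre_induction (P := fun V _ G => ∀ {u v : V}, G.Adj u v → dg G u = 3 ∨
    (∃ P : Finset V, 4 ≤ P.card ∧ q G P ≤ 5 ∧ ¬ (u ∈ P ∧ v ∈ P)) ∨
    ∃ (M : Finset V) (y₀ : V), M.Nonempty ∧ u ∉ M ∧ v ∉ M ∧ y₀ ∉ M ∧ y₀ ≠ v ∧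
      (∀ m ∈ M, ∀ w, w ∉ M → G.Adj m w → w = u ∨ w = y₀) ∧
      ∀ c : V → Fin 3, (∀ m ∈ M, ∀ w, G.Adj m w → c m ≠ c w) → c u ≠ c y₀) ?_ ?_ h
  · intro V _ G h u v huv
    exact Or.inl (h.dg_eq u)
  intro V V₁ V₂ _ _ _ G G₁ x y G₂ z S i₁ i₂ O ih₁ _ u v huv
  have hno := isOre_not_proper O.ore₂
  have hmr : ∀ b, b ≠ z → i₂ b ∈ O.right := fun b hb => O.mem_right.2 ⟨b, hb, rfl⟩
  have hrn : ∀ a, i₁ a ∉ O.right := fun a ha => by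
    obtain ⟨b, hb, e⟩ := O.mem_right.1 ha
    exact O.disj a b hb e.symm
  have hrne : O.right.Nonempty := by
    obtain ⟨w, -, hw⟩ := O.hz₁
    exact ⟨_, hmr w hw.ne'⟩
  by_cases hboth : (∃ a, i₁ a = u) ∧ ∃ a, i₁ a = v
  swap
  · -- the first part has lost the edge `xy`, so it has weight five
    refine Or.inr (Or.inl ⟨univ.image i₁, ?_, ?_, ?_⟩)
    · rw [Finset.card_image_of_injective _ O.inj₁, Finset.card_univ]
      have h1 := isOre_q O.ore₁
      obtain ⟨w, -, hw⟩ := O.hz₁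
      obtain ⟨a, b, c, hT, ha, hb, hc, ha', hb'⟩ := isOre_goodTri O.ore₁ O.hxy
      have : ({x, a, b, c} : Finset V₁).card = 4 := by
        rw [Finset.card_eq_of_equiv_fin]
        have h1 := hT.ab.ne; have h2 := hT.bc.ne; have h3 := hT.ac.ne
        exact (Finset.equivFinOfCardEq (by simp [*]))
      calc 4 = _ := this.symm
        _ ≤ _ := Finset.card_le_univ _
    · rw [O.q_image₁, q_deleteEdge G₁ (by simp) (by simp) O.hxy, isOre_q O.ore₁]
      norm_num
    · simpa using hboth
  obtain ⟨⟨u, rfl⟩, v, rfl⟩ := hboth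
  obtain ⟨huv₁, hne⟩ := (O.adj₁ u v).1 huv
  have hMr : ∀ m ∈ O.right, ∀ w, w ∉ O.right → G.Adj m w → w = i₁ x ∨ w = i₁ y := by
    intro m hm w hw hmw
    obtain ⟨b, hb, rfl⟩ := O.mem_right.1 hm
    rcases O.cover w with ⟨a, rfl⟩ | ⟨c, hc, rfl⟩
    · rcases ((O.adj₁₂ a b hb).1 hmw.symm).2 with h | h
      · exact Or.inl (by rw [h.1])
      · exact Or.inr (by rw [h.1])
    · exact absurd (hmr c hc) hw
  rcases ih₁ huv₁ with h | ⟨P, hP, hqP, hnP⟩ | ⟨M, y₀, hM, huM, hvM, hyM, hyv, hN, hcol⟩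
  · -- the degree of `u` is unchanged unless `u` is `x` or `y`; then `M` is the second part
    by_cases hux : u = x
    · refine Or.inr (Or.inr ⟨O.right, i₁ y, hrne, hrn _, hrn _, hrn _, ?_, ?_, ?_⟩)
      · intro e
        exact hne (by rw [hux, O.inj₁ e])
      · rw [hux]; exact hMr
      · rw [hux]; exact fun c hc => O.ne_of_proper hno hc
    · by_cases huy : u = y
      · refine Or.inr (Or.inr ⟨O.right, i₁ x, hrne, hrn _, hrn _, hrn _, ?_, ?_, ?_⟩)
        · intro e
          exact hne (by rw [huy, ← O.inj₁ e, Sym2.eq_swap])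
        · rw [huy]; exact fun m hm w hw hmw => (hMr m hm w hw hmw).symm
        · rw [huy]; exact fun c hc => (O.ne_of_proper hno hc).symm
      · exact Or.inl ((O.dg₁ hux huy).trans h)
  · -- the set `P` absorbs the second part if it contains both `x` and `y`
    refine Or.inr (Or.inl ?_)
    by_cases hxy : x ∈ P ∧ y ∈ P
    · refine ⟨P.image i₁ ∪ O.right, ?_, ?_, ?_⟩
      · calc 4 ≤ (P.image i₁).card := by rwa [Finset.card_image_of_injective _ O.inj₁]
          _ ≤ _ := Finset.card_le_card Finset.subset_union_left
      · rw [O.q_union_right hxy.1 hxy.2, isOre_q O.ore₂]; linarith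
      · rintro ⟨h1, h2⟩
        refine hnP ⟨?_, ?_⟩
        · rcases Finset.mem_union.1 h1 with h1 | h1
          · exact O.inj₁.mem_finset_image.1 h1
          · exact absurd h1 (hrn _)
        · rcases Finset.mem_union.1 h2 with h1 | h1
          · exact O.inj₁.mem_finset_image.1 h1
          · exact absurd h1 (hrn _)
    · refine ⟨P.image i₁, ?_, ?_, ?_⟩
      · rwa [Finset.card_image_of_injective _ O.inj₁]
      · rw [q_image_eq G G₁ i₁ P O.inj₁.injOn]
        · exact hqP
        · intro a ha b hb
          rw [O.adj₁]
          refine ⟨fun h => ⟨h, fun e => hxy ?_⟩, fun h => h.1⟩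
          rcases Sym2.eq_iff.1 e with ⟨rfl, rfl⟩ | ⟨rfl, rfl⟩
          · exact ⟨ha, hb⟩
          · exact ⟨hb, ha⟩
      · rintro ⟨h1, h2⟩
        exact hnP ⟨O.inj₁.mem_finset_image.1 h1,
          O.inj₁.mem_finset_image.1 h2⟩
  · -- the set `M` absorbs the second part if it contains `x` or `y`
    refine Or.inr (Or.inr ?_)
    have hmi : ∀ a, i₁ a ∈ M.image i₁ ↔ a ∈ M := fun a => O.inj₁.mem_finset_image
    by_cases hxy : x ∈ M ∨ y ∈ M
    · have hm : ∀ a, i₁ a ∈ M.image i₁ ∪ O.right ↔ a ∈ M := fun a => by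
        rw [Finset.mem_union, hmi, or_iff_left (hrn a)]
      refine ⟨M.image i₁ ∪ O.right, i₁ y₀, hM.image i₁ |>.mono Finset.subset_union_left,
        by rwa [hm], by rwa [hm], by rwa [hm], O.inj₁.ne hyv, ?_, ?_⟩
      · intro m hmm w hw hmw
        rcases Finset.mem_union.1 hmm with hmm | hmm
        · obtain ⟨a, ha, rfl⟩ := Finset.mem_image.1 hmm
          rcases O.cover w with ⟨b, rfl⟩ | ⟨c, hc, rfl⟩
          · rw [hm] at hw
            rcases hN a ha b hw ((O.adj₁ a b).1 hmw).1 with e | e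
            · exact Or.inl (by rw [e])
            · exact Or.inr (by rw [e])
          · exact absurd (Finset.mem_union_right _ (hmr c hc)) hw
        · have hw' : w ∉ O.right := fun h => hw (Finset.mem_union_right _ h)
          have hNxy : ∀ p p', (p = x ∧ p' = y ∨ p = y ∧ p' = x) → p ∉ M → i₁ p = i₁ u ∨ i₁ p = i₁ y₀ := by
            rintro p p' (⟨rfl, rfl⟩ | ⟨rfl, rfl⟩) hp
            · have hy : p' ∈ M := hxy.resolve_left hp
              rcases hN p' hy p hp O.hxy.symm with e | e
              · exact Or.inl (by rw [e])
              · exact Or.inr (by rw [e])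
            · have hy : p' ∈ M := hxy.resolve_right hp
              rcases hN p' hy p hp O.hxy with e | e
              · exact Or.inl (by rw [e])
              · exact Or.inr (by rw [e])
          rcases hMr m hmm w hw' hmw with rfl | rfl
          · rw [hm] at hw
            exact hNxy x y (Or.inl ⟨rfl, rfl⟩) hw
          · rw [hm] at hw
            exact hNxy y x (Or.inr ⟨rfl, rfl⟩) hw
      · intro c hc
        have h1 := O.ne_of_proper hno (c := c) fun m hm w h => hc m (Finset.mem_union_right _ hm) w h
        refine hcol (c ∘ i₁) fun m hmm w hmw => ?_
        by_cases e : s(m, w) = s(x, y)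
        · rcases Sym2.eq_iff.1 e with ⟨rfl, rfl⟩ | ⟨rfl, rfl⟩
          · exact h1
          · exact h1.symm
        · exact hc _ (Finset.mem_union_left _ ((hmi m).2 hmm)) _ ((O.adj₁ m w).2 ⟨hmw, e⟩)
    · push Not at hxy
      have hadj : ∀ m ∈ M, ∀ w, G.Adj (i₁ m) w → ∃ b, i₁ b = w ∧ G₁.Adj m b := by
        intro m hmm w hmw
        rcases O.cover w with ⟨b, rfl⟩ | ⟨c, hc, rfl⟩
        · exact ⟨b, rfl, ((O.adj₁ m b).1 hmw).1⟩
        · rcases ((O.adj₁₂ m c hc).1 hmw).2 with h | h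
          · exact absurd (h.1 ▸ hmm) hxy.1
          · exact absurd (h.1 ▸ hmm) hxy.2
      refine ⟨M.image i₁, i₁ y₀, hM.image i₁, by rwa [hmi], by rwa [hmi], by rwa [hmi],
        O.inj₁.ne hyv, ?_, ?_⟩
      · intro m hmm w hw hmw
        obtain ⟨a, ha, rfl⟩ := Finset.mem_image.1 hmm
        obtain ⟨b, rfl, hab⟩ := hadj a ha w hmw
        rw [hmi] at hw
        rcases hN a ha b hw hab with e | e
        · exact Or.inl (by rw [e])
        · exact Or.inr (by rw [e])
      · intro c hc
        refine hcol (c ∘ i₁) fun m hmm w hmw => hc _ ((hmi m).2 hmm) _ ((O.adj₁ m w).2 ⟨hmw, ?_⟩)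
        intro e
        rcases Sym2.eq_iff.1 e with e | e
        · exact hxy.1 (e.1 ▸ hmm)
        · exact hxy.2 (e.1 ▸ hmm)

end OreStructure

/-! ### Packings given by explicit cycles -/

section PackingTools
variable {V : Type*} {G : SimpleGraph V}

/-- The list `l` is the cyclic vertex sequence of a triangle or a quadrilateral. -/
def CycList (G : SimpleGraph V) : List V → Prop
  | [a, b, c] => G.Adj a b ∧ G.Adj b c ∧ G.Adj c a
  | [a, b, c, d] => a ≠ c ∧ b ≠ d ∧ G.Adj a b ∧ G.Adj b c ∧ G.Adj c d ∧ G.Adj d a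
  | _ => False

instance (G : SimpleGraph V) [DecidableEq V] [DecidableRel G.Adj] (l : List V) :
    Decidable (CycList G l) := by
  unfold CycList
  split <;> infer_instance

theorem CycList.isShort {l : List V} (h : CycList G l) : IsShort G l.toFinset := by
  unfold CycList at h
  split at h
  · obtain ⟨h1, h2, h3⟩ := h
    exact Or.inl ⟨_, _, _, by simp, h1, h2, h3⟩
  · obtain ⟨h1, h2, h3, h4, h5, h6⟩ := h
    exact Or.inr ⟨_, _, _, _, by simp, h1, h2, h3, h4, h5, h6⟩
  · exact h.elim

/-- A list of cycles on `A` that are pairwise disjoint. -/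
def PackList (G : SimpleGraph V) (A : V → Prop) (P : List (List V)) : Prop :=
  (∀ l ∈ P, CycList G l ∧ ∀ v ∈ l, A v) ∧ P.Pairwise List.Disjoint

instance {n : ℕ} (l m : List (Fin n)) : Decidable (l.Disjoint m) :=
  decidable_of_iff (∀ a ∈ l, a ∉ m) ⟨fun h _ h1 h2 => h _ h1 h2, fun h _ h1 h2 => h h1 h2⟩

instance {n : ℕ} (G : SimpleGraph (Fin n)) [DecidableRel G.Adj] (A : Fin n → Prop)
    [DecidablePred A] (P : List (List (Fin n))) : Decidable (PackList G A P) := by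
  unfold PackList
  infer_instance

/-- Lower bounds for `pk` from an explicit packing, which `decide` can verify on `Fin n`. -/
theorem PackList.le_pk {A : V → Prop} {B : Finset V} {P : List (List V)} (h : PackList G A P)
    (hAB : ∀ v, A v → v ∈ B) : P.length ≤ pk G B := by
  induction P generalizing A B with
  | nil => simp
  | cons l P ih =>
    obtain ⟨h1, h2⟩ := h
    rw [List.pairwise_cons] at h2
    have h3 : PackList G (fun v => A v ∧ v ∉ l) P :=
      ⟨fun m hm => ⟨(h1 m (by simp [hm])).1, fun v hv =>
        ⟨(h1 m (by simp [hm])).2 v hv, fun hv' => h2.1 m hm hv' hv⟩⟩, h2.2⟩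
    have h4 := ih (B := B \ l.toFinset) h3 fun v hv => by
      simp [hAB v hv.1, hv.2]
    have h5 : 1 ≤ pk G (B ∩ l.toFinset) := one_le_pk (h1 l (by simp)).1.isShort fun v hv => by
      simp only [Finset.mem_inter]
      exact ⟨hAB v ((h1 l (by simp)).2 v (by simpa using hv)), hv⟩
    have h6 := pk_add (G := G) (A := B \ l.toFinset) (B := B ∩ l.toFinset) (C := B) (by simp)
      (by simp) (by rw [Finset.disjoint_left]; intro v; simp; tauto)
    simp only [List.length_cons]
    omega

theorem pk_le_of_iso {U : Type*} {W : SimpleGraph U} (e : W ≃g G) (A : Finset U) :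
    pk W A ≤ pk G (A.image e) :=
  pk_map e e.injective.injOn (fun a ha => by simpa using ha) fun a _ b _ h => e.map_adj_iff.2 h

/-- Deleting an edge lowers the packing number by at most one. -/
theorem pk_deleteEdge (G : SimpleGraph V) (A : Finset V) (x y : V) :
    pk G A ≤ pk (G.deleteEdges {s(x, y)}) A + 1 := by
  refine (pk_erase A x).trans (Nat.add_le_add_right ?_ 1)
  refine pk_map id Function.injective_id.injOn (fun a ha => Finset.mem_of_mem_erase ha) ?_
  intro a ha b hb hab
  simp only [id, SimpleGraph.deleteEdges_adj, Set.mem_singleton_iff]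
  refine ⟨hab, fun e => ?_⟩
  rcases Sym2.eq_iff.1 e with e | e
  · exact Finset.ne_of_mem_erase ha e.1
  · exact Finset.ne_of_mem_erase hb e.2

/-- A bound for the packing number by a set that meets every cycle of length at most four. -/
theorem pk_le_of_cover {A X : Finset V} (h : ∀ s, IsShort G s → s ⊆ A \ X → False) :
    pk G A ≤ X.card := by
  have h1 := pk_sdiff (G := G) A X
  have h2 : pk G (A \ X) = 0 := by
    by_contra hne
    obtain ⟨s, hs, hsA⟩ := exists_isShort (G := G) (A := A \ X) (by omega)
    exact h s hs hsA
  omega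

end PackingTools

/-! ### Splitting a vertex -/

section Split
variable {U V : Type*} {W : SimpleGraph U} {w : U} {G : SimpleGraph V} {a d : V} {g : U → V}

/-- The graph `G` contains the graph obtained from `W` by splitting `w` into `a` and `d`. -/
structure SplitIn (W : SimpleGraph U) (w : U) (G : SimpleGraph V) (a d : V) (g : U → V) : Prop where
  had : a ≠ d
  inj : ∀ s t, s ≠ w → t ≠ w → g s = g t → s = t
  ne_a : ∀ s, s ≠ w → g s ≠ a
  ne_d : ∀ s, s ≠ w → g s ≠ d
  adj : ∀ s t, s ≠ w → t ≠ w → W.Adj s t → G.Adj (g s) (g t)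
  adjw : ∀ s, W.Adj w s → G.Adj a (g s) ∨ G.Adj d (g s)

theorem SplitIn.iso {U' : Type*} {W' : SimpleGraph U'} (h : SplitIn W w G a d g) (e : W ≃g W') :
    SplitIn W' (e w) G a d (g ∘ e.symm) := by
  have hne : ∀ s, s ≠ e w → e.symm s ≠ w := fun s hs h => hs (by rw [← h]; simp)
  refine ⟨h.had, fun s t hs ht hst => ?_, fun s hs => h.ne_a _ (hne s hs),
    fun s hs => h.ne_d _ (hne s hs),
    fun s t hs ht hst => h.adj _ _ (hne s hs) (hne t ht) (e.symm.map_adj_iff.2 hst),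
    fun s hs => h.adjw _ ?_⟩
  · exact e.symm.injective (h.inj _ _ (hne s hs) (hne t ht) hst)
  · rw [← e.map_adj_iff]
    simpa using hs

theorem SplitIn.pk_le (h : SplitIn W w G a d g) {A : Finset U} (hA : w ∉ A) {B : Finset V}
    (hB : ∀ s ∈ A, g s ∈ B) : pk W A ≤ pk G B := by
  have hne : ∀ s ∈ A, s ≠ w := fun s hs e => hA (e ▸ hs)
  exact pk_map g (fun s hs t ht e => h.inj s t (hne s hs) (hne t ht) e) hB
    fun s hs t ht e => h.adj s t (hne s hs) (hne t ht) e

/-- When `w` is split, a path on three neighbours of `w` still lies in a cycle of length at most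
four through one of the two parts of `w`. -/
theorem SplitIn.exists_short (h : SplitIn W w G a d g) {α γ δ : U} (h1 : W.Adj w α)
    (h2 : W.Adj w γ) (h3 : W.Adj w δ) (h4 : W.Adj α γ) (h5 : W.Adj γ δ) (h6 : α ≠ δ) :
    ∃ r, (r = a ∨ r = d) ∧ ∃ s, IsShort G s ∧ s ⊆ {r, g α, g γ, g δ} := by
  have e1 := h.adj α γ h1.ne' h2.ne' h4
  have e2 := h.adj γ δ h2.ne' h3.ne' h5
  have e3 : g α ≠ g δ := fun e => h6 (h.inj _ _ h1.ne' h3.ne' e)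
  have tri : ∀ r p p', G.Adj r p → G.Adj r p' → G.Adj p p' → IsShort G {r, p, p'} :=
    fun r p p' k1 k2 k3 => Or.inl ⟨r, p, p', rfl, k1, k3, k2.symm⟩
  have key : ∀ r r', (r = a ∧ r' = d) ∨ (r = d ∧ r' = a) → G.Adj r (g γ) →
      ∃ r, (r = a ∨ r = d) ∧ ∃ s, IsShort G s ∧ s ⊆ {r, g α, g γ, g δ} := by
    intro r r' hr hγ
    have hr1 : r = a ∨ r = d := by tauto
    have hr2 : r' = a ∨ r' = d := by tauto
    have hα : G.Adj r (g α) ∨ G.Adj r' (g α) := by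
      rcases hr with ⟨rfl, rfl⟩ | ⟨rfl, rfl⟩
      · exact h.adjw α h1
      · exact (h.adjw α h1).symm
    have hδ : G.Adj r (g δ) ∨ G.Adj r' (g δ) := by
      rcases hr with ⟨rfl, rfl⟩ | ⟨rfl, rfl⟩
      · exact h.adjw δ h3
      · exact (h.adjw δ h3).symm
    have hne : r' ≠ g γ := by
      rcases hr2 with rfl | rfl
      · exact (h.ne_a γ h2.ne').symm
      · exact (h.ne_d γ h2.ne').symm
    rcases hα with hα | hα
    · exact ⟨r, hr1, _, tri _ _ _ hα hγ e1, by intro v; simp; tauto⟩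
    rcases hδ with hδ | hδ
    · exact ⟨r, hr1, _, tri _ _ _ hγ hδ e2, by intro v; simp; tauto⟩
    exact ⟨r', hr2, _, Or.inr ⟨r', g α, g γ, g δ, rfl, hne, e3, hα, e1, e2, hδ.symm⟩, subset_rfl⟩
  rcases h.adjw γ h2 with hγ | hγ
  · exact key a d (Or.inl ⟨rfl, rfl⟩) hγ
  · exact key d a (Or.inr ⟨rfl, rfl⟩) hγ

/-- The packing number after a split at `w`, when three neighbours of `w` form a path outside `A`.
-/
theorem SplitIn.exists_pk (h : SplitIn W w G a d g) {α γ δ : U} (h1 : W.Adj w α)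
    (h2 : W.Adj w γ) (h3 : W.Adj w δ) (h4 : W.Adj α γ) (h5 : W.Adj γ δ) (h6 : α ≠ δ)
    {A : Finset U} (hA : w ∉ A) (hα : α ∉ A) (hγ : γ ∉ A) (hδ : δ ∉ A) {B : Finset V}
    (hB : ∀ s, s ≠ w → g s ∈ B) :
    ∃ r, (r = a ∨ r = d) ∧ pk W A + 1 ≤ pk G (insert r B) := by
  obtain ⟨r, hr, s, hs, hsub⟩ := h.exists_short h1 h2 h3 h4 h5 h6
  refine ⟨r, hr, ?_⟩
  have hne : ∀ s ∈ A, s ≠ w := fun s hs e => hA (e ▸ hs)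
  have k1 : pk W A ≤ pk G (A.image g) :=
    h.pk_le hA fun s hs => Finset.mem_image_of_mem g hs
  have k2 : 1 ≤ pk G {r, g α, g γ, g δ} := one_le_pk hs hsub
  refine le_trans (Nat.add_le_add k1 k2) (pk_add ?_ ?_ ?_)
  · intro v hv
    obtain ⟨t, ht, rfl⟩ := Finset.mem_image.1 hv
    exact Finset.mem_insert_of_mem (hB t (hne t ht))
  · intro v hv
    simp only [Finset.mem_insert, Finset.mem_singleton] at hv
    rcases hv with rfl | rfl | rfl | rfl
    · simp
    · exact Finset.mem_insert_of_mem (hB _ h1.ne')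
    · exact Finset.mem_insert_of_mem (hB _ h2.ne')
    · exact Finset.mem_insert_of_mem (hB _ h3.ne')
  · rw [Finset.disjoint_left]
    intro v hv hv'
    obtain ⟨t, ht, rfl⟩ := Finset.mem_image.1 hv
    simp only [Finset.mem_insert, Finset.mem_singleton] at hv'
    have htw := hne t ht
    rcases hv' with e | e | e | e
    · rcases hr with rfl | rfl
      · exact h.ne_a t htw e
      · exact h.ne_d t htw e
    · exact hα (h.inj _ _ htw h1.ne' e ▸ ht)
    · exact hγ (h.inj _ _ htw h2.ne' e ▸ ht)
    · exact hδ (h.inj _ _ htw h3.ne' e ▸ ht)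

end Split

/-! ### Short cycles in the exceptional graphs -/

section Concrete

instance decH7 : DecidableRel graphH7.Adj := by unfold graphH7; infer_instance
instance decW5 : DecidableRel graphW5.Adj := by unfold graphW5; infer_instance
instance decT8 : DecidableRel graphT8.Adj := by unfold graphT8; infer_instance
instance decT11 : DecidableRel graphT11.Adj := by unfold graphT11; infer_instance

theorem dg_eq_card {V : Type*} [Fintype V] (G : SimpleGraph V) [DecidableRel G.Adj] (v : V) :
    dg G v = (univ.filter (G.Adj v)).card := by
  unfold dg
  congr

/-- A lower bound for `pk` from a list of candidate packings, one of which is valid. -/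
theorem exists_pk_of_packList {V : Type*} {G : SimpleGraph V} {A : V → Prop} {B : Finset V}
    {k : ℕ} {L : List (List (List V))} (h : ∃ P ∈ L, PackList G A P) (hL : ∀ P ∈ L, P.length = k)
    (hAB : ∀ v, A v → v ∈ B) : k ≤ pk G B := by
  obtain ⟨P, hP, h⟩ := h
  rw [← hL P hP]
  exact h.le_pk hAB

theorem h7_deleteEdge {i j : Fin 7} (h : graphH7.Adj i j) :
    2 ≤ pk (graphH7.deleteEdges {s(i, j)}) univ := by
  refine exists_pk_of_packList (A := fun _ => True) (L := [[[1, 2, 3], [4, 5, 6]],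
    [[0, 2, 3], [1, 5, 6]], [[0, 2, 1, 3], [4, 5, 6]], [[0, 2, 3], [1, 5, 4, 6]]]) ?_ (by simp)
    (by simp)
  revert i j
  decide

theorem h7_erase {i : Fin 7} (h : i ∉ ({2, 3, 5, 6} : Finset (Fin 7))) :
    2 ≤ pk graphH7 (univ.erase i) := by
  refine exists_pk_of_packList (A := fun v => v ≠ i) (L := [[[0, 2, 3], [4, 5, 6]],
    [[0, 2, 3], [1, 5, 6]], [[1, 2, 3], [4, 5, 6]]]) ?_ (by simp) (by simp)
  revert i
  decide

/-- The Moser spindle without a vertex other than its centre contains a diamond. -/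
theorem h7_diamond {i : Fin 7} (h : i ≠ 1) : ∃ a b c d : Fin 7, a ≠ d ∧ graphH7.Adj a b ∧
    graphH7.Adj a c ∧ graphH7.Adj b c ∧ graphH7.Adj b d ∧ graphH7.Adj c d ∧ dg graphH7 b = 3 ∧
    dg graphH7 c = 3 ∧ a ≠ i ∧ b ≠ i ∧ c ≠ i ∧ d ≠ i := by
  have h2 : dg graphH7 2 = 3 := by rw [dg_eq_card]; decide
  have h3 : dg graphH7 3 = 3 := by rw [dg_eq_card]; decide
  have h5 : dg graphH7 5 = 3 := by rw [dg_eq_card]; decide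
  have h6 : dg graphH7 6 = 3 := by rw [dg_eq_card]; decide
  by_cases hi : i = 0 ∨ i = 2 ∨ i = 3
  · refine ⟨1, 5, 6, 4, by decide, by decide, by decide, by decide, by decide, by decide, h5, h6, ?_⟩
    revert i; decide
  · refine ⟨0, 2, 3, 1, by decide, by decide, by decide, by decide, by decide, by decide, h2, h3, ?_⟩
    revert i; decide

/-- The Moser spindle without an edge contains a diamond. -/
theorem h7_diamond_edge {i j : Fin 7} (h : graphH7.Adj i j) : ∃ a b c d : Fin 7, a ≠ d ∧
    (graphH7.Adj a b ∧ s(a, b) ≠ s(i, j)) ∧ (graphH7.Adj a c ∧ s(a, c) ≠ s(i, j)) ∧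
    (graphH7.Adj b c ∧ s(b, c) ≠ s(i, j)) ∧ (graphH7.Adj b d ∧ s(b, d) ≠ s(i, j)) ∧
    (graphH7.Adj c d ∧ s(c, d) ≠ s(i, j)) := by
  by_cases hij : i ∈ ({0, 1, 2, 3} : Finset (Fin 7)) ∧ j ∈ ({0, 1, 2, 3} : Finset (Fin 7))
  · refine ⟨1, 5, 6, 4, ?_⟩
    revert i j; decide
  · refine ⟨0, 2, 3, 1, ?_⟩
    revert i j; decide

/-- A triangle avoids both `i` and `j`, or three neighbours of `j` form a path that avoids `i`, so
that by `SplitIn.exists_short` a short cycle avoids `i` after a split at `j`. -/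
theorem h7_two (i j : Fin 7) (hij : i ≠ j) : 1 ≤ pk graphH7 ((univ.erase i).erase j) ∨
    ∃ α γ δ : Fin 7, graphH7.Adj j α ∧ graphH7.Adj j γ ∧ graphH7.Adj j δ ∧ graphH7.Adj α γ ∧
      graphH7.Adj γ δ ∧ α ≠ δ ∧ α ≠ i ∧ γ ≠ i ∧ δ ≠ i := by
  have key : ∀ i j : Fin 7, i ≠ j →
      (∃ P ∈ [[[(0 : Fin 7), 2, 3]], [[1, 2, 3]], [[4, 5, 6]], [[1, 5, 6]]],
        PackList graphH7 (fun v => v ≠ i ∧ v ≠ j) P) ∨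
      ∃ p ∈ [((0 : Fin 7), (3 : Fin 7), (1 : Fin 7)), (0, 2, 1), (1, 6, 4), (1, 5, 4)],
        graphH7.Adj j p.1 ∧ graphH7.Adj j p.2.1 ∧ graphH7.Adj j p.2.2 ∧ graphH7.Adj p.1 p.2.1 ∧
        graphH7.Adj p.2.1 p.2.2 ∧ p.1 ≠ p.2.2 ∧ p.1 ≠ i ∧ p.2.1 ≠ i ∧ p.2.2 ≠ i := by decide
  rcases key i j hij with h | ⟨p, -, h⟩
  · exact Or.inl (exists_pk_of_packList h (by simp) (by simp; tauto))
  · exact Or.inr ⟨_, _, _, h⟩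

/-- After a split of the Moser spindle, two disjoint cycles of length at most four avoid one of the
two parts of the split vertex. -/
theorem h7_split {V : Type*} {G : SimpleGraph V} {a d : V} {g : Fin 7 → V} {i : Fin 7}
    (h : SplitIn graphH7 i G a d g) {B : Finset V} (hB : ∀ s, s ≠ i → g s ∈ B) :
    ∃ r, (r = a ∨ r = d) ∧ 2 ≤ pk G (insert r B) := by
  by_cases hi : i ∉ ({2, 3, 5, 6} : Finset (Fin 7))
  · refine ⟨a, Or.inl rfl, (h7_erase hi).trans (h.pk_le (by simp) fun s hs => ?_)⟩
    exact Finset.mem_insert_of_mem (hB s (by simpa using hs))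
  · simp only [not_not, Finset.mem_insert, Finset.mem_singleton] at hi
    have t1 : 1 ≤ pk graphH7 {4, 5, 6} := pk_triangle (a := 4) (b := 5) (c := 6) (by decide)
      (by decide) (by decide) (by decide) (by decide) (by decide)
    have t2 : 1 ≤ pk graphH7 {0, 2, 3} := pk_triangle (a := 0) (b := 2) (c := 3) (by decide)
      (by decide) (by decide) (by decide) (by decide) (by decide)
    rcases hi with rfl | rfl | rfl | rfl
    · obtain ⟨r, hr, h1⟩ := h.exists_pk (α := 0) (γ := 3) (δ := 1) (by decide) (by decide)
        (by decide) (by decide) (by decide) (by decide) (A := {4, 5, 6}) (by decide) (by decide)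
        (by decide) (by decide) hB
      exact ⟨r, hr, by omega⟩
    · obtain ⟨r, hr, h1⟩ := h.exists_pk (α := 0) (γ := 2) (δ := 1) (by decide) (by decide)
        (by decide) (by decide) (by decide) (by decide) (A := {4, 5, 6}) (by decide) (by decide)
        (by decide) (by decide) hB
      exact ⟨r, hr, by omega⟩
    · obtain ⟨r, hr, h1⟩ := h.exists_pk (α := 1) (γ := 6) (δ := 4) (by decide) (by decide)
        (by decide) (by decide) (by decide) (by decide) (A := {0, 2, 3}) (by decide) (by decide)
        (by decide) (by decide) hB
      exact ⟨r, hr, by omega⟩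
    · obtain ⟨r, hr, h1⟩ := h.exists_pk (α := 1) (γ := 5) (δ := 4) (by decide) (by decide)
        (by decide) (by decide) (by decide) (by decide) (A := {0, 2, 3}) (by decide) (by decide)
        (by decide) (by decide) hB
      exact ⟨r, hr, by omega⟩

theorem w5_deleteEdge {i j : Fin 6} (h : graphW5.Adj i j) :
    1 ≤ pk (graphW5.deleteEdges {s(i, j)}) univ := by
  refine exists_pk_of_packList (A := fun _ => True) (L := [[[0, 1, 5]], [[2, 3, 5]]]) ?_ (by simp)
    (by simp)
  revert i j
  decide

/-- After a split of the wheel, a short cycle avoids one of the two parts of the split vertex. -/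
theorem w5_split {V : Type*} {G : SimpleGraph V} {a d : V} {g : Fin 6 → V} {i : Fin 6}
    (h : SplitIn graphW5 i G a d g) {B : Finset V} (hB : ∀ s, s ≠ i → g s ∈ B) :
    ∃ r, (r = a ∨ r = d) ∧ 1 ≤ pk G (insert r B) := by
  by_cases hi : i = 5
  · subst hi
    obtain ⟨r, hr, h1⟩ := h.exists_pk (α := 0) (γ := 1) (δ := 2) (by decide) (by decide)
        (by decide) (by decide) (by decide) (by decide) (A := ∅) (by decide) (by decide)
        (by decide) (by decide) hB
    exact ⟨r, hr, by omega⟩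
  · have h1 : 1 ≤ pk graphW5 (univ.erase i) := by
      refine exists_pk_of_packList (A := fun v => v ≠ i) (L := [[[0, 1, 5]], [[2, 3, 5]]]) ?_
        (by simp) (by simp)
      clear h hB
      revert i
      decide
    exact ⟨a, Or.inl rfl, h1.trans (h.pk_le (by simp) fun s hs =>
      Finset.mem_insert_of_mem (hB s (by simpa using hs)))⟩

theorem t8_two : 2 ≤ pk graphT8 univ :=
  PackList.le_pk (A := fun _ => True) (P := [[0, 1, 2], [3, 6, 7]]) (by decide) (by simp)

theorem t8_deleteEdge {i j : Fin 8} (h : graphT8.Adj i j) :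
    2 ≤ pk (graphT8.deleteEdges {s(i, j)}) univ ∨ (1 ≤ pk (graphT8.deleteEdges {s(i, j)}) univ ∧
      i ∈ ({0, 1, 2} : Finset (Fin 8)) ∧ j ∈ ({0, 1, 2} : Finset (Fin 8))) := by
  by_cases hij : i ∈ ({0, 1, 2} : Finset (Fin 8)) ∧ j ∈ ({0, 1, 2} : Finset (Fin 8))
  · refine Or.inr ⟨?_, hij⟩
    refine exists_pk_of_packList (A := fun _ => True) (L := [[[3, 6, 7]]]) ?_ (by simp) (by simp)
    revert i j
    decide
  · left
    refine exists_pk_of_packList (A := fun _ => True) (L := [[[0, 1, 2], [3, 6, 7]],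
      [[0, 1, 2], [4, 6, 7]], [[0, 1, 2], [3, 6, 4, 7]]]) ?_ (by simp) (by simp)
    revert i j
    decide

/-- A triangle of `T₈` is disjoint from another one. -/
theorem t8_triangle {i j k : Fin 8} (h1 : graphT8.Adj i j) (h2 : graphT8.Adj j k)
    (h3 : graphT8.Adj i k) : 1 ≤ pk graphT8 ({i, j, k} : Finset (Fin 8))ᶜ := by
  refine exists_pk_of_packList (A := fun v => v ≠ i ∧ v ≠ j ∧ v ≠ k)
    (L := [[[0, 1, 2]], [[3, 6, 7]]]) ?_ (by simp) (by simp)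
  revert i j k
  decide

theorem t8_erase (i : Fin 8) : 1 ≤ pk graphT8 (univ.erase i) := by
  refine exists_pk_of_packList (A := fun v => v ≠ i) (L := [[[0, 1, 2]], [[3, 6, 7]]]) ?_ (by simp)
    (by simp)
  revert i
  decide

/-- After a split of `T₈` at a vertex outside its triangle `0 1 2`, two disjoint short cycles avoid
one of the two parts of the split vertex. -/
theorem t8_split {V : Type*} {G : SimpleGraph V} {a d : V} {g : Fin 8 → V} {i : Fin 8}
    (h : SplitIn graphT8 i G a d g) {B : Finset V} (hB : ∀ s, s ≠ i → g s ∈ B)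
    (hi : i ∉ ({0, 1, 2} : Finset (Fin 8))) :
    ∃ r, (r = a ∨ r = d) ∧ 2 ≤ pk G (insert r B) := by
  have t1 : 1 ≤ pk graphT8 {0, 1, 2} := pk_triangle (a := 0) (b := 1) (c := 2) (by decide)
    (by decide) (by decide) (by decide) (by decide) (by decide)
  by_cases hi6 : i = 6
  · subst hi6
    obtain ⟨r, hr, h1⟩ := h.exists_pk (α := 3) (γ := 7) (δ := 4) (by decide) (by decide)
        (by decide) (by decide) (by decide) (by decide) (A := {0, 1, 2}) (by decide) (by decide)
        (by decide) (by decide) hB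
    exact ⟨r, hr, by omega⟩
  by_cases hi7 : i = 7
  · subst hi7
    obtain ⟨r, hr, h1⟩ := h.exists_pk (α := 3) (γ := 6) (δ := 4) (by decide) (by decide)
        (by decide) (by decide) (by decide) (by decide) (A := {0, 1, 2}) (by decide) (by decide)
        (by decide) (by decide) hB
    exact ⟨r, hr, by omega⟩
  have h1 : 2 ≤ pk graphT8 (univ.erase i) := by
    refine exists_pk_of_packList (A := fun v => v ≠ i) (L := [[[0, 1, 2], [3, 6, 7]],
      [[0, 1, 2], [4, 6, 7]]]) ?_ (by simp) (by simp)
    clear h hB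
    revert i
    decide
  exact ⟨a, Or.inl rfl, h1.trans (h.pk_le (by simp) fun s hs =>
    Finset.mem_insert_of_mem (hB s (by simpa using hs)))⟩

theorem t11_two : 2 ≤ pk graphT11 univ :=
  PackList.le_pk (A := fun _ => True) (P := [[8, 9, 10], [3, 6, 7]]) (by decide) (by simp)

theorem t11_deleteEdge {i j : Fin 11} (h : graphT11.Adj i j) :
    2 ≤ pk (graphT11.deleteEdges {s(i, j)}) univ := by
  refine exists_pk_of_packList (A := fun _ => True) (L := [[[8, 9, 10], [3, 6, 7]],
    [[9, 10, 1], [4, 6, 7]], [[8, 9, 1, 10], [3, 6, 7]], [[8, 9, 10], [3, 6, 4, 7]]]) ?_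
    (by simp) (by simp)
  revert i j
  decide

theorem t11_triangle {i j k : Fin 11} (h1 : graphT11.Adj i j) (h2 : graphT11.Adj j k)
    (h3 : graphT11.Adj i k) : 1 ≤ pk graphT11 ({i, j, k} : Finset (Fin 11))ᶜ := by
  refine exists_pk_of_packList (A := fun v => v ≠ i ∧ v ≠ j ∧ v ≠ k)
    (L := [[[8, 9, 10]], [[3, 6, 7]]]) ?_ (by simp) (by simp)
  revert i j k
  decide

theorem t11_erase (i : Fin 11) : 1 ≤ pk graphT11 (univ.erase i) := by
  refine exists_pk_of_packList (A := fun v => v ≠ i) (L := [[[8, 9, 10]], [[3, 6, 7]]]) ?_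
    (by simp) (by simp)
  revert i
  decide

/-- After a split of `T₁₁`, two disjoint short cycles avoid one of the two parts of the split
vertex. -/
theorem t11_split {V : Type*} {G : SimpleGraph V} {a d : V} {g : Fin 11 → V} {i : Fin 11}
    (h : SplitIn graphT11 i G a d g) {B : Finset V} (hB : ∀ s, s ≠ i → g s ∈ B) :
    ∃ r, (r = a ∨ r = d) ∧ 2 ≤ pk G (insert r B) := by
  have t1 : 1 ≤ pk graphT11 {8, 9, 10} := pk_triangle (a := 8) (b := 9) (c := 10) (by decide)
    (by decide) (by decide) (by decide) (by decide) (by decide)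
  have t2 : 1 ≤ pk graphT11 {3, 6, 7} := pk_triangle (a := 3) (b := 6) (c := 7) (by decide)
    (by decide) (by decide) (by decide) (by decide) (by decide)
  by_cases hi6 : i = 6
  · subst hi6
    obtain ⟨r, hr, h1⟩ := h.exists_pk (α := 3) (γ := 7) (δ := 4) (by decide) (by decide)
        (by decide) (by decide) (by decide) (by decide) (A := {8, 9, 10}) (by decide) (by decide)
        (by decide) (by decide) hB
    exact ⟨r, hr, by omega⟩
  by_cases hi7 : i = 7
  · subst hi7
    obtain ⟨r, hr, h1⟩ := h.exists_pk (α := 3) (γ := 6) (δ := 4) (by decide) (by decide)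
        (by decide) (by decide) (by decide) (by decide) (A := {8, 9, 10}) (by decide) (by decide)
        (by decide) (by decide) hB
    exact ⟨r, hr, by omega⟩
  by_cases hi9 : i = 9
  · subst hi9
    obtain ⟨r, hr, h1⟩ := h.exists_pk (α := 8) (γ := 10) (δ := 1) (by decide) (by decide)
        (by decide) (by decide) (by decide) (by decide) (A := {3, 6, 7}) (by decide) (by decide)
        (by decide) (by decide) hB
    exact ⟨r, hr, by omega⟩
  by_cases hi10 : i = 10
  · subst hi10
    obtain ⟨r, hr, h1⟩ := h.exists_pk (α := 8) (γ := 9) (δ := 1) (by decide) (by decide)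
        (by decide) (by decide) (by decide) (by decide) (A := {3, 6, 7}) (by decide) (by decide)
        (by decide) (by decide) hB
    exact ⟨r, hr, by omega⟩
  have h1 : 2 ≤ pk graphT11 (univ.erase i) := by
    refine exists_pk_of_packList (A := fun v => v ≠ i) (L := [[[8, 9, 10], [3, 6, 7]],
      [[8, 9, 10], [4, 6, 7]], [[9, 10, 1], [3, 6, 7]]]) ?_ (by simp) (by simp)
    clear h hB
    revert i
    decide
  exact ⟨a, Or.inl rfl, h1.trans (h.pk_le (by simp) fun s hs =>
    Finset.mem_insert_of_mem (hB s (by simpa using hs)))⟩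

end Concrete

/-! ### Weights and colourings of the exceptional graphs -/

section ConcreteCounting

theorem two_mul_q_of_dec {n : ℕ} (G : SimpleGraph (Fin n)) [DecidableRel G.Adj] :
    2 * q G univ = 10 * (n : ℤ) - 3 * ∑ v, ((univ.filter (G.Adj v)).card : ℤ) := by
  have h1 := two_mul_ed G univ
  rw [ee_eq_sum] at h1
  have h2 : (∑ a, ((univ.filter (G.Adj a)).card : ℤ)) =
      ∑ v, ((@univ.filter _ (G.Adj v) (fun b => Classical.propDecidable _)).card : ℤ) :=
    Finset.sum_congr rfl fun v _ => by congr
  unfold q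
  simp only [card_univ, Fintype.card_fin]
  rw [h2]
  linarith

theorem h7_q : q graphH7 univ = 2 := by
  have h1 := two_mul_q_of_dec graphH7
  have h2 : ∑ v, ((univ.filter (graphH7.Adj v)).card : ℤ) = 22 := by decide +kernel
  rw [h2] at h1
  push_cast at h1
  omega

theorem w5_q : q graphW5 univ = 0 := by
  have h1 := two_mul_q_of_dec graphW5
  have h2 : ∑ v, ((univ.filter (graphW5.Adj v)).card : ℤ) = 20 := by decide +kernel
  rw [h2] at h1
  push_cast at h1
  omega

theorem t8_q : q graphT8 univ = 1 := by
  have h1 := two_mul_q_of_dec graphT8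
  have h2 : ∑ v, ((univ.filter (graphT8.Adj v)).card : ℤ) = 26 := by decide +kernel
  rw [h2] at h1
  push_cast at h1
  omega

theorem t11_q : q graphT11 univ = 1 := by
  have h1 := two_mul_q_of_dec graphT11
  have h2 : ∑ v, ((univ.filter (graphT11.Adj v)).card : ℤ) = 36 := by decide +kernel
  rw [h2] at h1
  push_cast at h1
  omega

theorem h7_pk : pk graphH7 univ = 2 := by
  have h1 := three_mul_pk_le (G := graphH7) univ
  have h2 := (h7_erase (i := 0) (by decide)).trans (pk_mono (G := graphH7) (subset_univ _))
  simp at h1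
  omega

theorem t8_pk : pk graphT8 univ = 2 := by
  have h1 := three_mul_pk_le (G := graphT8) univ
  have h2 := t8_two
  simp at h1
  omega

theorem w5_pk : pk graphW5 univ = 1 := by
  refine le_antisymm ?_ ?_
  · refine (pk_le_of_cover (X := {5}) ?_).trans (by simp)
    have h3 : ∀ a : Fin 6, a ≠ 5 → ∀ b, b ≠ 5 → graphW5.Adj a b → ∀ c, c ≠ 5 → graphW5.Adj b c →
      ¬ graphW5.Adj c a := by decide
    have h4 : ∀ a : Fin 6, a ≠ 5 → ∀ b, b ≠ 5 → graphW5.Adj a b → ∀ c, c ≠ 5 → graphW5.Adj b c →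
      a ≠ c → ∀ d, d ≠ 5 → b ≠ d → graphW5.Adj c d → ¬ graphW5.Adj d a := by decide
    rintro s (⟨a, b, c, rfl, k1, k2, k3⟩ | ⟨a, b, c, d, rfl, k1, k2, k3, k4, k5, k6⟩) hs
    · simp only [insert_subset_iff, singleton_subset_iff, mem_sdiff, mem_univ, true_and,
        mem_singleton] at hs
      exact h3 a hs.1 b hs.2.1 k1 c hs.2.2 k2 k3
    · simp only [insert_subset_iff, singleton_subset_iff, mem_sdiff, mem_univ, true_and,
        mem_singleton] at hs
      exact h4 a hs.1 b hs.2.1 k3 c hs.2.2.1 k4 k1 d hs.2.2.2 k2 k5 k6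
  · exact pk_triangle (a := 0) (b := 1) (c := 5) (by simp) (by simp) (by simp) (by decide)
      (by decide) (by decide)

theorem t11_pk : pk graphT11 univ = 2 := by
  refine le_antisymm ?_ t11_two
  refine (pk_le_of_cover (X := {6, 9}) ?_).trans (by simp)
  have h3 : ∀ a : Fin 11, a ≠ 6 ∧ a ≠ 9 → ∀ b, b ≠ 6 ∧ b ≠ 9 → graphT11.Adj a b → ∀ c,
    c ≠ 6 ∧ c ≠ 9 → graphT11.Adj b c → ¬ graphT11.Adj c a := by decide +kernel
  have h4 : ∀ a : Fin 11, a ≠ 6 ∧ a ≠ 9 → ∀ b, b ≠ 6 ∧ b ≠ 9 → graphT11.Adj a b → ∀ c,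
    c ≠ 6 ∧ c ≠ 9 → graphT11.Adj b c → a ≠ c → ∀ d, d ≠ 6 ∧ d ≠ 9 → b ≠ d → graphT11.Adj c d →
    ¬ graphT11.Adj d a := by decide +kernel
  rintro s (⟨a, b, c, rfl, k1, k2, k3⟩ | ⟨a, b, c, d, rfl, k1, k2, k3, k4, k5, k6⟩) hs
  · simp only [insert_subset_iff, singleton_subset_iff, mem_sdiff, mem_univ, true_and,
      mem_singleton, mem_insert, not_or] at hs
    exact h3 a hs.1 b hs.2.1 k1 c hs.2.2 k2 k3
  · simp only [insert_subset_iff, singleton_subset_iff, mem_sdiff, mem_univ, true_and,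
      mem_singleton, mem_insert, not_or] at hs
    exact h4 a hs.1 b hs.2.1 k3 c hs.2.2.1 k4 k1 d hs.2.2.2 k2 k5 k6

theorem color_eq_of_ne {x y u v : Fin 3} (h1 : u ≠ v) (h2 : x ≠ u) (h3 : x ≠ v) (h4 : y ≠ u)
    (h5 : y ≠ v) : x = y := by
  revert x y u v; decide

/-- The rim, an odd cycle, would have to be coloured with two colours. -/
theorem w5_not_proper : ¬ ∃ c, Proper graphW5 univ c := by
  rintro ⟨c, hc⟩
  have h : ∀ i j, graphW5.Adj i j → c i ≠ c j := fun i j => hc i (mem_univ _) j (mem_univ _)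
  have key : ∀ a b c d e f : Fin 3, a ≠ b → f ≠ a → f ≠ b → b ≠ c → f ≠ c → c ≠ d → f ≠ d →
    d ≠ e → f ≠ e → e = a := by decide
  exact h 4 0 (by decide) <| key _ _ _ _ _ _ (h 0 1 (by decide)) (h 5 0 (by decide)) (h 5 1 (by decide))
    (h 1 2 (by decide)) (h 5 2 (by decide)) (h 2 3 (by decide)) (h 5 3 (by decide))
    (h 3 4 (by decide)) (h 5 4 (by decide))

theorem no_four_colors {x y u v : Fin 3} (h1 : x ≠ y) (h2 : x ≠ u) (h3 : x ≠ v) (h4 : y ≠ u)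
    (h5 : y ≠ v) (h6 : u ≠ v) : False :=
  h6 (color_eq_of_ne h1 h2.symm h4.symm h3.symm h5.symm)

/-- The vertices `3`, `4` and `5` have the same colour, which is then missing on the triangle `0 1
2`. -/
theorem t8_not_proper : ¬ ∃ c, Proper graphT8 univ c := by
  rintro ⟨c, hc⟩
  have h : ∀ i j, graphT8.Adj i j → c i ≠ c j := fun i j => hc i (mem_univ _) j (mem_univ _)
  have e1 : c 3 = c 4 := color_eq_of_ne (h 6 7 (by decide)) (h 3 6 (by decide)) (h 3 7 (by decide))
    (h 4 6 (by decide)) (h 4 7 (by decide))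
  have e2 : c 3 = c 5 := color_eq_of_ne (h 6 7 (by decide)) (h 3 6 (by decide)) (h 3 7 (by decide))
    (h 5 6 (by decide)) (h 5 7 (by decide))
  exact no_four_colors (h 0 1 (by decide)) (h 0 2 (by decide)) (h 0 3 (by decide))
    (h 1 2 (by decide)) (e1 ▸ h 1 4 (by decide)) (e2 ▸ h 2 5 (by decide))

/-- The ends `8` and `1` of a diamond have the same colour, so `0` and `1` differ as if they were
adjacent, and the argument for `T₈` applies. -/
theorem t11_not_proper : ¬ ∃ c, Proper graphT11 univ c := by
  rintro ⟨c, hc⟩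
  have h : ∀ i j, graphT11.Adj i j → c i ≠ c j := fun i j => hc i (mem_univ _) j (mem_univ _)
  have e0 : c 8 = c 1 := color_eq_of_ne (h 9 10 (by decide)) (h 8 9 (by decide))
    (h 8 10 (by decide)) (h 1 9 (by decide)) (h 1 10 (by decide))
  have e1 : c 3 = c 4 := color_eq_of_ne (h 6 7 (by decide)) (h 3 6 (by decide)) (h 3 7 (by decide))
    (h 4 6 (by decide)) (h 4 7 (by decide))
  have e2 : c 3 = c 5 := color_eq_of_ne (h 6 7 (by decide)) (h 3 6 (by decide)) (h 3 7 (by decide))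
    (h 5 6 (by decide)) (h 5 7 (by decide))
  exact no_four_colors (e0 ▸ h 0 8 (by decide)) (h 0 2 (by decide)) (h 0 3 (by decide))
    (h 1 2 (by decide)) (e1 ▸ h 1 4 (by decide)) (e2 ▸ h 2 5 (by decide))

/-- In a colouring of `T₈` without one edge of its triangle `0 1 2`, no further vertex is forced to
have the colour of the two ends of that edge. -/
theorem t8_deleteEdge_color (i j v : Fin 8) (hi : i ∈ ({0, 1, 2} : Finset (Fin 8)))
    (hj : j ∈ ({0, 1, 2} : Finset (Fin 8))) (hij : i ≠ j) (hvi : v ≠ i) (hvj : v ≠ j) :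
    ∃ c : Fin 8 → Fin 3, (∀ s t, graphT8.Adj s t → s(s, t) ≠ s(i, j) → c s ≠ c t) ∧ c v ≠ c i := by
  refine ⟨fun s => if s = i ∨ s = j then 0 else if s = 0 ∨ s = 1 ∨ s = 2 then 2 else
    if s = 6 then if v = 6 then 2 else 0 else if s = 7 then if v = 6 then 0 else 2 else 1, ?_⟩
  revert i j v
  decide +kernel

/-- A diamond is `K₄` minus an edge; `G` has no diamond as a subgraph. -/
def NoDiamond {V : Type*} (G : SimpleGraph V) : Prop :=
  ∀ a b c d, a ≠ d → G.Adj a b → G.Adj a c → G.Adj b c → G.Adj b d → G.Adj c d → False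

/-- The diamond on `3, 6, 7, 4` survives a split at a vertex of the triangle `0 1 2`. -/
theorem t8_split_diamond {V : Type*} {G : SimpleGraph V} {a d : V} {g : Fin 8 → V} {i : Fin 8}
    (h : SplitIn graphT8 i G a d g) (hi : i ∈ ({0, 1, 2} : Finset (Fin 8))) : ¬ NoDiamond G := by
  intro hn
  have h3 : (3 : Fin 8) ≠ i := by rintro rfl; revert hi; decide
  have h4 : (4 : Fin 8) ≠ i := by rintro rfl; revert hi; decide
  have h6 : (6 : Fin 8) ≠ i := by rintro rfl; revert hi; decide
  have h7 : (7 : Fin 8) ≠ i := by rintro rfl; revert hi; decide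
  exact hn (g 3) (g 6) (g 7) (g 4) (fun e => absurd (h.inj _ _ h3 h4 e) (by decide))
    (h.adj _ _ h3 h6 (by decide)) (h.adj _ _ h3 h7 (by decide)) (h.adj _ _ h6 h7 (by decide))
    (h.adj _ _ h6 h4 (by decide)) (h.adj _ _ h7 h4 (by decide))

/-- A map is a homomorphism if it preserves the edges of a list that contains all edges. -/
theorem hom_of_list {V : Type*} {G : SimpleGraph V} {n : ℕ} {H : SimpleGraph (Fin n)}
    (L : List (Fin n × Fin n)) (hL : ∀ i j, H.Adj i j → (i, j) ∈ L ∨ (j, i) ∈ L) (f : Fin n → V)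
    (h : ∀ p ∈ L, G.Adj (f p.1) (f p.2)) : ∀ i j, H.Adj i j → G.Adj (f i) (f j) := by
  intro i j hij
  rcases hL i j hij with h1 | h1
  · exact h _ h1
  · exact (h _ h1).symm

/-- A bijective homomorphism between graphs with equally many edges is an isomorphism. -/
theorem iso_of_q {U V : Type*} [Fintype U] [Fintype V] {H : SimpleGraph U} {G : SimpleGraph V}
    (f : U → V) (hf : Function.Bijective f) (hom : ∀ a b, H.Adj a b → G.Adj (f a) (f b))
    (hq : q H univ = q G univ) : Nonempty (G ≃g H) := by
  refine ⟨(SimpleGraph.Iso.symm ⟨Equiv.ofBijective f hf, ?_⟩)⟩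
  intro a b
  refine ⟨fun hab => ?_, fun h => hom a b h⟩
  by_contra hne
  change G.Adj (f a) (f b) at hab
  have h1 : univ.image f = univ := Finset.image_univ_of_surjective hf.2
  have h2 := q_image_le (G := G.deleteEdges {s(f a, f b)}) H f univ hf.1.injOn (by
    intro c _ d _ hcd
    simp only [SimpleGraph.deleteEdges_adj, Set.mem_singleton_iff]
    refine ⟨hom c d hcd, fun e => ?_⟩
    rcases Sym2.eq_iff.1 e with e | e
    · rw [hf.1 e.1, hf.1 e.2] at hcd; exact hne hcd
    · rw [hf.1 e.1, hf.1 e.2] at hcd; exact hne hcd.symm)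
  rw [h1, q_deleteEdge G (mem_univ _) (mem_univ _) hab] at h2
  omega

theorem q_iso {U V : Type*} [Fintype U] [Fintype V] {H : SimpleGraph U} {G : SimpleGraph V}
    (e : G ≃g H) : q G univ = q H univ := by
  rw [← q_image_eq (G := H) G e univ e.injective.injOn fun a _ b _ => e.map_adj_iff.symm]
  rw [Finset.image_univ_of_surjective e.surjective]

theorem pk_iso {U V : Type*} [Fintype U] [Fintype V] {H : SimpleGraph U} {G : SimpleGraph V}
    (e : G ≃g H) : pk G univ = pk H univ := by
  have h1 := pk_le_of_iso e univ
  have h2 := pk_le_of_iso e.symm univ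
  rw [Finset.image_univ_of_surjective e.surjective] at h1
  rw [Finset.image_univ_of_surjective e.symm.surjective] at h2
  omega

theorem pk_iso_erase {U V : Type*} [Fintype U] [Fintype V] {H : SimpleGraph U} {G : SimpleGraph V}
    (e : G ≃g H) (v : V) : pk H (univ.erase (e v)) ≤ pk G (univ.erase v) := by
  refine pk_map e.symm e.symm.injective.injOn (fun a ha => ?_) fun a _ b _ h => e.symm.map_adj_iff.2 h
  simp only [mem_erase, mem_univ, and_true] at ha ⊢
  intro h
  exact ha (by rw [← h]; simp)

theorem pk_iso_deleteEdge {U V : Type*} [Fintype U] [Fintype V] {H : SimpleGraph U}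
    {G : SimpleGraph V} (e : G ≃g H) (x y : V) :
    pk (H.deleteEdges {s(e x, e y)}) univ ≤ pk (G.deleteEdges {s(x, y)}) univ := by
  refine pk_map e.symm e.symm.injective.injOn (fun a ha => mem_univ _) fun a _ b _ h => ?_
  simp only [SimpleGraph.deleteEdges_adj, Set.mem_singleton_iff] at h ⊢
  refine ⟨e.symm.map_adj_iff.2 h.1, fun k => h.2 ?_⟩
  rcases Sym2.eq_iff.1 k with k | k
  · rw [← k.1, ← k.2]; simp
  · rw [← k.1, ← k.2, Sym2.eq_swap]; simp

end ConcreteCounting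

/-! ### Packings in `4`-Ore graphs -/

section OrePacking

theorem IsK4.pk_erase {V : Type*} [Fintype V] {G : SimpleGraph V} (h : IsK4 G) (v : V) :
    1 ≤ pk G (univ.erase v) := by
  obtain ⟨w, hw⟩ : ∃ w, w ≠ v := by
    have : 1 < Fintype.card V := by rw [h.1]; norm_num
    exact Fintype.exists_ne_of_one_lt_card this v
  obtain ⟨a, b, hab, hav, haw, hbv, hbw, -⟩ := h.exists_two hw.symm
  exact pk_triangle (a := w) (b := a) (c := b) (by simp [hw]) (by simp [hav]) (by simp [hbv])
    (h.2 _ _ haw.symm) (h.2 _ _ hab) (h.2 _ _ hbw)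

/-- A vertex set that misses an end of the edge `xy` does not see its deletion. -/
theorem pk_erase_deleteEdge {V : Type*} {G : SimpleGraph V} {x y e : V} (he : e = x ∨ e = y)
    {A : Finset V} (hA : e ∉ A) : pk G A ≤ pk (G.deleteEdges {s(x, y)}) A := by
  refine pk_map id Function.injective_id.injOn (fun a ha => ha) ?_
  intro a ha b hb hab
  simp only [id, SimpleGraph.deleteEdges_adj, Set.mem_singleton_iff]
  refine ⟨hab, fun k => hA ?_⟩
  rcases Sym2.eq_iff.1 k with k | k <;> rcases he with rfl | rfl
  · exact k.1 ▸ ha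
  · exact k.2 ▸ hb
  · exact k.2 ▸ hb
  · exact k.1 ▸ ha

theorem IsK4.pk_deleteEdge {V : Type*} [Fintype V] {G : SimpleGraph V} (h : IsK4 G) (x y : V) :
    1 ≤ pk (G.deleteEdges {s(x, y)}) univ :=
  (h.pk_erase x).trans ((pk_erase_deleteEdge (Or.inl rfl) (by simp)).trans
    (pk_mono (subset_univ _)))

namespace OreDecomp
variable {V V₁ V₂ : Type u} [Fintype V] [Fintype V₁] [Fintype V₂] {G : SimpleGraph V}
  {G₁ : SimpleGraph V₁} {x y : V₁} {G₂ : SimpleGraph V₂} {z : V₂} {S : Set V₂} {i₁ : V₁ → V}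
  {i₂ : V₂ → V}

theorem pk_image₁ (O : OreDecomp G G₁ x y G₂ z S i₁ i₂) (A : Finset V₁) :
    pk (G₁.deleteEdges {s(x, y)}) A ≤ pk G (A.image i₁) := by
  refine pk_map i₁ O.inj₁.injOn (fun a ha => mem_image_of_mem _ ha) fun a _ b _ h => ?_
  rw [SimpleGraph.deleteEdges_adj, Set.mem_singleton_iff] at h
  exact (O.adj₁ a b).2 h

theorem pk_image₂ (O : OreDecomp G G₁ x y G₂ z S i₁ i₂) {A : Finset V₂} (hA : z ∉ A) :
    pk G₂ A ≤ pk G (A.image i₂) := by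
  have hne : ∀ b ∈ A, b ≠ z := fun b hb e => hA (e ▸ hb)
  exact pk_map i₂ (fun a ha b hb e => O.inj₂ a b (hne a ha) (hne b hb) e)
    (fun a ha => mem_image_of_mem _ ha) fun a ha b hb h => (O.adj₂ a b (hne a ha) (hne b hb)).2 h

/-- Packings in the two parts of a composition are disjoint. -/
theorem pk_union (O : OreDecomp G G₁ x y G₂ z S i₁ i₂) (A₁ : Finset V₁) {A₂ : Finset V₂}
    (hA : z ∉ A₂) : pk (G₁.deleteEdges {s(x, y)}) A₁ + pk G₂ A₂ ≤
      pk G (A₁.image i₁ ∪ A₂.image i₂) := by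
  refine (Nat.add_le_add (O.pk_image₁ A₁) (O.pk_image₂ hA)).trans
    (pk_add subset_union_left subset_union_right ?_)
  rw [Finset.disjoint_left]
  rintro v hv hv'
  obtain ⟨a, -, rfl⟩ := mem_image.1 hv
  obtain ⟨b, hb, e⟩ := mem_image.1 hv'
  exact O.disj a b (fun e => hA (e ▸ hb)) e.symm

theorem pk_le (O : OreDecomp G G₁ x y G₂ z S i₁ i₂) :
    pk (G₁.deleteEdges {s(x, y)}) univ + pk G₂ (univ.erase z) ≤ pk G univ :=
  (O.pk_union univ (by simp)).trans (pk_mono (subset_univ _))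

/-- A composition contains its second graph with the vertex `z` split into `x` and `y`. -/
theorem splitIn (O : OreDecomp G G₁ x y G₂ z S i₁ i₂) :
    SplitIn G₂ z G (i₁ x) (i₁ y) i₂ :=
  ⟨fun e => O.hxy.ne (O.inj₁ e), O.inj₂,
    fun s hs e => O.disj x s hs e.symm, fun s hs e => O.disj y s hs e.symm,
    fun _ _ hs ht h => (O.adj₂ _ _ hs ht).2 h, fun _ hs => (O.nbr_z hs.ne').1 hs⟩

theorem card_eq (O : OreDecomp G G₁ x y G₂ z S i₁ i₂) :
    Fintype.card V + 1 = Fintype.card V₁ + Fintype.card V₂ := by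
  have h := congrArg Finset.card O.univ_eq
  rw [card_union_of_disjoint (O.disjoint_right _), OreDecomp.right, card_image_of_injOn O.injOn₂,
    card_image_of_injective _ O.inj₁, card_univ, card_univ, card_erase_of_mem (mem_univ _),
    card_univ] at h
  have : 0 < Fintype.card V₂ := Fintype.card_pos_iff.2 ⟨z⟩
  omega

end OreDecomp

theorem nodup_injective {V : Type*} {n : ℕ} {f : Fin n → V} (h : (List.ofFn f).Nodup) :
    Function.Injective f := List.nodup_ofFn.1 h

/-- Both graphs have weight two, so a bijective homomorphism from the Moser spindle is an
isomorphism. -/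
theorem isOre_h7_of_hom {V : Type u} [Fintype V] {G : SimpleGraph V} (hG : IsOre 4 G)
    (hV : Fintype.card V = 7) (f : Fin 7 → V) (hf : Function.Injective f)
    (hom : ∀ p ∈ [((0 : Fin 7), (2 : Fin 7)), (0, 3), (1, 2), (1, 3), (2, 3), (4, 5), (4, 6), (5, 6),
      (0, 4), (1, 5), (1, 6)], G.Adj (f p.1) (f p.2)) : Nonempty (G ≃g graphH7) := by
  have hb : Function.Bijective f := by
    rw [Fintype.bijective_iff_injective_and_card]
    exact ⟨hf, by simp [hV]⟩
  exact iso_of_q f hb (hom_of_list _ (by decide) f hom) (by rw [h7_q, isOre_q hG])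

namespace OreDecomp
variable {V V₁ V₂ : Type u} [Fintype V] [Fintype V₁] [Fintype V₂] {G : SimpleGraph V}
  {G₁ : SimpleGraph V₁} {x y : V₁} {G₂ : SimpleGraph V₂} {z : V₂} {S : Set V₂} {i₁ : V₁ → V}
  {i₂ : V₂ → V}

/-- Interchanging `x` and `y` interchanges the two sides of the split. -/
theorem symm (O : OreDecomp G G₁ x y G₂ z S i₁ i₂) : OreDecomp G G₁ y x G₂ z Sᶜ i₁ i₂ where
  ore₁ := O.ore₁
  ore₂ := O.ore₂
  hxy := O.hxy.symm
  hz₁ := O.hz₂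
  hz₂ := by simpa using O.hz₁
  inj₁ := O.inj₁
  inj₂ := O.inj₂
  disj := O.disj
  cover := O.cover
  adj₁ a a' := by rw [O.adj₁, Sym2.eq_swap (a := x)]
  adj₂ := O.adj₂
  adj₁₂ a b hb := by
    rw [O.adj₁₂ a b hb]
    simp only [Set.mem_compl_iff, not_not]
    tauto

theorem adj_x (O : OreDecomp G G₁ x y G₂ z S i₁ i₂) {b : V₂} (hzb : G₂.Adj z b) :
    G.Adj (i₁ x) (i₂ b) ↔ b ∈ S := by
  rw [O.adj₁₂ x b hzb.ne']
  have := O.hxy.ne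
  tauto

theorem adj_y (O : OreDecomp G G₁ x y G₂ z S i₁ i₂) {b : V₂} (hzb : G₂.Adj z b) :
    G.Adj (i₁ y) (i₂ b) ↔ b ∉ S := by
  rw [O.adj₁₂ y b hzb.ne']
  have := O.hxy.ne'
  tauto

/-- When the split side is `K₄`, one part of the split vertex has two of its three neighbours. -/
theorem exists_triple (O : OreDecomp G G₁ x y G₂ z S i₁ i₂) (h : IsK4 G₂) :
    ∃ t₁ t₂ t₃ : V₂, t₁ ≠ t₂ ∧ t₁ ≠ t₃ ∧ t₂ ≠ t₃ ∧ t₁ ≠ z ∧ t₂ ≠ z ∧ t₃ ≠ z ∧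
      ((t₁ ∈ S ∧ t₂ ∉ S ∧ t₃ ∉ S) ∨ (t₁ ∉ S ∧ t₂ ∈ S ∧ t₃ ∈ S)) := by
  obtain ⟨t₁, h1, k1⟩ := O.hz₁
  obtain ⟨t₂, h2, k2⟩ := O.hz₂
  have h12 : t₁ ≠ t₂ := by rintro rfl; exact h2 h1
  obtain ⟨a, b, hab, ha1, ha2, hb1, hb2, hu⟩ := h.exists_two h12
  have hz : z ∈ ({t₁, t₂, a, b} : Finset V₂) := hu ▸ mem_univ z
  simp only [mem_insert, mem_singleton] at hz
  have key : ∀ t, t ≠ t₁ → t ≠ t₂ → t ≠ z → ∃ t₁ t₂ t₃ : V₂, t₁ ≠ t₂ ∧ t₁ ≠ t₃ ∧ t₂ ≠ t₃ ∧ t₁ ≠ z ∧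
      t₂ ≠ z ∧ t₃ ≠ z ∧ ((t₁ ∈ S ∧ t₂ ∉ S ∧ t₃ ∉ S) ∨ (t₁ ∉ S ∧ t₂ ∈ S ∧ t₃ ∈ S)) := by
    intro t e1 e2 e3
    by_cases ht : t ∈ S
    · exact ⟨t₂, t₁, t, h12.symm, e2.symm, e1.symm, k2.ne', k1.ne', e3, Or.inr ⟨h2, h1, ht⟩⟩
    · exact ⟨t₁, t₂, t, h12, e1.symm, e2.symm, k1.ne', k2.ne', e3, Or.inl ⟨h1, h2, ht⟩⟩
  rcases hz with rfl | rfl | rfl | rfl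
  · exact absurd rfl k1.ne
  · exact absurd rfl k2.ne
  · exact key b hb1 hb2 hab.symm
  · exact key a ha1 ha2 hab

/-- The Moser spindle is the only Ore-composition of two copies of `K₄`. -/
theorem h7_of_k4 (O : OreDecomp G G₁ x y G₂ z S i₁ i₂) (hG : IsOre 4 G) (h1 : IsK4 G₁)
    (h2 : IsK4 G₂) : Nonempty (G ≃g graphH7) := by
  have key : ∀ (x y : V₁) (S : Set V₂) (t₁ t₂ t₃ : V₂), OreDecomp G G₁ x y G₂ z S i₁ i₂ → t₁ ≠ t₂ →
      t₁ ≠ t₃ → t₂ ≠ t₃ → t₁ ≠ z → t₂ ≠ z → t₃ ≠ z → t₁ ∈ S → t₂ ∉ S → t₃ ∉ S →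
      Nonempty (G ≃g graphH7) := by
    intro x y S t₁ t₂ t₃ O n12 n13 n23 n1 n2 n3 m1 m2 m3
    obtain ⟨a, b, hab, hax, hay, hbx, hby, hu⟩ := h1.exists_two O.hxy.ne
    have hc := O.card_eq
    rw [h1.1, h2.1] at hc
    have A1 : ∀ s t, s ≠ t → s ≠ x ∨ t ≠ y → s ≠ y ∨ t ≠ x → G.Adj (i₁ s) (i₁ t) := by
      intro s t hst e1 e2
      refine (O.adj₁ s t).2 ⟨h1.2 s t hst, fun e => ?_⟩
      rcases Sym2.eq_iff.1 e with e | e <;> tauto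
    have A2 : ∀ s t, s ≠ t → s ≠ z → t ≠ z → G.Adj (i₂ s) (i₂ t) := fun s t hst hs ht =>
      (O.adj₂ s t hs ht).2 (h2.2 s t hst)
    have e : ∀ s t, t ≠ z → i₁ s ≠ i₂ t := fun s t ht => O.disj s t ht
    have e1 : ∀ s t, s ≠ t → i₁ s ≠ i₁ t := fun s t h => O.inj₁.ne h
    refine isOre_h7_of_hom hG (by omega) ![i₁ x, i₁ y, i₁ a, i₁ b, i₂ t₁, i₂ t₂, i₂ t₃] ?_ ?_
    · refine nodup_injective ?_
      simp [List.ofFn_succ, e _ _ n1, e _ _ n2, e _ _ n3, e1 _ _ O.hxy.ne, e1 _ _ hax.symm,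
        e1 _ _ hbx.symm, e1 _ _ hay.symm, e1 _ _ hby.symm, e1 _ _ hab, (A2 _ _ n12 n1 n2).ne,
        (A2 _ _ n13 n1 n3).ne, (A2 _ _ n23 n2 n3).ne]
    · simp only [List.forall_mem_cons, List.not_mem_nil, false_implies, implies_true, and_true]
      refine ⟨A1 x a hax.symm ?_ ?_, A1 x b hbx.symm ?_ ?_, A1 y a hay.symm ?_ ?_,
        A1 y b hby.symm ?_ ?_, A1 a b hab ?_ ?_, A2 _ _ n12 n1 n2, A2 _ _ n13 n1 n3,
        A2 _ _ n23 n2 n3, (O.adj_x (h2.2 _ _ n1.symm)).2 m1, (O.adj_y (h2.2 _ _ n2.symm)).2 m2,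
        (O.adj_y (h2.2 _ _ n3.symm)).2 m3⟩ <;> tauto
  obtain ⟨t₁, t₂, t₃, n12, n13, n23, n1, n2, n3, h | h⟩ := O.exists_triple h2
  · exact key x y S t₁ t₂ t₃ O n12 n13 n23 n1 n2 n3 h.1 h.2.1 h.2.2
  · exact key y x Sᶜ t₁ t₂ t₃ O.symm n12 n13 n23 n1 n2 n3 h.1 (by simpa using h.2.1)
      (by simpa using h.2.2)

end OreDecomp

/-- A `4`-Ore graph is `K₄`, the Moser spindle, or has three disjoint cycles of length at most
four. -/
theorem isOre_cases {V : Type u} [Fintype V] {G : SimpleGraph V} (hG : IsOre 4 G) :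
    IsK4 G ∨ Nonempty (G ≃g graphH7) ∨ 3 ≤ pk G univ := by
  refine isOre_induction (P := fun V _ G => IsOre 4 G →
    IsK4 G ∨ Nonempty (G ≃g graphH7) ∨ 3 ≤ pk G univ) (fun V _ G h _ => Or.inl h) ?_ hG hG
  intro V V₁ V₂ _ _ _ G G₁ x y G₂ z S i₁ i₂ O ih₁ ih₂ hG
  right
  have hle := O.pk_le
  have hE := pk_deleteEdge G₁ univ x y
  have hz := pk_erase (G := G₂) univ z
  have hz1 : 1 ≤ pk G₂ (univ.erase z) := by
    rcases ih₂ O.ore₂ with h | ⟨⟨e⟩⟩ | h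
    · exact h.pk_erase z
    · have h1 := pk_iso e
      rw [h7_pk] at h1
      omega
    · omega
  rcases ih₁ O.ore₁ with h1 | ⟨⟨e⟩⟩ | h1
  · rcases ih₂ O.ore₂ with h2 | ⟨⟨e⟩⟩ | h2
    · exact Or.inl (O.h7_of_k4 hG h1 h2)
    · right
      obtain ⟨r, hr, k1⟩ := h7_split (O.splitIn.iso e) (B := O.right) (fun s hs => by
        rw [O.mem_right]
        exact ⟨e.symm s, fun h => hs (by rw [← h]; simp), rfl⟩)
      obtain ⟨r', hr', hrr⟩ : ∃ r', (r' = x ∨ r' = y) ∧ r = i₁ r' := by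
        rcases hr with rfl | rfl
        · exact ⟨x, Or.inl rfl, rfl⟩
        · exact ⟨y, Or.inr rfl, rfl⟩
      have k2 := (h1.pk_erase r').trans ((pk_erase_deleteEdge hr' (by simp)).trans
        (O.pk_image₁ _))
      have k3 := pk_add (G := G) (A := insert r O.right) (B := (univ.erase r').image i₁)
        (C := univ) (subset_univ _) (subset_univ _) (by
          rw [disjoint_insert_left]
          refine ⟨fun h => ?_, (O.disjoint_right _).symm⟩
          obtain ⟨a, ha, e⟩ := mem_image.1 h
          rw [hrr] at e
          exact ne_of_mem_erase ha (O.inj₁ e))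
      omega
    · right
      have := h1.pk_deleteEdge x y
      omega
  · right
    have := (h7_deleteEdge (e.map_adj_iff.2 O.hxy)).trans (pk_iso_deleteEdge e x y)
    omega
  · right
    omega

theorem isOre_pk_erase {V : Type u} [Fintype V] {G : SimpleGraph V} (hG : IsOre 4 G) (v : V) :
    1 ≤ pk G (univ.erase v) := by
  have hz := pk_erase (G := G) univ v
  rcases isOre_cases hG with h | ⟨⟨e⟩⟩ | h
  · exact h.pk_erase v
  · have h1 := pk_iso e
    rw [h7_pk] at h1
    omega
  · omega

end OrePacking

/-! ### Splitting a vertex of a `4`-Ore graph -/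

section OreSplit

/-- The Moser spindle with its centre split into `0` and `1`, so that no diamond remains: two
triangles `2 3 4` and `5 6 7`, an edge `47`, and two paths `2 0 5` and `3 1 6`. -/
def graphR8 : SimpleGraph (Fin 8) :=
  SimpleGraph.fromEdgeSet
    {s(0, 2), s(0, 5), s(1, 3), s(1, 6), s(2, 3), s(2, 4), s(3, 4), s(5, 6), s(5, 7), s(6, 7),
      s(4, 7)}

instance decR8 : DecidableRel graphR8.Adj := by unfold graphR8; infer_instance

/-- A diamond that avoids the split vertex survives the split. -/
theorem SplitIn.not_diamond {U V : Type*} {W : SimpleGraph U} {w : U} {G : SimpleGraph V} {a d : V}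
    {g : U → V} (h : SplitIn W w G a d g) (hn : NoDiamond G) {α β γ δ : U} (hα : α ≠ w) (hβ : β ≠ w)
    (hγ : γ ≠ w) (hδ : δ ≠ w) (hαδ : α ≠ δ) (h1 : W.Adj α β) (h2 : W.Adj α γ) (h3 : W.Adj β γ)
    (h4 : W.Adj β δ) (h5 : W.Adj γ δ) : False :=
  hn (g α) (g β) (g γ) (g δ) (fun e => hαδ (h.inj _ _ hα hδ e)) (h.adj _ _ hα hβ h1)
    (h.adj _ _ hα hγ h2) (h.adj _ _ hβ hγ h3) (h.adj _ _ hβ hδ h4) (h.adj _ _ hγ hδ h5)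

/-- If an end of a diamond is split and no diamond remains, then the two inner vertices are
attached to different parts. -/
theorem SplitIn.not_diamond_split {U V : Type*} {W : SimpleGraph U} {w : U} {G : SimpleGraph V}
    {a d : V} {g : U → V} (h : SplitIn W w G a d g) (hn : NoDiamond G) {β γ δ : U}
    (hβ : W.Adj w β) (hγ : W.Adj w γ) (hδ : δ ≠ w) (h3 : W.Adj β γ) (h4 : W.Adj β δ)
    (h5 : W.Adj γ δ) :
    (G.Adj a (g β) ∧ G.Adj d (g γ)) ∨ (G.Adj a (g γ) ∧ G.Adj d (g β)) := by
  have key : ∀ e, (e = a ∨ e = d) → G.Adj e (g β) → G.Adj e (g γ) → False := by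
    intro e he k1 k2
    refine hn e (g β) (g γ) (g δ) ?_ k1 k2 (h.adj _ _ hβ.ne' hγ.ne' h3) (h.adj _ _ hβ.ne' hδ h4)
      (h.adj _ _ hγ.ne' hδ h5)
    rcases he with rfl | rfl
    · exact (h.ne_a δ hδ).symm
    · exact (h.ne_d δ hδ).symm
  have := key a (Or.inl rfl)
  have := key d (Or.inr rfl)
  have := h.adjw β hβ
  have := h.adjw γ hγ
  tauto

/-- A split of the Moser spindle that leaves no diamond is a split of its centre, and each part
receives one inner vertex of each of the two diamonds. -/
theorem h7_split_pattern {V : Type*} {G : SimpleGraph V} {a d : V} {g : Fin 7 → V} {i : Fin 7}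
    (h : SplitIn graphH7 i G a d g) (hn : NoDiamond G) {B : Finset V} (ha : a ∈ B) (hd : d ∈ B)
    (hB : ∀ s, s ≠ i → g s ∈ B) :
    ∃ f : Fin 8 → V, Function.Injective f ∧ f 0 = a ∧ f 1 = d ∧ (∀ s, f s ∈ B) ∧
      ∀ s t, graphR8.Adj s t → G.Adj (f s) (f t) := by
  by_cases hi : i ≠ 1
  · obtain ⟨α, β, γ, δ, h1, h2, h3, h4, h5, h6, -, -, h7, h8, h9, h10⟩ := h7_diamond hi
    exact (h.not_diamond hn h7 h8 h9 h10 h1 h2 h3 h4 h5 h6).elim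
  · rw [not_not] at hi
    subst hi
    have key : ∀ β β' γ γ' : Fin 7, (β = 2 ∧ β' = 3 ∨ β = 3 ∧ β' = 2) →
        (γ = 5 ∧ γ' = 6 ∨ γ = 6 ∧ γ' = 5) → G.Adj a (g β) → G.Adj d (g β') → G.Adj a (g γ) →
        G.Adj d (g γ') → ∃ f : Fin 8 → V, Function.Injective f ∧ f 0 = a ∧ f 1 = d ∧
        (∀ s, f s ∈ B) ∧ ∀ s t, graphR8.Adj s t → G.Adj (f s) (f t) := by
      intro β β' γ γ' hβ hγ k1 k2 k3 k4
      have n1 : β ≠ 1 ∧ β' ≠ 1 ∧ γ ≠ 1 ∧ γ' ≠ 1 ∧ β ≠ β' ∧ β ≠ 0 ∧ β ≠ γ ∧ β ≠ γ' ∧ β ≠ 4 ∧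
          β' ≠ 0 ∧ β' ≠ γ ∧ β' ≠ γ' ∧ β' ≠ 4 ∧ γ ≠ γ' ∧ γ ≠ 4 ∧ γ' ≠ 4 ∧ γ ≠ 0 ∧ γ' ≠ 0 := by
        rcases hβ with ⟨rfl, rfl⟩ | ⟨rfl, rfl⟩ <;> rcases hγ with ⟨rfl, rfl⟩ | ⟨rfl, rfl⟩ <;> decide
      obtain ⟨m1, m2, m3, m4, m5, m6, m7, m8, m9, m10, m11, m12, m13, m14, m15, m16, m17, m18⟩ := n1
      have e1 : graphH7.Adj β β' ∧ graphH7.Adj β 0 ∧ graphH7.Adj β' 0 ∧ graphH7.Adj γ γ' ∧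
          graphH7.Adj γ 4 ∧ graphH7.Adj γ' 4 := by
        rcases hβ with ⟨rfl, rfl⟩ | ⟨rfl, rfl⟩ <;> rcases hγ with ⟨rfl, rfl⟩ | ⟨rfl, rfl⟩ <;> decide
      obtain ⟨c1, c2, c3, c4, c5, c6⟩ := e1
      have hne : ∀ s t, s ≠ 1 → t ≠ 1 → s ≠ t → g s ≠ g t := fun s t hs ht hst e =>
        hst (h.inj s t hs ht e)
      have z1 : (0 : Fin 7) ≠ 1 := by decide
      have z4 : (4 : Fin 7) ≠ 1 := by decide
      have z04 : (0 : Fin 7) ≠ 4 := by decide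
      refine ⟨![a, d, g β, g β', g 0, g γ, g γ', g 4], nodup_injective ?_, rfl, rfl, ?_, ?_⟩
      · simp [List.ofFn_succ, h.had, (h.ne_a _ m1).symm, (h.ne_a _ m2).symm, (h.ne_a _ m3).symm,
          (h.ne_a _ m4).symm, (h.ne_a _ z1).symm, (h.ne_a _ z4).symm, (h.ne_d _ m1).symm,
          (h.ne_d _ m2).symm, (h.ne_d _ m3).symm, (h.ne_d _ m4).symm, (h.ne_d _ z1).symm,
          (h.ne_d _ z4).symm, hne _ _ m1 m2 m5, hne _ _ m1 z1 m6, hne _ _ m1 m3 m7,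
          hne _ _ m1 m4 m8, hne _ _ m1 z4 m9, hne _ _ m2 z1 m10, hne _ _ m2 m3 m11,
          hne _ _ m2 m4 m12, hne _ _ m2 z4 m13, hne _ _ m3 m4 m14, hne _ _ m3 z4 m15,
          hne _ _ m4 z4 m16, hne _ _ z1 m3 m17.symm, hne _ _ z1 m4 m18.symm, hne _ _ z1 z4 z04]
      · intro s
        fin_cases s
        exacts [ha, hd, hB _ m1, hB _ m2, hB _ z1, hB _ m3, hB _ m4, hB _ z4]
      · refine hom_of_list [(0, 2), (0, 5), (1, 3), (1, 6), (2, 3), (2, 4), (3, 4), (5, 6), (5, 7),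
          (6, 7), (4, 7)] (by decide) _ ?_
        simp only [List.forall_mem_cons, List.not_mem_nil, false_implies, implies_true, and_true]
        exact ⟨k1, k3, k2, k4, h.adj _ _ m1 m2 c1, h.adj _ _ m1 z1 c2, h.adj _ _ m2 z1 c3,
          h.adj _ _ m3 m4 c4, h.adj _ _ m3 z4 c5, h.adj _ _ m4 z4 c6,
          h.adj _ _ z1 z4 (by decide)⟩
    rcases h.not_diamond_split hn (β := 2) (γ := 3) (δ := 0) (by decide) (by decide) (by decide)
      (by decide) (by decide) (by decide) with p | p <;>
    rcases h.not_diamond_split hn (β := 5) (γ := 6) (δ := 4) (by decide) (by decide) (by decide)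
      (by decide) (by decide) (by decide) with p' | p'
    · exact key 2 3 5 6 (by decide) (by decide) p.1 p.2 p'.1 p'.2
    · exact key 2 3 6 5 (by decide) (by decide) p.1 p.2 p'.1 p'.2
    · exact key 3 2 5 6 (by decide) (by decide) p.1 p.2 p'.1 p'.2
    · exact key 3 2 6 5 (by decide) (by decide) p.1 p.2 p'.1 p'.2

variable {V W₀ V₁ V₂ : Type u} [Fintype W₀] [Fintype V₁] [Fintype V₂] {W : SimpleGraph W₀}
  {G₁ : SimpleGraph V₁} {x y : V₁} {G₂ : SimpleGraph V₂} {z : V₂} {S : Set V₂} {i₁ : V₁ → W₀}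
  {i₂ : V₂ → W₀} {w : W₀} {G : SimpleGraph V} {a d : V} {g : W₀ → V} {B : Finset V}

theorem SplitIn.three_le_of_path (h : SplitIn W w G a d g) {α γ δ : W₀} (h1 : W.Adj w α)
    (h2 : W.Adj w γ) (h3 : W.Adj w δ) (h4 : W.Adj α γ) (h5 : W.Adj γ δ) (h6 : α ≠ δ)
    {A : Finset W₀} (hA : w ∉ A) (hα : α ∉ A) (hγ : γ ∉ A) (hδ : δ ∉ A) (ha : a ∈ B) (hd : d ∈ B)
    (hB : ∀ s, s ≠ w → g s ∈ B) (h2A : 2 ≤ pk W A) : 3 ≤ pk G B := by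
  obtain ⟨r, hr, hle⟩ := h.exists_pk h1 h2 h3 h4 h5 h6 hA hα hγ hδ hB
  have : insert r B = B := insert_eq_of_mem (by rcases hr with rfl | rfl <;> assumption)
  rw [this] at hle
  omega

theorem SplitIn.three_le (h : SplitIn W w G a d g) {A : Finset W₀} (hA : w ∉ A)
    (hB : ∀ s, s ≠ w → g s ∈ B) (h3 : 3 ≤ pk W A) : 3 ≤ pk G B :=
  h3.trans (h.pk_le hA fun s hs => hB s fun e => hA (e ▸ hs))

/-- If the first graph is `K₄` or the Moser spindle, it still contains a diamond after the deletion
of the edge `xy`. -/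
theorem OreDecomp.diamond_left (O : OreDecomp W G₁ x y G₂ z S i₁ i₂) (hT : pk G₁ univ < 3) :
    ∃ α β γ δ, α ≠ δ ∧ W.Adj (i₁ α) (i₁ β) ∧ W.Adj (i₁ α) (i₁ γ) ∧ W.Adj (i₁ β) (i₁ γ) ∧
      W.Adj (i₁ β) (i₁ δ) ∧ W.Adj (i₁ γ) (i₁ δ) := by
  rcases isOre_cases O.ore₁ with h | ⟨⟨e⟩⟩ | h
  · obtain ⟨p, s, hps, hpx, hpy, hsx, hsy, -⟩ := h.exists_two O.hxy.ne
    have A1 : ∀ s t, s ≠ t → s ≠ x ∨ t ≠ y → s ≠ y ∨ t ≠ x → W.Adj (i₁ s) (i₁ t) := by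
      intro s t hst e1 e2
      refine (O.adj₁ s t).2 ⟨h.2 s t hst, fun e => ?_⟩
      rcases Sym2.eq_iff.1 e with e | e <;> tauto
    refine ⟨x, p, s, y, O.hxy.ne, A1 _ _ hpx.symm ?_ ?_, A1 _ _ hsx.symm ?_ ?_, A1 _ _ hps ?_ ?_,
      A1 _ _ hpy ?_ ?_, A1 _ _ hsy ?_ ?_⟩ <;> tauto
  · obtain ⟨α, β, γ, δ, h1, h2⟩ := h7_diamond_edge (e.map_adj_iff.2 O.hxy)
    have A1 : ∀ s t, (graphH7.Adj s t ∧ s(s, t) ≠ s(e x, e y)) →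
        W.Adj (i₁ (e.symm s)) (i₁ (e.symm t)) := by
      intro s t hst
      refine (O.adj₁ _ _).2 ⟨e.symm.map_adj_iff.2 hst.1, fun k => hst.2 ?_⟩
      rcases Sym2.eq_iff.1 k with k | k
      · rw [← k.1, ← k.2]; simp
      · rw [← k.1, ← k.2, Sym2.eq_swap]; simp
    exact ⟨e.symm α, e.symm β, e.symm γ, e.symm δ, fun k => h1 (e.symm.injective k), A1 _ _ h2.1,
      A1 _ _ h2.2.1, A1 _ _ h2.2.2.1, A1 _ _ h2.2.2.2.1, A1 _ _ h2.2.2.2.2⟩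
  · omega

/-- A split in the second part. As no diamond remains, the first graph has three disjoint short
cycles, two of which survive the deletion of `xy`; the third cycle comes from the second part. -/
theorem OreDecomp.split_right (O : OreDecomp W G₁ x y G₂ z S i₁ i₂) {b : V₂} (hb : b ≠ z)
    (h : SplitIn W (i₂ b) G a d g) (hn : NoDiamond G) (ha : a ∈ B) (hd : d ∈ B)
    (hB : ∀ s, s ≠ i₂ b → g s ∈ B) : 3 ≤ pk G B := by
  have hi : ∀ c, i₁ c ≠ i₂ b := fun c => O.disj c b hb
  by_cases hT : pk G₁ univ < 3
  · obtain ⟨α, β, γ, δ, h1, h2, h3, h4, h5, h6⟩ := O.diamond_left hT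
    exact (h.not_diamond hn (hi _) (hi _) (hi _) (hi _) (O.inj₁.ne h1) h2 h3 h4 h5 h6).elim
  have k1 := pk_deleteEdge G₁ univ x y
  have k2 : ∀ e, (e = x ∨ e = y) → 2 ≤ pk W ((univ.erase e).image i₁) := fun e he => by
    have k3 := pk_erase (G := G₁) univ e
    have k4 := pk_erase_deleteEdge (G := G₁) (x := x) (y := y) he (A := univ.erase e) (by simp)
    have k5 := O.pk_image₁ (univ.erase e)
    omega
  have nm1 : ∀ A : Finset V₁, i₂ b ∉ A.image i₁ := fun A hA => by
    obtain ⟨c, -, e⟩ := mem_image.1 hA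
    exact hi c e
  have nm2 : ∀ A : Finset V₂, z ∉ A → b ∉ A → i₂ b ∉ A.image i₂ := fun A hz hA hm => by
    obtain ⟨c, hc, e⟩ := mem_image.1 hm
    exact hA (O.inj₂ c b (fun e => hz (e ▸ hc)) hb e ▸ hc)
  have nm3 : ∀ (A : Finset V₁) {c : V₂}, c ≠ z → i₂ c ∉ A.image i₁ := fun A c hc hA => by
    obtain ⟨c', -, e⟩ := mem_image.1 hA
    exact O.disj c' c hc e
  have nm4 : ∀ e : V₁, i₁ e ∉ (univ.erase e).image i₁ := fun e hA => by
    obtain ⟨c', hc, k⟩ := mem_image.1 hA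
    exact ne_of_mem_erase hc (O.inj₁ k)
  -- a cycle in the second part that avoids both split vertices gives the third cycle
  have k6 : 1 ≤ pk G₂ ((univ.erase z).erase b) → 3 ≤ pk G B := fun k => by
    refine h.three_le (A := univ.image i₁ ∪ ((univ.erase z).erase b).image i₂) ?_ hB ?_
    · rw [mem_union]
      rintro (hm | hm)
      · exact nm1 _ hm
      · exact nm2 _ (by simp) (by simp) hm
    · have := O.pk_union univ (A₂ := (univ.erase z).erase b) (by simp)
      omega
  have k7 : ∀ α γ δ : V₂, G₂.Adj b α → G₂.Adj b γ → G₂.Adj b δ → G₂.Adj α γ → G₂.Adj γ δ →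
      α ≠ δ → α ≠ z → γ ≠ z → δ ≠ z → 3 ≤ pk G B := by
    intro α γ δ c1 c2 c3 c4 c5 c6 hα hγ hδ
    refine h.three_le_of_path (α := i₂ α) (γ := i₂ γ) (δ := i₂ δ) ((O.adj₂ _ _ hb hα).2 c1)
      ((O.adj₂ _ _ hb hγ).2 c2) ((O.adj₂ _ _ hb hδ).2 c3) ((O.adj₂ _ _ hα hγ).2 c4)
      ((O.adj₂ _ _ hγ hδ).2 c5) (fun e => c6 (O.inj₂ _ _ hα hδ e)) (nm1 univ) (nm3 _ hα) (nm3 _ hγ)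
      (nm3 _ hδ) ha hd hB ?_
    have := O.pk_image₁ univ
    omega
  rcases isOre_cases O.ore₂ with h2 | ⟨⟨e⟩⟩ | h2
  · obtain ⟨t₁, t₂, ht, ht1, ht1', ht2, ht2', -⟩ := h2.exists_two hb
    have key : ∀ e, (e = x ∨ e = y) → W.Adj (i₁ e) (i₂ b) → ∀ t t', t ≠ t' → t ≠ b → t ≠ z →
        t' ≠ b → t' ≠ z → W.Adj (i₁ e) (i₂ t) → 3 ≤ pk G B := by
      intro e he k t t' n1 n2 n3 n4 n5 kt
      exact h.three_le_of_path (α := i₂ t') (γ := i₂ t) (δ := i₁ e)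
        ((O.adj₂ _ _ hb n5).2 (h2.2 _ _ n4.symm)) ((O.adj₂ _ _ hb n3).2 (h2.2 _ _ n2.symm)) k.symm
        ((O.adj₂ _ _ n5 n3).2 (h2.2 _ _ n1.symm)) kt.symm (O.disj _ _ n5).symm
        (nm1 (univ.erase e)) (nm3 _ n5) (nm3 _ n3) (nm4 e) ha hd hB (k2 e he)
    have key2 : ∀ e, (e = x ∨ e = y) → W.Adj (i₁ e) (i₂ t₁) → W.Adj (i₁ e) (i₂ t₂) →
        3 ≤ pk G B := by
      intro e he c1 c2
      refine h.three_le (A := (univ.erase e).image i₁ ∪ {i₁ e, i₂ t₁, i₂ t₂}) ?_ hB ?_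
      · simp only [mem_union, mem_insert, mem_singleton, not_or]
        exact ⟨nm1 _, (hi e).symm, fun k => ht1 (O.inj₂ _ _ hb ht1' k).symm,
          fun k => ht2 (O.inj₂ _ _ hb ht2' k).symm⟩
      · have c3 : 1 ≤ pk W {i₁ e, i₂ t₁, i₂ t₂} := pk_triangle (a := i₁ e) (b := i₂ t₁)
          (c := i₂ t₂) (by simp) (by simp) (by simp) c1
          ((O.adj₂ _ _ ht1' ht2').2 (h2.2 _ _ ht)) c2.symm
        have c4 := pk_add (G := W) (A := (univ.erase e).image i₁) (B := {i₁ e, i₂ t₁, i₂ t₂})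
          subset_union_left subset_union_right (by
            simp only [disjoint_insert_right, disjoint_singleton_right]
            exact ⟨nm4 e, nm3 _ ht1', nm3 _ ht2'⟩)
        have := k2 e he
        omega
    have c0 := (O.nbr_z hb).1 (h2.2 _ _ hb.symm)
    have c1 := (O.nbr_z ht1').1 (h2.2 _ _ ht1'.symm)
    have c2 := (O.nbr_z ht2').1 (h2.2 _ _ ht2'.symm)
    have f1 := key x (Or.inl rfl)
    have f2 := key y (Or.inr rfl)
    rcases c0 with c0 | c0 <;> rcases c1 with c1 | c1 <;> rcases c2 with c2 | c2
    · exact f1 c0 t₁ t₂ ht ht1 ht1' ht2 ht2' c1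
    · exact f1 c0 t₁ t₂ ht ht1 ht1' ht2 ht2' c1
    · exact f1 c0 t₂ t₁ ht.symm ht2 ht2' ht1 ht1' c2
    · exact key2 y (Or.inr rfl) c1 c2
    · exact key2 x (Or.inl rfl) c1 c2
    · exact f2 c0 t₂ t₁ ht.symm ht2 ht2' ht1 ht1' c2
    · exact f2 c0 t₁ t₂ ht ht1 ht1' ht2 ht2' c1
    · exact f2 c0 t₁ t₂ ht ht1 ht1' ht2 ht2' c1
  · rcases h7_two (e z) (e b) (fun k => hb (e.injective k).symm) with c | ⟨α, γ, δ, c1, c2, c3, c4, c5,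
      c6, c7, c8, c9⟩
    · refine k6 (c.trans (pk_map e.symm e.symm.injective.injOn (fun s hs => ?_)
        fun s _ t _ k => e.symm.map_adj_iff.2 k))
      simp only [mem_erase, mem_univ, and_true] at hs ⊢
      exact ⟨fun k => hs.1 (by rw [← k]; simp), fun k => hs.2 (by rw [← k]; simp)⟩
    · have tr : ∀ s t, graphH7.Adj s t → G₂.Adj (e.symm s) (e.symm t) := fun s t k =>
        e.symm.map_adj_iff.2 k
      have trb : ∀ t, graphH7.Adj (e b) t → G₂.Adj b (e.symm t) := fun t k => by
        simpa using tr _ _ k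
      have ne : ∀ t, t ≠ e z → e.symm t ≠ z := fun t ht k => ht (by rw [← k]; simp)
      exact k7 _ _ _ (trb _ c1) (trb _ c2) (trb _ c3) (tr _ _ c4) (tr _ _ c5)
        (fun k => c6 (e.symm.injective k)) (ne _ c7) (ne _ c8) (ne _ c9)
  · refine k6 ?_
    have c1 := pk_erase (G := G₂) univ z
    have c2 := pk_erase (G := G₂) (univ.erase z) b
    omega

/-- A split in the first part. If the second graph is not `K₄`, two disjoint short cycles lie in
the second part, and one more comes from the first part. If it is `K₄`, then one of `x`, `y` is an
end of a diamond with three vertices of the second part; so this is the split vertex, and the first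
part has two disjoint short cycles that avoid it. -/
theorem OreDecomp.split_left (O : OreDecomp W G₁ x y G₂ z S i₁ i₂) {c : V₁}
    (h : SplitIn W (i₁ c) G a d g) (hn : NoDiamond G) (ha : a ∈ B) (hd : d ∈ B)
    (hB : ∀ s, s ≠ i₁ c → g s ∈ B) (hK : ¬ (IsK4 G₁ ∧ IsK4 G₂)) : 3 ≤ pk G B := by
  have hi : ∀ b, b ≠ z → i₂ b ≠ i₁ c := fun b hb => (O.disj c b hb).symm
  have nm1 : ∀ A : Finset V₁, c ∉ A → i₁ c ∉ A.image i₁ := fun A hA hm => by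
    obtain ⟨c', hc, e⟩ := mem_image.1 hm
    exact hA (O.inj₁ e ▸ hc)
  have nm2 : ∀ A : Finset V₂, z ∉ A → ∀ c, i₁ c ∉ A.image i₂ := fun A hA c hm => by
    obtain ⟨b, hb, e⟩ := mem_image.1 hm
    exact O.disj c b (fun k => hA (k ▸ hb)) e.symm
  have hun : ∀ A : Finset V₁, c ∉ A → ∀ A' : Finset V₂, z ∉ A' →
      3 ≤ pk (G₁.deleteEdges {s(x, y)}) A + pk G₂ A' → 3 ≤ pk G B := by
    intro A hA A' hA' k
    refine h.three_le (A := A.image i₁ ∪ A'.image i₂) ?_ hB (k.trans (O.pk_union A hA'))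
    rw [mem_union]
    rintro (hm | hm)
    · exact nm1 _ hA hm
    · exact nm2 _ hA' _ hm
  have path : 2 ≤ pk G₂ (univ.erase z) → ∀ α γ δ : V₁, G₁.Adj c α → G₁.Adj c γ → G₁.Adj c δ →
      G₁.Adj α γ → G₁.Adj γ δ → α ≠ δ → s(c, α) ≠ s(x, y) → s(c, γ) ≠ s(x, y) →
      s(c, δ) ≠ s(x, y) → s(α, γ) ≠ s(x, y) → s(γ, δ) ≠ s(x, y) → 3 ≤ pk G B := by
    intro k α γ δ c1 c2 c3 c4 c5 c6 d1 d2 d3 d4 d5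
    exact h.three_le_of_path (α := i₁ α) (γ := i₁ γ) (δ := i₁ δ) ((O.adj₁ _ _).2 ⟨c1, d1⟩)
      ((O.adj₁ _ _).2 ⟨c2, d2⟩) ((O.adj₁ _ _).2 ⟨c3, d3⟩) ((O.adj₁ _ _).2 ⟨c4, d4⟩)
      ((O.adj₁ _ _).2 ⟨c5, d5⟩) (O.inj₁.ne c6) (A := (univ.erase z).image i₂)
      (nm2 _ (by simp) _) (nm2 _ (by simp) _) (nm2 _ (by simp) _) (nm2 _ (by simp) _) ha hd hB
      (k.trans (O.pk_image₂ (by simp)))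
  -- two disjoint cycles in the second part leave one cycle to be found in the first part
  have two : 2 ≤ pk G₂ (univ.erase z) → 3 ≤ pk G B := by
    intro k
    have one : 1 ≤ pk (G₁.deleteEdges {s(x, y)}) (univ.erase c) → 3 ≤ pk G B := fun k' =>
      hun (univ.erase c) (by simp) (univ.erase z) (by simp) (by omega)
    by_cases hc : c = x ∨ c = y
    · exact one ((isOre_pk_erase O.ore₁ c).trans (pk_erase_deleteEdge hc (by simp)))
    rw [not_or] at hc
    have one' : 1 ≤ pk G₁ ((univ.erase x).erase c) → 3 ≤ pk G B := fun k' => by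
      refine one (k'.trans ((pk_erase_deleteEdge (x := x) (y := y) (e := x) (Or.inl rfl)
        (by simp)).trans (pk_mono ?_)))
      intro v hv
      simp only [mem_erase, mem_univ, and_true] at hv ⊢
      exact hv.1
    rcases isOre_cases O.ore₁ with h1 | ⟨⟨e⟩⟩ | h1
    · obtain ⟨p, hpx, hpy, hpc⟩ : ∃ p, p ≠ x ∧ p ≠ y ∧ p ≠ c := by
        obtain ⟨a, b, hab, hax, hay, hbx, hby, -⟩ := h1.exists_two O.hxy.ne
        by_cases hac : a = c
        · exact ⟨b, hbx, hby, fun e => hab (hac.trans e.symm)⟩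
        · exact ⟨a, hax, hay, hac⟩
      have ne : ∀ s t, (s ≠ x ∧ s ≠ y) ∨ (t ≠ x ∧ t ≠ y) → s(s, t) ≠ s(x, y) := by
        intro s t h e
        rcases Sym2.eq_iff.1 e with e | e <;> tauto
      exact path k x p y (h1.2 _ _ hc.1) (h1.2 _ _ hpc.symm) (h1.2 _ _ hc.2) (h1.2 _ _ hpx.symm)
        (h1.2 _ _ hpy) O.hxy.ne (ne _ _ (Or.inl hc)) (ne _ _ (Or.inl hc)) (ne _ _ (Or.inl hc))
        (ne _ _ (Or.inr ⟨hpx, hpy⟩)) (ne _ _ (Or.inl ⟨hpx, hpy⟩))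
    · rcases h7_two (e x) (e c) (fun k => hc.1 (e.injective k).symm) with c | ⟨α, γ, δ, c1, c2, c3,
        c4, c5, c6, c7, c8, c9⟩
      · refine one' (c.trans (pk_map e.symm e.symm.injective.injOn (fun s hs => ?_)
          fun s _ t _ k => e.symm.map_adj_iff.2 k))
        simp only [mem_erase, mem_univ, and_true] at hs ⊢
        exact ⟨fun k => hs.1 (by rw [← k]; simp), fun k => hs.2 (by rw [← k]; simp)⟩
      · have tr : ∀ s t, graphH7.Adj s t → G₁.Adj (e.symm s) (e.symm t) := fun s t k =>
          e.symm.map_adj_iff.2 k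
        have trb : ∀ t, graphH7.Adj (e c) t → G₁.Adj c (e.symm t) := fun t k => by
          simpa using tr _ _ k
        have ne : ∀ t, t ≠ e x → e.symm t ≠ x := fun t ht k => ht (by rw [← k]; simp)
        have ne2 : ∀ s t, s ≠ x → t ≠ x → s(s, t) ≠ s(x, y) := by
          intro s t hs ht e
          rcases Sym2.eq_iff.1 e with e | e <;> tauto
        exact path k _ _ _ (trb _ c1) (trb _ c2) (trb _ c3) (tr _ _ c4) (tr _ _ c5)
          (fun k => c6 (e.symm.injective k)) (ne2 _ _ hc.1 (ne _ c7)) (ne2 _ _ hc.1 (ne _ c8))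
          (ne2 _ _ hc.1 (ne _ c9)) (ne2 _ _ (ne _ c7) (ne _ c8)) (ne2 _ _ (ne _ c8) (ne _ c9))
    · refine one' ?_
      have c1 := pk_erase (G := G₁) univ x
      have c2 := pk_erase (G := G₁) (univ.erase x) c
      omega
  rcases isOre_cases O.ore₂ with h2 | ⟨⟨e⟩⟩ | h2
  · have key : ∀ y' : V₁, (y' = x ∨ y' = y) → ∀ t₁ t₂ t₃ : V₂, t₁ ≠ t₂ → t₁ ≠ t₃ → t₂ ≠ t₃ →
        t₁ ≠ z → t₂ ≠ z → t₃ ≠ z → ¬ W.Adj (i₁ y') (i₂ t₁) → W.Adj (i₁ y') (i₂ t₂) →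
        W.Adj (i₁ y') (i₂ t₃) → 3 ≤ pk G B := by
      intro y' hy' t₁ t₂ t₃ n12 n13 n23 n1 n2 n3 m1 m2 m3
      have A2 : ∀ s t, s ≠ t → s ≠ z → t ≠ z → W.Adj (i₂ s) (i₂ t) := fun s t hst hs ht =>
        (O.adj₂ s t hs ht).2 (h2.2 s t hst)
      by_cases hc : y' ≠ c
      · exact (h.not_diamond hn (O.inj₁.ne hc) (hi _ n2) (hi _ n3) (hi _ n1) (O.disj _ _ n1) m2 m3
          (A2 _ _ n23 n2 n3) (A2 _ _ n12.symm n2 n1) (A2 _ _ n13.symm n3 n1)).elim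
      rw [not_not] at hc
      subst hc
      have fin : 2 ≤ pk G₁ (univ.erase y') → 3 ≤ pk G B := fun k => by
        have k1 := k.trans (pk_erase_deleteEdge hy' (by simp))
        have k2 := h2.pk_erase z
        exact hun (univ.erase y') (by simp) (univ.erase z) (by simp) (by omega)
      rcases isOre_cases O.ore₁ with h1 | ⟨⟨e⟩⟩ | h1
      · exact (hK ⟨h1, h2⟩).elim
      · by_cases h1 : e y' = 1
        · have k := pk_iso_erase e y'
          rw [h1] at k
          exact fin (Nat.le_trans (by convert h7_erase (i := 1) (by decide)) k)
        · obtain ⟨α, β, γ, δ, c1, c2, c3, c4, c5, c6, -, -, c7, c8, c9, c10⟩ := h7_diamond h1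
          have ne : ∀ t, t ≠ e y' → e.symm t ≠ y' := fun t ht k => ht (by rw [← k]; simp)
          have A1 : ∀ s t, graphH7.Adj s t → s ≠ e y' → t ≠ e y' →
              W.Adj (i₁ (e.symm s)) (i₁ (e.symm t)) := by
            intro s t hst hs ht
            refine (O.adj₁ _ _).2 ⟨e.symm.map_adj_iff.2 hst, fun k => ?_⟩
            rcases Sym2.eq_iff.1 k with k | k <;> rcases hy' with rfl | rfl
            exacts [ne _ hs k.1, ne _ ht k.2, ne _ ht k.2, ne _ hs k.1]
          exact (h.not_diamond hn (O.inj₁.ne (ne _ c7)) (O.inj₁.ne (ne _ c8)) (O.inj₁.ne (ne _ c9))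
            (O.inj₁.ne (ne _ c10)) (O.inj₁.ne fun k => c1 (e.symm.injective k)) (A1 _ _ c2 c7 c8)
            (A1 _ _ c3 c7 c9) (A1 _ _ c4 c8 c9) (A1 _ _ c5 c8 c10) (A1 _ _ c6 c9 c10)).elim
      · have := pk_erase (G := G₁) univ y'
        exact fin (by omega)
    obtain ⟨t₁, t₂, t₃, n12, n13, n23, n1, n2, n3, m | m⟩ := O.exists_triple h2
    · refine key y (Or.inr rfl) t₁ t₂ t₃ n12 n13 n23 n1 n2 n3 ?_ ?_ ?_
      · rw [O.adj_y (h2.2 _ _ n1.symm)]; exact not_not.2 m.1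
      · rw [O.adj_y (h2.2 _ _ n2.symm)]; exact m.2.1
      · rw [O.adj_y (h2.2 _ _ n3.symm)]; exact m.2.2
    · refine key x (Or.inl rfl) t₁ t₂ t₃ n12 n13 n23 n1 n2 n3 ?_ ?_ ?_
      · rw [O.adj_x (h2.2 _ _ n1.symm)]; exact m.1
      · rw [O.adj_x (h2.2 _ _ n2.symm)]; exact m.2.1
      · rw [O.adj_x (h2.2 _ _ n3.symm)]; exact m.2.2
  · by_cases h1 : e z = 1
    · have k := pk_iso_erase e z
      rw [h1] at k
      exact two (Nat.le_trans (by convert h7_erase (i := 1) (by decide)) k)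
    · obtain ⟨α, β, γ, δ, c1, c2, c3, c4, c5, c6, -, -, c7, c8, c9, c10⟩ := h7_diamond h1
      have ne : ∀ t, t ≠ e z → e.symm t ≠ z := fun t ht k => ht (by rw [← k]; simp)
      have A1 : ∀ s t, graphH7.Adj s t → s ≠ e z → t ≠ e z →
          W.Adj (i₂ (e.symm s)) (i₂ (e.symm t)) := fun s t hst hs ht =>
        (O.adj₂ _ _ (ne _ hs) (ne _ ht)).2 (e.symm.map_adj_iff.2 hst)
      exact (h.not_diamond hn (hi _ (ne _ c7)) (hi _ (ne _ c8)) (hi _ (ne _ c9)) (hi _ (ne _ c10))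
        (fun k => c1 (e.symm.injective (O.inj₂ _ _ (ne _ c7) (ne _ c10) k))) (A1 _ _ c2 c7 c8)
        (A1 _ _ c3 c7 c9) (A1 _ _ c4 c8 c9) (A1 _ _ c5 c8 c10) (A1 _ _ c6 c9 c10)).elim
  · have := pk_erase (G := G₂) univ z
    exact two (by omega)

theorem isOre_exists_decomp {V : Type u} [Fintype V] {G : SimpleGraph V} (hG : IsOre 4 G) :
    IsK4 G ∨ ∃ (V₁ V₂ : Type u) (_ : Fintype V₁) (_ : Fintype V₂) (G₁ : SimpleGraph V₁) (x y : V₁)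
      (G₂ : SimpleGraph V₂) (z : V₂) (S : Set V₂) (i₁ : V₁ → V) (i₂ : V₂ → V),
      OreDecomp G G₁ x y G₂ z S i₁ i₂ :=
  isOre_induction (P := fun V _ G => IsK4 G ∨ ∃ (V₁ V₂ : Type u) (_ : Fintype V₁) (_ : Fintype V₂)
      (G₁ : SimpleGraph V₁) (x y : V₁) (G₂ : SimpleGraph V₂) (z : V₂) (S : Set V₂) (i₁ : V₁ → V)
      (i₂ : V₂ → V), OreDecomp G G₁ x y G₂ z S i₁ i₂) (fun _ _ _ h => Or.inl h)
    (fun _ V₁ V₂ _ _ _ _ G₁ x y G₂ z S i₁ i₂ O _ _ =>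
      Or.inr ⟨V₁, V₂, inferInstance, inferInstance, G₁, x, y, G₂, z, S, i₁, i₂, O⟩) hG

/-- Splitting a vertex of a `4`-Ore graph so that no diamond remains gives three disjoint cycles of
length at most four, or the split Moser spindle. -/
theorem isOre_split (hW : IsOre 4 W) (h : SplitIn W w G a d g) (hn : NoDiamond G) (ha : a ∈ B)
    (hd : d ∈ B) (hB : ∀ s, s ≠ w → g s ∈ B) :
    3 ≤ pk G B ∨ (Fintype.card W₀ = 7 ∧ ∃ f : Fin 8 → V, Function.Injective f ∧ f 0 = a ∧ f 1 = d ∧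
      (∀ s, f s ∈ B) ∧ ∀ s t, graphR8.Adj s t → G.Adj (f s) (f t)) := by
  have case7 : Nonempty (W ≃g graphH7) → (Fintype.card W₀ = 7 ∧ ∃ f : Fin 8 → V,
      Function.Injective f ∧ f 0 = a ∧ f 1 = d ∧ (∀ s, f s ∈ B) ∧
        ∀ s t, graphR8.Adj s t → G.Adj (f s) (f t)) := by
    rintro ⟨e⟩
    refine ⟨by simpa using Fintype.card_congr e.toEquiv, h7_split_pattern (h.iso e) hn ha hd ?_⟩
    exact fun s hs => hB _ fun k => hs (by rw [← k]; simp)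
  rcases isOre_exists_decomp hW with hK | ⟨V₁, V₂, _, _, G₁, x, y, G₂, z, S, i₁, i₂, O⟩
  · exfalso
    obtain ⟨v, hv⟩ : ∃ v, v ≠ w := Fintype.exists_ne_of_one_lt_card (by rw [hK.1]; norm_num) w
    obtain ⟨p, r, hpr, hpw, hpv, hrw, hrv, -⟩ := hK.exists_two hv.symm
    have s1 := h.not_diamond_split hn (hK.2 _ _ hv.symm) (hK.2 _ _ hpw.symm) hrw (hK.2 _ _ hpv.symm)
      (hK.2 _ _ hrv.symm) (hK.2 _ _ hpr)
    have s2 := h.not_diamond_split hn (hK.2 _ _ hv.symm) (hK.2 _ _ hrw.symm) hpw (hK.2 _ _ hrv.symm)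
      (hK.2 _ _ hpv.symm) (hK.2 _ _ hpr.symm)
    -- two of the three other vertices are joined to the same part
    have diam : ∀ e β γ δ, (e = a ∨ e = d) → β ≠ w → γ ≠ w → δ ≠ w → β ≠ γ → β ≠ δ → γ ≠ δ →
        G.Adj e (g β) → G.Adj e (g γ) → False := by
      intro e β γ δ he n1 n2 n3 n4 n5 n6 k1 k2
      refine hn e (g β) (g γ) (g δ) ?_ k1 k2 (h.adj _ _ n1 n2 (hK.2 _ _ n4))
        (h.adj _ _ n1 n3 (hK.2 _ _ n5)) (h.adj _ _ n2 n3 (hK.2 _ _ n6))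
      rcases he with rfl | rfl
      · exact (h.ne_a δ n3).symm
      · exact (h.ne_d δ n3).symm
    rcases s1 with ⟨p1, p2⟩ | ⟨p1, p2⟩ <;> rcases s2 with ⟨q1, q2⟩ | ⟨q1, q2⟩
    · exact diam d p r v (Or.inr rfl) hpw hrw hv hpr hpv hrv p2 q2
    · exact diam a v r p (Or.inl rfl) hv hrw hpw hrv.symm hpv.symm hpr.symm p1 q1
    · exact diam a v p r (Or.inl rfl) hv hpw hrw hpv.symm hrv.symm hpr q1 p1
    · exact diam a p r v (Or.inl rfl) hpw hrw hv hpr hpv hrv p1 q1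
  · by_cases hK : IsK4 G₁ ∧ IsK4 G₂
    · exact Or.inr (case7 (O.h7_of_k4 hW hK.1 hK.2))
    left
    rcases O.cover w with ⟨c, rfl⟩ | ⟨b, hb, rfl⟩
    · exact O.split_left h hn ha hd hB hK
    · exact O.split_right hb h hn ha hd hB

end OreSplit

/-! ### Reductions and extensions of colourings -/

section Reduction
variable {V : Type u} [Fintype V] {G : SimpleGraph V}

/-- If all colourings of `G[D]` agree on `s` and `t`, then `G[D]` plus the edge `st` contains a
critical graph through that edge, here the edge `xy` of `W`. -/
theorem exists_crit_addEdge {D : Finset V} {s t : V} (hs : s ∈ D) (ht : t ∈ D) (hst : s ≠ t)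
    (hcol : ∃ c, Proper G D c) (hno : ∀ c, Proper G D c → c s = c t) :
    ∃ (U : Type u) (_ : Fintype U) (W : SimpleGraph U) (f : U → V) (x y : U),
      IsFourCritical W ∧ Function.Injective f ∧ (∀ u, f u ∈ D) ∧ W.Adj x y ∧ f x = s ∧ f y = t ∧
      ∀ a b, W.Adj a b → s(a, b) ≠ s(x, y) → G.Adj (f a) (f b) := by
  let H : SimpleGraph V :=
    { Adj := fun a b => a ∈ D ∧ b ∈ D ∧ (G.Adj a b ∨ (a = s ∧ b = t) ∨ (a = t ∧ b = s))
      symm := ⟨fun a b h => ⟨h.2.1, h.1, by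
        rcases h.2.2 with h | h | h
        · exact Or.inl h.symm
        · exact Or.inr (Or.inr h.symm)
        · exact Or.inr (Or.inl h.symm)⟩⟩
      loopless := ⟨fun a h => by
        rcases h.2.2 with h | h | h
        · exact G.irrefl h
        · exact hst (h.1.symm.trans h.2)
        · exact hst (h.2.symm.trans h.1)⟩ }
  obtain ⟨U, hU, W, f, hf, hfa, hcrit⟩ := exists_crit H (by
    rintro ⟨c, hc⟩
    refine hc s (mem_univ _) t (mem_univ _) ⟨hs, ht, Or.inr (Or.inl ⟨rfl, rfl⟩)⟩ (hno c ?_)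
    exact fun a ha b hb hab => hc a (mem_univ _) b (mem_univ _) ⟨ha, hb, Or.inl hab⟩)
  have hD : ∀ v, f v ∈ D := fun v => by
    have h3 := crit_deg hcrit v
    obtain ⟨t, ht⟩ : (univ.filter (W.Adj v)).Nonempty := by
      rw [← Finset.card_pos]; unfold dg at h3; omega
    exact (hfa v t (Finset.mem_filter.1 ht).2).1
  by_cases hex : ∃ x y, W.Adj x y ∧ f x = s ∧ f y = t
  · obtain ⟨x, y, hxy, hx, hy⟩ := hex
    refine ⟨U, hU, W, f, x, y, hcrit, hf, hD, hxy, hx, hy, fun a b hab hne => ?_⟩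
    rcases (hfa a b hab).2.2 with h | h | h
    · exact h
    · exact absurd (by rw [hf (h.1.trans hx.symm), hf (h.2.trans hy.symm)]) hne
    · exact absurd (by rw [hf (h.1.trans hy.symm), hf (h.2.trans hx.symm), Sym2.eq_swap]) hne
  · exfalso
    obtain ⟨c, hc⟩ := hcol
    refine crit_not_proper hcrit (c ∘ f) fun a _ b _ hab => ?_
    refine hc _ (hD a) _ (hD b) ?_
    rcases (hfa a b hab).2.2 with h | h | h
    · exact h
    · exact (hex ⟨a, b, hab, h.1, h.2⟩).elim
    · exact (hex ⟨b, a, hab.symm, h.2, h.1⟩).elim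

/-- If all colourings of `G[D]` differ on `a` and `d`, then a critical graph arises from a subgraph
of `G[D]` by identifying `a` and `d`. -/
theorem exists_crit_identify {D : Finset V} {a d : V} (ha : a ∈ D) (hd : d ∈ D) (had : a ≠ d)
    (hadj : ¬ G.Adj a d) (hcol : ∃ c, Proper G D c) (hno : ∀ c, Proper G D c → c a ≠ c d) :
    ∃ (U : Type u) (_ : Fintype U) (W : SimpleGraph U) (w : U) (g : U → V),
      IsFourCritical W ∧ SplitIn W w G a d g ∧ ∀ s, s ≠ w → g s ∈ D := by
  obtain ⟨U, hU, W, X, g, col, L⟩ := exists_lift G D {a, d} (fun _ => 0) (by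
    intro r hr r' hr' hadj'
    simp only [mem_insert, mem_singleton] at hr hr'
    rcases hr with rfl | rfl <;> rcases hr' with rfl | rfl
    · exact absurd hadj' G.irrefl
    · exact absurd hadj' hadj
    · exact absurd hadj'.symm hadj
    · exact absurd hadj' G.irrefl) fun ψ hψ h => hno ψ hψ ((h a (by simp) d (by simp)).2 rfl)
  have hcol0 : ∀ x ∈ X, col x = 0 := fun x hx => by
    obtain ⟨r, -, h⟩ := L.exists_color hx
    exact h.symm
  have hX : X.Nonempty := by
    rw [nonempty_iff_ne_empty]
    rintro rfl
    obtain ⟨c, hc⟩ := hcol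
    exact crit_not_proper L.crit (c ∘ g) fun s _ t _ hst =>
      hc _ (L.g_mem s (by simp)).1 _ (L.g_mem t (by simp)).1 (L.adj s (by simp) t (by simp) hst)
  obtain ⟨w, hw⟩ := hX
  have hXw : ∀ s, s ≠ w → s ∉ X := fun s hs hsX =>
    hs (L.col_inj s hsX w hw (by rw [hcol0 s hsX, hcol0 w hw]))
  refine ⟨U, hU, W, w, g, L.crit, ⟨had, ?_, ?_, ?_, ?_, ?_⟩, fun s hs => (L.g_mem s (hXw s hs)).1⟩
  · exact fun s t hs ht => L.g_inj s (hXw s hs) t (hXw t ht)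
  · exact fun s hs e => (L.g_mem s (hXw s hs)).2 (by simp [e])
  · exact fun s hs e => (L.g_mem s (hXw s hs)).2 (by simp [e])
  · exact fun s t hs ht => L.adj s (hXw s hs) t (hXw t ht)
  · intro s hs
    obtain ⟨r, hr, -, h⟩ := L.adjX s (hXw s hs.ne') w hw hs.symm
    simp only [mem_insert, mem_singleton] at hr
    rcases hr with rfl | rfl
    · exact Or.inl h.symm
    · exact Or.inr h.symm

/-- A split is a lift with a single colour. -/
theorem SplitIn.lift {U : Type u} [Fintype U] {W : SimpleGraph U} {w : U} {a d : V} {g : U → V}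
    (h : SplitIn W w G a d g) (hW : IsFourCritical W) {R : Finset V} (ha : a ∈ R) (hd : d ∈ R)
    (hR : ∀ s, s ≠ w → g s ∉ R) : Lift G univ R (fun _ => 0) W {w} g (fun _ => 0) where
  crit := hW
  g_mem s hs := ⟨mem_univ _, hR s (by simpa using hs)⟩
  g_inj s hs t ht e := h.inj s t (by simpa using hs) (by simpa using ht) e
  col_inj s hs t ht _ := by rw [mem_singleton.1 hs, mem_singleton.1 ht]
  adj s hs t ht e := h.adj s t (by simpa using hs) (by simpa using ht) e
  adjX s hs x hx e := by
    rw [mem_singleton.1 hx] at e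
    rcases h.adjw s e.symm with h1 | h1
    · exact ⟨a, ha, rfl, h1.symm⟩
    · exact ⟨d, hd, rfl, h1.symm⟩

theorem SplitIn.q_le {U : Type u} [Fintype U] {W : SimpleGraph U} {w : U} {a d : V} {g : U → V}
    (h : SplitIn W w G a d g) (hW : IsFourCritical W) {R : Finset V} (ha : a ∈ R) (hd : d ∈ R)
    (hR : ∀ s, s ≠ w → g s ∉ R) :
    q G (R ∪ liftSet {w} g) ≤ q G R + q W univ - 5 := by
  have := (h.lift hW ha hd hR).q_le
  rw [card_singleton] at this
  exact this

/-- Two colourings that agree on the intersection of two sets separated by it can be glued. -/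
theorem Proper.glue {A B : Finset V} {c c' : V → Fin 3} (hc : Proper G A c) (hc' : Proper G B c')
    (hagree : ∀ v ∈ A, v ∈ B → c v = c' v)
    (hsep : ∀ a ∈ A, a ∉ B → ∀ b ∈ B, b ∉ A → ¬ G.Adj a b) :
    Proper G (A ∪ B) (fun v => if v ∈ A then c v else c' v) := by
  intro s hs t ht hst
  simp only [mem_union] at hs ht
  by_cases hsA : s ∈ A <;> by_cases htA : t ∈ A
  · simp only [hsA, htA, if_true]
    exact hc s hsA t htA hst
  · simp only [hsA, htA, if_true, if_false]
    by_cases hsB : s ∈ B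
    · rw [hagree s hsA hsB]
      exact hc' s hsB t (by tauto) hst
    · exact absurd hst (hsep s hsA hsB t (by tauto) htA)
  · simp only [hsA, htA, if_true, if_false]
    by_cases htB : t ∈ B
    · rw [hagree t htA htB]
      exact hc' s (by tauto) t htB hst
    · exact absurd hst.symm (hsep t htA htB s (by tauto) hsA)
  · simp only [hsA, htA, if_false]
    exact hc' s (by tauto) t (by tauto) hst

theorem Proper.extend_two {A : Finset V} {c : V → Fin 3} (h : Proper G A c) {v : V} (hv : v ∉ A)
    (k l : Fin 3) (hc : ∀ a ∈ A, G.Adj v a → c a = k ∨ c a = l) :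
    ∃ c', Proper G (insert v A) c' ∧ (∀ a, a ≠ v → c' a = c a) ∧ c' v ≠ k ∧ c' v ≠ l := by
  obtain ⟨c', h1, h2, h3⟩ := h.extend hv {k, l} (card_le_two) fun a ha hva => by
    simpa using hc a ha hva
  refine ⟨c', h1, h2, ?_⟩
  simpa using h3

/-- A partial colouring extends greedily when at every uncoloured vertex the number of colours seen
plus the number of uncoloured neighbours is at most two. -/
theorem Proper.greedy (n : ℕ) {A : Finset V} (hn : Aᶜ.card = n) {c : V → Fin 3} (hc : Proper G A c)
    (h : ∀ v, v ∉ A → ((A.filter (G.Adj v)).image c).card + (Aᶜ.filter (G.Adj v)).card ≤ 2) :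
    ∃ c', Proper G univ c' ∧ ∀ a ∈ A, c' a = c a := by
  induction n generalizing A c with
  | zero =>
    rw [card_eq_zero, compl_eq_empty_iff] at hn
    subst hn
    exact ⟨c, hc, fun _ _ => rfl⟩
  | succ n ih =>
    obtain ⟨v, hv⟩ : Aᶜ.Nonempty := card_pos.1 (by omega)
    have hv' : v ∉ A := by simpa using hv
    obtain ⟨c', h1, h2, -⟩ := hc.extend hv' ((A.filter (G.Adj v)).image c)
      (by have := h v hv'; omega) fun a ha hva => mem_image_of_mem _ (by simp [ha, hva])
    have hAc : (insert v A)ᶜ = Aᶜ.erase v := by ext s; simp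
    have hcA : ∀ a ∈ A, c' a = c a := fun a ha => h2 a fun e => hv' (e ▸ ha)
    obtain ⟨c'', k1, k2⟩ := ih (A := insert v A) (c := c')
      (by rw [hAc, card_erase_of_mem hv]; omega) h1 (by
        intro s hs
        have hs' : s ∉ A := fun k => hs (mem_insert_of_mem k)
        have h3 := h s hs'
        have him : (A.filter (G.Adj s)).image c' = (A.filter (G.Adj s)).image c :=
          image_congr fun a ha => hcA a (by simp at ha; exact ha.1)
        rw [filter_insert, hAc, filter_erase]
        split_ifs with hsv
        · have h4 := card_insert_le (c' v) ((A.filter (G.Adj s)).image c')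
          rw [← image_insert, him] at h4
          rw [card_erase_of_mem (by simp [hv', hsv])]
          have h5 : 0 < (Aᶜ.filter (G.Adj s)).card := card_pos.2 ⟨v, by simp [hv', hsv]⟩
          omega
        · have h4 : ((Aᶜ.filter (G.Adj s)).erase v).card ≤ (Aᶜ.filter (G.Adj s)).card :=
            card_erase_le
          rw [him]
          omega)
    exact ⟨c'', k1, fun a ha => (k2 a (mem_insert_of_mem ha)).trans (hcA a ha)⟩

theorem exists_three_nbrs {v : V} (h : dg G v = 3) : ∃ a b c, a ≠ b ∧ a ≠ c ∧ b ≠ c ∧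
    ∀ w, G.Adj v w ↔ w = a ∨ w = b ∨ w = c := by
  obtain ⟨a, b, c, hab, hac, hbc, e⟩ := card_eq_three.1 h
  refine ⟨a, b, c, hab, hac, hbc, fun w => ?_⟩
  have : w ∈ univ.filter (G.Adj v) ↔ w ∈ ({a, b, c} : Finset V) := by rw [e]
  simpa using this

theorem exists_two_nbrs {v p : V} (h : dg G v = 3) (hp : G.Adj v p) : ∃ a b, a ≠ b ∧ a ≠ p ∧ b ≠ p ∧
    ∀ w, G.Adj v w ↔ w = p ∨ w = a ∨ w = b := by
  obtain ⟨a, b, c, hab, hac, hbc, e⟩ := exists_three_nbrs h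
  rcases (e p).1 hp with rfl | rfl | rfl
  · exact ⟨b, c, hbc, hab.symm, hac.symm, e⟩
  · exact ⟨a, c, hac, hab, hbc.symm, fun w => (e w).trans (by tauto)⟩
  · exact ⟨a, b, hab, hac, hbc, fun w => (e w).trans (by tauto)⟩

theorem exists_third_nbr {v p r : V} (h : dg G v = 3) (hp : G.Adj v p) (hr : G.Adj v r)
    (hpr : p ≠ r) : ∃ s, s ≠ p ∧ s ≠ r ∧ ∀ w, G.Adj v w ↔ w = p ∨ w = r ∨ w = s := by
  obtain ⟨a, b, hab, ha, hb, e⟩ := exists_two_nbrs h hp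
  rcases (e r).1 hr with rfl | rfl | rfl
  · exact absurd rfl hpr
  · exact ⟨b, hb, hab.symm, e⟩
  · exact ⟨a, ha, hab, fun w => (e w).trans (by tauto)⟩

/-- Along a path `y x z` of cubic vertices, a colouring of the rest that gives the two outer
neighbours of `y` the same colour extends. -/
theorem cubic_path_no_color (hG : IsFourCritical G) {x y z x₁ a₁ a₂ z₁ z₂ : V}
    (hyz : y ≠ z) (hnyz : ¬ G.Adj y z)
    (hx : ∀ w, G.Adj x w ↔ w = y ∨ w = z ∨ w = x₁) (hy : ∀ w, G.Adj y w ↔ w = x ∨ w = a₁ ∨ w = a₂)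
    (hz : ∀ w, G.Adj z w ↔ w = x ∨ w = z₁ ∨ w = z₂) {c : V → Fin 3}
    (hc : Proper G (univ \ {x, y, z}) c) : c a₁ ≠ c a₂ := by
  intro e
  have hxy : x ≠ y := ((hx y).2 (by simp)).ne
  have hxz : x ≠ z := ((hx z).2 (by simp)).ne
  have ha1 : a₁ ≠ z ∧ a₂ ≠ z := ⟨fun k => hnyz (k ▸ (hy a₁).2 (by simp)),
    fun k => hnyz (k ▸ (hy a₂).2 (by simp))⟩
  obtain ⟨c1, h1, k1, -⟩ := hc.extend_two (v := z) (by simp) (c z₁) (c z₂) fun a ha hza => by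
    rcases (hz a).1 hza with rfl | rfl | rfl
    · simp at ha
    · exact Or.inl rfl
    · exact Or.inr rfl
  obtain ⟨c2, h2, k2, -⟩ := h1.extend_two (v := x) (by simp [hxz]) (c1 z) (c1 x₁)
    fun a ha hxa => by
      rcases (hx a).1 hxa with rfl | rfl | rfl
      · simp [hyz] at ha
      · exact Or.inl rfl
      · exact Or.inr rfl
  have hxa : ∀ a, (a = a₁ ∨ a = a₂) → a ≠ z ∧ (a ≠ x → c2 a = c a) := by
    intro a ha
    have haz : a ≠ z := by rcases ha with rfl | rfl; exacts [ha1.1, ha1.2]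
    exact ⟨haz, fun hax => by rw [k2 a hax, k1 a haz]⟩
  obtain ⟨c3, h3, -⟩ := h2.extend_two (v := y) (by simp [hxy.symm, hyz]) (c2 x) (c a₁)
    fun a ha hya => by
      rcases (hy a).1 hya with rfl | rfl | rfl
      · exact Or.inl rfl
      · by_cases hax : a = x
        · exact Or.inl (by rw [hax])
        · exact Or.inr ((hxa a (Or.inl rfl)).2 hax)
      · by_cases hax : a = x
        · exact Or.inl (by rw [hax])
        · exact Or.inr (((hxa a (Or.inr rfl)).2 hax).trans e.symm)
  refine crit_not_proper hG c3 ?_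
  have : insert y (insert x (insert z (univ \ {x, y, z}))) = (univ : Finset V) := by
    ext v; simp; tauto
  rwa [this] at h3

/-- When `x` and `y` are adjacent cubic vertices with a common neighbour, every colouring of the
rest gives their remaining neighbours the same colour. -/
theorem cubic_triangle_color (hG : IsFourCritical G) {x y z x' y' : V}
    (hx : ∀ w, G.Adj x w ↔ w = y ∨ w = z ∨ w = x') (hy : ∀ w, G.Adj y w ↔ w = x ∨ w = z ∨ w = y')
    {c : V → Fin 3} (hc : Proper G (univ \ {x, y}) c) : c x' = c y' := by
  by_contra hne
  have hxy : x ≠ y := ((hx y).2 (by simp)).ne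
  have huniv : insert y (insert x (univ \ {x, y})) = (univ : Finset V) := by
    ext v; simp; tauto
  have huniv' : insert x (insert y (univ \ {x, y})) = (univ : Finset V) := by
    ext v; simp; tauto
  by_cases hzy : c z = c y'
  · -- the neighbours of `y` other than `x` have one colour, so `x` can be coloured first
    obtain ⟨c1, h1, k1, -⟩ := hc.extend_two (v := x) (by simp) (c z) (c x') fun a ha hxa => by
      rcases (hx a).1 hxa with rfl | rfl | rfl
      · simp at ha
      · exact Or.inl rfl
      · exact Or.inr rfl
    obtain ⟨c2, h2, -⟩ := h1.extend_two (v := y) (by simp [hxy.symm]) (c1 x) (c z) fun a ha hya => by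
      rcases (hy a).1 hya with rfl | rfl | rfl
      · exact Or.inl rfl
      · by_cases hax : a = x
        · exact Or.inl (by rw [hax])
        · exact Or.inr (k1 a hax)
      · by_cases hax : a = x
        · exact Or.inl (by rw [hax])
        · exact Or.inr ((k1 a hax).trans hzy.symm)
    rw [huniv] at h2
    exact crit_not_proper hG c2 h2
  · obtain ⟨c1, h1, k1, m1, m2⟩ := hc.extend_two (v := y) (by simp) (c z) (c y') fun a ha hya => by
      rcases (hy a).1 hya with rfl | rfl | rfl
      · simp at ha
      · exact Or.inl rfl
      · exact Or.inr rfl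
    -- `x'` avoids the colour of `y'`, so it has the colour of `z` or that of `y`
    have key : ∀ p q r s : Fin 3, p ≠ q → p ≠ r → q ≠ r → s ≠ r → s = p ∨ s = q := by decide
    have hzn : z ≠ y := by
      have := (hy z).2 (by simp)
      exact this.ne'
    obtain ⟨c2, h2, -⟩ := h1.extend_two (v := x) (by simp [hxy]) (c z) (c1 y) fun a ha hxa => by
      rcases (hx a).1 hxa with rfl | rfl | rfl
      · exact Or.inr rfl
      · exact Or.inl (k1 a hzn)
      · by_cases hay : a = y
        · exact Or.inr (by rw [hay])
        · rw [k1 a hay]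
          exact key (c z) (c1 y) (c y') (c a) m1.symm hzy m2 hne
    rw [huniv'] at h2
    exact crit_not_proper hG c2 h2

end Reduction

/-! ### Counting in small sets -/

section Counting
variable {V : Type u} [Fintype V] {G : SimpleGraph V}

theorem q_pair_le (a d : V) : q G {a, d} ≤ 10 := by
  unfold q
  have h1 := ed_nonneg G {a, d}
  have h2 : (({a, d} : Finset V).card : ℤ) ≤ 2 := by exact_mod_cast card_le_two
  linarith

theorem q_diamond_le {a b c d : V} (had : a ≠ d) (hab : G.Adj a b) (hac : G.Adj a c)
    (hbc : G.Adj b c) (hbd : G.Adj b d) (hcd : G.Adj c d) : q G {a, b, c, d} ≤ 5 := by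
  have h0 : q G {d} = 5 := by simp [q, ed_singleton]
  have h1 := q_insert_le (G := G) (a := c) (A := {d}) (S := {d}) (by simpa using hcd.ne)
    (by simp) (by simpa using hcd)
  have h2 := q_insert_le (G := G) (a := b) (A := {c, d}) (S := {c, d})
    (by simp [hbc.ne, hbd.ne]) (by simp) (by simp [hbc, hbd])
  have h3 := q_insert_le (G := G) (a := a) (A := {b, c, d}) (S := {b, c})
    (by simp [hab.ne, hac.ne, had]) (by intro v; simp; tauto) (by simp [hab, hac])
  rw [card_singleton] at h1
  rw [card_pair hcd.ne] at h2
  rw [card_pair hbc.ne] at h3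
  push_cast at *
  linarith

theorem card_diamond {a b c d : V} (had : a ≠ d) (hab : G.Adj a b) (hac : G.Adj a c)
    (hbc : G.Adj b c) (hbd : G.Adj b d) (hcd : G.Adj c d) :
    ({a, b, c, d} : Finset V).card = 4 := by
  rw [card_eq_succ]
  exact ⟨a, {b, c, d}, by simp [hab.ne, hac.ne, had], rfl, by
    rw [card_eq_three]; exact ⟨b, c, d, hbc.ne, hbd.ne, hcd.ne, rfl⟩⟩

/-- An injective homomorphism whose image has too few edges for another one is an embedding. -/
theorem hom_exact {U : Type*} [Fintype U] {H : SimpleGraph U} {f : U → V}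
    (hf : Function.Injective f) (hom : ∀ a b, H.Adj a b → G.Adj (f a) (f b))
    (hq : q H univ < q G (univ.image f) + 3) (a b : U) (hab : G.Adj (f a) (f b)) : H.Adj a b := by
  by_contra hne
  have h2 := q_image_le (G := G.deleteEdges {s(f a, f b)}) H f univ hf.injOn (by
    intro c _ d _ hcd
    simp only [SimpleGraph.deleteEdges_adj, Set.mem_singleton_iff]
    refine ⟨hom c d hcd, fun e => ?_⟩
    rcases Sym2.eq_iff.1 e with e | e
    · rw [hf e.1, hf e.2] at hcd; exact hne hcd
    · rw [hf e.1, hf e.2] at hcd; exact hne hcd.symm)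
  rw [q_deleteEdge G (mem_image_of_mem _ (mem_univ _)) (mem_image_of_mem _ (mem_univ _)) hab] at h2
  omega

/-- An edge of `W` that is missing in `G` costs three units of weight. -/
theorem q_image_addEdge {U : Type u} [Fintype U] {W : SimpleGraph U} {f : U → V} {x y : U}
    (hf : Function.Injective f) (hxy : W.Adj x y)
    (hom : ∀ a b, W.Adj a b → s(a, b) ≠ s(x, y) → G.Adj (f a) (f b)) :
    q G (univ.image f) ≤ q W univ + 3 := by
  rw [← q_deleteEdge W (mem_univ x) (mem_univ y) hxy]
  exact q_image_le G _ f univ hf.injOn fun a _ b _ h => by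
    rw [SimpleGraph.deleteEdges_adj, Set.mem_singleton_iff] at h
    exact hom a b h.1 h.2

theorem isK4_of_card (hG : IsFourCritical G) (h : Fintype.card V = 4) : IsK4 G := by
  refine ⟨h, fun a b hab => ?_⟩
  by_contra hne
  have h1 := crit_deg hG a
  have h2 : univ.filter (G.Adj a) ⊆ univ \ {a, b} := by
    intro v hv
    have hv : G.Adj a v := by simpa using hv
    simp only [mem_sdiff, mem_univ, true_and, mem_insert, mem_singleton, not_or]
    exact ⟨hv.ne', fun e => hne (e ▸ hv)⟩
  have h3 := card_le_card h2
  rw [card_sdiff_of_subset (subset_univ _), card_pair hab, card_univ, h] at h3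
  unfold dg at h1
  omega

theorem IsK4.iso (h : IsK4 G) : Nonempty (G ≃g (⊤ : SimpleGraph (Fin 4))) := by
  obtain ⟨e⟩ := Fintype.card_eq.1 (h.1.trans (Fintype.card_fin 4).symm)
  refine ⟨⟨e, ?_⟩⟩
  intro a b
  simp only [SimpleGraph.top_adj, ne_eq, EmbeddingLike.apply_eq_iff_eq]
  exact ⟨fun k => h.2 a b k, fun k => k.ne⟩

theorem isK4_of_iso (e : G ≃g (⊤ : SimpleGraph (Fin 4))) : IsK4 G := by
  refine ⟨by simpa using Fintype.card_congr e.toEquiv, fun a b hab => ?_⟩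
  rw [← e.map_adj_iff]
  simpa using hab

theorem IsK4.isOre (h : IsK4 G) : IsOre 4 G := by
  obtain ⟨e⟩ := h.iso
  exact IsOre.complete G e

end Counting

/-! ### Extensions of a proper subset -/

section LiftUniv
variable {V U : Type u} [Fintype V] [Fintype U] {G : SimpleGraph V} {R : Finset V}
  {φ : V → Fin 3} {W : SimpleGraph U} {X : Finset U} {g : U → V} {col : U → Fin 3}

/-- A critical graph has no colouring at all, so every colouring of a subset yields a lift. -/
theorem exists_lift_univ (hG : IsFourCritical G) (hφ : Proper G R φ) :
    ∃ (U : Type u) (_ : Fintype U) (W : SimpleGraph U) (X : Finset U) (g : U → V)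
      (col : U → Fin 3), Lift G univ R φ W X g col :=
  exists_lift G univ R φ hφ fun ψ hψ _ => crit_not_proper hG ψ hψ

/-- A lift without colours would be a proper subgraph of `G` that is not `3`-colourable. -/
theorem Lift.nonempty (hG : IsFourCritical G) (hR : R.Nonempty)
    (L : Lift G univ R φ W X g col) : X.Nonempty := by
  rw [nonempty_iff_ne_empty]
  rintro rfl
  obtain ⟨r, hr⟩ := hR
  obtain ⟨c, hc⟩ := crit_exists_proper hG (A := univ \ R) (by
    intro e
    have := e ▸ mem_univ r
    simp [hr] at this)
  exact crit_not_proper L.crit (c ∘ g) fun s _ t _ hst =>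
    hc _ (by simpa using (L.g_mem s (by simp)).2) _ (by simpa using (L.g_mem t (by simp)).2)
      (L.adj s (by simp) t (by simp) hst)

theorem Lift.card_cases (hG : IsFourCritical G) (hR : R.Nonempty)
    (L : Lift G univ R φ W X g col) : X.card = 1 ∨ X.card = 2 ∨ X.card = 3 := by
  have h1 := L.card_le
  have h2 := card_pos.2 (L.nonempty hG hR)
  omega

theorem Lift.card_union (L : Lift G univ R φ W X g col) :
    (R ∪ liftSet X g).card = R.card + (liftSet X g).card :=
  card_union_of_disjoint L.disjoint

/-- A lift has at most three vertices that are not in `G`, so it is smaller than `G` when `R` has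
four vertices. -/
theorem Lift.card_lt (L : Lift G univ R φ W X g col) (hR : 4 ≤ R.card) :
    Fintype.card U < Fintype.card V := by
  have h1 := L.card_le
  have h2 := L.card_liftSet
  have h3 := L.card_union
  have h4 := card_le_univ (R ∪ liftSet X g)
  omega

theorem Lift.mem_of_notMem (hs : R ∪ liftSet X g = univ) {v : V} (hv : v ∉ R) :
    ∃ s, s ∉ X ∧ g s = v := by
  have : v ∈ R ∪ liftSet X g := hs ▸ mem_univ v
  rw [mem_union] at this
  exact mem_liftSet.1 (this.resolve_left hv)

/-- A tight lift that covers `G` does not increase the degrees of the lifted vertices. -/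
theorem Tight.dg_le (T : Tight G R φ W X g col) (hs : R ∪ liftSet X g = univ) {s : U}
    (hsX : s ∉ X) : dg G (g s) ≤ dg W s := by
  have key : ∀ v : V, ∃ t : U, G.Adj (g s) v → W.Adj s t ∧
      ((v ∈ R ∧ t ∈ X ∧ col t = φ v) ∨ (v ∉ R ∧ t ∉ X ∧ g t = v)) := by
    intro v
    by_cases hv : v ∈ R
    · by_cases h : G.Adj (g s) v
      · obtain ⟨x, hx, h1, h2⟩ := T.nbr s hsX v hv h
        exact ⟨x, fun _ => ⟨h2, Or.inl ⟨hv, hx, h1⟩⟩⟩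
      · exact ⟨s, fun k => absurd k h⟩
    · obtain ⟨t, ht, rfl⟩ := Lift.mem_of_notMem hs hv
      exact ⟨t, fun k => ⟨T.adj_of s hsX t ht k, Or.inr ⟨hv, ht, rfl⟩⟩⟩
  choose f hf using key
  refine card_le_card_of_injOn f (fun v hv => ?_) ?_
  · have hv : G.Adj (g s) v := by simpa using hv
    simpa using (hf v hv).1
  · intro v hv v' hv' e
    have hv : G.Adj (g s) v := by simpa using hv
    have hv' : G.Adj (g s) v' := by simpa using hv'
    rcases (hf v hv).2 with ⟨k1, k2, k3⟩ | ⟨k1, k2, k3⟩ <;>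
      rcases (hf v' hv').2 with ⟨m1, m2, m3⟩ | ⟨m1, m2, m3⟩
    · exact T.uniq s hsX v k1 v' m1 hv hv' (by rw [← k3, ← m3, e])
    · exact absurd (e ▸ k2) m2
    · exact absurd (e ▸ m2) k2
    · rw [← k3, ← m3, e]

end LiftUniv

/-! ### Discharging -/

section Discharging
variable {V : Type u} [Fintype V] {G : SimpleGraph V}

/-- No triangle of `G` has two vertices of degree three. -/
def NoCubicPairTriangle (G : SimpleGraph V) : Prop :=
  ∀ x y z, G.Adj x y → G.Adj y z → G.Adj x z → dg G x = 3 → dg G y = 3 → False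

/-- The vertex `y` lies in a triangle. -/
def InTriangle (G : SimpleGraph V) (y : V) : Prop := ∃ p r, G.Adj y p ∧ G.Adj y r ∧ G.Adj p r

/-- The ends of a path on three vertices of degree three do not both avoid all triangles. -/
def CubicPathTriangle (G : SimpleGraph V) : Prop :=
  ∀ x y z, y ≠ z → G.Adj x y → G.Adj x z → dg G x = 3 → dg G y = 3 → dg G z = 3 →
    InTriangle G y ∨ InTriangle G z

/-- The vertices of degree three. -/
noncomputable def cubic (G : SimpleGraph V) : Finset V := univ.filter fun v => dg G v = 3

/-- The number of neighbours of degree three. -/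
noncomputable def cnbr (G : SimpleGraph V) (v : V) : ℕ := ((cubic G).filter (G.Adj v)).card

theorem mem_cubic {v : V} : v ∈ cubic G ↔ dg G v = 3 := by simp [cubic]

/-- The vertices of degree three in triangles. -/
noncomputable def cubicTri (G : SimpleGraph V) : Finset V := (cubic G).filter (InTriangle G)

/-- The vertices of degree three without a neighbour of degree three. -/
noncomputable def cubicIso (G : SimpleGraph V) : Finset V := (cubic G).filter fun v => cnbr G v = 0

/-- The two other vertices of the triangle are not cubic. -/
theorem cnbr_le_of_inTriangle (hT : NoCubicPairTriangle G) {y : V} (hy : dg G y = 3)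
    (h : InTriangle G y) : cnbr G y ≤ 1 := by
  obtain ⟨p, r, hp, hr, hpr⟩ := h
  have hp3 : dg G p ≠ 3 := fun e => hT y p r hp hpr hr hy e
  have hr3 : dg G r ≠ 3 := fun e => hT y r p hr hpr.symm hp hy e
  have h1 : (cubic G).filter (G.Adj y) ⊆ univ.filter (G.Adj y) \ {p, r} := by
    intro v hv
    simp only [mem_filter, mem_cubic] at hv
    simp only [mem_sdiff, mem_filter, mem_univ, true_and, mem_insert, mem_singleton, not_or]
    exact ⟨hv.2, fun e => hp3 (e ▸ hv.1), fun e => hr3 (e ▸ hv.1)⟩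
  have h2 := card_le_card h1
  rw [card_sdiff_of_subset (by intro v; simp; rintro (rfl | rfl) <;> assumption),
    card_pair hpr.ne] at h2
  unfold dg at hy
  unfold cnbr
  omega

/-- At most one cubic neighbour of a cubic vertex avoids all triangles. -/
theorem cnbr_le_cubicTri (hP : CubicPathTriangle G) {x : V} (hx : dg G x = 3) :
    cnbr G x ≤ ((cubicTri G).filter (G.Adj x)).card + 1 := by
  have h1 : (cubic G).filter (G.Adj x) ⊆ (cubicTri G).filter (G.Adj x) ∪
      ((cubic G).filter (G.Adj x)).filter fun y => ¬ InTriangle G y := by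
    intro v hv
    simp only [mem_filter, mem_union, cubicTri] at hv ⊢
    tauto
  have h2 := (card_le_card h1).trans (card_union_le _ _)
  have h3 : (((cubic G).filter (G.Adj x)).filter fun y => ¬ InTriangle G y).card ≤ 1 := by
    rw [card_le_one]
    intro a ha b hb
    simp only [mem_filter, mem_cubic] at ha hb
    by_contra hab
    rcases hP x a b hab ha.1.2 hb.1.2 hx ha.1.1 hb.1.1 with h | h
    · exact ha.2 h
    · exact hb.2 h
  unfold cnbr
  omega

/-- The discharging inequality. Let `C` be the set of cubic vertices. As all others have degree at
least four, `-4q ≥ |C| - ∑ v ∈ C, cnbr v + ee G Cᶜ Cᶜ`, and by the two structural hypotheses the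
sum is at most `|C| - |cubicIso| + |cubicTri|`. -/
theorem discharge (hG : IsFourCritical G) (hT : NoCubicPairTriangle G) (hP : CubicPathTriangle G) :
    ((cubicIso G).card : ℤ) + ee G (cubic G)ᶜ (cubic G)ᶜ - (cubicTri G).card ≤ -4 * q G univ := by
  have hsum : ∀ s : Finset V, ee G s univ = ∑ v ∈ s, (dg G v : ℤ) := fun s => ee_eq_sum G s univ
  have h1 : ee G univ univ = ee G (cubic G) univ + ee G (cubic G)ᶜ univ := by
    rw [← ee_union_left G disjoint_compl_right, union_compl]
  have h2 : ee G (cubic G) univ = 3 * ((cubic G).card : ℤ) := by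
    rw [hsum, sum_congr rfl (g := fun _ => (3 : ℤ)) fun v hv => by rw [mem_cubic.1 hv]; norm_num]
    simp [mul_comm]
  have h3 : 4 * ((cubic G)ᶜ.card : ℤ) ≤ ee G (cubic G)ᶜ univ := by
    rw [hsum, mul_comm, ← nsmul_eq_mul]
    refine card_nsmul_le_sum _ _ _ fun v hv => ?_
    have h4 := crit_deg hG v
    have h5 : dg G v ≠ 3 := by simpa [mem_cubic] using hv
    have : 4 ≤ dg G v := by omega
    exact_mod_cast this
  have h4 : ee G (cubic G) univ = ee G (cubic G) (cubic G) + ee G (cubic G) (cubic G)ᶜ := by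
    rw [← ee_union_right G _ disjoint_compl_right, union_compl]
  have h5 : ee G (cubic G)ᶜ univ = ee G (cubic G)ᶜ (cubic G) + ee G (cubic G)ᶜ (cubic G)ᶜ := by
    rw [← ee_union_right G _ disjoint_compl_right, union_compl]
  have h6 := ee_comm G (cubic G)ᶜ (cubic G)
  have h7 : ee G (cubic G) (cubic G) = ∑ v ∈ cubic G, (cnbr G v : ℤ) := ee_eq_sum G _ _
  have h8 : ee G (cubic G) (cubicTri G) =
      ∑ v ∈ cubic G, (((cubicTri G).filter (G.Adj v)).card : ℤ) := ee_eq_sum G _ _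
  have h9 : ee G (cubicTri G) (cubic G) ≤ (cubicTri G).card := by
    rw [ee_eq_sum]
    refine (sum_le_card_nsmul _ _ 1 fun v hv => ?_).trans (by simp)
    simp only [cubicTri, mem_filter, mem_cubic] at hv
    exact_mod_cast cnbr_le_of_inTriangle hT hv.1 hv.2
  have h10 := ee_comm G (cubicTri G) (cubic G)
  have h11 : (((cubicIso G).card : ℤ)) = ∑ v ∈ cubic G, if cnbr G v = 0 then (1 : ℤ) else 0 := by
    simp [cubicIso]
  have h12 : ∑ v ∈ cubic G, ((if cnbr G v = 0 then (1 : ℤ) else 0) + (cnbr G v : ℤ)) ≤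
      ∑ v ∈ cubic G, (1 + (((cubicTri G).filter (G.Adj v)).card : ℤ)) := by
    refine sum_le_sum fun v hv => ?_
    have k1 := cnbr_le_cubicTri hP (mem_cubic.1 hv)
    split_ifs with h
    · rw [h]; push_cast; omega
    · omega
  rw [sum_add_distrib, sum_add_distrib] at h12
  simp only [sum_const, nsmul_eq_mul, mul_one] at h12
  have h13 := two_mul_ed G univ
  have h14 : (Fintype.card V : ℤ) = (cubic G).card + (cubic G)ᶜ.card := by
    rw [← card_add_card_compl (cubic G)]; push_cast; ring
  unfold q
  rw [card_univ]
  linarith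

theorem ee_eq_card (A : Finset V) :
    ee G A A = (((A ×ˢ A).filter fun p => G.Adj p.1 p.2).card : ℤ) := by
  rw [card_filter, sum_product]
  unfold ee
  push_cast
  rfl

/-- A cubic vertex in a triangle sees an edge between two vertices that are not cubic, and
different cubic vertices see different edges. -/
theorem two_mul_cubicTri_le (hT : NoCubicPairTriangle G) (hD : NoDiamond G) :
    2 * ((cubicTri G).card : ℤ) ≤ ee G (cubic G)ᶜ (cubic G)ᶜ := by
  rw [ee_eq_card]
  have key : ∀ y, ∃ p : V × V, y ∈ cubicTri G → G.Adj y p.1 ∧ G.Adj y p.2 ∧ G.Adj p.1 p.2 := by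
    intro y
    by_cases hy : y ∈ cubicTri G
    · obtain ⟨p, r, h⟩ := (mem_filter.1 hy).2
      exact ⟨(p, r), fun _ => h⟩
    · exact ⟨(y, y), fun h => absurd h hy⟩
  choose f hf using key
  have hbig : ∀ y p r, y ∈ cubicTri G → G.Adj y p → G.Adj y r → G.Adj p r → p ∈ (cubic G)ᶜ := by
    intro y p r hy h1 h2 h3
    rw [mem_compl, mem_cubic]
    exact fun e => hT y p r h1 h3 h2 (mem_cubic.1 (mem_filter.1 hy).1) e
  have hsub : (cubicTri G).image f ∪ (cubicTri G).image (Prod.swap ∘ f) ⊆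
      ((cubic G)ᶜ ×ˢ (cubic G)ᶜ).filter fun p => G.Adj p.1 p.2 := by
    intro p hp
    rw [mem_union, mem_image, mem_image] at hp
    rcases hp with ⟨y, hy, rfl⟩ | ⟨y, hy, rfl⟩ <;> obtain ⟨h1, h2, h3⟩ := hf y hy <;>
      simp only [mem_filter, mem_product, Function.comp, Prod.fst_swap, Prod.snd_swap]
    · exact ⟨⟨hbig y _ _ hy h1 h2 h3, hbig y _ _ hy h2 h1 h3.symm⟩, h3⟩
    · exact ⟨⟨hbig y _ _ hy h2 h1 h3.symm, hbig y _ _ hy h1 h2 h3⟩, h3.symm⟩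
  -- a diamond would arise from two vertices with the same pair of adjacent neighbours
  have hdia : ∀ y ∈ cubicTri G, ∀ y' ∈ cubicTri G, (f y = f y' ∨ f y = (f y').swap) → y = y' := by
    intro y hy y' hy' h
    by_contra hne
    obtain ⟨h1, h2, h3⟩ := hf y hy
    obtain ⟨k1, k2, k3⟩ := hf y' hy'
    rcases h with h | h
    · rw [← h] at k1 k2
      exact hD y _ _ y' hne h1 h2 h3 k1.symm k2.symm
    · have e1 : (f y').1 = (f y).2 := by rw [h]; rfl
      have e2 : (f y').2 = (f y).1 := by rw [h]; rfl
      rw [e1] at k1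
      rw [e2] at k2
      exact hD y _ _ y' hne h1 h2 h3 k2.symm k1.symm
  have hc := card_le_card hsub
  rw [card_union_of_disjoint, card_image_of_injOn, card_image_of_injOn] at hc
  · push_cast [← two_mul] at hc ⊢
    omega
  · intro y hy y' hy' e
    exact hdia y hy y' hy' (Or.inl (Prod.swap_injective e))
  · intro y hy y' hy' e
    exact hdia y hy y' hy' (Or.inl e)
  · rw [Finset.disjoint_left]
    intro p hp hp'
    obtain ⟨y, hy, rfl⟩ := mem_image.1 hp
    obtain ⟨y', hy', e⟩ := mem_image.1 hp'
    have := hdia y hy y' hy' (Or.inr e.symm)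
    subst this
    have h3 := (hf y hy).2.2
    have : (f y).2 = (f y).1 := congrArg Prod.fst e
    exact h3.ne this.symm

end Discharging

/-! ### Two-vertex cuts and light sets in a smallest counterexample to the weight bound -/

/-- A critical graph with `3|E| ≤ 5|V| - 2` that is not `4`-Ore, smallest possible. -/
structure MinNotOre {V : Type u} [Fintype V] (G : SimpleGraph V) : Prop where
  crit : IsFourCritical G
  min : ∀ (U : Type u) [Fintype U] (W : SimpleGraph U), IsFourCritical W →
    Fintype.card U < Fintype.card V → q W univ ≤ 2 ∧ (q W univ = 2 → IsOre 4 W)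
  two_le : 2 ≤ q G univ
  not_ore : ¬ IsOre 4 G

namespace MinNotOre
variable {V : Type u} [Fintype V] {G : SimpleGraph V}

/-- When all colourings of one side agree on the cut `x, y` and all colourings of the other side
differ, `G` is the Ore-composition of the critical graph in the first side plus the edge `xy` and
of the critical graph in the second side with `x` and `y` identified. Both have weight two, so they
are `4`-Ore, and so is `G`. -/
theorem two_cut_aux (h : MinNotOre G) {M N : Finset V} {x y : V}
    (hMN : Disjoint M N) (hxM : x ∉ M) (hyM : y ∉ M) (hxN : x ∉ N) (hyN : y ∉ N)
    (hA : ∀ c, Proper G (insert x (insert y M)) c → c x = c y)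
    (hB : ∀ c, Proper G (insert x (insert y N)) c → c x ≠ c y)
    (hAc : ∃ c, Proper G (insert x (insert y M)) c)
    (hBc : ∃ c, Proper G (insert x (insert y N)) c) : False := by
  have hxy : x ≠ y := by
    obtain ⟨c, hc⟩ := hBc
    exact fun e => hB c hc (congrArg c e)
  have hnadj : ¬ G.Adj x y := by
    obtain ⟨c, hc⟩ := hAc
    exact fun k => hc x (by simp) y (by simp) k (hA c hc)
  obtain ⟨U₁, _, W₁, f, x₁, y₁, hW₁, hf, hfD, hxy₁, rfl, rfl, hfa⟩ :=
    exists_crit_addEdge (by simp) (by simp) hxy hAc hA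
  obtain ⟨U₂, _, W₂, w, g, hW₂, hg, hgD⟩ :=
    exists_crit_identify (by simp) (by simp) hxy hnadj hBc hB
  have hgN : ∀ s, s ≠ w → g s ∈ N := fun s hs => by
    have := hgD s hs
    simp only [mem_insert] at this
    exact (this.resolve_left (hg.ne_a s hs)).resolve_left (hg.ne_d s hs)
  have hfg : ∀ a s, s ≠ w → f a ≠ g s := fun a s hs e => by
    have h1 := hfD a
    have h2 := hgN s hs
    rw [← e] at h2
    simp only [mem_insert] at h1
    rcases h1 with h1 | h1 | h1
    · exact hxN (h1 ▸ h2)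
    · exact hyN (h1 ▸ h2)
    · exact (Finset.disjoint_left.1 hMN) h1 h2
  let S : Set U₂ := {b | G.Adj (f x₁) (g b)}
  -- the map from the Ore-composition to `G`
  let F : U₁ ⊕ {b : U₂ // b ≠ w} → V := Sum.elim f fun b => g b
  have hFinj : Function.Injective F := by
    rintro (a | a) (b | b) e
    · exact congrArg _ (hf e)
    · exact (hfg a b b.2 e).elim
    · exact (hfg b a a.2 e.symm).elim
    · exact congrArg _ (Subtype.ext (hg.inj a b a.2 b.2 e))
  have hcross : ∀ (a : U₁) (b : {b : U₂ // b ≠ w}), (oreComposition W₁ x₁ y₁ W₂ w S).Adj (.inl a)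
      (.inr b) → G.Adj (f a) (g b) := by
    rintro a b ⟨h1, ⟨rfl, h2⟩ | ⟨rfl, h2⟩⟩
    · exact h2
    · exact (hg.adjw b h1).resolve_left h2
  have hFhom : ∀ a b, (oreComposition W₁ x₁ y₁ W₂ w S).Adj a b → G.Adj (F a) (F b) := by
    rintro (a | a) (b | b) hab
    · exact hfa a b hab.1 hab.2
    · exact hcross a b hab
    · exact (hcross b a hab.symm).symm
    · exact hg.adj a b a.2 b.2 hab
  have hno : ¬ ∃ c, Proper (oreComposition W₁ x₁ y₁ W₂ w S) univ c := by
    rintro ⟨c, hc⟩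
    have hc' : ∀ a b, (oreComposition W₁ x₁ y₁ W₂ w S).Adj a b → c a ≠ c b :=
      fun a b => hc a (mem_univ _) b (mem_univ _)
    by_cases e : c (.inl x₁) = c (.inl y₁)
    · have hw : ∀ b (hb : b ≠ w), W₂.Adj w b → c (.inl x₁) ≠ c (.inr ⟨b, hb⟩) := by
        intro b hb hwb
        by_cases hS : b ∈ S
        · exact hc' (.inl x₁) (.inr ⟨b, hb⟩) ⟨hwb, Or.inl ⟨rfl, hS⟩⟩
        · rw [e]
          exact hc' (.inl y₁) (.inr ⟨b, hb⟩) ⟨hwb, Or.inr ⟨rfl, hS⟩⟩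
      refine crit_not_proper hW₂ (fun b => if hb : b ≠ w then c (.inr ⟨b, hb⟩) else c (.inl x₁)) ?_
      intro a _ b _ hab
      by_cases ha : a ≠ w <;> by_cases hb : b ≠ w
      · simp only [ha, hb, dif_pos, ne_eq, not_false_eq_true]
        exact hc' (.inr ⟨a, ha⟩) (.inr ⟨b, hb⟩) hab
      · simp only [ha, hb, dif_pos, ne_eq, not_false_eq_true, dif_neg]
        rw [not_not] at hb
        subst hb
        exact (hw a ha hab.symm).symm
      · simp only [ha, hb, dif_pos, ne_eq, not_false_eq_true, dif_neg]
        rw [not_not] at ha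
        subst ha
        exact hw b hb hab
      · rw [not_not] at ha hb
        exact absurd (ha.trans hb.symm) hab.ne
    · refine crit_not_proper hW₁ (fun a => c (.inl a)) fun a _ b _ hab => ?_
      by_cases hs : s(a, b) = s(x₁, y₁)
      · rcases Sym2.eq_iff.1 hs with ⟨rfl, rfl⟩ | ⟨rfl, rfl⟩
        · exact e
        · exact Ne.symm e
      · exact hc' (.inl a) (.inl b) ⟨hab, hs⟩
  -- neither part of the split vertex is isolated, since `W₂` is not contained in `G`
  obtain ⟨cB, hcB⟩ := hBc
  have hpart : ∀ r, r ∈ insert (f x₁) (insert (f y₁) N) →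
      (∀ b, W₂.Adj w b → G.Adj r (g b)) → False := by
    intro r hr hall
    refine crit_not_proper hW₂ (fun b => if b = w then cB r else cB (g b)) ?_
    intro a _ b _ hab
    by_cases ha : a = w <;> by_cases hb : b = w
    · exact absurd (ha.trans hb.symm) hab.ne
    · simp only [ha, hb, if_true, if_false]
      exact hcB r hr (g b) (hgD b hb) (hall b (ha ▸ hab))
    · simp only [ha, hb, if_true, if_false]
      exact hcB (g a) (hgD a ha) r hr (hall a (hb ▸ hab.symm)).symm
    · simp only [ha, hb, if_false]
      exact hcB (g a) (hgD a ha) (g b) (hgD b hb) (hg.adj a b ha hb hab)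
  have hz₁ : ∃ b ∈ S, W₂.Adj w b := by
    by_contra hcon
    push Not at hcon
    refine hpart (f y₁) (by simp) fun b hb => ?_
    exact (hg.adjw b hb).resolve_left fun k => hcon b k hb
  have hz₂ : ∃ b ∉ S, W₂.Adj w b := by
    by_contra hcon
    push Not at hcon
    refine hpart (f x₁) (by simp) fun b hb => ?_
    by_contra k
    exact hcon b k hb
  obtain ⟨e⟩ := crit_iso h.crit hno F hFinj hFhom
  have hcov : (univ : Finset V) = univ.image f ∪ liftSet {w} g := by
    refine (eq_univ_of_forall fun v => ?_).symm
    obtain ⟨s, rfl⟩ := (crit_hom h.crit hno F hFhom).1 v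
    rw [mem_union]
    rcases s with a | b
    · exact Or.inl (mem_image_of_mem f (mem_univ a))
    · exact Or.inr (mem_liftSet.2 ⟨b, by simpa using b.2, rfl⟩)
  have hq1 := q_image_addEdge hf hxy₁ hfa
  have hq2 := hg.q_le hW₂ (R := univ.image f) (mem_image_of_mem _ (mem_univ _))
    (mem_image_of_mem _ (mem_univ _)) fun s hs k => by
      obtain ⟨a, -, e⟩ := mem_image.1 k
      exact hfg a s hs e
  rw [← hcov] at hq2
  have hcard : Fintype.card V = Fintype.card U₁ + (Fintype.card U₂ - 1) := by
    rw [Fintype.card_congr e.toEquiv, Fintype.card_sum]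
    congr 1
    simp [Fintype.card_subtype_compl]
  have h4 := crit_four_le hW₁
  have h5 := crit_four_le hW₂
  have m1 := h.min U₁ W₁ hW₁ (by omega)
  have m2 := h.min U₂ W₂ hW₂ (by omega)
  have h2 := h.two_le
  exact h.not_ore (IsOre.composition G W₁ W₂ x₁ y₁ w S (m1.2 (by omega)) (m2.2 (by omega)) hxy₁
    hz₁ hz₂ e)

/-- A smallest counterexample has no separating set of at most two vertices: otherwise it is an
Ore-composition of two smaller critical graphs. -/
theorem two_cut (h : MinNotOre G) {M N : Finset V} {x y : V} (hM : M.Nonempty) (hN : N.Nonempty)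
    (hMN : Disjoint M N) (hxM : x ∉ M) (hyM : y ∉ M) (hxN : x ∉ N) (hyN : y ∉ N)
    (huniv : ∀ v, v ∈ M ∨ v ∈ N ∨ v = x ∨ v = y) (hadj : ∀ m ∈ M, ∀ n ∈ N, ¬ G.Adj m n) :
    False := by
  have hA : insert x (insert y M) ≠ univ := by
    obtain ⟨n, hn⟩ := hN
    intro e
    have := e ▸ mem_univ n
    simp only [mem_insert] at this
    rcases this with rfl | rfl | h
    · exact hxN hn
    · exact hyN hn
    · exact Finset.disjoint_left.1 hMN h hn
  have hB : insert x (insert y N) ≠ univ := by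
    obtain ⟨n, hn⟩ := hM
    intro e
    have := e ▸ mem_univ n
    simp only [mem_insert] at this
    rcases this with rfl | rfl | h
    · exact hxM hn
    · exact hyM hn
    · exact Finset.disjoint_left.1 hMN hn h
  have hAc := crit_exists_proper h.crit hA
  have hBc := crit_exists_proper h.crit hB
  have hglue : ∀ c c', Proper G (insert x (insert y M)) c → Proper G (insert x (insert y N)) c' →
      (c x = c y ↔ c' x = c' y) → False := by
    intro c c' hc hc' hiff
    obtain ⟨σ, h1, h2⟩ := exists_perm_two _ _ _ _ hiff
    have hgl := (hc.perm σ).glue hc' (by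
      intro v hv hv'
      simp only [mem_insert] at hv hv'
      rcases hv with rfl | rfl | hv
      · exact h1
      · exact h2
      · rcases hv' with rfl | rfl | hv'
        · exact h1
        · exact h2
        · exact (Finset.disjoint_left.1 hMN hv hv').elim) (by
      intro a ha ha' b hb hb'
      simp only [mem_insert, not_or] at ha ha' hb hb'
      exact hadj a (by tauto) b (by tauto))
    refine crit_not_proper h.crit _ (hgl.mono fun v _ => ?_)
    simp only [mem_union, mem_insert]
    have := huniv v
    tauto
  by_cases hc : ∀ c, Proper G (insert x (insert y M)) c → c x = c y
  · refine h.two_cut_aux hMN hxM hyM hxN hyN hc (fun c' hc' e => ?_) hAc hBc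
    obtain ⟨c, hc0⟩ := hAc
    exact hglue c c' hc0 hc' (by simp [hc c hc0, e])
  · push Not at hc
    obtain ⟨c, hc0, hne⟩ := hc
    have hB' : ∀ c', Proper G (insert x (insert y N)) c' → c' x = c' y := by
      intro c' hc'
      by_contra e
      exact hglue c c' hc0 hc' (by simp [hne, e])
    refine h.two_cut_aux hMN.symm hxN hyN hxM hyM hB' (fun c' hc' e => ?_) hBc hAc
    obtain ⟨c'', hc''⟩ := hBc
    exact hglue c' c'' hc' hc'' (by simp [hB' c'' hc'', e])

/-- The vertices of `R` with a neighbour outside `R`. -/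
noncomputable def bd (G : SimpleGraph V) (R : Finset V) : Finset V :=
  R.filter fun r => ∃ w, w ∉ R ∧ G.Adj r w

theorem mem_bd {R : Finset V} {r : V} : r ∈ bd G R ↔ r ∈ R ∧ ∃ w, w ∉ R ∧ G.Adj r w := by
  simp [bd]

/-- By `two_cut`, at least three vertices of a proper subset have outer neighbours. -/
theorem three_le_card_bd (h : MinNotOre G) {R : Finset V} (h4 : 4 ≤ R.card) (hR : R ≠ univ) :
    3 ≤ (bd G R).card := by
  by_contra hlt
  obtain ⟨P, hP1, hP2, hP3⟩ := exists_subsuperset_card_eq (s := bd G R) (t := R) (n := 2)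
    (filter_subset _ _) (by omega) (by omega)
  obtain ⟨x, y, hxy, rfl⟩ := card_eq_two.1 hP3
  have hx : x ∈ R := hP2 (by simp)
  have hy : y ∈ R := hP2 (by simp)
  refine h.two_cut (M := R \ {x, y}) (N := univ \ R) (x := x) (y := y) ?_ ?_ ?_ (by simp) (by simp)
    (by simp [hx]) (by simp [hy]) ?_ ?_
  · rw [← card_pos, card_sdiff_of_subset hP2, hP3]
    omega
  · rw [sdiff_nonempty]
    exact fun k => hR (univ_subset_iff.1 k)
  · rw [Finset.disjoint_left]
    intro v hv hv'
    simp at hv hv'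
    exact hv' hv.1
  · intro v
    simp only [mem_sdiff, mem_univ, true_and, mem_insert, mem_singleton]
    tauto
  · intro m hm n hn hmn
    simp only [mem_sdiff, mem_univ, true_and] at hm hn
    exact hm.2 (hP1 (mem_bd.2 ⟨hm.1, n, hn, hmn⟩))

/-- A lift changes the weight by at most `2 - 5`, so a lighter set could be extended step by step,
its weight always decreasing, until it fills `G` with weight less than two. -/
theorem five_le_q (h : MinNotOre G) {R : Finset V} (h4 : 4 ≤ R.card) (hR : R ≠ univ) :
    5 ≤ q G R := by
  induction hn : Rᶜ.card using Nat.strong_induction_on generalizing R with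
  | _ n ih =>
    by_contra hlt
    obtain ⟨φ, hφ⟩ := crit_exists_proper h.crit hR
    obtain ⟨U, _, W, X, g, col, L⟩ := exists_lift_univ h.crit hφ
    have hm := (h.min U W L.crit (L.card_lt h4)).1
    have h1 := L.q_le
    have h2 := L.card_cases h.crit (card_pos.1 (by omega))
    have h3 : 5 ≤ kap X.card := by rcases h2 with e | e | e <;> rw [e] <;> decide
    have h5 := L.card_union
    have h6 := card_pos.2 L.liftSet_nonempty
    by_cases hu : R ∪ liftSet X g = univ
    · rw [hu] at h1
      have := h.two_le
      omega
    · have h7 := card_add_card_compl R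
      have h8 := card_add_card_compl (R ∪ liftSet X g)
      have := ih _ (by omega) (by omega) hu rfl
      omega

/-- By `five_le_q`, an extension of a set of weight at most seven leaves no room for a further one.
-/
theorem lift_spans (h : MinNotOre G) {R : Finset V} (h4 : 4 ≤ R.card) (h7 : q G R ≤ 7)
    {φ : V → Fin 3} {U : Type u} [Fintype U] {W : SimpleGraph U} {X : Finset U} {g : U → V}
    {col : U → Fin 3} (L : Lift G univ R φ W X g col) : R ∪ liftSet X g = univ := by
  by_contra hu
  have hm := (h.min U W L.crit (L.card_lt h4)).1
  have h1 := L.q_le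
  have h2 := L.card_cases h.crit (card_pos.1 (by omega))
  have h3 : 5 ≤ kap X.card := by rcases h2 with e | e | e <;> rw [e] <;> decide
  have h5 := h.five_le_q (card_le_card subset_union_left |>.trans' h4) hu
  omega

/-- If all colourings of `G[D]` agree on two vertices, then `D` contains a critical graph minus an
edge, which has weight at most five. -/
theorem exists_small (h : MinNotOre G) {D : Finset V} (hD : D ≠ univ) {s t : V} (hs : s ∈ D)
    (ht : t ∈ D) (hst : s ≠ t) (hno : ∀ c, Proper G D c → c s = c t) :
    ∃ P ⊆ D, 4 ≤ P.card ∧ q G P ≤ 5 := by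
  obtain ⟨U, _, W, f, x, y, hW, hf, hfD, hxy, -, -, hfa⟩ :=
    exists_crit_addEdge hs ht hst (crit_exists_proper h.crit hD) hno
  have hsub : univ.image f ⊆ D := by
    intro v hv
    obtain ⟨a, -, rfl⟩ := mem_image.1 hv
    exact hfD a
  have hc : (univ.image f).card = Fintype.card U := by
    rw [card_image_of_injective _ hf, card_univ]
  have hlt : Fintype.card U < Fintype.card V := by
    rw [← hc]
    exact (card_le_card hsub).trans_lt (by
      rw [← card_univ]; exact card_lt_card (ssubset_univ_iff.2 hD))
  have hm := (h.min U W hW hlt).1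
  have hq := q_image_addEdge hf hxy hfa
  exact ⟨_, hsub, by rw [hc]; exact crit_four_le hW, by omega⟩

end MinNotOre

/-! ### The weight bound for critical graphs -/

namespace MinNotOre
variable {V : Type u} [Fintype V] {G : SimpleGraph V}

/-- A set of weight five leaves no choice but a tight lift with a single colour, so all its
vertices with outer neighbours have this colour. -/
theorem bd_monochromatic (h : MinNotOre G) {R : Finset V} (h4 : 4 ≤ R.card) (h5 : q G R ≤ 5)
    {φ : V → Fin 3} (hφ : Proper G R φ) {u v : V} (hu : u ∈ bd G R) (hv : v ∈ bd G R) :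
    φ u = φ v := by
  obtain ⟨U, _, W, X, g, col, L⟩ := exists_lift_univ h.crit hφ
  have hm := (h.min U W L.crit (L.card_lt h4)).1
  have hs := h.lift_spans h4 (by omega) L
  have h1 := L.q_le
  have h2 := h.two_le
  rw [hs] at h1
  have h3 : X.card = 1 := by
    rcases L.card_cases h.crit (card_pos.1 (by omega)) with e | e | e
    · exact e
    · rw [e] at h1
      have : kap 2 = 7 := by decide
      omega
    · rw [e] at h1
      have : kap 3 = 6 := by decide
      omega
  obtain ⟨x, rfl⟩ := card_eq_one.1 h3
  have hk : kap ({x} : Finset U).card = 5 := by rw [card_singleton]; decide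
  obtain ⟨T, -⟩ := L.tight (by rw [hs]; omega)
  have key : ∀ r ∈ bd G R, φ r = col x := by
    intro r hr
    obtain ⟨hrR, w, hw, hadj⟩ := mem_bd.1 hr
    obtain ⟨s, hsX, rfl⟩ := Lift.mem_of_notMem hs hw
    obtain ⟨x', hx', e, -⟩ := T.nbr s hsX r hrR hadj.symm
    rw [← e, mem_singleton.1 hx']
  rw [key u hu, key v hv]

/-- In a smallest set `R` of weight five, every colouring is constant on the vertices with outer
neighbours. Hence `R` plus an edge `uv` between two of them is a `4`-Ore graph, and each
alternative of `isOre_edge` for this edge yields a smaller set of weight five or a cut of two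
vertices. -/
theorem six_le_q (h : MinNotOre G) {R : Finset V} (h4 : 4 ≤ R.card) (hR : R ≠ univ) :
    6 ≤ q G R := by
  induction hn : R.card using Nat.strong_induction_on generalizing R with
  | _ n ih =>
  by_contra hlt
  have h5 : q G R ≤ 5 := by omega
  -- `R` is a smallest set of weight five
  have hmin : ∀ P, P ⊆ R → P ≠ R → 4 ≤ P.card → q G P ≤ 5 → False := by
    intro P hP hne hP4 hP5
    have hss := hP.ssubset_of_ne hne
    have := ih P.card (by rw [← hn]; exact card_lt_card hss) hP4
      (fun e => hR (univ_subset_iff.1 (e ▸ hP))) rfl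
    omega
  obtain ⟨c₀, hc₀⟩ := crit_exists_proper h.crit hR
  obtain ⟨u, hu, v, hv, t, ht, huv, hut, hvt⟩ := two_lt_card.1 (h.three_le_card_bd h4 hR)
  have huR := (mem_bd.1 hu).1
  have hvR := (mem_bd.1 hv).1
  have htR := (mem_bd.1 ht).1
  have hmono : ∀ {c}, Proper G R c → ∀ {a b}, a ∈ bd G R → b ∈ bd G R → c a = c b :=
    fun hc _ _ ha hb => h.bd_monochromatic h4 h5 hc ha hb
  obtain ⟨U, _, W, f, x, y, hW, hf, hfR, hxy, rfl, rfl, hfa⟩ :=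
    exists_crit_addEdge huR hvR huv ⟨c₀, hc₀⟩ fun c hc => hmono hc hu hv
  have himg_sub : ∀ P : Finset U, P.image f ⊆ R := by
    intro P w hw
    obtain ⟨a, -, rfl⟩ := mem_image.1 hw
    exact hfR a
  have hcard : (univ.image f).card = Fintype.card U := by
    rw [card_image_of_injective _ hf, card_univ]
  have hlt' : Fintype.card U < Fintype.card V := by
    rw [← hcard, ← card_univ]
    exact (card_le_card (himg_sub univ)).trans_lt (card_lt_card (ssubset_univ_iff.2 hR))
  have hm := h.min U W hW hlt'
  have hq := q_image_addEdge hf hxy hfa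
  have hRU : univ.image f = R := by
    by_contra hne
    exact hmin _ (himg_sub univ) hne (by rw [hcard]; exact crit_four_le hW) (by omega)
  have hR5 := h.five_le_q h4 hR
  rw [hRU] at hq
  have hore := hm.2 (by omega)
  have hexact : ∀ a b, G.Adj (f a) (f b) → W.Adj a b ∧ s(a, b) ≠ s(x, y) := by
    intro a b hab
    have := hom_exact (G := G) (H := W.deleteEdges {s(x, y)}) hf (fun a b hab => by
      rw [SimpleGraph.deleteEdges_adj, Set.mem_singleton_iff] at hab
      exact hfa a b hab.1 hab.2) (by
      rw [q_deleteEdge W (mem_univ x) (mem_univ y) hxy, hRU]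
      omega) a b hab
    rwa [SimpleGraph.deleteEdges_adj, Set.mem_singleton_iff] at this
  have hsurj : ∀ r ∈ R, ∃ a, f a = r := by
    intro r hr
    rw [← hRU] at hr
    obtain ⟨a, -, e⟩ := mem_image.1 hr
    exact ⟨a, e⟩
  rcases isOre_edge hore hxy with hd | ⟨P, hP4, hP5, hPxy⟩ | ⟨M, y₀, hMne, hxM, hyM, hy₀M, hy₀y, hMN, hMc⟩
  · -- `u` has two neighbours in `R`, so `v` and `t` agree already on `R` without `u`
    obtain ⟨a, b, hab, hay, hby, hx⟩ := exists_two_nbrs hd hxy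
    have hD : R.erase (f x) ≠ univ := fun e => by
      have := e ▸ mem_univ (f x)
      simp at this
    obtain ⟨P, hP, hP4, hP5⟩ := h.exists_small hD (s := f y) (t := t)
      (mem_erase.2 ⟨huv.symm, hvR⟩) (mem_erase.2 ⟨hut.symm, htR⟩) hvt (by
        intro c hc
        obtain ⟨c', h1, h2, -⟩ := hc.extend_two (v := f x) (by simp) (c (f a)) (c (f b)) (by
          intro r hr hadj
          obtain ⟨s, rfl⟩ := hsurj r (mem_of_mem_erase hr)
          obtain ⟨h3, h4⟩ := hexact x s hadj
          rcases (hx s).1 h3 with rfl | rfl | rfl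
          · exact absurd rfl h4
          · exact Or.inl rfl
          · exact Or.inr rfl)
        rw [insert_erase huR] at h1
        rw [← h2 _ huv.symm, ← h2 _ hut.symm]
        exact hmono h1 hv ht)
    exact hmin P (hP.trans (erase_subset _ _)) (fun e => by
      have := hP (e ▸ huR)
      simp at this) hP4 hP5
  · -- `P` does not contain the added edge, so it is a light set in `G` as well
    have hqP : q G (P.image f) ≤ q W P := q_image_le G W f P hf.injOn fun a ha b hb hab =>
      hfa a b hab fun e => hPxy (by
        rcases Sym2.eq_iff.1 e with ⟨rfl, rfl⟩ | ⟨rfl, rfl⟩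
        · exact ⟨ha, hb⟩
        · exact ⟨hb, ha⟩)
    refine hmin _ (himg_sub P) (fun e => hPxy ?_) (by rwa [card_image_of_injective _ hf])
      (hqP.trans hP5)
    have : ∀ a, a ∈ P := by
      intro a
      have h1 : f a ∈ P.image f := e ▸ hfR a
      obtain ⟨b, hb, e⟩ := mem_image.1 h1
      exact hf e ▸ hb
    exact ⟨this x, this y⟩
  · have hmf : ∀ {a}, f a ∈ M.image f → a ∈ M := by
      intro a ha
      obtain ⟨b, hb, e⟩ := mem_image.1 ha
      exact hf e ▸ hb
    -- a colouring of `M` with its neighbours distinguishes `u` and `y₀`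
    have hMcol : ∀ c, Proper G (insert (f x) (insert (f y₀) (M.image f))) c → c (f x) ≠ c (f y₀) := by
      intro c hc
      refine hMc (c ∘ f) fun m hm w hmw => ?_
      have hw : f w ∈ insert (f x) (insert (f y₀) (M.image f)) := by
        by_cases hwM : w ∈ M
        · simp [mem_image_of_mem f hwM]
        · rcases hMN m hm w hwM hmw with rfl | rfl <;> simp
      refine hc _ (by simp [mem_image_of_mem f hm]) _ hw (hfa m w hmw fun e => ?_)
      rcases Sym2.eq_iff.1 e with ⟨rfl, rfl⟩ | ⟨rfl, rfl⟩
      · exact hxM hm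
      · exact hyM hm
    have hDR : insert (f x) (insert (f y₀) (M.image f)) ⊆ R := by
      intro r hr
      simp only [mem_insert] at hr
      rcases hr with rfl | rfl | hr
      · exact huR
      · exact hfR y₀
      · exact himg_sub M hr
    have hvD : f y ∉ insert (f x) (insert (f y₀) (M.image f)) := by
      simp only [mem_insert, not_or]
      exact ⟨huv.symm, fun e => hy₀y (hf e).symm, fun k => hyM (hmf k)⟩
    have hxy₀ : f x ≠ f y₀ := fun e => hMcol c₀ (hc₀.mono hDR) (congrArg c₀ e)
    have hsep : ∀ m ∈ M.image f, ∀ w, w ∈ R → w ∉ M.image f → G.Adj m w → w = f x ∨ w = f y₀ := by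
      intro m hm w hw hwM hadj
      obtain ⟨m, hm', rfl⟩ := mem_image.1 hm
      obtain ⟨w, rfl⟩ := hsurj w hw
      rcases hMN m hm' w (fun k => hwM (mem_image_of_mem f k)) (hexact m w hadj).1 with rfl | rfl
      · exact Or.inl rfl
      · exact Or.inr rfl
    by_cases hMbd : ∃ t', t' ∈ M.image f ∧ t' ∈ bd G R
    · -- the colours at `u` and `y₀` differ in every colouring of `M` with its neighbours, so this
      -- colouring extends to `R`, and `t'` and `u` agree already on the smaller set
      obtain ⟨t', ht'M, ht'⟩ := hMbd
      have ht'x : t' ≠ f x := fun e => hxM (hmf (e ▸ ht'M))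
      obtain ⟨P, hP, hP4, hP5⟩ := h.exists_small
        (D := insert (f x) (insert (f y₀) (M.image f))) (fun e => hvD (e ▸ mem_univ _)) (s := t')
        (t := f x) (by simp [ht'M]) (by simp) ht'x (by
          intro c hc
          obtain ⟨σ, h1, h2⟩ := exists_perm_two (c₀ (f x)) (c₀ (f y₀)) (c (f x)) (c (f y₀))
            (by simp [hMcol c hc, hMcol c₀ (hc₀.mono hDR)])
          have hgl := hc.glue ((hc₀.perm σ).mono (sdiff_subset (s := R) (t := M.image f))) (by
            intro w hw hw'
            simp only [mem_insert] at hw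
            rcases hw with rfl | rfl | hw
            · exact h1.symm
            · exact h2.symm
            · exact absurd hw (mem_sdiff.1 hw').2) (by
            intro a ha ha' b hb hb' hab
            have haM : a ∈ M.image f := by
              by_contra k
              exact ha' (mem_sdiff.2 ⟨hDR ha, k⟩)
            simp only [mem_insert, not_or] at hb'
            rcases hsep a haM b (mem_sdiff.1 hb).1 (mem_sdiff.1 hb).2 hab with e | e
            · exact hb'.1 e
            · exact hb'.2.1 e)
          have hgl' := hgl.mono (A := R) (fun w hw => by
            rw [mem_union, mem_sdiff]
            by_cases hwM : w ∈ M.image f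
            · left; simp [hwM]
            · exact Or.inr ⟨hw, hwM⟩)
          have := hmono hgl' ht' hu
          simpa [ht'M] using this)
      exact hmin P (hP.trans hDR) (fun e => hvD (hP (e ▸ hvR))) hP4 hP5
    · -- `M` has no outer neighbours beyond `u` and `y₀`, which therefore form a cut
      push Not at hMbd
      obtain ⟨m₀, hm₀⟩ := hMne
      refine h.two_cut (M := M.image f)
        (N := univ \ insert (f x) (insert (f y₀) (M.image f))) (x := f x) (y := f y₀)
        ⟨f m₀, mem_image_of_mem f hm₀⟩ ⟨f y, by simpa using hvD⟩ ?_ (fun k => hxM (hmf k))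
        (fun k => hy₀M (hmf k)) (by simp) (by simp) ?_ ?_
      · rw [Finset.disjoint_left]
        intro w hw hw'
        simp [hw] at hw'
      · intro w
        simp only [mem_sdiff, mem_univ, true_and, mem_insert]
        tauto
      · intro m hm w hw hmw
        simp only [mem_sdiff, mem_univ, true_and, mem_insert, not_or] at hw
        by_cases hwR : w ∈ R
        · rcases hsep m hm w hwR hw.2.2 hmw with e | e
          · exact hw.1 e
          · exact hw.2.1 e
        · exact hMbd m hm (mem_bd.2 ⟨himg_sub M hm, w, hwR, hmw⟩)

/-- By `exists_small` and `six_le_q`, no two vertices of a proper subset are forced to have the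
same colour. -/
theorem exists_ne_color (h : MinNotOre G) {D : Finset V} (hD : D ≠ univ) {s t : V} (hs : s ∈ D)
    (ht : t ∈ D) (hst : s ≠ t) : ∃ c, Proper G D c ∧ c s ≠ c t := by
  by_contra hno
  push Not at hno
  obtain ⟨P, hP, hP4, hP5⟩ := h.exists_small hD hs ht hst hno
  have := h.six_le_q hP4 fun e => hD (univ_subset_iff.1 (e ▸ hP))
  omega

theorem noDiamond (h : MinNotOre G) : NoDiamond G := by
  intro a b c d had hab hac hbc hbd hcd
  have h1 := card_diamond had hab hac hbc hbd hcd
  have h2 := q_diamond_le had hab hac hbc hbd hcd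
  have := h.six_le_q h1.ge fun e => h.not_ore (isK4_of_card h.crit (by
    rw [← card_univ, ← e, h1])).isOre
  omega

/-- The outer neighbours of the two cubic vertices would be forced to have the same colour. -/
theorem noCubicPairTriangle (h : MinNotOre G) : NoCubicPairTriangle G := by
  intro x y z hxy hyz hxz hx hy
  obtain ⟨x', hx'y, hx'z, hx'⟩ := exists_third_nbr hx hxy hxz hyz.ne
  obtain ⟨y', hy'x, hy'z, hy'⟩ := exists_third_nbr hy hxy.symm hyz hxz.ne
  have ax : G.Adj x x' := (hx' x').2 (by simp)
  have ay : G.Adj y y' := (hy' y').2 (by simp)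
  have hne : x' ≠ y' := by
    rintro rfl
    exact h.noDiamond x' x y z hx'z ax.symm ay.symm hxy hxz hyz
  obtain ⟨c, hc, hcne⟩ := h.exists_ne_color (D := univ \ {x, y}) (fun e => by
    have := e ▸ mem_univ x
    simp at this) (s := x') (t := y') (by simp [ax.ne', hx'y]) (by simp [ay.ne', hy'x]) hne
  exact hcne (cubic_triangle_color h.crit hx' hy' hc)

/-- A set of weight six misses only one vertex. Colour two of its vertices with outer neighbours
differently; then the lift has three colours, is tight and `4`-Ore. If it is not `K₄`, it has a
triangle with two cubic vertices that avoids the colours, and this triangle also lies in `G`. -/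
theorem eq_of_q_le_six (h : MinNotOre G) {R : Finset V} (h4 : 4 ≤ R.card) (hR : R ≠ univ)
    (h6 : q G R ≤ 6) {v w : V} (hv : v ∉ R) (hw : w ∉ R) : v = w := by
  obtain ⟨a, ha, b, hb, hab⟩ := one_lt_card.1 (Nat.lt_of_lt_of_le (by norm_num)
    (h.three_le_card_bd h4 hR))
  obtain ⟨φ, hφ, hne⟩ := h.exists_ne_color hR (mem_bd.1 ha).1 (mem_bd.1 hb).1 hab
  obtain ⟨U, _, W, X, g, col, L⟩ := exists_lift_univ h.crit hφ
  have hm := h.min U W L.crit (L.card_lt h4)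
  have hs := h.lift_spans h4 (by omega) L
  have h1 := L.q_le
  have h2 := h.two_le
  have k1 : kap 1 = 5 := by decide
  have k2 : kap 2 = 7 := by decide
  have k3 : kap 3 = 6 := by decide
  rw [hs] at h1
  have hX := L.card_cases h.crit (card_pos.1 (by omega))
  obtain ⟨T, hTq⟩ := L.tight (by rw [hs]; rcases hX with e | e | e <;> rw [e] <;> omega)
  rw [hs] at hTq
  rcases hX with e | e | e
  · exfalso
    obtain ⟨x, rfl⟩ := card_eq_one.1 e
    have key : ∀ r ∈ bd G R, φ r = col x := by
      intro r hr
      obtain ⟨hrR, w, hw, hadj⟩ := mem_bd.1 hr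
      obtain ⟨s, hsX, rfl⟩ := Lift.mem_of_notMem hs hw
      obtain ⟨x', hx', e, -⟩ := T.nbr s hsX r hrR hadj.symm
      rw [← e, mem_singleton.1 hx']
    exact hne (by rw [key a ha, key b hb])
  · rw [e] at h1
    omega
  · rw [e] at hTq
    have hore := hm.2 (by omega)
    by_cases hK : IsK4 W
    · have h8 := L.card_liftSet
      rw [hK.1, e] at h8
      have hmem : ∀ {v}, v ∉ R → v ∈ liftSet X g := fun hv =>
        mem_liftSet.2 (Lift.mem_of_notMem hs hv)
      exact card_le_one.1 (by omega) v (hmem hv) w (hmem hw)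
    · exfalso
      obtain ⟨a, b, c, hT, haX, hbX, hcX⟩ := isOre_goodTri_disjoint hore hK X T.clique
      have da := T.dg_le hs haX
      have db := T.dg_le hs hbX
      rw [hT.da] at da
      rw [hT.db] at db
      have da' := crit_deg h.crit (g a)
      have db' := crit_deg h.crit (g b)
      exact h.noCubicPairTriangle (g a) (g b) (g c) (L.adj _ haX _ hbX hT.ab)
        (L.adj _ hbX _ hcX hT.bc) (L.adj _ haX _ hcX hT.ac) (by omega) (by omega)

/-- Identifying the two outer neighbours of an end `y` of the path gives a critical graph, and
hence a set of weight at most six around `y` that misses `x` and `z`. -/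
theorem cubicPathTriangle (h : MinNotOre G) : CubicPathTriangle G := by
  intro x y z hyz hxy hxz hx hy hz
  left
  by_contra hT
  have hnyz : ¬ G.Adj y z := fun k => hT ⟨x, z, hxy.symm, k, hxz⟩
  obtain ⟨x₁, -, -, hx⟩ := exists_third_nbr hx hxy hxz hyz
  obtain ⟨a₁, a₂, ha, ha₁x, ha₂x, hy⟩ := exists_two_nbrs hy hxy.symm
  obtain ⟨z₁, z₂, -, -, -, hz⟩ := exists_two_nbrs hz hxz.symm
  have b1 : G.Adj y a₁ := (hy a₁).2 (by simp)
  have b2 : G.Adj y a₂ := (hy a₂).2 (by simp)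
  have hnadj : ¬ G.Adj a₁ a₂ := fun k => hT ⟨a₁, a₂, b1, b2, k⟩
  have m1 : a₁ ∈ univ \ {x, y, z} := by
    simp only [mem_sdiff, mem_univ, true_and, mem_insert, mem_singleton, not_or]
    exact ⟨ha₁x, b1.ne', fun e => hnyz (e ▸ b1)⟩
  have m2 : a₂ ∈ univ \ {x, y, z} := by
    simp only [mem_sdiff, mem_univ, true_and, mem_insert, mem_singleton, not_or]
    exact ⟨ha₂x, b2.ne', fun e => hnyz (e ▸ b2)⟩
  have hD : univ \ {x, y, z} ≠ (univ : Finset V) := fun e => by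
    have := e ▸ mem_univ x
    simp at this
  obtain ⟨U, _, W, w, g, hW, hg, hgD⟩ := exists_crit_identify m1 m2 ha hnadj
    (crit_exists_proper h.crit hD) fun c hc => cubic_path_no_color h.crit hyz hnyz hx hy hz hc
  have hgR : ∀ s, s ≠ w → g s ∉ ({a₁, a₂} : Finset V) := fun s hs k => by
    simp only [mem_insert, mem_singleton] at k
    exact k.elim (hg.ne_a s hs) (hg.ne_d s hs)
  have L := hg.lift hW (R := {a₁, a₂}) (by simp) (by simp) hgR
  have hq := hg.q_le hW (R := {a₁, a₂}) (by simp) (by simp) hgR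
  have hsub : {a₁, a₂} ∪ liftSet {w} g ⊆ univ \ {x, y, z} := by
    refine union_subset (by intro v; simp only [mem_insert, mem_singleton]; rintro (rfl | rfl) <;>
      assumption) fun v hv => ?_
    obtain ⟨s, hs, rfl⟩ := mem_liftSet.1 hv
    exact hgD s (by simpa using hs)
  have hc1 := L.card_liftSet
  have hc2 := L.card_union
  rw [card_pair ha] at hc2
  rw [card_singleton] at hc1
  have hU := crit_four_le hW
  have hlt : Fintype.card U < Fintype.card V := by
    have := card_lt_univ_of_notMem (s := {a₁, a₂} ∪ liftSet {w} g) (x := x) fun k => by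
      have := hsub k
      simp at this
    omega
  have hm := (h.min U W hW hlt).1
  have hyQ : y ∉ {a₁, a₂} ∪ liftSet {w} g := fun k => by
    have := hsub k
    simp at this
  have hins := q_insert_le (G := G) hyQ (S := {a₁, a₂}) subset_union_left (by simp [b1, b2])
  rw [card_pair ha] at hins
  have hp := q_pair_le (G := G) a₁ a₂
  have hx' : x ∉ insert y ({a₁, a₂} ∪ liftSet {w} g) := fun k => by
    rcases mem_insert.1 k with k | k
    · exact hxy.ne k
    · have := hsub k
      simp at this
  have hz' : z ∉ insert y ({a₁, a₂} ∪ liftSet {w} g) := fun k => by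
    rcases mem_insert.1 k with k | k
    · exact hyz k.symm
    · have := hsub k
      simp at this
  exact hxz.ne (h.eq_of_q_le_six (by rw [card_insert_of_notMem hyQ]; omega)
    (fun e => hx' (by rw [e]; exact mem_univ x)) (by push_cast at hins; omega) hx' hz')

/-- The edges between vertices that are not cubic outweigh `|cubicTri|`, so discharging gives `q ≤
0`. -/
theorem false (h : MinNotOre G) : False := by
  have h1 := discharge h.crit h.noCubicPairTriangle h.cubicPathTriangle
  have h2 := two_mul_cubicTri_le h.noCubicPairTriangle h.noDiamond
  have h3 := ee_nonneg G (cubic G)ᶜ (cubic G)ᶜ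
  have h4 := h.two_le
  omega

end MinNotOre

/-- A `4`-critical graph has `5|V| - 3|E| ≤ 2`, with equality only for `4`-Ore graphs. -/
theorem crit_q_le {V : Type u} [Fintype V] {G : SimpleGraph V} (hG : IsFourCritical G) :
    q G univ ≤ 2 ∧ (q G univ = 2 → IsOre 4 G) := by
  induction hn : Fintype.card V using Nat.strong_induction_on generalizing V with
  | _ n ih =>
    by_contra hcon
    refine MinNotOre.false (G := G) ⟨hG, fun U _ W hW hlt => ih _ (hn ▸ hlt) hW rfl, ?_, ?_⟩
    · by_contra h
      exact hcon ⟨by omega, fun e => by omega⟩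
    · intro h
      exact hcon ⟨(isOre_q h).le, fun _ => h⟩

/-! ### The change of the potential under an extension -/

section Gain

theorem dg_iso {U V : Type*} [Fintype U] [Fintype V] {H : SimpleGraph U} {G : SimpleGraph V}
    (e : G ≃g H) (v : V) : dg H (e v) = dg G v := by
  unfold dg
  rw [← card_image_of_injective _ e.injective]
  congr 1
  ext w
  simp only [mem_filter, mem_univ, true_and, mem_image]
  constructor
  · intro h
    exact ⟨e.symm w, by rw [← e.map_adj_iff]; simpa using h, by simp⟩
  · rintro ⟨t, h, rfl⟩
    exact e.map_adj_iff.2 h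

/-- A missing edge adds three units to the weight of a clique. -/
theorem kap_add_three_le {U : Type*} [Fintype U] {W : SimpleGraph U} {X : Finset U} {a b : U}
    (ha : a ∈ X) (hb : b ∈ X) (hab : a ≠ b) (h : ¬ W.Adj a b) : kap X.card + 3 ≤ q W X := by
  have h1 := kap_le (W := W ⊔ SimpleGraph.edge a b) X
  have h2 := q_deleteEdge (W ⊔ SimpleGraph.edge a b) ha hb (by
    rw [SimpleGraph.sup_adj, SimpleGraph.edge_adj]
    exact Or.inr ⟨Or.inl ⟨rfl, rfl⟩, hab⟩)
  have h3 : (W ⊔ SimpleGraph.edge a b).deleteEdges {s(a, b)} = W := by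
    ext s t
    simp only [SimpleGraph.deleteEdges_adj, SimpleGraph.sup_adj, SimpleGraph.edge_adj,
      Set.mem_singleton_iff]
    constructor
    · rintro ⟨h4 | h4, h5⟩
      · exact h4
      · rcases h4.1 with ⟨rfl, rfl⟩ | ⟨rfl, rfl⟩
        · exact absurd rfl h5
        · exact absurd Sym2.eq_swap h5
    · intro h4
      refine ⟨Or.inl h4, fun e => ?_⟩
      rcases Sym2.eq_iff.1 e with ⟨rfl, rfl⟩ | ⟨rfl, rfl⟩
      · exact h h4
      · exact h h4.symm
  rw [h3] at h2
  omega

/-- The possible critical graphs: the exceptional ones, and those of potential at most `-2`. For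
`4`-Ore graphs with at least three disjoint short cycles the number of cycles is left open. -/
def Kind {U : Type u} [Fintype U] (W : SimpleGraph U) : Prop :=
  IsK4 W ∨ (IsOre 4 W ∧ Nonempty (W ≃g graphH7)) ∨ (IsOre 4 W ∧ 3 ≤ pk W univ) ∨
    Nonempty (W ≃g graphW5) ∨ Nonempty (W ≃g graphT8) ∨ Nonempty (W ≃g graphT11) ∨
    (q W univ ≤ 1 ∧ q W univ + 2 ≤ pk W univ)

variable {U : Type u} [Fintype U] {W : SimpleGraph U}

/-- If two colours of a lift `W` are not adjacent, an extension by `W` lowers the potential by at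
least seven. -/
theorem gain_not_clique (hW : Kind W) {X : Finset U} (h3 : X.card ≤ 3) {a b : U} (ha : a ∈ X)
    (hb : b ∈ X) (hab : a ≠ b) (h : ¬ W.Adj a b) :
    q W univ - q W X - pk W Xᶜ ≤ -7 := by
  have h1 := kap_add_three_le ha hb hab h
  have h2 : 2 ≤ X.card := by
    rw [← card_pair hab]
    exact card_le_card (by intro v; simp only [mem_insert, mem_singleton]; rintro (rfl | rfl) <;>
      assumption)
  have h4 : 6 ≤ kap X.card := by interval_cases X.card <;> decide
  have h5 := pk_sdiff (G := W) univ X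
  rw [← compl_eq_univ_sdiff] at h5
  rcases hW with k | ⟨k, -⟩ | ⟨k, -⟩ | ⟨⟨e⟩⟩ | ⟨⟨e⟩⟩ | ⟨⟨e⟩⟩ | k
  · exact absurd (k.2 a b hab) h
  · rw [isOre_q k]; omega
  · rw [isOre_q k]; omega
  · rw [q_iso e, w5_q]; omega
  · rw [q_iso e, t8_q]; omega
  · rw [q_iso e, t11_q]; omega
  · omega

/-- An extension by `W` with a single colour lowers the potential by at least four; by exactly four
only for `K₄` and for the Moser spindle with a colour other than its centre. -/
theorem gain_one (hW : Kind W) (w : U) :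
    q W univ - 5 - pk W (univ.erase w) ≤ -4 ∧ (q W univ - 5 - pk W (univ.erase w) = -4 →
      IsK4 W ∨ ∃ e : W ≃g graphH7, e w ≠ 1) := by
  have h5 := pk_erase (G := W) univ w
  rcases hW with k | ⟨k, ⟨e⟩⟩ | ⟨k, hk3⟩ | ⟨⟨e⟩⟩ | ⟨⟨e⟩⟩ | ⟨⟨e⟩⟩ | k
  · have := k.pk_erase w
    rw [k.q_eq]
    exact ⟨by omega, fun _ => Or.inl k⟩
  · have := isOre_pk_erase k w
    rw [isOre_q k]
    refine ⟨by omega, fun h => Or.inr ⟨e, fun h1 => ?_⟩⟩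
    have h2 := pk_iso_erase e w
    rw [h1] at h2
    have h3 : 2 ≤ pk W (univ.erase w) :=
      Nat.le_trans (by convert h7_erase (i := 1) (by decide)) h2
    omega
  · rw [isOre_q k]; constructor <;> omega
  · rw [q_iso e, w5_q]; constructor <;> omega
  · have h1 := pk_iso_erase e w
    have h2 : 1 ≤ pk W (univ.erase w) := Nat.le_trans (by convert t8_erase (e w)) h1
    rw [q_iso e, t8_q]; constructor <;> omega
  · have h1 := pk_iso_erase e w
    have h2 : 1 ≤ pk W (univ.erase w) := Nat.le_trans (by convert t11_erase (e w)) h1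
    rw [q_iso e, t11_q]; constructor <;> omega
  · constructor <;> omega

/-- Every clique of a `4`-Ore graph other than `K₄` avoids a triangle. -/
theorem isOre_pk_compl (hW : IsOre 4 W) (hK : ¬ IsK4 W) {X : Finset U}
    (hX : ∀ a ∈ X, ∀ b ∈ X, a ≠ b → W.Adj a b) : 1 ≤ pk W Xᶜ := by
  obtain ⟨a, b, c, h, ha, hb, hc⟩ := isOre_goodTri_disjoint hW hK X hX
  exact pk_triangle (mem_compl.2 ha) (mem_compl.2 hb) (mem_compl.2 hc) h.ab h.bc h.ac.symm

/-- An extension by `W` with two colours lowers the potential by at least five, by exactly five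
only for `K₄`. -/
theorem gain_two (hW : Kind W) {X : Finset U} (hX : X.card = 2)
    (hc : ∀ a ∈ X, ∀ b ∈ X, a ≠ b → W.Adj a b) :
    q W univ - 7 - pk W Xᶜ ≤ -5 ∧ (q W univ - 7 - pk W Xᶜ = -5 → IsK4 W) := by
  have h5 := pk_sdiff (G := W) univ X
  rw [← compl_eq_univ_sdiff, hX] at h5
  by_cases hK : IsK4 W
  · rw [hK.q_eq]
    exact ⟨by omega, fun _ => hK⟩
  rcases hW with k | ⟨k, -⟩ | ⟨k, -⟩ | ⟨⟨e⟩⟩ | ⟨⟨e⟩⟩ | ⟨⟨e⟩⟩ | k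
  · exact absurd k hK
  · have := isOre_pk_compl k hK hc
    rw [isOre_q k]; constructor <;> omega
  · have := isOre_pk_compl k hK hc
    rw [isOre_q k]; constructor <;> omega
  · rw [q_iso e, w5_q]; constructor <;> omega
  · rw [q_iso e, t8_q]; constructor <;> omega
  · rw [q_iso e, t11_q]; constructor <;> omega
  · constructor <;> omega

theorem pk_iso_compl {H : Type*} [Fintype H] {T : SimpleGraph H} (e : W ≃g T) {a b c : U} :
    pk T ({e a, e b, e c} : Finset H)ᶜ ≤ pk W ({a, b, c} : Finset U)ᶜ := by
  refine pk_map e.symm e.symm.injective.injOn (fun s hs => ?_) fun s _ t _ h => e.symm.map_adj_iff.2 h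
  simp only [mem_compl, mem_insert, mem_singleton, not_or] at hs ⊢
  refine ⟨fun k => hs.1 ?_, fun k => hs.2.1 ?_, fun k => hs.2.2 ?_⟩ <;> rw [← k] <;> simp

/-- An extension by `W` with three colours lowers the potential by at least four, by exactly four
only for `K₄`. -/
theorem gain_three (hW : Kind W) {X : Finset U} (hX : X.card = 3)
    (hc : ∀ a ∈ X, ∀ b ∈ X, a ≠ b → W.Adj a b) :
    q W univ - 6 - pk W Xᶜ ≤ -4 ∧ (q W univ - 6 - pk W Xᶜ = -4 → IsK4 W) ∧
      (q W univ - 6 - pk W Xᶜ = -5 → IsOre 4 W ∨ (q W univ ≤ 1 ∧ q W univ + 2 ≤ pk W univ)) := by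
  have h5 := pk_sdiff (G := W) univ X
  rw [← compl_eq_univ_sdiff, hX] at h5
  by_cases hK : IsK4 W
  · rw [hK.q_eq]
    exact ⟨by omega, fun _ => hK, fun _ => Or.inl hK.isOre⟩
  obtain ⟨a, b, c, hab, hac, hbc, rfl⟩ := card_eq_three.1 hX
  have ab := hc a (by simp) b (by simp) hab
  have ac := hc a (by simp) c (by simp) hac
  have bc := hc b (by simp) c (by simp) hbc
  rcases hW with k | ⟨k, -⟩ | ⟨k, -⟩ | ⟨⟨e⟩⟩ | ⟨⟨e⟩⟩ | ⟨⟨e⟩⟩ | k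
  · exact absurd k hK
  · have := isOre_pk_compl k hK hc
    rw [isOre_q k]
    exact ⟨by omega, fun _ => by omega, fun _ => Or.inl k⟩
  · have := isOre_pk_compl k hK hc
    rw [isOre_q k]
    exact ⟨by omega, fun _ => by omega, fun _ => Or.inl k⟩
  · rw [q_iso e, w5_q]
    exact ⟨by omega, fun _ => by omega, fun _ => by omega⟩
  · have h1 : 1 ≤ pk W ({a, b, c} : Finset U)ᶜ := Nat.le_trans (by
      convert t8_triangle (e.map_adj_iff.2 ab) (e.map_adj_iff.2 bc) (e.map_adj_iff.2 ac))
      (pk_iso_compl e)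
    rw [q_iso e, t8_q]
    exact ⟨by omega, fun _ => by omega, fun _ => by omega⟩
  · have h1 : 1 ≤ pk W ({a, b, c} : Finset U)ᶜ := Nat.le_trans (by
      convert t11_triangle (e.map_adj_iff.2 ab) (e.map_adj_iff.2 bc) (e.map_adj_iff.2 ac))
      (pk_iso_compl e)
    rw [q_iso e, t11_q]
    exact ⟨by omega, fun _ => by omega, fun _ => by omega⟩
  · exact ⟨by omega, fun _ => by omega, fun _ => Or.inr k⟩

end Gain

/-! ### Potentials of subsets in a smallest dense counterexample -/

/-- The potential of a set of vertices: its weight minus its packing number. -/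
noncomputable def pt {V : Type*} (G : SimpleGraph V) (R : Finset V) : ℤ := q G R - pk G R

/-- A critical graph with `5|V| - 3|E| ≤ 1` and potential at least `-1` that is none of `W₅`, `T₈`,
`T₁₁`, smallest possible. -/
structure MinDense {V : Type u} [Fintype V] (G : SimpleGraph V) : Prop where
  crit : IsFourCritical G
  kind : ∀ (U : Type u) [Fintype U] (W : SimpleGraph U), IsFourCritical W →
    Fintype.card U < Fintype.card V → Kind W
  low : -1 ≤ pt G univ
  q_le : q G univ ≤ 1
  not_w5 : ¬ Nonempty (G ≃g graphW5)
  not_t8 : ¬ Nonempty (G ≃g graphT8)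
  not_t11 : ¬ Nonempty (G ≃g graphT11)

namespace MinDense
variable {V : Type u} [Fintype V] {G : SimpleGraph V}

/-- Every extension lowers the potential by at least four, and by at least seven when two of the
colours are not adjacent. -/
theorem lift_pt_le (h : MinDense G) {R : Finset V} (h4 : 4 ≤ R.card) {φ : V → Fin 3} {U : Type u}
    [Fintype U] {W : SimpleGraph U} {X : Finset U} {g : U → V} {col : U → Fin 3}
    (L : Lift G univ R φ W X g col) : pt G (R ∪ liftSet X g) ≤ pt G R - 4 ∧
    ((∃ a ∈ X, ∃ b ∈ X, a ≠ b ∧ ¬ W.Adj a b) → pt G (R ∪ liftSet X g) ≤ pt G R - 7) := by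
  have hk := h.kind U W L.crit (L.card_lt h4)
  have h1 := L.pk_le
  have h2 := L.q_eq
  have h3 := L.ed_le
  have h5 := L.ee_le
  have h6 := L.card_cases h.crit (card_pos.1 (by omega))
  have key : (∃ a ∈ X, ∃ b ∈ X, a ≠ b ∧ ¬ W.Adj a b) → pt G (R ∪ liftSet X g) ≤ pt G R - 7 := by
    rintro ⟨a, ha, b, hb, hab, hadj⟩
    have := gain_not_clique hk L.card_le ha hb hab hadj
    unfold pt
    omega
  refine ⟨?_, key⟩
  by_cases hcl : ∃ a ∈ X, ∃ b ∈ X, a ≠ b ∧ ¬ W.Adj a b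
  · have := key hcl
    omega
  · push Not at hcl
    have h7 := kap_le (W := W) X
    have k1 : kap 1 = 5 := by decide
    have k2 : kap 2 = 7 := by decide
    have k3 : kap 3 = 6 := by decide
    unfold pt
    rcases h6 with e | e | e
    · rw [e, k1] at h7
      obtain ⟨w, rfl⟩ := card_eq_one.1 e
      have := (gain_one hk w).1
      have hw : ({w} : Finset U)ᶜ = univ.erase w := by ext; simp
      rw [hw] at h1
      omega
    · rw [e, k2] at h7
      have := (gain_two hk e hcl).1
      omega
    · rw [e, k3] at h7
      have := (gain_three hk e hcl).1
      omega

/-- Otherwise the set could be extended step by step, its potential always decreasing, until it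
fills `G` with potential less than `-1`. -/
theorem three_le_pt (h : MinDense G) {R : Finset V} (h4 : 4 ≤ R.card) (hR : R ≠ univ) :
    3 ≤ pt G R := by
  induction hn : Rᶜ.card using Nat.strong_induction_on generalizing R with
  | _ n ih =>
    by_contra hlt
    obtain ⟨φ, hφ⟩ := crit_exists_proper h.crit hR
    obtain ⟨U, _, W, X, g, col, L⟩ := exists_lift_univ h.crit hφ
    have h1 := (h.lift_pt_le h4 L).1
    have h5 := L.card_union
    have h6 := card_pos.2 L.liftSet_nonempty
    by_cases hu : R ∪ liftSet X g = univ
    · rw [hu] at h1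
      have := h.low
      omega
    · have h7 := card_add_card_compl R
      have h8 := card_add_card_compl (R ∪ liftSet X g)
      have := ih _ (by omega) (by omega) hu rfl
      omega

theorem lift_spans (h : MinDense G) {R : Finset V} (h4 : 4 ≤ R.card) (h6 : pt G R ≤ 6)
    {φ : V → Fin 3} {U : Type u} [Fintype U] {W : SimpleGraph U} {X : Finset U} {g : U → V}
    {col : U → Fin 3} (L : Lift G univ R φ W X g col) : R ∪ liftSet X g = univ := by
  by_contra hu
  have h1 := (h.lift_pt_le h4 L).1
  have := h.three_le_pt (card_le_card subset_union_left |>.trans' h4) hu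
  omega

/-- An extension of a set of potential at most four is tight. -/
theorem lift_tight (h : MinDense G) {R : Finset V} (h4 : 4 ≤ R.card) (hp : pt G R ≤ 4)
    {φ : V → Fin 3} {U : Type u} [Fintype U] {W : SimpleGraph U} {X : Finset U} {g : U → V}
    {col : U → Fin 3} (L : Lift G univ R φ W X g col) : Tight G R φ W X g col ∧
    q G univ = q G R + q W univ - kap X.card ∧
    -1 - pt G R ≤ q W univ - kap X.card - pk W Xᶜ := by
  have hs := h.lift_spans h4 (by omega) L
  have h1 := h.lift_pt_le h4 L
  have h2 := L.pk_le
  have h3 := L.q_le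
  have hlow := h.low
  have hk := h.kind U W L.crit (L.card_lt h4)
  have hcl : ∀ a ∈ X, ∀ b ∈ X, a ≠ b → W.Adj a b := by
    intro a ha b hb hab
    by_contra hadj
    have := h1.2 ⟨a, ha, b, hb, hab, hadj⟩
    rw [hs] at this
    omega
  have hg : q W univ - kap X.card - pk W Xᶜ ≤ -4 := by
    have k1 : kap 1 = 5 := by decide
    have k2 : kap 2 = 7 := by decide
    have k3 : kap 3 = 6 := by decide
    rcases L.card_cases h.crit (card_pos.1 (by omega)) with e | e | e
    · obtain ⟨w, rfl⟩ := card_eq_one.1 e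
      have := (gain_one hk w).1
      have hw : ({w} : Finset U)ᶜ = univ.erase w := by ext; simp
      rw [hw, e, k1]
      omega
    · rw [e, k2]
      have := (gain_two hk e hcl).1
      omega
    · rw [e, k3]
      have := (gain_three hk e hcl).1
      omega
  unfold pt at *
  obtain ⟨T, hT⟩ := L.tight (by rw [hs] at h2 ⊢; omega)
  rw [hs] at h2 hT
  exact ⟨T, hT, by omega⟩

theorem pk_le (h : MinDense G) : (pk G univ : ℤ) ≤ q G univ + 1 := by
  have := h.low
  unfold pt at this
  omega

/-- A diamond has weight five and contains a triangle, so its potential is at most four. -/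
theorem diamond_facts (h : MinDense G) {a b c d : V} (had : a ≠ d) (hab : G.Adj a b)
    (hac : G.Adj a c) (hbc : G.Adj b c) (hbd : G.Adj b d) (hcd : G.Adj c d) :
    ({a, b, c, d} : Finset V).card = 4 ∧ ({a, b, c, d} : Finset V) ≠ univ ∧
    pt G {a, b, c, d} ≤ 4 ∧ q G {a, b, c, d} = 5 := by
  have h1 := card_diamond had hab hac hbc hbd hcd
  have h2 := q_diamond_le had hab hac hbc hbd hcd
  have h3 : 1 ≤ pk G {a, b, c, d} :=
    pk_triangle (a := a) (b := b) (c := c) (by simp) (by simp) (by simp) hab hbc hac.symm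
  have h4 : ({a, b, c, d} : Finset V) ≠ univ := fun e => by
    have := (isK4_of_card h.crit (by rw [← card_univ, ← e, h1])).q_eq
    have := h.q_le
    omega
  have h5 := h.three_le_pt h1.ge h4
  refine ⟨h1, h4, by unfold pt; omega, ?_⟩
  unfold pt at h5
  have h6 : q G {a, b, c, d} = 20 - 3 * ed G {a, b, c, d} := by
    unfold q
    rw [h1]
    norm_num
  omega

end MinDense

/-! ### Diamonds whose inner vertices are cubic -/

theorem adj_iff_of_three {V : Type*} [Fintype V] {G : SimpleGraph V} {v a b c : V}
    (hv : dg G v = 3) (ha : G.Adj v a) (hb : G.Adj v b) (hc : G.Adj v c) (hab : a ≠ b) (hac : a ≠ c)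
    (hbc : b ≠ c) (w : V) : G.Adj v w ↔ w = a ∨ w = b ∨ w = c := by
  obtain ⟨s, -, -, h⟩ := exists_third_nbr hv ha hb hab
  rcases (h c).1 hc with e | e | e
  · exact absurd e.symm hac
  · exact absurd e.symm hbc
  · rw [e]; exact h w

/-- The symmetries of `T₈` act transitively on its triangle `0 1 2`. -/
theorem t8_rotate {i : Fin 8} (hi : i ∈ ({0, 1, 2} : Finset (Fin 8))) :
    ∃ e : graphT8 ≃g graphT8, e i = 2 := by
  simp only [mem_insert, mem_singleton] at hi
  rcases hi with rfl | rfl | rfl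
  · exact ⟨⟨Equiv.swap 0 2 * Equiv.swap 3 5, by decide⟩, by decide⟩
  · exact ⟨⟨Equiv.swap 1 2 * Equiv.swap 4 5, by decide⟩, by decide⟩
  · exact ⟨SimpleGraph.Iso.refl, rfl⟩

namespace MinDense
variable {V : Type u} [Fintype V] {G : SimpleGraph V}

/-- `G` is critical, so an injective homomorphism from `T₁₁` to `G` is an isomorphism. -/
theorem not_iso_t11_of_hom (h : MinDense G) {f : Fin 11 → V} (hf : (List.ofFn f).Nodup)
    (hom : ∀ p ∈ [((0 : Fin 11), (8 : Fin 11)), (8, 9), (8, 10), (9, 10), (9, 1), (10, 1), (1, 2),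
      (2, 0), (0, 3), (1, 4), (2, 5), (3, 6), (3, 7), (4, 6), (4, 7), (5, 6), (5, 7), (6, 7)],
      G.Adj (f p.1) (f p.2)) : False :=
  h.not_t11 (crit_iso h.crit t11_not_proper f (nodup_injective hf)
    (hom_of_list _ (by decide) f hom))

/-- `G` does not arise from `T₈` by splitting the vertex `2` into the two ends of a diamond: the
result is `T₁₁`, or has three disjoint triangles. -/
theorem leaf_t8 (h : MinDense G) (hpk : pk G univ ≤ 2) {a b c d : V} {g : Fin 8 → V}
    (S : SplitIn graphT8 2 G a d g)
    (hgb : ∀ s, s ≠ 2 → g s ≠ b ∧ g s ≠ c) (hab : G.Adj a b) (hac : G.Adj a c) (hbc : G.Adj b c)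
    (hbd : G.Adj b d) (hcd : G.Adj c d) : False := by
  have key : ∀ r r', (r = a ∧ r' = d) ∨ (r = d ∧ r' = a) → G.Adj r' (g 5) → False := by
    intro r r' hr k5
    have hrr : r ≠ r' ∧ G.Adj r b ∧ G.Adj r c ∧ G.Adj r' b ∧ G.Adj r' c := by
      rcases hr with ⟨rfl, rfl⟩ | ⟨rfl, rfl⟩
      · exact ⟨S.had, hab, hac, hbd.symm, hcd.symm⟩
      · exact ⟨S.had.symm, hbd.symm, hcd.symm, hab, hac⟩
    obtain ⟨hne, rb, rc, rb', rc'⟩ := hrr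
    have hgr : ∀ s, s ≠ 2 → g s ≠ r ∧ g s ≠ r' := by
      intro s hs
      rcases hr with ⟨rfl, rfl⟩ | ⟨rfl, rfl⟩
      · exact ⟨S.ne_a s hs, S.ne_d s hs⟩
      · exact ⟨S.ne_d s hs, S.ne_a s hs⟩
    have hw : ∀ s, graphT8.Adj 2 s → G.Adj r (g s) ∨ G.Adj r' (g s) := by
      intro s hs
      rcases hr with ⟨rfl, rfl⟩ | ⟨rfl, rfl⟩
      · exact S.adjw s hs
      · exact (S.adjw s hs).symm
    have hg : ∀ s t, s ≠ 2 → t ≠ 2 → s ≠ t → g s ≠ g t := fun s t hs ht hst e =>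
      hst (S.inj s t hs ht e)
    -- a part of `2` adjacent to both `0` and `1` yields three disjoint triangles
    have tri : ∀ p p', p ≠ p' → (∀ s, s ≠ 2 → g s ≠ p ∧ g s ≠ p') → p ≠ b → p ≠ c →
        G.Adj p' b → G.Adj p' c → G.Adj p (g 0) → G.Adj p (g 1) → False := by
      intro p p' hpp hgp hpb hpc pb pc k0 k1
      have t1 : 1 ≤ pk G {p, g 0, g 1} := pk_triangle (a := p) (b := g 0) (c := g 1) (by simp)
        (by simp) (by simp) k0 (S.adj _ _ (by decide) (by decide) (by decide)) k1.symm
      have t2 : 1 ≤ pk G {g 3, g 6, g 7} := pk_triangle (a := g 3) (b := g 6) (c := g 7) (by simp)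
        (by simp) (by simp) (S.adj _ _ (by decide) (by decide) (by decide))
        (S.adj _ _ (by decide) (by decide) (by decide))
        (S.adj _ _ (by decide) (by decide) (by decide))
      have t3 : 1 ≤ pk G {p', b, c} := pk_triangle (a := p') (b := b) (c := c) (by simp) (by simp)
        (by simp) pb hbc pc.symm
      have d1 : Disjoint ({p, g 0, g 1} : Finset V) {g 3, g 6, g 7} := by
        simp only [disjoint_insert_left, disjoint_singleton_left, mem_insert, mem_singleton, not_or]
        exact ⟨⟨(hgp _ (by decide)).1.symm, (hgp _ (by decide)).1.symm, (hgp _ (by decide)).1.symm⟩,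
          ⟨hg _ _ (by decide) (by decide) (by decide), hg _ _ (by decide) (by decide) (by decide),
            hg _ _ (by decide) (by decide) (by decide)⟩, hg _ _ (by decide) (by decide) (by decide),
            hg _ _ (by decide) (by decide) (by decide), hg _ _ (by decide) (by decide) (by decide)⟩
      have d2 : Disjoint ({p, g 0, g 1} ∪ {g 3, g 6, g 7} : Finset V) {p', b, c} := by
        have e : ∀ s, s ≠ 2 → ¬ (g s = p' ∨ g s = b ∨ g s = c) := fun s hs => by
          simp only [not_or]
          exact ⟨(hgp s hs).2, (hgb s hs).1, (hgb s hs).2⟩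
        simp only [disjoint_union_left, disjoint_insert_left, disjoint_singleton_left, mem_insert,
          mem_singleton]
        exact ⟨⟨by simp only [not_or]; exact ⟨hpp, hpb, hpc⟩, e _ (by decide), e _ (by decide)⟩,
          e _ (by decide), e _ (by decide), e _ (by decide)⟩
      have s1 := pk_add (G := G) (subset_union_left (s₁ := {p, g 0, g 1}) (s₂ := {g 3, g 6, g 7}))
        subset_union_right d1
      have s2 := pk_add (G := G) (subset_univ _) (subset_univ _) d2
      omega
    -- each of `0`, `1` attached to its own part gives `T₁₁`
    have iso : ∀ j k j' k' : Fin 8, j ≠ 2 → k ≠ 2 → j' ≠ 2 → k' ≠ 2 →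
        ([j, k, j', k', 5, 6, 7] : List (Fin 8)).Nodup → graphT8.Adj j k → graphT8.Adj j j' →
        graphT8.Adj k k' → graphT8.Adj j' 6 → graphT8.Adj j' 7 → graphT8.Adj k' 6 →
        graphT8.Adj k' 7 → G.Adj r (g j) → G.Adj r' (g k) → False := by
      intro j k j' k' hj hk hj' hk' hnd e1 e2 e3 e4 e5 e6 e7 kj kk
      have A : ∀ s t, s ≠ 2 → t ≠ 2 → graphT8.Adj s t → G.Adj (g s) (g t) := S.adj
      refine h.not_iso_t11_of_hom
        (f := ![g j, r', g k, g j', g 5, g k', g 6, g 7, r, b, c]) ?_ ?_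
      · have nd : (List.map g [j, k, j', k', 5, 6, 7]).Nodup := by
          refine List.Nodup.map_on (fun s hs t ht e => ?_) hnd
          have : ∀ s ∈ ([j, k, j', k', 5, 6, 7] : List (Fin 8)), s ≠ 2 := by
            intro s hs
            simp only [List.mem_cons, List.not_mem_nil, or_false] at hs
            rcases hs with rfl | rfl | rfl | rfl | rfl | rfl | rfl <;> first | assumption | decide
          exact S.inj s t (this s hs) (this t ht) e
        have nd2 : (List.map g [j, k, j', k', 5, 6, 7] ++ [r', r, b, c]).Nodup := by
          rw [List.nodup_append]
          refine ⟨nd, ?_, ?_⟩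
          · simp [hne.symm, rb'.ne, rc'.ne, rb.ne, rc.ne, hbc.ne]
          · intro x hx y hy
            obtain ⟨s, hs, rfl⟩ := List.mem_map.1 hx
            have hs2 : s ≠ 2 := by
              simp only [List.mem_cons, List.not_mem_nil, or_false] at hs
              rcases hs with rfl | rfl | rfl | rfl | rfl | rfl | rfl <;> first | assumption | decide
            simp only [List.mem_cons, List.not_mem_nil, or_false] at hy
            rcases hy with rfl | rfl | rfl | rfl
            · exact (hgr s hs2).2
            · exact (hgr s hs2).1
            · exact (hgb s hs2).1
            · exact (hgb s hs2).2
        refine List.Perm.nodup (List.perm_iff_count.2 fun x => ?_) nd2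
        simp [List.ofFn_succ, List.count_cons]
        omega
      · simp only [List.forall_mem_cons, List.not_mem_nil, false_imp_iff, implies_true, and_true]
        exact ⟨kj.symm, rb, rc, hbc, rb'.symm, rc'.symm, kk, A _ _ hk hj e1.symm, A _ _ hj hj' e2, k5,
          A _ _ hk hk' e3, A _ _ hj' (by decide) e4, A _ _ hj' (by decide) e5,
          A _ _ (by decide) (by decide) (by decide), A _ _ (by decide) (by decide) (by decide),
          A _ _ hk' (by decide) e6, A _ _ hk' (by decide) e7,
          A _ _ (by decide) (by decide) (by decide)⟩
    rcases hw 0 (by decide) with k0 | k0 <;> rcases hw 1 (by decide) with k1 | k1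
    · exact tri r r' hne hgr rb.ne rc.ne rb' rc' k0 k1
    · exact iso 0 1 3 4 (by decide) (by decide) (by decide) (by decide) (by decide) (by decide)
        (by decide) (by decide) (by decide) (by decide) (by decide) (by decide) k0 k1
    · exact iso 1 0 4 3 (by decide) (by decide) (by decide) (by decide) (by decide) (by decide)
        (by decide) (by decide) (by decide) (by decide) (by decide) (by decide) k1 k0
    · exact tri r' r hne.symm (fun s hs => (hgr s hs).symm) rb'.ne rc'.ne rb rc k0 k1
  rcases S.adjw 5 (by decide) with k | k
  · exact key d a (Or.inr ⟨rfl, rfl⟩) k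
  · exact key a d (Or.inl ⟨rfl, rfl⟩) k

/-- `G` does not arise from a critical graph `W` of the same weight by splitting a vertex `w` into
the two ends of a diamond. Such a split keeps the short cycles that avoid one of the two parts, and
the diamond has one more disjoint from them; the only case without enough cycles is `T₁₁`. -/
theorem leaf_kind (h : MinDense G) {a b c d : V} {U : Type u} [Fintype U] {W : SimpleGraph U}
    {w : U} {g : U → V} (hW : Kind W) (S : SplitIn W w G a d g) (hq : q G univ = q W univ)
    (hgb : ∀ s, s ≠ w → g s ≠ b ∧ g s ≠ c) (hab : G.Adj a b) (hac : G.Adj a c) (hbc : G.Adj b c)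
    (hbd : G.Adj b d) (hcd : G.Adj c d) : False := by
  have hpk := h.pk_le
  have hq1 := h.q_le
  have tri : ∀ p, (p = a ∨ p = d) → 1 ≤ pk G {p, b, c} := by
    rintro p (rfl | rfl)
    · exact pk_triangle (a := p) (b := b) (c := c) (by simp) (by simp) (by simp) hab hbc hac.symm
    · exact pk_triangle (a := p) (b := b) (c := c) (by simp) (by simp) (by simp) hbd.symm hbc hcd
  -- cycles through at most one part of the split vertex avoid a triangle of the diamond
  have split : ∀ n r, (r = a ∨ r = d) → n ≤ pk G (insert r ((univ.erase w).image g)) →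
      n + 1 ≤ pk G univ := by
    intro n r hr hn
    obtain ⟨r', hr', hne⟩ : ∃ r', (r' = a ∨ r' = d) ∧ r' ≠ r := by
      rcases hr with rfl | rfl
      · exact ⟨d, Or.inr rfl, S.had.symm⟩
      · exact ⟨a, Or.inl rfl, S.had⟩
    have hr'g : ∀ s, s ≠ w → g s ≠ r' := fun s hs => by
      rcases hr' with rfl | rfl
      · exact S.ne_a s hs
      · exact S.ne_d s hs
    have hrb : r ≠ b ∧ r ≠ c := by
      rcases hr with rfl | rfl
      · exact ⟨hab.ne, hac.ne⟩
      · exact ⟨hbd.ne', hcd.ne'⟩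
    have := pk_add (G := G) (A := insert r ((univ.erase w).image g)) (B := {r', b, c})
      (subset_univ _) (subset_univ _) (by
        rw [disjoint_insert_left]
        refine ⟨by simp [hne.symm, hrb], ?_⟩
        rw [Finset.disjoint_left]
        intro x hx hx'
        obtain ⟨s, hs, rfl⟩ := mem_image.1 hx
        have hs := ne_of_mem_erase hs
        simp only [mem_insert, mem_singleton] at hx'
        rcases hx' with e | e | e
        · exact hr'g s hs e
        · exact (hgb s hs).1 e
        · exact (hgb s hs).2 e)
    have := tri r' hr'
    omega
  have hB : ∀ s, s ≠ w → g s ∈ (univ.erase w).image g := fun s hs =>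
    mem_image_of_mem g (by simpa using hs)
  have hBiso : ∀ {n : ℕ} {T : SimpleGraph (Fin n)} (e : W ≃g T) (s : Fin n), s ≠ e w →
      (g ∘ e.symm) s ∈ (univ.erase w).image g := fun e s hs => hB _ fun k => hs (by rw [← k]; simp)
  rcases hW with k | ⟨k, -⟩ | ⟨k, -⟩ | ⟨⟨e⟩⟩ | ⟨⟨e⟩⟩ | ⟨⟨e⟩⟩ | k
  · have := k.q_eq; omega
  · have := isOre_q k; omega
  · have := isOre_q k; omega
  · obtain ⟨r, hr, h1⟩ := w5_split (S.iso e) (hBiso e)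
    have := split _ r hr h1
    have := q_iso e
    have := w5_q
    omega
  · have h1 := q_iso e
    have h2 := t8_q
    by_cases hi : e w ∈ ({0, 1, 2} : Finset (Fin 8))
    · obtain ⟨e', he'⟩ := t8_rotate hi
      have S' := S.iso (e.trans e')
      have hw : (e.trans e') w = 2 := he'
      rw [hw] at S'
      refine h.leaf_t8 (by omega) S' (fun s hs => hgb _ fun k => hs ?_) hab hac hbc hbd hcd
      rw [← hw, ← k]
      exact ((e.trans e').apply_symm_apply s).symm
    · obtain ⟨r, hr, h3⟩ := t8_split (S.iso e) (hBiso e) hi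
      have := split _ r hr h3
      omega
  · obtain ⟨r, hr, h1⟩ := t11_split (S.iso e) (hBiso e)
    have := split _ r hr h1
    have := q_iso e
    have := t11_q
    omega
  · have h1 := pk_erase (G := W) univ w
    have h2 := S.pk_le (A := univ.erase w) (by simp) (B := insert a ((univ.erase w).image g))
      fun s hs => mem_insert_of_mem (hB s (ne_of_mem_erase hs))
    have := split _ a (Or.inl rfl) h2
    omega

/-- When the inner vertices of a diamond are cubic, only its two ends have outer neighbours, and
they have the same colour in every colouring. So the lift has a single colour, and `leaf_kind`
applies. -/
theorem noLeafDiamond (h : MinDense G) {a b c d : V} (had : a ≠ d) (hab : G.Adj a b)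
    (hac : G.Adj a c) (hbc : G.Adj b c) (hbd : G.Adj b d) (hcd : G.Adj c d) (hb : dg G b = 3)
    (hc : dg G c = 3) : False := by
  obtain ⟨h4, hu, hp, hq⟩ := h.diamond_facts had hab hac hbc hbd hcd
  have nb := adj_iff_of_three hb hab.symm hbc hbd hac.ne had hcd.ne
  have nc := adj_iff_of_three hc hac.symm hbc.symm hcd hab.ne had hbd.ne
  obtain ⟨φ, hφ⟩ := crit_exists_proper h.crit hu
  obtain ⟨U, _, W, X, g, col, L⟩ := exists_lift_univ h.crit hφ
  obtain ⟨T, hTq, -⟩ := h.lift_tight h4.ge hp L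
  have hd : φ a = φ d := color_eq_of_ne (hφ b (by simp) c (by simp) hbc)
    (hφ a (by simp) b (by simp) hab) (hφ a (by simp) c (by simp) hac)
    (hφ d (by simp) b (by simp) hbd.symm) (hφ d (by simp) c (by simp) hcd.symm)
  have hgR : ∀ s, s ∉ X → ∀ r ∈ ({a, b, c, d} : Finset V), g s ≠ r := fun s hs r hr e =>
    (L.g_mem s hs).2 (e ▸ hr)
  have hadj : ∀ s, s ∉ X → ∀ r ∈ ({a, b, c, d} : Finset V), G.Adj (g s) r → r = a ∨ r = d := by
    intro s hs r hr k
    have hr' := hr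
    simp only [mem_insert, mem_singleton] at hr
    rcases hr with rfl | rfl | rfl | rfl
    · exact Or.inl rfl
    · rcases (nb _).1 k.symm with e | e | e <;> exact absurd e (hgR s hs _ (by simp))
    · rcases (nc _).1 k.symm with e | e | e <;> exact absurd e (hgR s hs _ (by simp))
    · exact Or.inr rfl
  have hcol : ∀ x ∈ X, col x = φ a := by
    intro x hx
    obtain ⟨s, hs, k⟩ := L.exists_nbr hx
    obtain ⟨r, hr, e, k'⟩ := L.adjX s hs x hx k
    rw [← e]
    rcases hadj s hs r hr k' with rfl | rfl
    · rfl
    · exact hd.symm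
  obtain ⟨w, hw⟩ := L.nonempty h.crit ⟨a, by simp⟩
  have hXw : X = {w} := eq_singleton_iff_unique_mem.2 ⟨hw, fun x hx =>
    L.col_inj x hx w hw (by rw [hcol x hx, hcol w hw])⟩
  subst hXw
  have k1 : kap 1 = 5 := by decide
  rw [card_singleton, k1, hq] at hTq
  have hne : ∀ s, s ≠ w → s ∉ ({w} : Finset U) := fun s hs => by simpa using hs
  refine h.leaf_kind (h.kind U W L.crit (L.card_lt h4.ge)) (w := w) (g := g) (a := a) (d := d)
    (b := b) (c := c) ⟨had, ?_, ?_, ?_, ?_, ?_⟩ (by omega) ?_ hab hac hbc hbd hcd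
  · exact fun s t hs ht => L.g_inj s (hne s hs) t (hne t ht)
  · exact fun s hs => hgR s (hne s hs) a (by simp)
  · exact fun s hs => hgR s (hne s hs) d (by simp)
  · exact fun s t hs ht => L.adj s (hne s hs) t (hne t ht)
  · intro s hs
    have hs' := hne s hs.ne'
    obtain ⟨r, hr, -, k⟩ := L.adjX s hs' w (by simp) hs.symm
    rcases hadj s hs' r hr k with rfl | rfl
    · exact Or.inl k.symm
    · exact Or.inr k.symm
  · exact fun s hs => ⟨hgR s (hne s hs) b (by simp), hgR s (hne s hs) c (by simp)⟩

end MinDense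

/-! ### Sets of potential three and triangles with two cubic vertices -/

/-- A triangle of cubic vertices meets six edges, and its removal changes the weight by `15 - 18`.
-/
theorem q_cubic_triangle {V : Type*} [Fintype V] {G : SimpleGraph V} {x y z : V} (hxy : G.Adj x y)
    (hyz : G.Adj y z) (hxz : G.Adj x z) (hx : dg G x = 3) (hy : dg G y = 3) (hz : dg G z = 3) :
    q G univ = q G ({x, y, z} : Finset V)ᶜ - 3 := by
  obtain ⟨x', -, -, nx⟩ := exists_third_nbr hx hxy hxz hyz.ne
  obtain ⟨y', y1, y2, ny⟩ := exists_third_nbr hy hxy.symm hyz hxz.ne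
  obtain ⟨z', z1, z2, nz⟩ := exists_third_nbr hz hxz.symm hyz.symm hxy.ne
  have e1 : ({x, y, z} : Finset V)ᶜ.filter (G.Adj z) = {z'} := by
    have := ((nz z').2 (by simp)).ne
    ext w
    simp only [mem_filter, mem_compl, mem_insert, mem_singleton, nz]
    grind
  have e2 : (insert z ({x, y, z} : Finset V)ᶜ).filter (G.Adj y) = {z, y'} := by
    have := ((ny y').2 (by simp)).ne
    have := hyz.ne
    ext w
    simp only [mem_filter, mem_compl, mem_insert, mem_singleton, ny]
    grind
  have e3 : insert x (insert y (insert z ({x, y, z} : Finset V)ᶜ)) = univ := by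
    ext w
    simp only [mem_compl, mem_insert, mem_singleton, mem_univ, iff_true]
    tauto
  have e4 : (insert y (insert z ({x, y, z} : Finset V)ᶜ)).filter (G.Adj x) =
      univ.filter (G.Adj x) := by
    ext w
    have : w = x ∨ w ∈ insert y (insert z ({x, y, z} : Finset V)ᶜ) := by
      rw [← mem_insert, e3]; exact mem_univ _
    simp only [mem_filter, mem_univ, true_and]
    refine ⟨fun k => k.2, fun k => ⟨this.resolve_left k.ne', k⟩⟩
  have h1 := q_insert G (a := z) (A := ({x, y, z} : Finset V)ᶜ) (by simp)
  have h2 := q_insert G (a := y) (A := insert z ({x, y, z} : Finset V)ᶜ) (by simp [hyz.ne])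
  have h3 := q_insert G (a := x) (A := insert y (insert z ({x, y, z} : Finset V)ᶜ))
    (by simp [hxy.ne, hxz.ne])
  rw [e1, card_singleton] at h1
  rw [e2, card_pair y2.symm] at h2
  rw [e3, e4] at h3
  unfold dg at hx
  rw [hx] at h3
  push_cast at *
  omega

namespace MinDense
variable {V : Type u} [Fintype V] {G : SimpleGraph V}

/-- The complement of a set of potential three is one vertex or a triangle of cubic vertices. -/
theorem compl_of_pt_le_three (h : MinDense G) {R : Finset V} (h4 : 4 ≤ R.card) (hR : R ≠ univ)
    (hp : pt G R ≤ 3) : Rᶜ.card = 1 ∨ ∃ x y z, G.Adj x y ∧ G.Adj y z ∧ G.Adj x z ∧ dg G x = 3 ∧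
      dg G y = 3 ∧ dg G z = 3 ∧ Rᶜ = {x, y, z} := by
  obtain ⟨φ, hφ⟩ := crit_exists_proper h.crit hR
  obtain ⟨U, _, W, X, g, col, L⟩ := exists_lift_univ h.crit hφ
  obtain ⟨T, -, hg⟩ := h.lift_tight h4 (by omega) L
  have hs := h.lift_spans h4 (by omega) L
  have hk := h.kind U W L.crit (L.card_lt h4)
  have hc : Rᶜ = liftSet X g := by
    ext v
    have h1 := L.disjoint
    have h2 : v ∈ R ∪ liftSet X g := hs ▸ mem_univ v
    rw [mem_union] at h2
    rw [mem_compl]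
    exact ⟨fun k => h2.resolve_left k, fun k k' => Finset.disjoint_left.1 h1 k' k⟩
  have hcard := L.card_liftSet
  have k1 : kap 1 = 5 := by decide
  have k2 : kap 2 = 7 := by decide
  have k3 : kap 3 = 6 := by decide
  rcases L.card_cases h.crit (card_pos.1 (by omega)) with e | e | e
  · obtain ⟨w, rfl⟩ := card_eq_one.1 e
    have hw : ({w} : Finset U)ᶜ = univ.erase w := by ext; simp
    rw [e, k1, hw] at hg
    have hg1 := gain_one hk w
    right
    have hmem : ∀ s, s ≠ w → s ∉ ({w} : Finset U) := fun s hs => by simpa using hs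
    rcases hg1.2 (by omega) with k | ⟨f, hf⟩
    · have h3 : ({w} : Finset U)ᶜ.card = 3 := by rw [card_compl, k.1, card_singleton]
      obtain ⟨s, t, r, hst, hsr, htr, hX⟩ := card_eq_three.1 h3
      have m : ∀ p, p ∈ ({s, t, r} : Finset U) → p ∉ ({w} : Finset U) := fun p hp => by
        rw [← hX] at hp
        exact mem_compl.1 hp
      have ms := m s (by simp)
      have mt := m t (by simp)
      have mr := m r (by simp)
      have deg : ∀ p, p ∉ ({w} : Finset U) → dg G (g p) = 3 := fun p hp => by
        have h1 := T.dg_le hs hp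
        have h2 := crit_deg h.crit (g p)
        rw [k.dg_eq] at h1
        omega
      refine ⟨g s, g t, g r, L.adj _ ms _ mt (k.2 _ _ hst), L.adj _ mt _ mr (k.2 _ _ htr),
        L.adj _ ms _ mr (k.2 _ _ hsr), deg _ ms, deg _ mt, deg _ mr, ?_⟩
      rw [hc, liftSet, hX]
      simp
    · exfalso
      obtain ⟨α, β, γ, δ, h1, a1, a2, a3, a4, a5, d1, d2, n1, n2, n3, n4⟩ := h7_diamond hf
      have hne : ∀ s, s ≠ f w → f.symm s ∉ ({w} : Finset U) := fun s hs k => hs (by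
        rw [← mem_singleton.1 k]; simp)
      have A : ∀ s t, s ≠ f w → t ≠ f w → graphH7.Adj s t → G.Adj (g (f.symm s)) (g (f.symm t)) :=
        fun s t hs ht k => L.adj _ (hne s hs) _ (hne t ht) (f.symm.map_adj_iff.2 k)
      have deg : ∀ s, s ≠ f w → dg graphH7 s = 3 → dg G (g (f.symm s)) = 3 := fun s hs' k => by
        have h1 := T.dg_le hs (hne s hs')
        have h2 := crit_deg h.crit (g (f.symm s))
        rw [dg_iso f.symm, k] at h1
        omega
      exact h.noLeafDiamond (fun k => h1 (f.symm.injective (L.g_inj _ (hne _ n1) _ (hne _ n4) k)))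
        (A _ _ n1 n2 a1) (A _ _ n1 n3 a2) (A _ _ n2 n3 a3) (A _ _ n2 n4 a4) (A _ _ n3 n4 a5)
        (deg _ n2 d1) (deg _ n3 d2)
  · have := (gain_two hk e T.clique).1
    rw [e, k2] at hg
    omega
  · have := gain_three hk e T.clique
    rw [e, k3] at hg
    have k := this.2.1 (by omega)
    left
    have := k.1
    rw [hc]
    omega

/-- In a triangle with two cubic vertices, the third neighbours of these are the ends of a diamond.
-/
theorem triangle_ends (h : MinDense G) {x y z x' y' : V} (hxy : G.Adj x y) (hyz : G.Adj y z)
    (hxz : G.Adj x z) (dx : dg G x = 3) (dy : dg G y = 3) (hx'y : x' ≠ y) (hx'z : x' ≠ z)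
    (hy'x : y' ≠ x) (hy'z : y' ≠ z) (hx : ∀ w, G.Adj x w ↔ w = y ∨ w = z ∨ w = x')
    (hy : ∀ w, G.Adj y w ↔ w = x ∨ w = z ∨ w = y') :
    x' ≠ y' ∧ ∃ m m', G.Adj x' m ∧ G.Adj x' m' ∧ G.Adj m m' ∧ G.Adj m y' ∧ G.Adj m' y' ∧
      m ∉ ({x, y} : Finset V) ∧ m' ∉ ({x, y} : Finset V) := by
  have ax : G.Adj x x' := (hx x').2 (by simp)
  have ay : G.Adj y y' := (hy y').2 (by simp)
  have hne : x' ≠ y' := by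
    rintro rfl
    exact h.noLeafDiamond hx'z ax.symm ay.symm hxy hxz hyz dx dy
  refine ⟨hne, ?_⟩
  have hD : univ \ {x, y} ≠ (univ : Finset V) := fun e => by
    have := e ▸ mem_univ x
    simp at this
  obtain ⟨U, _, W, f, p, r, hW, hf, hfD, hpr, rfl, rfl, hfa⟩ :=
    exists_crit_addEdge (D := univ \ {x, y}) (s := x') (t := y') (by simp [ax.ne', hx'y])
      (by simp [ay.ne', hy'x]) hne (crit_exists_proper h.crit hD) fun c hc =>
        cubic_triangle_color h.crit hx hy hc
  have hfm : ∀ u, f u ∉ ({x, y} : Finset V) := fun u => (mem_sdiff.1 (hfD u)).2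
  by_cases hK : IsK4 W
  · obtain ⟨s, t, hst, hsp, hsr, htp, htr, -⟩ := hK.exists_two hpr.ne
    have A : ∀ a b, a ≠ b → a ≠ p ∨ b ≠ r → a ≠ r ∨ b ≠ p → G.Adj (f a) (f b) := by
      intro a b hab e1 e2
      refine hfa a b (hK.2 a b hab) fun e => ?_
      rcases Sym2.eq_iff.1 e with e | e <;> tauto
    exact ⟨f s, f t, A _ _ hsp.symm (Or.inr hsr) (Or.inl hpr.ne),
      A _ _ htp.symm (Or.inr htr) (Or.inl hpr.ne),
      A _ _ hst (Or.inl hsp) (Or.inl hsr), A _ _ hsr (Or.inl hsp) (Or.inl hsr),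
      A _ _ htr (Or.inl htp) (Or.inl htr), hfm s, hfm t⟩
  exfalso
  have hcard : (univ.image f).card = Fintype.card U := by
    rw [card_image_of_injective _ hf, card_univ]
  have hxP : x ∉ univ.image f := fun k => by
    obtain ⟨u, -, e⟩ := mem_image.1 k
    exact hfm u (by simp [e])
  have hyP : y ∉ univ.image f := fun k => by
    obtain ⟨u, -, e⟩ := mem_image.1 k
    exact hfm u (by simp [e])
  have hPu : univ.image f ≠ univ := fun e => hxP (e ▸ mem_univ x)
  have hlt : Fintype.card U < Fintype.card V := by
    rw [← hcard, ← card_univ]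
    exact card_lt_card (ssubset_univ_iff.2 hPu)
  have h4 : 4 ≤ (univ.image f).card := hcard ▸ crit_four_le hW
  have hq := q_image_addEdge hf hpr hfa
  have hpk : pk (W.deleteEdges {s(p, r)}) univ ≤ pk G (univ.image f) := by
    refine pk_map f hf.injOn (fun a ha => mem_image_of_mem f ha) fun a _ b _ hab => ?_
    rw [SimpleGraph.deleteEdges_adj, Set.mem_singleton_iff] at hab
    exact hfa a b hab.1 hab.2
  have h3 := h.three_le_pt h4 hPu
  -- the complement of the image is the triangle, and its vertices are cubic
  have tri : pt G (univ.image f) ≤ 3 → dg G z = 3 ∧ (univ.image f)ᶜ = {x, y, z} := by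
    intro h3'
    have hxm : x ∈ (univ.image f)ᶜ := mem_compl.2 hxP
    have hym : y ∈ (univ.image f)ᶜ := mem_compl.2 hyP
    rcases h.compl_of_pt_le_three h4 hPu h3' with e | ⟨a, b, c, hab, hbc, hac, da, db, dc, e⟩
    · exact absurd (card_le_one.1 e.le x hxm y hym) hxy.ne
    · have common : ∀ w, G.Adj x w → G.Adj y w → w = z := by
        intro w k1 k2
        rcases (hx w).1 k1 with e | e | e
        · exact absurd e k2.ne'
        · exact e
        · rcases (hy w).1 k2 with e' | e' | e'
          · exact absurd e' k1.ne'
          · exact e'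
          · exact absurd (e.symm.trans e') hne
      have key : ∀ s t u, G.Adj s t → G.Adj t u → G.Adj s u → dg G u = 3 →
          (univ.image f)ᶜ = {s, t, u} → x = s → y = t →
          dg G z = 3 ∧ (univ.image f)ᶜ = {x, y, z} := by
        rintro s t u - h2 h3 h4 h5 rfl rfl
        obtain rfl := common u h3 h2
        exact ⟨h4, h5⟩
      have hx1 := hxm
      have hy1 := hym
      rw [e] at hx1 hy1
      simp only [mem_insert, mem_singleton] at hx1 hy1
      rcases hx1 with ex | ex | ex <;> rcases hy1 with ey | ey | ey
      · exact absurd (ex.trans ey.symm) hxy.ne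
      · exact key a b c hab hbc hac dc e ex ey
      · exact key a c b hac hbc.symm hab db (by rw [e]; ext; simp; tauto) ex ey
      · exact key b a c hab.symm hac hbc dc (by rw [e]; ext; simp; tauto) ex ey
      · exact absurd (ex.trans ey.symm) hxy.ne
      · exact key b c a hbc hac.symm hab.symm da (by rw [e]; ext; simp; tauto) ex ey
      · exact key c a b hac.symm hab hbc.symm db (by rw [e]; ext; simp; tauto) ex ey
      · exact key c b a hbc.symm hab.symm hac.symm da (by rw [e]; ext; simp; tauto) ex ey
      · exact absurd (ex.trans ey.symm) hxy.ne
  have hqV : pt G (univ.image f) ≤ 3 → (pk (W.deleteEdges {s(p, r)}) univ : ℤ) ≤ q G univ ∧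
      q G univ = q G (univ.image f) - 3 := by
    intro h3'
    obtain ⟨dz, e⟩ := tri h3'
    have := q_cubic_triangle hxy hyz hxz dx dy dz
    rw [← e, compl_compl] at this
    unfold pt at h3
    omega
  have hq1 := h.q_le
  rcases h.kind U W hW hlt with k | ⟨k, ⟨e⟩⟩ | ⟨k, hk3⟩ | ⟨⟨e⟩⟩ | ⟨⟨e⟩⟩ | ⟨⟨e⟩⟩ | k
  · exact hK k
  · have h1 := pk_iso_deleteEdge e p r
    have h2 := h7_deleteEdge (e.map_adj_iff.2 hpr)
    have h5 := isOre_q k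
    have := (hqV (by unfold pt; omega)).1
    omega
  · have h1 := pk_deleteEdge W univ p r
    have h5 := isOre_q k
    have := (hqV (by unfold pt; omega)).1
    omega
  · have h1 := pk_iso_deleteEdge e p r
    have h2 := w5_deleteEdge (e.map_adj_iff.2 hpr)
    have h5 := q_iso e
    rw [w5_q] at h5
    unfold pt at h3
    omega
  · have h1 := pk_iso_deleteEdge e p r
    have h5 := q_iso e
    rw [t8_q] at h5
    rcases t8_deleteEdge (e.map_adj_iff.2 hpr) with h2 | ⟨h2, hp3, hr3⟩
    · unfold pt at h3
      omega
    have h6 : pt G (univ.image f) ≤ 3 := by unfold pt; omega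
    obtain ⟨dz, hcompl⟩ := tri h6
    obtain ⟨h7, h8⟩ := hqV h6
    obtain ⟨z', hz'x, hz'y, hz⟩ := exists_third_nbr dz hxz.symm hyz.symm hxy.ne
    have az : G.Adj z z' := (hz z').2 (by simp)
    have hz'P : z' ∈ univ.image f := by
      by_contra hn
      have := mem_compl.2 hn
      rw [hcompl] at this
      simp [hz'x, hz'y, az.ne'] at this
    obtain ⟨v, -, rfl⟩ := mem_image.1 hz'P
    have hvp : f v ≠ f p := fun k => by
      rw [k] at az
      exact h.noLeafDiamond hx'y ax.symm az.symm hxz hxy hyz.symm dx dz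
    have hvr : f v ≠ f r := fun k => by
      rw [k] at az
      exact h.noLeafDiamond hy'x ay.symm az.symm hyz hxy.symm hxz.symm dy dz
    obtain ⟨c, hc, hcne⟩ := t8_deleteEdge_color (i := e p) (j := e r) (v := e v) hp3 hr3
      (e.injective.ne hpr.ne) (e.injective.ne fun k => hvp (by rw [k]))
      (e.injective.ne fun k => hvr (by rw [k]))
    have hexact : ∀ a b, G.Adj (f a) (f b) → W.Adj a b ∧ s(a, b) ≠ s(p, r) := by
      intro a b hab
      have := hom_exact (G := G) (H := W.deleteEdges {s(p, r)}) hf (fun a b hab => by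
        rw [SimpleGraph.deleteEdges_adj, Set.mem_singleton_iff] at hab
        exact hfa a b hab.1 hab.2) (by
        rw [q_deleteEdge W (mem_univ p) (mem_univ r) hpr]
        omega) a b hab
      rwa [SimpleGraph.deleteEdges_adj, Set.mem_singleton_iff] at this
    have hcP : Proper G (univ.image f) (Function.extend f (c ∘ e) 0) := by
      intro a ha b hb hab
      obtain ⟨a, -, rfl⟩ := mem_image.1 ha
      obtain ⟨b, -, rfl⟩ := mem_image.1 hb
      obtain ⟨k1, k2⟩ := hexact a b hab
      rw [hf.extend_apply, hf.extend_apply]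
      refine hc _ _ (e.map_adj_iff.2 k1) fun k => k2 ?_
      rcases Sym2.eq_iff.1 k with k | k <;> rw [e.injective k.1, e.injective k.2]
      exact Sym2.eq_swap
    obtain ⟨c', hc', hag, -⟩ := hcP.extend_two hyP (c (e r)) (c (e r)) (by
      intro a ha k
      have hna : a ∉ ({x, y, z} : Finset V) := by
        rw [← hcompl, mem_compl, not_not]; exact ha
      simp only [mem_insert, mem_singleton, not_or] at hna
      rcases (hy a).1 k with rfl | rfl | rfl
      · exact absurd rfl hna.1
      · exact absurd rfl hna.2.2
      · rw [hf.extend_apply]; simp)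
    have := cubic_triangle_color h.crit (x := x) (y := z) (z := y) (x' := f p) (y' := f v)
      (fun w => (hx w).trans or_left_comm) hz (hc'.mono fun w hw => by
        rw [mem_insert]
        by_contra hn
        rw [not_or] at hn
        have h9 := mem_compl.2 hn.2
        rw [hcompl] at h9
        simp only [mem_sdiff, mem_univ, true_and, mem_insert, mem_singleton, not_or] at hw h9
        rcases h9 with k | k | k
        · exact hw.1 k
        · exact hn.1 k
        · exact hw.2 k)
    rw [hag _ hx'y, hag _ hz'y, hf.extend_apply, hf.extend_apply] at this
    exact hcne this.symm
  · have h1 := pk_iso_deleteEdge e p r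
    have h2 := t11_deleteEdge (e.map_adj_iff.2 hpr)
    have h5 := q_iso e
    rw [t11_q] at h5
    unfold pt at h3
    omega
  · have h1 := pk_deleteEdge W univ p r
    unfold pt at h3
    omega

end MinDense

/-! ### Excluding diamonds -/

namespace MinDense
variable {V : Type u} [Fintype V] {G : SimpleGraph V}

/-- The ends of the diamond given by `triangle_ends`, the diamond and the triangle span seven
vertices; the only way to complete them with `5|V| - 3|E| = 1` is `T₈`. -/
theorem no_cubic_pair_of_q_eq_one (h : MinDense G) (hq : q G univ = 1) {x y z : V} (hxy : G.Adj x y)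
    (hyz : G.Adj y z) (hxz : G.Adj x z) (dx : dg G x = 3) (dy : dg G y = 3) : False := by
  obtain ⟨x', hx'y, hx'z, hx⟩ := exists_third_nbr dx hxy hxz hyz.ne
  obtain ⟨y', hy'x, hy'z, hy⟩ := exists_third_nbr dy hxy.symm hyz hxz.ne
  have ax : G.Adj x x' := (hx x').2 (by simp)
  have ay : G.Adj y y' := (hy y').2 (by simp)
  obtain ⟨hne, m, m', b1, b2, b3, b4, b5, hm, hm'⟩ :=
    h.triangle_ends hxy hyz hxz dx dy hx'y hx'z hy'x hy'z hx hy
  simp only [mem_insert, mem_singleton, not_or] at hm hm'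
  have hcardD := card_diamond hne b1 b2 b3 b4 b5
  have hqD := q_diamond_le hne b1 b2 b3 b4 b5
  have hxD : x ∉ ({x', m, m', y'} : Finset V) := by
    simp only [mem_insert, mem_singleton, not_or]
    exact ⟨ax.ne, fun e => hm.1 e.symm, fun e => hm'.1 e.symm, fun e => hy'x e.symm⟩
  have hyD : y ∉ ({x', m, m', y'} : Finset V) := by
    simp only [mem_insert, mem_singleton, not_or]
    exact ⟨fun e => hx'y e.symm, fun e => hm.2 e.symm, fun e => hm'.2 e.symm, ay.ne⟩
  have hyxD : y ∉ insert x ({x', m, m', y'} : Finset V) := by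
    rw [mem_insert, not_or]; exact ⟨hxy.ne', hyD⟩
  have mod : ∀ A : Finset V, q G A = 5 * (A.card : ℤ) - 3 * ed G A := fun A => rfl
  by_cases hzD : z ∈ ({x', m, m', y'} : Finset V)
  · have h1 := q_insert_le G (a := x) (S := {z, x'}) hxD (by
      intro v; simp only [mem_insert, mem_singleton] at hzD ⊢; rintro (rfl | rfl) <;> simp [hzD])
      (by simp [hxz, ax])
    have h2 := q_insert_le G (a := y) (S := {x, z, y'}) hyxD (by
      intro v; simp only [mem_insert, mem_singleton] at hzD ⊢
      rintro (rfl | rfl | rfl) <;> simp [hzD]) (by simp [hxy.symm, hyz, ay])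
    rw [card_pair hx'z.symm] at h1
    rw [card_eq_three.2 ⟨x, z, y', hxz.ne, hy'x.symm, hy'z.symm, rfl⟩] at h2
    have h4 : 4 ≤ (insert y (insert x ({x', m, m', y'} : Finset V))).card := by
      rw [card_insert_of_notMem hyxD, card_insert_of_notMem hxD]
      omega
    have hu : insert y (insert x ({x', m, m', y'} : Finset V)) ≠ univ := fun e => by
      rw [e] at h2
      push_cast at h1 h2
      omega
    have := h.three_le_pt h4 hu
    unfold pt at this
    push_cast at h1 h2
    omega
  · have hz_x : x ∉ insert z ({x', m, m', y'} : Finset V) := by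
      rw [mem_insert, not_or]; exact ⟨hxz.ne, hxD⟩
    have hz_y : y ∉ insert x (insert z ({x', m, m', y'} : Finset V)) := by
      rw [mem_insert, mem_insert, not_or, not_or]; exact ⟨hxy.ne', hyz.ne, hyD⟩
    have h0 := q_insert G (a := z) hzD
    have h1 := q_insert_le G (a := x) (S := {z, x'}) hz_x (by
      intro v; simp only [mem_insert, mem_singleton]; rintro (rfl | rfl) <;> simp)
      (by simp [hxz, ax])
    have h2 := q_insert_le G (a := y) (S := {x, z, y'}) hz_y (by
      intro v; simp only [mem_insert, mem_singleton]
      rintro (rfl | rfl | rfl) <;> simp) (by simp [hxy.symm, hyz, ay])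
    rw [card_pair hx'z.symm] at h1
    rw [card_eq_three.2 ⟨x, z, y', hxz.ne, hy'x.symm, hy'z.symm, rfl⟩] at h2
    have h7 : (insert y (insert x (insert z ({x', m, m', y'} : Finset V)))).card = 7 := by
      rw [card_insert_of_notMem hz_y, card_insert_of_notMem hz_x, card_insert_of_notMem hzD]
      omega
    have hpk : 2 ≤ pk G (insert y (insert x (insert z ({x', m, m', y'} : Finset V)))) := by
      have t1 : 1 ≤ pk G {x', m, m', y'} := pk_triangle (a := x') (b := m) (c := m') (by simp)
        (by simp) (by simp) b1 b3 b2.symm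
      have t2 : 1 ≤ pk G {x, y, z} := pk_triangle (a := x) (b := y) (c := z) (by simp)
        (by simp) (by simp) hxy hyz hxz.symm
      have := pk_add (G := G) (A := {x', m, m', y'}) (B := {x, y, z})
        (C := insert y (insert x (insert z ({x', m, m', y'} : Finset V))))
        (fun v hv => by simp only [mem_insert] at hv ⊢; grind)
        (by intro v; simp only [mem_insert, mem_singleton]; grind) (by
          rw [Finset.disjoint_right]
          intro v hv
          simp only [mem_insert, mem_singleton] at hv
          rcases hv with rfl | rfl | rfl <;> assumption)
      omega
    generalize hQ : insert y (insert x (insert z ({x', m, m', y'} : Finset V))) = Q at h2 h7 hpk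
    have hmod := mod Q
    rw [h7] at hmod
    push_cast at h0 h1 h2 hmod
    have hQu : Q ≠ univ := fun e => by
      rw [e] at hmod
      omega
    rcases h.compl_of_pt_le_three (by omega) hQu (by unfold pt; omega) with
      e | ⟨s, t, u, k1, k2, k3, k4, k5, k6, e⟩
    · obtain ⟨u, hu⟩ := card_eq_one.1 e
      have huQ : ∀ v, v ≠ u → v ∈ Q := fun v hv => by
        by_contra hn
        rw [← mem_compl, hu] at hn
        exact hv (mem_singleton.1 hn)
      have huQ' : u ∉ Q := by rw [← mem_compl, hu]; simp
      have hins : insert u Q = univ := by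
        ext v
        simp only [mem_insert, mem_univ, iff_true]
        by_cases k : v = u
        · exact Or.inl k
        · exact Or.inr (huQ v k)
      have h8 := q_insert G (a := u) huQ'
      have hdu : Q.filter (G.Adj u) = univ.filter (G.Adj u) := by
        ext v
        simp only [mem_filter, mem_univ, true_and, and_iff_right_iff_imp]
        exact fun k => huQ v k.ne'
      have h9 := crit_deg h.crit u
      unfold dg at h9
      rw [hins, hdu] at h8
      -- the seven vertices span no further edge
      have hzN : ({x', m, m', y'} : Finset V).filter (G.Adj z) = ∅ := by
        rw [← card_eq_zero]
        omega
      have hu' := huQ'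
      rw [← hQ] at hu'
      simp only [mem_insert, mem_singleton, not_or] at hu'
      obtain ⟨uy, ux, uz, ux', um, um', uy'⟩ := hu'
      have hzn : ∀ w, G.Adj z w → w = x ∨ w = y ∨ w = u := by
        intro w k
        by_cases e1 : w = u
        · exact Or.inr (Or.inr e1)
        have e2 := huQ w e1
        rw [← hQ, mem_insert, mem_insert, mem_insert] at e2
        rcases e2 with e2 | e2 | e2 | e2
        · exact Or.inr (Or.inl e2)
        · exact Or.inl e2
        · exact absurd e2 k.ne'
        · have : w ∈ ({x', m, m', y'} : Finset V).filter (G.Adj z) := mem_filter.2 ⟨e2, k⟩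
          rw [hzN] at this
          simp at this
      have hzu : G.Adj z u := by
        by_contra hn
        have h10 := crit_deg h.crit z
        have : univ.filter (G.Adj z) ⊆ {x, y} := by
          intro w hw
          have hw := (mem_filter.1 hw).2
          rcases hzn w hw with e | e | e
          · simp [e]
          · simp [e]
          · exact absurd (e ▸ hw) hn
        have := (card_le_card this).trans card_le_two
        unfold dg at h10
        omega
      have hz : ∀ w, G.Adj z w ↔ w = x ∨ w = y ∨ w = u := fun w => ⟨hzn w, by
        rintro (rfl | rfl | rfl)
        · exact hxz.symm
        · exact hyz.symm
        · exact hzu⟩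
      have hcol : ∀ s : V, ∀ A : Finset V, s ∈ A → univ \ A ≠ univ := fun s A hs e => by
        have := e ▸ mem_univ s
        simp [hs] at this
      have hux' : ¬ G.Adj u x' := fun k => by
        obtain ⟨c, hc⟩ := crit_exists_proper h.crit (hcol x {x, z} (by simp))
        have := cubic_triangle_color h.crit (x := x) (y := z) (z := y) (x' := x') (y' := u)
          (fun w => (hx w).trans or_left_comm) hz hc
        exact hc u (by simp [ux, uz]) x' (by simp [ax.ne', hx'z]) k this.symm
      have huy' : ¬ G.Adj u y' := fun k => by
        obtain ⟨c, hc⟩ := crit_exists_proper h.crit (hcol y {y, z} (by simp))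
        have := cubic_triangle_color h.crit (x := y) (y := z) (z := x) (x' := y') (y' := u)
          (fun w => (hy w).trans or_left_comm) (fun w => (hz w).trans or_left_comm) hc
        exact hc u (by simp [uy, uz]) y' (by simp [ay.ne', hy'z]) k this.symm
      have hun : univ.filter (G.Adj u) ⊆ {z, m, m'} := by
        intro w hw
        have hw := (mem_filter.1 hw).2
        have e2 := huQ w hw.ne'
        rw [← hQ] at e2
        simp only [mem_insert, mem_singleton] at e2 ⊢
        rcases e2 with rfl | rfl | e2 | rfl | e2 | e2 | rfl
        · rcases (hy u).1 hw.symm with e | e | e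
          · exact absurd e ux
          · exact absurd e uz
          · exact absurd e uy'
        · rcases (hx u).1 hw.symm with e | e | e
          · exact absurd e uy
          · exact absurd e uz
          · exact absurd e ux'
        · exact Or.inl e2
        · exact absurd hw hux'
        · exact Or.inr (Or.inl e2)
        · exact Or.inr (Or.inr e2)
        · exact absurd hw huy'
      have hue := eq_of_subset_of_card_le hun (card_le_three.trans h9)
      have hum : G.Adj u m := by
        have : m ∈ univ.filter (G.Adj u) := by rw [hue]; simp
        exact (mem_filter.1 this).2
      have hum' : G.Adj u m' := by
        have : m' ∈ univ.filter (G.Adj u) := by rw [hue]; simp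
        exact (mem_filter.1 this).2
      have hzD' := hzD
      simp only [mem_insert, mem_singleton, not_or] at hxD hyD hzD'
      refine h.not_t8 (crit_iso h.crit t8_not_proper ![x, y, z, x', y', u, m, m']
        (nodup_injective ?_) (hom_of_list [(0, 1), (1, 2), (2, 0), (0, 3), (1, 4), (2, 5), (3, 6),
          (3, 7), (4, 6), (4, 7), (5, 6), (5, 7), (6, 7)] (by decide) _ ?_))
      · simp [List.ofFn_succ, hxy.ne, hxz.ne, hyz.ne, hxD, hyD, hzD', Ne.symm ux, Ne.symm uy,
          Ne.symm uz, Ne.symm ux', Ne.symm uy', um, um', hne, b1.ne, b2.ne, b3.ne, b4.ne', b5.ne']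
      · simp only [List.forall_mem_cons, List.not_mem_nil, false_imp_iff, implies_true, and_true]
        exact ⟨hxy, hyz, hxz.symm, ax, ay, hzu, b1, b2, b4.symm, b5.symm, hum, hum', b3⟩
    · have := q_cubic_triangle k1 k2 k3 k4 k5 k6
      rw [← e, compl_compl] at this
      omega

/-- A diamond has potential at most four, so the lift that replaces it is tight. With one colour
the inner vertices of the diamond are cubic; with two colours the lift is `K₄` and `G` is the
wheel; with three colours the lift is either `4`-Ore, whence `G` has weight one and a triangle with
two cubic vertices, or has so many short cycles that `G` has potential less than `-1`. -/
theorem noDiamond (h : MinDense G) : NoDiamond G := by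
  intro a b c d had hab hac hbc hbd hcd
  obtain ⟨h4, hu, hp, hq⟩ := h.diamond_facts had hab hac hbc hbd hcd
  obtain ⟨φ, hφ⟩ := crit_exists_proper h.crit hu
  obtain ⟨U, _, W, X, g, col, L⟩ := exists_lift_univ h.crit hφ
  obtain ⟨T, hTq, hg⟩ := h.lift_tight h4.ge hp L
  have hs := h.lift_spans h4.ge (by omega) L
  have hk := h.kind U W L.crit (L.card_lt h4.ge)
  have cab : φ a ≠ φ b := hφ a (by simp) b (by simp) hab
  have cac : φ a ≠ φ c := hφ a (by simp) c (by simp) hac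
  have cbc : φ b ≠ φ c := hφ b (by simp) c (by simp) hbc
  have hd : φ a = φ d := color_eq_of_ne cbc cab cac
    (hφ d (by simp) b (by simp) hbd.symm) (hφ d (by simp) c (by simp) hcd.symm)
  have hnad : ¬ G.Adj a d := fun k => hφ a (by simp) d (by simp) k hd
  -- the vertex of the diamond seen by a given colour
  have ofb : ∀ r ∈ ({a, b, c, d} : Finset V), φ r = φ b → r = b := by
    intro r hr e
    simp only [mem_insert, mem_singleton] at hr
    rcases hr with rfl | rfl | rfl | rfl
    · exact absurd e cab
    · rfl
    · exact absurd e.symm cbc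
    · exact absurd (hd.trans e) cab
  have ofc : ∀ r ∈ ({a, b, c, d} : Finset V), φ r = φ c → r = c := by
    intro r hr e
    simp only [mem_insert, mem_singleton] at hr
    rcases hr with rfl | rfl | rfl | rfl
    · exact absurd e cac
    · exact absurd e cbc
    · rfl
    · exact absurd (hd.trans e) cac
  -- a vertex of the diamond with an outer neighbour is seen by the extension
  have outer : ∀ r ∈ ({a, b, c, d} : Finset V), (∃ v, v ∉ ({a, b, c, d} : Finset V) ∧ G.Adj v r) →
      ∃ s, s ∉ X ∧ G.Adj (g s) r ∧ ∃ x ∈ X, col x = φ r ∧ W.Adj s x := by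
    rintro r hr ⟨v, hv, k⟩
    obtain ⟨s, hsX, rfl⟩ := Lift.mem_of_notMem hs hv
    exact ⟨s, hsX, k, T.nbr s hsX r hr k⟩
  have houtE : ∀ e e', e ≠ e' → ¬ G.Adj e e' → e ∈ ({a, b, c, d} : Finset V) →
      ({a, b, c, d} : Finset V) = {e, b, c, e'} →
      ∃ v, v ∉ ({a, b, c, d} : Finset V) ∧ G.Adj v e := by
    intro e e' hee hne he hset
    by_contra! hn
    have h1 := crit_deg h.crit e
    have : univ.filter (G.Adj e) ⊆ {b, c} := by
      intro w hw
      have hw := (mem_filter.1 hw).2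
      by_contra hwn
      refine hn w (fun hw' => ?_) hw.symm
      rw [hset] at hw'
      simp only [mem_insert, mem_singleton, not_or] at hw' hwn
      rcases hw' with rfl | e1 | e1 | rfl
      · exact G.irrefl hw
      · exact hwn.1 e1
      · exact hwn.2 e1
      · exact hne hw
    have := (card_le_card this).trans card_le_two
    unfold dg at h1
    omega
  obtain ⟨s, hsX, hsa, xa, hxa, hcxa, -⟩ := outer a (by simp) (houtE a d had hnad (by simp) rfl)
  obtain ⟨t, htX, htd, -⟩ := outer d (by simp) (houtE d a had.symm (fun k => hnad k.symm) (by simp)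
    (by ext; simp; tauto))
  have hst : s ≠ t := by
    rintro rfl
    exact had (T.uniq s hsX a (by simp) d (by simp) hsa htd hd)
  have hone : ∀ w : U, ({w} : Finset U)ᶜ = univ.erase w := fun w => by ext; simp
  have k1 : kap 1 = 5 := by decide
  have k2 : kap 2 = 7 := by decide
  have k3 : kap 3 = 6 := by decide
  rcases L.card_cases h.crit ⟨a, by simp⟩ with e | e | e
  · -- the inner vertices of the diamond have no outer neighbour
    have inner : ∀ r, r ∈ ({a, b, c, d} : Finset V) → φ r ≠ φ a → univ.filter (G.Adj r) ⊆
        ({a, b, c, d} : Finset V).erase r := by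
      intro r hr hne v hv
      have hv := (mem_filter.1 hv).2
      refine mem_erase.2 ⟨hv.ne', ?_⟩
      by_contra hn
      obtain ⟨-, -, -, x, hx, hcx, -⟩ := outer r hr ⟨v, hn, hv.symm⟩
      rw [card_le_one.1 e.le x hx xa hxa, hcxa] at hcx
      exact hne hcx.symm
    have deg : ∀ r, r ∈ ({a, b, c, d} : Finset V) → φ r ≠ φ a → dg G r = 3 := by
      intro r hr hne
      have h1 := card_le_card (inner r hr hne)
      rw [card_erase_of_mem hr, h4] at h1
      have h2 := crit_deg h.crit r
      unfold dg at *
      omega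
    exact h.noLeafDiamond had hab hac hbc hbd hcd (deg b (by simp) cab.symm)
      (deg c (by simp) cac.symm)
  · -- the extension is a `K₄`, which makes a wheel
    have h2 := gain_two hk e T.clique
    rw [e, k2] at hg
    have hK := h2.2 (by omega)
    have hAst : G.Adj (g s) (g t) := L.adj s hsX t htX (hK.2 s t hst)
    obtain ⟨x, hx, hxne⟩ := exists_mem_ne (by omega : 1 < X.card) xa
    have hcx : col x ≠ φ a := fun k => hxne (L.col_inj x hx xa hxa (by rw [k, hcxa]))
    have wheel : ∀ p r, G.Adj a p → G.Adj a r → G.Adj p r → G.Adj p d → G.Adj r d → p ∈ ({a, b, c, d} : Finset V) →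
        r ∈ ({a, b, c, d} : Finset V) →
        (∀ v ∈ ({a, b, c, d} : Finset V), φ v = φ p → v = p) → col x = φ p → False := by
      intro p r hap har hpr hpd hrd hp hr huniq hcol
      have hub : ∀ s', s' ∉ X → G.Adj (g s') p := by
        intro s' hs'
        obtain ⟨v, hv, hv', k⟩ := L.adjX s' hs' x hx (hK.2 _ _ fun k => hs' (k ▸ hx))
        rwa [huniq v hv (hv'.trans hcol)] at k
      have gR : ∀ s', s' ∉ X → ∀ v ∈ ({a, b, c, d} : Finset V), g s' ≠ v := fun s' hs' v hv e =>
        (L.g_mem s' hs').2 (e ▸ hv)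
      refine h.not_w5 (crit_iso h.crit w5_not_proper ![r, a, g s, g t, d, p]
        (nodup_injective ?_) (hom_of_list [(0, 1), (1, 2), (2, 3), (3, 4), (4, 0), (5, 0), (5, 1),
          (5, 2), (5, 3), (5, 4)] (by decide) _ ?_))
      · simp [List.ofFn_succ, har.ne', (gR s hsX _ hr).symm, (gR t htX _ hr).symm, hrd.ne,
          hpr.ne', (gR s hsX a (by simp)).symm, (gR t htX a (by simp)).symm, had, hap.ne, hAst.ne,
          gR s hsX d (by simp), gR t htX d (by simp), gR s hsX _ hp, gR t htX _ hp, hpd.ne']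
      · simp only [List.forall_mem_cons, List.not_mem_nil, false_imp_iff, implies_true, and_true]
        exact ⟨har.symm, hsa.symm, hAst, htd, hrd.symm, hpr, hap.symm, (hub s hsX).symm,
          (hub t htX).symm, hpd⟩
    obtain ⟨r, hr, hcr⟩ := L.exists_color hx
    have hr' := hr
    simp only [mem_insert, mem_singleton] at hr'
    rcases hr' with rfl | rfl | rfl | rfl
    · exact hcx hcr.symm
    · exact wheel r c hab hac hbc hbd hcd (by simp) (by simp) ofb hcr.symm
    · exact wheel r b hac hab hbc.symm hcd hbd (by simp) (by simp) ofc hcr.symm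
    · exact hcx (hcr.symm.trans hd.symm)
  · rw [e, k3] at hg hTq
    have h2 := gain_three hk e T.clique
    by_cases hK : IsK4 W
    · have h5 := L.card_liftSet
      rw [e, hK.1] at h5
      have hmem : ∀ s, s ∉ X → g s ∈ liftSet X g := fun s hs => mem_liftSet.2 ⟨s, hs, rfl⟩
      exact hst (L.g_inj s hsX t htX (card_le_one.1 (by omega) _ (hmem s hsX) _ (hmem t htX)))
    have h3 : q W univ - 6 - pk W Xᶜ = -5 := by
      rcases (by omega : q W univ - 6 - pk W Xᶜ = -4 ∨ q W univ - 6 - pk W Xᶜ = -5) with k | k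
      · exact absurd (h2.2.1 k) hK
      · exact k
    rcases h2.2.2 h3 with k | k
    · obtain ⟨α, β, γ, hT, hα, hβ, hγ⟩ := isOre_goodTri_disjoint k hK X T.clique
      have hqW := isOre_q k
      have da := T.dg_le hs hα
      have db := T.dg_le hs hβ
      rw [hT.da] at da
      rw [hT.db] at db
      have da' := crit_deg h.crit (g α)
      have db' := crit_deg h.crit (g β)
      exact h.no_cubic_pair_of_q_eq_one (by omega) (L.adj _ hα _ hβ hT.ab) (L.adj _ hβ _ hγ hT.bc)
        (L.adj _ hα _ hγ hT.ac) (by omega) (by omega)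
    · -- the lift has potential at most `-2`;
      -- sending the colours of `b` and `c` to these vertices embeds the extension without `xa`
      have hcx : ∀ x ∈ X, x ≠ xa → col x = φ b ∨ col x = φ c := by
        intro x hx hne
        obtain ⟨r, hr, hcr⟩ := L.exists_color hx
        have hca : col x ≠ φ a := fun k => hne (L.col_inj x hx xa hxa (by rw [k, hcxa]))
        simp only [mem_insert, mem_singleton] at hr
        rcases hr with rfl | rfl | rfl | rfl
        · exact absurd hcr.symm hca
        · exact Or.inl hcr.symm
        · exact Or.inr hcr.symm
        · exact absurd (hcr.symm.trans hd.symm) hca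
      let f : U → V := fun u => if u ∈ X then (if col u = φ b then b else c) else g u
      have fX : ∀ x ∈ X, x ≠ xa → f x ∈ ({a, b, c, d} : Finset V) ∧ φ (f x) = col x ∧
          (∀ v ∈ ({a, b, c, d} : Finset V), φ v = col x → v = f x) := by
        intro x hx hne
        by_cases k : col x = φ b
        · have : f x = b := by simp [f, hx, k]
          rw [this, k]
          exact ⟨by simp, rfl, ofb⟩
        · have : f x = c := by simp [f, hx, k]
          rw [this, (hcx x hx hne).resolve_left k]
          exact ⟨by simp, rfl, ofc⟩
      have fg : ∀ u, u ∉ X → f u = g u := fun u hu => by simp [f, hu]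
      have hle : pk W (univ.erase xa) ≤ pk G univ := by
        refine pk_map f ?_ (fun _ _ => mem_univ _) ?_
        · intro u hu v hv huv
          have hu := ne_of_mem_erase (mem_coe.1 hu)
          have hv := ne_of_mem_erase (mem_coe.1 hv)
          by_cases h1 : u ∈ X <;> by_cases h2 : v ∈ X
          · refine L.col_inj u h1 v h2 ?_
            rw [← (fX u h1 hu).2.1, ← (fX v h2 hv).2.1, huv]
          · rw [fg v h2] at huv
            exact absurd (huv ▸ (fX u h1 hu).1) (L.g_mem v h2).2
          · rw [fg u h1] at huv
            exact absurd (huv ▸ (fX v h2 hv).1) (L.g_mem u h1).2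
          · rw [fg u h1, fg v h2] at huv
            exact L.g_inj u h1 v h2 huv
        · have mixed : ∀ u v, u ∉ X → v ∈ X → v ≠ xa → W.Adj u v → G.Adj (f u) (f v) := by
            intro u v hu hv hne k
            obtain ⟨r, hr, hcr, k'⟩ := L.adjX u hu v hv k
            rw [fg u hu, ← (fX v hv hne).2.2 r hr hcr]
            exact k'
          intro u hu v hv huv
          have hu := ne_of_mem_erase hu
          have hv := ne_of_mem_erase hv
          by_cases h1 : u ∈ X <;> by_cases h2 : v ∈ X
          · have hne : col u ≠ col v := fun k => huv.ne (L.col_inj u h1 v h2 k)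
            rcases hcx u h1 hu with k1 | k1 <;> rcases hcx v h2 hv with k2 | k2
            · exact absurd (k1.trans k2.symm) hne
            · rw [← (fX u h1 hu).2.2 b (by simp) k1.symm, ← (fX v h2 hv).2.2 c (by simp) k2.symm]
              exact hbc
            · rw [← (fX u h1 hu).2.2 c (by simp) k1.symm, ← (fX v h2 hv).2.2 b (by simp) k2.symm]
              exact hbc.symm
            · exact absurd (k1.trans k2.symm) hne
          · exact (mixed v u h2 h1 hu huv.symm).symm
          · exact mixed u v h1 h2 hv huv
          · rw [fg u h1, fg v h2]
            exact L.adj u h1 v h2 huv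
      have h5 := pk_erase (G := W) univ xa
      have h6 := h.pk_le
      omega

/-- Such a triangle yields a diamond, by `triangle_ends`. -/
theorem noCubicPairTriangle (h : MinDense G) : NoCubicPairTriangle G := by
  intro x y z hxy hyz hxz dx dy
  obtain ⟨x', hx'y, hx'z, hx⟩ := exists_third_nbr dx hxy hxz hyz.ne
  obtain ⟨y', hy'x, hy'z, hy⟩ := exists_third_nbr dy hxy.symm hyz hxz.ne
  obtain ⟨hne, m, m', b1, b2, b3, b4, b5, -⟩ :=
    h.triangle_ends hxy hyz hxz dx dy hx'y hx'z hy'x hy'z hx hy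
  exact h.noDiamond x' m m' y' hne b1 b2 b3 b4 b5

/-- The complement of a set of potential three is one vertex. -/
theorem card_compl_of_pt_le_three (h : MinDense G) {R : Finset V} (h4 : 4 ≤ R.card) (hR : R ≠ univ)
    (hp : pt G R ≤ 3) : Rᶜ.card = 1 := by
  rcases h.compl_of_pt_le_three h4 hR hp with e | ⟨x, y, z, k1, k2, k3, k4, k5, k6, -⟩
  · exact e
  · exact (h.noCubicPairTriangle x y z k1 k2 k3 k4 k5).elim

end MinDense

/-! ### Paths of cubic vertices -/

theorem r8_q : q graphR8 univ = 7 := by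
  have h1 := two_mul_q_of_dec graphR8
  have h2 : ∑ v, ((univ.filter (graphR8.Adj v)).card : ℤ) = 22 := by decide +kernel
  rw [h2] at h1
  push_cast at h1
  omega

theorem r8_dg_eq_two (s : Fin 8) : dg graphR8 s = 2 ↔ s = 0 ∨ s = 1 := by
  rw [dg_eq_card]
  revert s
  decide

theorem r8_dg_eq_three {s : Fin 8} (hs : s = 2 ∨ s = 3 ∨ s = 5 ∨ s = 6) : dg graphR8 s = 3 := by
  rw [dg_eq_card]
  revert s
  decide

/-- The degrees in an induced subgraph, given by an embedding of it. -/
theorem card_image_filter_adj {U V : Type*} [Fintype U] {W : SimpleGraph U} {G : SimpleGraph V}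
    {f : U → V} (hf : Function.Injective f) (hfa : ∀ s t, W.Adj s t ↔ G.Adj (f s) (f t)) (s : U) :
    ((univ.image f).filter (G.Adj (f s))).card = dg W s := by
  unfold dg
  rw [← card_image_of_injective _ hf]
  congr 1
  ext w
  simp only [mem_filter, mem_image, mem_univ, true_and]
  constructor
  · rintro ⟨⟨t, rfl⟩, k⟩
    exact ⟨t, (hfa s t).2 k, rfl⟩
  · rintro ⟨t, k, rfl⟩
    exact ⟨⟨t, rfl⟩, (hfa s t).1 k⟩

/-- The only sets of weight at most seven in the split Moser spindle that meet both of its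
triangles are the edge between the triangles and the whole. -/
theorem r8_subset {A : Finset (Fin 8)} (h : q graphR8 A ≤ 7)
    (h1 : ∃ i ∈ ({2, 3, 4} : Finset (Fin 8)), i ∈ A) (h2 : ∃ i ∈ ({5, 6, 7} : Finset (Fin 8)), i ∈ A) :
    A = univ ∨ A = {4, 7} := by
  have key : ∀ A : Finset (Fin 8),
      10 * A.card ≤ 14 + 3 * ∑ a ∈ A, (@Finset.filter _ (graphR8.Adj a) (decR8 a) A).card →
      (∃ i ∈ ({2, 3, 4} : Finset (Fin 8)), i ∈ A) → (∃ i ∈ ({5, 6, 7} : Finset (Fin 8)), i ∈ A) →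
      A = univ ∨ A = {4, 7} := by decide +kernel
  refine key A ?_ h1 h2
  have h3 := two_mul_ed graphR8 A
  rw [ee_eq_sum] at h3
  have h4 : ∑ a ∈ A, ((A.filter (graphR8.Adj a)).card : ℤ) =
      ((∑ a ∈ A, (@Finset.filter _ (graphR8.Adj a) (decR8 a) A).card : ℕ) : ℤ) := by
    push_cast
    refine sum_congr rfl fun a _ => ?_
    congr 2
  have h5 := h3.trans (by convert h4)
  unfold q at h
  omega

/-- An edge between the two sides improves submodularity. -/
theorem q_submodular_of_adj {V : Type*} {G : SimpleGraph V} {A B : Finset V} {u v : V} (hu : u ∈ A)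
    (huB : u ∉ B) (hv : v ∈ B) (hvA : v ∉ A) (h : G.Adj u v) :
    q G (A ∪ B) + q G (A ∩ B) + 3 ≤ q G A + q G B := by
  have h1 := q_submodular (G.deleteEdges {s(u, v)}) A B
  have h2 := q_deleteEdge G (A := A ∪ B) (mem_union_left _ hu) (mem_union_right _ hv) h
  have h3 : ∀ C : Finset V, (u ∉ C ∨ v ∉ C) → q (G.deleteEdges {s(u, v)}) C = q G C := by
    intro C hC
    have := q_image_eq (G := G.deleteEdges {s(u, v)}) G id C (Set.injOn_id _) fun a ha b hb => by
      simp only [SimpleGraph.deleteEdges_adj, Set.mem_singleton_iff, id, iff_self_and]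
      intro _ e
      rcases Sym2.eq_iff.1 e with ⟨rfl, rfl⟩ | ⟨rfl, rfl⟩ <;> tauto
    rwa [image_id] at this
  rw [h2, h3 A (Or.inr hvA), h3 B (Or.inl huB),
    h3 (A ∩ B) (Or.inl fun k => huB (mem_inter.1 k).2)] at h1
  omega

namespace MinDense
variable {V : Type u} [Fintype V] {G : SimpleGraph V}

/-- Let `y x z` be a path of cubic vertices and `a₁`, `a₂` the outer neighbours of its end `y`, not
adjacent. Identifying these gives a critical graph `W`. As a set of potential at most three misses
only one vertex, `y` and the vertices of `W` form a set of larger potential; since `G` has no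
diamond, `W` must be the Moser spindle, with its centre split into `a₁` and `a₂`. -/
theorem path_pattern (h : MinDense G) {x y z x₁ a₁ a₂ z₁ z₂ : V} (hyz : y ≠ z) (hnyz : ¬ G.Adj y z)
    (ha : a₁ ≠ a₂) (hna : ¬ G.Adj a₁ a₂) (ha₁x : a₁ ≠ x) (ha₂x : a₂ ≠ x)
    (hx : ∀ w, G.Adj x w ↔ w = y ∨ w = z ∨ w = x₁) (hy : ∀ w, G.Adj y w ↔ w = x ∨ w = a₁ ∨ w = a₂)
    (hz : ∀ w, G.Adj z w ↔ w = x ∨ w = z₁ ∨ w = z₂) :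
    ∃ f : Fin 8 → V, Function.Injective f ∧ f 0 = a₁ ∧ f 1 = a₂ ∧
      (∀ s, f s ≠ x ∧ f s ≠ y ∧ f s ≠ z) ∧ (∀ s t, graphR8.Adj s t ↔ G.Adj (f s) (f t)) ∧
      q G (insert y (univ.image f)) = 6 ∧ 2 ≤ pk G (univ.image f) := by
  have hxy : G.Adj x y := (hx y).2 (by simp)
  have hxz : G.Adj x z := (hx z).2 (by simp)
  have b1 : G.Adj y a₁ := (hy a₁).2 (by simp)
  have b2 : G.Adj y a₂ := (hy a₂).2 (by simp)
  have m1 : a₁ ∈ univ \ {x, y, z} := by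
    simp only [mem_sdiff, mem_univ, true_and, mem_insert, mem_singleton, not_or]
    exact ⟨ha₁x, b1.ne', fun e => hnyz (e ▸ b1)⟩
  have m2 : a₂ ∈ univ \ {x, y, z} := by
    simp only [mem_sdiff, mem_univ, true_and, mem_insert, mem_singleton, not_or]
    exact ⟨ha₂x, b2.ne', fun e => hnyz (e ▸ b2)⟩
  have hD : univ \ {x, y, z} ≠ (univ : Finset V) := fun e => by
    have := e ▸ mem_univ x
    simp at this
  -- a set around `y` avoiding `x` and `z` has potential at least four
  have four : ∀ B : Finset V, B ⊆ univ \ {x, y, z} → a₁ ∈ B → a₂ ∈ B → 3 ≤ B.card →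
      (q G B - 1 : ℤ) - pk G B ≤ 3 → False := by
    intro B hB h1 h2 h3 h5
    have hyB : y ∉ B := fun k => by
      have := hB k
      simp at this
    have hins := q_insert_le (G := G) hyB (S := {a₁, a₂}) (by
      intro v; simp only [mem_insert, mem_singleton]; rintro (rfl | rfl) <;> assumption)
      (by simp [b1, b2])
    rw [card_pair ha] at hins
    have hx' : x ∉ insert y B := fun k => by
      rcases mem_insert.1 k with k | k
      · exact hxy.ne k
      · have := hB k
        simp at this
    have hz' : z ∉ insert y B := fun k => by
      rcases mem_insert.1 k with k | k
      · exact hyz k.symm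
      · have := hB k
        simp at this
    have h6 := pk_mono (G := G) (subset_insert y B)
    have h7 := h.card_compl_of_pt_le_three (R := insert y B)
      (by rw [card_insert_of_notMem hyB]; omega) (fun e => hx' (by rw [e]; exact mem_univ x))
      (by unfold pt; push_cast at hins; omega)
    exact hxz.ne (card_le_one.1 h7.le x (mem_compl.2 hx') z (mem_compl.2 hz'))
  obtain ⟨U, _, W, w, g, hW, hg, hgD⟩ := exists_crit_identify m1 m2 ha hna
    (crit_exists_proper h.crit hD) fun c hc => cubic_path_no_color h.crit hyz hnyz hx hy hz hc
  have hgR : ∀ s, s ≠ w → g s ∉ ({a₁, a₂} : Finset V) := fun s hs k => by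
    simp only [mem_insert, mem_singleton] at k
    exact k.elim (hg.ne_a s hs) (hg.ne_d s hs)
  have L := hg.lift hW (R := {a₁, a₂}) (by simp) (by simp) hgR
  have hq := hg.q_le hW (R := {a₁, a₂}) (by simp) (by simp) hgR
  have hsub : {a₁, a₂} ∪ liftSet {w} g ⊆ univ \ {x, y, z} := by
    refine union_subset (by intro v; simp only [mem_insert, mem_singleton]; rintro (rfl | rfl) <;>
      assumption) fun v hv => ?_
    obtain ⟨s, hs, rfl⟩ := mem_liftSet.1 hv
    exact hgD s (by simpa using hs)
  have hc1 := L.card_liftSet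
  have hc2 := L.card_union
  rw [card_pair ha] at hc2
  rw [card_singleton] at hc1
  have hU := crit_four_le hW
  have hlt : Fintype.card U < Fintype.card V := by
    have := card_lt_univ_of_notMem (s := {a₁, a₂} ∪ liftSet {w} g) (x := x) fun k => by
      have := hsub k
      simp at this
    omega
  have hp := q_pair_le (G := G) a₁ a₂
  generalize hBdef : {a₁, a₂} ∪ liftSet {w} g = B at hq hsub hc2
  have ha₁B : a₁ ∈ B := by rw [← hBdef]; simp
  have ha₂B : a₂ ∈ B := by rw [← hBdef]; simp
  have hgB : ∀ s, s ≠ w → g s ∈ B := fun s hs => by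
    rw [← hBdef]
    exact mem_union_right _ (mem_liftSet.2 ⟨s, by simpa using hs, rfl⟩)
  have hgBiso : ∀ {n : ℕ} {T : SimpleGraph (Fin n)} (e : W ≃g T) (s : Fin n), s ≠ e w →
      (g ∘ e.symm) s ∈ B := fun e s hs => hgB _ fun k => hs (by rw [← k]; simp)
  have hr : ∀ r, (r = a₁ ∨ r = a₂) → insert r B = B := by
    rintro r (rfl | rfl) <;> exact insert_eq_of_mem (by assumption)
  have fB := four B hsub ha₁B ha₂B (by omega)
  have hore : IsOre 4 W → ∃ f : Fin 8 → V, Function.Injective f ∧ f 0 = a₁ ∧ f 1 = a₂ ∧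
      (∀ s, f s ∈ B) ∧ ∀ s t, graphR8.Adj s t → G.Adj (f s) (f t) := by
    intro k
    rcases isOre_split k hg h.noDiamond ha₁B ha₂B hgB with h3 | ⟨-, h3⟩
    · have := isOre_q k
      exact (fB (by omega)).elim
    · exact h3
  obtain ⟨f, hf, hf0, hf1, hfB, hfa⟩ : ∃ f : Fin 8 → V, Function.Injective f ∧ f 0 = a₁ ∧
      f 1 = a₂ ∧ (∀ s, f s ∈ B) ∧ ∀ s t, graphR8.Adj s t → G.Adj (f s) (f t) := by
    rcases h.kind U W hW hlt with k | ⟨k, -⟩ | ⟨k, -⟩ | ⟨⟨e⟩⟩ | ⟨⟨e⟩⟩ | ⟨⟨e⟩⟩ | k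
    · exact hore k.isOre
    · exact hore k
    · exact hore k
    · exfalso
      obtain ⟨r, hr', h1⟩ := w5_split (hg.iso e) (hgBiso e)
      rw [hr r hr'] at h1
      have := q_iso e
      rw [w5_q] at this
      exact fB (by omega)
    · exfalso
      have h2 := q_iso e
      rw [t8_q] at h2
      by_cases hi : e w ∈ ({0, 1, 2} : Finset (Fin 8))
      · exact t8_split_diamond (hg.iso e) hi h.noDiamond
      · obtain ⟨r, hr', h1⟩ := t8_split (hg.iso e) (hgBiso e) hi
        rw [hr r hr'] at h1
        exact fB (by omega)
    · exfalso
      obtain ⟨r, hr', h1⟩ := t11_split (hg.iso e) (hgBiso e)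
      rw [hr r hr'] at h1
      have := q_iso e
      rw [t11_q] at this
      exact fB (by omega)
    · exfalso
      have h1 := pk_erase (G := W) univ w
      have h2 := hg.pk_le (A := univ.erase w) (by simp) (B := B) fun s hs =>
        hgB s (ne_of_mem_erase hs)
      exact fB (by omega)
  have hfx : ∀ s, f s ≠ x ∧ f s ≠ y ∧ f s ≠ z := fun s => by
    have := hsub (hfB s)
    simpa only [mem_sdiff, mem_univ, true_and, mem_insert, mem_singleton, not_or] using this
  have hpk : 2 ≤ pk G (univ.image f) :=
    (PackList.le_pk (A := fun _ => True) (P := [[2, 3, 4], [5, 6, 7]]) (by decide)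
      (by simp) : 2 ≤ pk graphR8 univ).trans
      (pk_map f hf.injOn (fun a ha => mem_image_of_mem f ha) fun a _ b _ => hfa a b)
  have hq1 := q_image_le G graphR8 f univ hf.injOn fun a _ b _ => hfa a b
  rw [r8_q] at hq1
  have hcard : (univ.image f).card = 8 := by
    rw [card_image_of_injective _ hf, card_univ, Fintype.card_fin]
  have hq2 : 7 ≤ q G (univ.image f) := by
    by_contra hlt
    refine four (univ.image f) (fun v hv => ?_) ?_ ?_ (by omega) (by omega)
    · obtain ⟨s, -, rfl⟩ := mem_image.1 hv
      exact hsub (hfB s)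
    · rw [← hf0]; exact mem_image_of_mem f (mem_univ 0)
    · rw [← hf1]; exact mem_image_of_mem f (mem_univ 1)
  refine ⟨f, hf, hf0, hf1, hfx, fun s t => ⟨hfa s t, hom_exact hf hfa (by rw [r8_q]; omega) s t⟩,
    ?_, hpk⟩
  have hyf : y ∉ univ.image f := fun k => by
    obtain ⟨s, -, e⟩ := mem_image.1 k
    exact (hfx s).2.1 e
  have hN : (univ.image f).filter (G.Adj y) = {a₁, a₂} := by
    ext v
    simp only [mem_filter, mem_image, mem_univ, true_and, mem_insert, mem_singleton]
    constructor
    · rintro ⟨⟨s, rfl⟩, k⟩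
      exact ((hy _).1 k).resolve_left (hfx s).1
    · rintro (rfl | rfl)
      · exact ⟨⟨0, hf0⟩, b1⟩
      · exact ⟨⟨1, hf1⟩, b2⟩
  rw [q_insert G hyf, hN, card_pair ha]
  push_cast
  omega

/-- As `G` has at most two disjoint short cycles, each triangle of one split spindle meets the
other spindle. -/
theorem image_inter_meets (h : MinDense G) {f f' : Fin 8 → V} (hf : ∀ s t, graphR8.Adj s t →
    G.Adj (f s) (f t)) (hpk : 2 ≤ pk G (univ.image f')) {i j k : Fin 8} (hij : graphR8.Adj i j)
    (hjk : graphR8.Adj j k) (hik : graphR8.Adj i k) :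
    ∃ s ∈ ({i, j, k} : Finset (Fin 8)), f s ∈ univ.image f' := by
  by_contra! hn
  have h1 : 1 ≤ pk G {f i, f j, f k} := pk_triangle (a := f i) (b := f j) (c := f k) (by simp)
    (by simp) (by simp) (hf _ _ hij) (hf _ _ hjk) (hf _ _ hik).symm
  have h2 := pk_add (G := G) (A := {f i, f j, f k}) (B := univ.image f') (subset_univ _)
    (subset_univ _) (by
      simp only [disjoint_insert_left, disjoint_singleton_left]
      exact ⟨hn i (by simp), hn j (by simp), hn k (by simp)⟩)
  have h3 := h.pk_le
  have h4 := h.q_le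
  omega

/-- Otherwise both ends of the path carry a split Moser spindle. By submodularity of the weight the
two spindles coincide or share an edge. In the first case `G` has three disjoint short cycles, in
the second case a triangle with two cubic vertices. -/
theorem cubicPathTriangle (h : MinDense G) : CubicPathTriangle G := by
  intro x y z hyz hxy hxz hx hy hz
  by_contra hT
  rw [not_or] at hT
  obtain ⟨hTy, hTz⟩ := hT
  have hnyz : ¬ G.Adj y z := fun k => hTy ⟨x, z, hxy.symm, k, hxz⟩
  obtain ⟨x₁, -, -, hx⟩ := exists_third_nbr hx hxy hxz hyz
  obtain ⟨a₁, a₂, ha, ha₁x, ha₂x, hy⟩ := exists_two_nbrs hy hxy.symm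
  obtain ⟨z₁, z₂, hz12, hz₁x, hz₂x, hz⟩ := exists_two_nbrs hz hxz.symm
  have b1 : G.Adj y a₁ := (hy a₁).2 (by simp)
  have b2 : G.Adj y a₂ := (hy a₂).2 (by simp)
  have c1 : G.Adj z z₁ := (hz z₁).2 (by simp)
  have c2 : G.Adj z z₂ := (hz z₂).2 (by simp)
  obtain ⟨f, hf, hf0, hf1, hfx, hfa, hq, hpk⟩ := h.path_pattern hyz hnyz ha
    (fun k => hTy ⟨a₁, a₂, b1, b2, k⟩) ha₁x ha₂x hx hy hz
  obtain ⟨f', hf', hf0', hf1', hfx', hfa', hq', hpk'⟩ := h.path_pattern hyz.symm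
    (fun k => hnyz k.symm) hz12 (fun k => hTz ⟨z₁, z₂, c1, c2, k⟩) hz₁x hz₂x
    (fun w => (hx w).trans or_left_comm) hz hy
  have himf : ∀ {w}, w ∈ univ.image f ↔ ∃ s, f s = w := by simp
  have himf' : ∀ {w}, w ∈ univ.image f' ↔ ∃ s, f' s = w := by simp
  have hcardf : (univ.image f).card = 8 := by
    rw [card_image_of_injective _ hf, card_univ, Fintype.card_fin]
  have hcardf' : (univ.image f').card = 8 := by
    rw [card_image_of_injective _ hf', card_univ, Fintype.card_fin]
  have hyf : y ∉ univ.image f := fun k => by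
    obtain ⟨s, e⟩ := himf.1 k
    exact (hfx s).2.1 e
  have hzf : z ∉ univ.image f := fun k => by
    obtain ⟨s, e⟩ := himf.1 k
    exact (hfx s).2.2 e
  have hyf' : y ∉ univ.image f' := fun k => by
    obtain ⟨s, e⟩ := himf'.1 k
    exact (hfx' s).2.2 e
  have hxA : x ∉ insert y (univ.image f) := fun k => by
    rcases mem_insert.1 k with k | k
    · exact hxy.ne k
    · obtain ⟨s, e⟩ := himf.1 k
      exact (hfx s).1 e
  have hxB : x ∉ insert z (univ.image f') := fun k => by
    rcases mem_insert.1 k with k | k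
    · exact hxz.ne k
    · obtain ⟨s, e⟩ := himf'.1 k
      exact (hfx' s).1 e
  have hxAB : x ∉ insert y (univ.image f) ∪ insert z (univ.image f') := fun k =>
    (mem_union.1 k).elim hxA hxB
  have hABu : insert y (univ.image f) ∪ insert z (univ.image f') ≠ univ := fun e =>
    hxAB (by rw [e]; exact mem_univ x)
  have hAB4 : 4 ≤ (insert y (univ.image f) ∪ insert z (univ.image f')).card := by
    have := card_le_card ((subset_insert y (univ.image f)).trans
      (subset_union_left (s₂ := insert z (univ.image f'))))
    omega
  have hABpk : 2 ≤ pk G (insert y (univ.image f) ∪ insert z (univ.image f')) :=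
    hpk.trans (pk_mono ((subset_insert y (univ.image f)).trans subset_union_left))
  have hAB3 := h.three_le_pt hAB4 hABu
  obtain ⟨T, hTdef⟩ : ∃ T, T = univ.filter fun s => f s ∈ univ.image f' := ⟨_, rfl⟩
  have hTm : ∀ s, s ∈ T ↔ f s ∈ univ.image f' := fun s => by
    rw [hTdef, mem_filter]
    simp
  have hinter : insert y (univ.image f) ∩ insert z (univ.image f') = T.image f := by
    ext w
    rw [mem_inter, mem_insert, mem_insert, mem_image (s := T)]
    constructor
    · rintro ⟨rfl | k1, k2⟩
      · rcases k2 with k2 | k2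
        · exact absurd k2 hyz
        · exact absurd k2 hyf'
      · rcases k2 with rfl | k2
        · exact absurd k1 hzf
        · obtain ⟨s, rfl⟩ := himf.1 k1
          exact ⟨s, (hTm s).2 k2, rfl⟩
    · rintro ⟨s, hs, rfl⟩
      exact ⟨Or.inr (himf.2 ⟨s, rfl⟩), Or.inr ((hTm s).1 hs)⟩
  have hsub := q_submodular G (insert y (univ.image f)) (insert z (univ.image f'))
  have hqT : q G (T.image f) = q graphR8 T := q_image_eq G graphR8 f T hf.injOn fun a _ b _ => hfa a b
  rw [hinter] at hsub
  have hfa1 : ∀ s t, graphR8.Adj s t → G.Adj (f s) (f t) := fun s t => (hfa s t).1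
  have hqle := h.q_le
  have hpkle := h.pk_le
  unfold pt at hAB3
  have hT7 : q graphR8 T ≤ 7 := by omega
  rcases r8_subset hT7 (by
      obtain ⟨s, hs, k⟩ := h.image_inter_meets hfa1 hpk' (i := 2) (j := 3) (k := 4) (by decide)
        (by decide) (by decide)
      exact ⟨s, hs, (hTm s).2 k⟩) (by
      obtain ⟨s, hs, k⟩ := h.image_inter_meets hfa1 hpk' (i := 5) (j := 6) (k := 7) (by decide)
        (by decide) (by decide)
      exact ⟨s, hs, (hTm s).2 k⟩) with hT | hT
  · -- the same spindle at both ends: its two vertices of degree two make a square with `y`, `z`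
    have heq : univ.image f = univ.image f' := by
      refine eq_of_subset_of_card_le (fun w hw => ?_) (by omega)
      obtain ⟨s, rfl⟩ := himf.1 hw
      exact (hTm s).1 (by rw [hT]; exact mem_univ s)
    have ends : ∀ r, r = 0 ∨ r = 1 → f' r = f 0 ∨ f' r = f 1 := by
      intro r hr
      obtain ⟨s, hs⟩ := himf.1 (by rw [heq]; exact himf'.2 ⟨r, rfl⟩ : f' r ∈ univ.image f)
      have h1 := card_image_filter_adj hf hfa s
      rw [hs, heq, card_image_filter_adj hf' hfa' r, (r8_dg_eq_two r).2 hr] at h1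
      rcases (r8_dg_eq_two s).1 h1.symm with rfl | rfl
      · exact Or.inl hs.symm
      · exact Or.inr hs.symm
    have hne01 : f' 0 ≠ f' 1 := hf'.ne (by decide)
    have hz0 : G.Adj z (f 0) ∧ G.Adj z (f 1) := by
      rw [← hf0'] at c1
      rw [← hf1'] at c2
      rcases ends 0 (Or.inl rfl) with e | e <;> rcases ends 1 (Or.inr rfl) with e' | e'
      · exact absurd (e.trans e'.symm) hne01
      · rw [← e, ← e']; exact ⟨c1, c2⟩
      · rw [← e, ← e']; exact ⟨c2, c1⟩
      · exact absurd (e.trans e'.symm) hne01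
    have p1 : 1 ≤ pk G {y, f 0, z, f 1} := pk_square (a := y) (b := f 0) (c := z) (d := f 1)
      (by simp) (by simp) (by simp) (by simp) hyz (hf.ne (by decide)) (hf0 ▸ b1) hz0.1.symm hz0.2
      (hf1 ▸ b2.symm)
    have p2 : 2 ≤ pk G (({0, 1} : Finset (Fin 8))ᶜ.image f) :=
      (PackList.le_pk (A := fun s => s ≠ 0 ∧ s ≠ 1) (P := [[2, 3, 4], [5, 6, 7]]) (by decide)
        (by simp) : 2 ≤ pk graphR8 ({0, 1} : Finset (Fin 8))ᶜ).trans
        (pk_map f hf.injOn (fun a ha => mem_image_of_mem f ha) fun a _ b _ => hfa1 a b)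
    have p3 := pk_add (G := G) (A := {y, f 0, z, f 1}) (B := ({0, 1} : Finset (Fin 8))ᶜ.image f)
      (subset_univ _) (subset_univ _) (by
        rw [Finset.disjoint_right]
        intro w hw hw'
        obtain ⟨s, hs, rfl⟩ := mem_image.1 hw
        simp only [mem_compl, mem_insert, mem_singleton, not_or] at hs hw'
        rcases hw' with e | e | e | e
        · exact (hfx s).2.1 e
        · exact hs.1 (hf e)
        · exact (hfx s).2.2 e
        · exact hs.2 (hf e))
    omega
  · -- the two spindles share an edge and with `x`, `y`, `z` make up the whole graph
    have hqT7 := kap_le (W := graphR8) {4, 7}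
    have k2 : kap ({4, 7} : Finset (Fin 8)).card = 7 := by decide
    rw [k2] at hqT7
    rw [hT] at hqT
    have hcompl := h.card_compl_of_pt_le_three hAB4 hABu (by
      unfold pt
      rw [hT] at hsub
      omega)
    have hall : ∀ w, w ≠ x → w ∈ insert y (univ.image f) ∪ insert z (univ.image f') := by
      intro w hw
      by_contra hn
      exact hw (card_le_one.1 hcompl.le w (mem_compl.2 hn) x (mem_compl.2 hxAB))
    have nbr : ∀ s, s ≠ 0 → s ≠ 1 → s ∉ T → f s ≠ x₁ → ∀ w, G.Adj (f s) w →
        ∃ t, graphR8.Adj s t ∧ f t = w := by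
      intro s h0 h1 hs hsx w hw
      have hfz : f s ∉ insert z (univ.image f') := fun k => by
        rcases mem_insert.1 k with k | k
        · exact (hfx s).2.2 k
        · exact hs ((hTm s).2 k)
      have hfA : f s ∈ insert y (univ.image f) := mem_insert_of_mem (himf.2 ⟨s, rfl⟩)
      have hwx : w ≠ x := by
        rintro rfl
        rcases (hx _).1 hw.symm with e | e | e
        · exact (hfx s).2.1 e
        · exact (hfx s).2.2 e
        · exact hsx e
      by_cases hwA : w ∈ insert y (univ.image f)
      · rcases mem_insert.1 hwA with rfl | k
        · rcases (hy _).1 hw.symm with e | e | e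
          · exact absurd e (hfx s).1
          · exact absurd (hf (e.trans hf0.symm)) h0
          · exact absurd (hf (e.trans hf1.symm)) h1
        · obtain ⟨t, rfl⟩ := himf.1 k
          exact ⟨t, (hfa s t).2 hw, rfl⟩
      · have hwB := (mem_union.1 (hall w hwx)).resolve_left hwA
        have := q_submodular_of_adj hfA hfz hwB hwA hw
        rw [hinter, hT] at this
        omega
    have deg : ∀ s, s ≠ 0 → s ≠ 1 → s ∉ T → f s ≠ x₁ → dg graphR8 s = 3 → dg G (f s) = 3 := by
      intro s h0 h1 hs hsx hd
      have h2 := crit_deg h.crit (f s)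
      have h4 : dg G (f s) ≤ dg graphR8 s := by
        unfold dg
        refine le_trans (card_le_card fun w hw => ?_) (card_image_le (f := f))
        obtain ⟨t, ht, e⟩ := nbr s h0 h1 hs hsx w (mem_filter.1 hw).2
        exact mem_image.2 ⟨t, by simpa using ht, e⟩
      omega
    have tri : ∀ i j k : Fin 8, graphR8.Adj i j → graphR8.Adj j k → graphR8.Adj i k → i ≠ 0 →
        i ≠ 1 → i ∉ T → j ≠ 0 → j ≠ 1 → j ∉ T → dg graphR8 i = 3 → dg graphR8 j = 3 → f i ≠ x₁ →
        f j ≠ x₁ → False := by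
      intro i j k h1 h2 h3 i0 i1 iT j0 j1 jT di dj ix jx
      exact h.noCubicPairTriangle (f i) (f j) (f k) (hfa1 _ _ h1) (hfa1 _ _ h2) (hfa1 _ _ h3)
        (deg i i0 i1 iT ix di) (deg j j0 j1 jT jx dj)
    have d2 := r8_dg_eq_three (s := 2) (by simp)
    have d3 := r8_dg_eq_three (s := 3) (by simp)
    have d5 := r8_dg_eq_three (s := 5) (by simp)
    have d6 := r8_dg_eq_three (s := 6) (by simp)
    by_cases hx23 : f 2 = x₁ ∨ f 3 = x₁
    · have hne : ∀ s : Fin 8, s ≠ 2 → s ≠ 3 → f s ≠ x₁ := by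
        intro s h2 h3 e
        rcases hx23 with e' | e'
        · exact h2 (hf (e.trans e'.symm))
        · exact h3 (hf (e.trans e'.symm))
      exact tri 5 6 7 (by decide) (by decide) (by decide) (by decide) (by decide)
        (by rw [hT]; decide) (by decide) (by decide) (by rw [hT]; decide) d5 d6
        (hne _ (by decide) (by decide)) (hne _ (by decide) (by decide))
    · rw [not_or] at hx23
      exact tri 2 3 4 (by decide) (by decide) (by decide) (by decide) (by decide)
        (by rw [hT]; decide) (by decide) (by decide) (by rw [hT]; decide) d2 d3 hx23.1 hx23.2

end MinDense

/-! ### The final colouring and the classification -/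

section Coloring
variable {V : Type u} [Fintype V] {G : SimpleGraph V}

theorem card_filter_add_cnbr (v : V) :
    ((cubic G)ᶜ.filter (G.Adj v)).card + cnbr G v = dg G v := by
  unfold cnbr dg
  rw [← card_union_of_disjoint]
  · congr 1
    ext w
    simp only [mem_union, mem_filter, mem_compl, mem_univ, true_and]
    tauto
  · rw [Finset.disjoint_left]
    intro w hw hw'
    exact mem_compl.1 (mem_filter.1 hw).1 (mem_filter.1 hw').1

/-- Suppose that the cubic vertices induce a matching and that the other vertices are coloured with
every colour but `0` used at most once. The cubic vertices that see two colours get their forced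
colours first; the remaining ones can then be coloured greedily. -/
theorem no_coloring_of_big (hG : IsFourCritical G) (h1 : ∀ v ∈ cubic G, cnbr G v ≤ 1)
    {c : V → Fin 3} (hc : Proper G (cubic G)ᶜ c)
    (hinj : ∀ b, b ∉ cubic G → ∀ b', b' ∉ cubic G → c b = c b' → c b ≠ 0 → b = b')
    (hiso : cubicIso G = ∅ ∨ ∀ b, b ∉ cubic G → c b ≠ 2)
    (htri : ∀ b, b ∉ cubic G → c b ≠ 0 → ∀ v w, G.Adj b v → G.Adj b w → G.Adj v w → False) :
    False := by
  obtain ⟨seen, hseen⟩ : ∃ seen : V → Finset (Fin 3),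
      ∀ v, seen v = ((cubic G)ᶜ.filter (G.Adj v)).image c := ⟨_, fun _ => rfl⟩
  have mem_seen : ∀ {v k}, k ∈ seen v ↔ ∃ b, b ∉ cubic G ∧ G.Adj v b ∧ c b = k := by
    intro v k
    rw [hseen, mem_image]
    simp only [mem_filter, mem_compl, and_assoc]
  have hle : ∀ v ∈ cubic G, (seen v).card ≤ 2 := by
    intro v hv
    have h2 := card_filter_add_cnbr (G := G) v
    rw [mem_cubic.1 hv] at h2
    by_cases h0 : cnbr G v = 0
    · have hv' : v ∈ cubicIso G := mem_filter.2 ⟨hv, h0⟩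
      rcases hiso with k | k
      · rw [k] at hv'
        simp at hv'
      · have h3 : seen v ⊆ univ.erase 2 := by
          intro j hj
          obtain ⟨b, hb, -, rfl⟩ := mem_seen.1 hj
          exact mem_erase.2 ⟨k b hb, mem_univ _⟩
        exact (card_le_card h3).trans (by simp)
    · rw [hseen]
      have := card_image_le (s := (cubic G)ᶜ.filter (G.Adj v)) (f := c)
      omega
  have hpick : ∀ v, ∃ k, v ∈ cubic G → k ∉ seen v := by
    intro v
    by_cases hv : v ∈ cubic G
    · obtain ⟨k, hk⟩ := exists_color_notMem _ (hle v hv)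
      exact ⟨k, fun _ => hk⟩
    · exact ⟨0, fun k => absurd k hv⟩
  choose pick hpick using hpick
  obtain ⟨F, hF⟩ : ∃ F, F = (cubic G).filter fun v => (seen v).card = 2 := ⟨_, rfl⟩
  have memF : ∀ {v}, v ∈ F ↔ v ∈ cubic G ∧ (seen v).card = 2 := by
    intro v
    rw [hF, mem_filter]
  let c' : V → Fin 3 := fun v => if v ∈ cubic G then pick v else c v
  have hcB : ∀ v, v ∉ cubic G → c' v = c v := fun v hv => by simp [c', hv]
  have hcF : ∀ v ∈ cubic G, c' v = pick v := fun v hv => by simp [c', hv]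
  have hmixed : ∀ v ∈ F, ∀ b, b ∉ cubic G → G.Adj v b → c' v ≠ c' b := by
    intro v hv b hb k e
    rw [hcF v (memF.1 hv).1, hcB b hb] at e
    exact hpick v (memF.1 hv).1 (mem_seen.2 ⟨b, hb, k, e.symm⟩)
  have hproper : Proper G ((cubic G)ᶜ ∪ F) c' := by
    intro v hv w hw hvw
    rw [mem_union, mem_compl] at hv hw
    by_cases h2 : v ∈ cubic G <;> by_cases h3 : w ∈ cubic G
    · have hvF : v ∈ F := hv.resolve_left fun k => k h2
      have hwF : w ∈ F := hw.resolve_left fun k => k h3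
      rw [hcF v h2, hcF w h3]
      intro e
      -- equal forced colours mean that the same two colours are seen, one of them at one vertex
      have hs : ∀ u ∈ F, seen u = univ.erase (pick u) := fun u hu =>
        eq_of_subset_of_card_le (fun j hj => mem_erase.2 ⟨fun k => hpick u (memF.1 hu).1 (k ▸ hj),
          mem_univ _⟩) (by rw [(memF.1 hu).2]; simp)
      obtain ⟨j, hj0, hj⟩ : ∃ j : Fin 3, j ≠ 0 ∧ j ≠ pick v := by
        generalize pick v = k
        revert k
        decide
      obtain ⟨b, hb, k1, k2⟩ := mem_seen.1 (by rw [hs v hvF]; simp [hj] : j ∈ seen v)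
      obtain ⟨b', hb', k3, k4⟩ := mem_seen.1 (by rw [hs w hwF, ← e]; simp [hj] : j ∈ seen w)
      obtain rfl := hinj b hb b' hb' (k2.trans k4.symm) (by rw [k2]; exact hj0)
      exact htri b hb (by rw [k2]; exact hj0) v w k1.symm k3.symm hvw
    · exact hmixed v (hv.resolve_left fun k => k h2) w h3 hvw
    · exact (hmixed w (hw.resolve_left fun k => k h3) v h2 hvw.symm).symm
    · rw [hcB v h2, hcB w h3]
      exact hc v (mem_compl.2 h2) w (mem_compl.2 h3) hvw
  obtain ⟨c'', h2, -⟩ := hproper.greedy _ rfl fun v hv => by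
    rw [mem_union, not_or, mem_compl, not_not] at hv
    have h3 : (seen v).card ≤ 1 := by
      have := hle v hv.1
      have : (seen v).card ≠ 2 := fun k => hv.2 (memF.2 ⟨hv.1, k⟩)
      omega
    have h4 : (((cubic G)ᶜ ∪ F).filter (G.Adj v)).image c' ⊆
        seen v ∪ (F.filter (G.Adj v)).image c' := by
      intro k hk
      obtain ⟨w, hw, rfl⟩ := mem_image.1 hk
      obtain ⟨hw, hvw⟩ := mem_filter.1 hw
      by_cases hwc : w ∈ cubic G
      · refine mem_union_right _ (mem_image_of_mem _ (mem_filter.2 ⟨?_, hvw⟩))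
        exact (mem_union.1 hw).resolve_left fun k => mem_compl.1 k hwc
      · exact mem_union_left _ (mem_seen.2 ⟨w, hwc, hvw, (hcB w hwc).symm⟩)
    have h5 := (card_le_card h4).trans (card_union_le _ _)
    have h6 := card_image_le (s := F.filter (G.Adj v)) (f := c')
    have h7 : (F.filter (G.Adj v)).card + ((((cubic G)ᶜ ∪ F)ᶜ).filter (G.Adj v)).card ≤
        cnbr G v := by
      rw [← card_union_of_disjoint]
      · refine card_le_card fun w hw => ?_
        rw [mem_union, mem_filter, mem_filter, mem_compl, mem_union, not_or, mem_compl, not_not] at hw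
        rcases hw with hw | hw
        · exact mem_filter.2 ⟨(memF.1 hw.1).1, hw.2⟩
        · exact mem_filter.2 ⟨hw.1.1, hw.2⟩
      · rw [Finset.disjoint_left]
        intro w hw hw'
        exact mem_compl.1 (mem_filter.1 hw').1 (mem_union_right _ (mem_filter.1 hw).1)
    have h8 := h1 v hv.1
    omega
  exact crit_not_proper hG c'' h2

/-- Distinct ordered pairs of adjacent vertices of `A` are counted by `ee G A A`. -/
theorem length_le_ee {A : Finset V} {L : List (V × V)} (hL : L.Nodup)
    (h : ∀ p ∈ L, p.1 ∈ A ∧ p.2 ∈ A ∧ G.Adj p.1 p.2) : (L.length : ℤ) ≤ ee G A A := by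
  rw [ee_eq_card, ← List.toFinset_card_of_nodup hL]
  refine Int.ofNat_le.2 (card_le_card fun p hp => ?_)
  obtain ⟨h1, h2, h3⟩ := h p (List.mem_toFinset.1 hp)
  exact mem_filter.2 ⟨mem_product.2 ⟨h1, h2⟩, h3⟩

end Coloring

namespace MinDense
variable {V : Type u} [Fintype V] {G : SimpleGraph V}

/-- Discharging forces `q` to be `0` or `-1`, without cubic vertices in triangles, and leaves at
most two edges between vertices that are not cubic. Colour one end of the first with `1`, one end
of an edge that remains with `2`, and all other such vertices with `0`. -/
theorem false (h : MinDense G) : False := by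
  have h1 := discharge h.crit h.noCubicPairTriangle h.cubicPathTriangle
  have h2 := two_mul_cubicTri_le h.noCubicPairTriangle h.noDiamond
  have h3 := ee_nonneg G (cubic G)ᶜ (cubic G)ᶜ
  have h4 := h.q_le
  have h5 := h.pk_le
  have hq : q G univ = 0 ∨ q G univ = -1 := by omega
  have htri0 : cubicTri G = ∅ := by
    rcases hq with hq | hq
    · rw [← card_eq_zero]
      omega
    · refine eq_empty_of_forall_notMem fun v hv => ?_
      obtain ⟨p, r, hp, hr, hpr⟩ := (mem_filter.1 hv).2
      have := pk_triangle (G := G) (mem_univ v) (mem_univ p) (mem_univ r) hp hpr hr.symm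
      omega
  rw [htri0, card_empty] at h1
  have hcn : ∀ v ∈ cubic G, cnbr G v ≤ 1 := fun v hv => by
    have := cnbr_le_cubicTri h.cubicPathTriangle (mem_cubic.1 hv)
    rw [htri0] at this
    simpa using this
  by_cases hB : ∃ s t, s ∉ cubic G ∧ t ∉ cubic G ∧ G.Adj s t
  swap
  · refine no_coloring_of_big h.crit hcn (c := fun _ => 0) (fun s hs t ht hst => ?_)
      (fun _ _ _ _ _ k => absurd rfl k) (Or.inr fun _ _ => by decide) fun _ _ k => absurd rfl k
    exact absurd ⟨s, t, mem_compl.1 hs, mem_compl.1 ht, hst⟩ hB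
  obtain ⟨u₁, t₁, hu₁, ht₁, k1⟩ := hB
  have ne1 := k1.ne
  have hee : (2 : ℤ) ≤ ee G (cubic G)ᶜ (cubic G)ᶜ :=
    length_le_ee (L := [(u₁, t₁), (t₁, u₁)]) (by simp [ne1]) (by simp [hu₁, ht₁, k1, k1.symm])
  have hq : q G univ = -1 := by omega
  have notri : ∀ b v w, G.Adj b v → G.Adj b w → G.Adj v w → False := by
    intro b v w hv hw hvw
    have := pk_triangle (G := G) (mem_univ b) (mem_univ v) (mem_univ w) hv hvw hw.symm
    omega
  by_cases hB2 : ∃ s t, s ∉ cubic G ∧ t ∉ cubic G ∧ s ≠ u₁ ∧ t ≠ u₁ ∧ G.Adj s t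
  swap
  · refine no_coloring_of_big h.crit hcn (c := fun v => if v = u₁ then 1 else 0) ?_ ?_ ?_ ?_
    · intro s hs t ht hst
      have hne := hst.ne
      have := fun k1 k2 => hB2 ⟨s, t, mem_compl.1 hs, mem_compl.1 ht, k1, k2, hst⟩
      by_cases e1 : s = u₁ <;> by_cases e2 : t = u₁
      · exact absurd (e1.trans e2.symm) hne
      · simp [e1, e2]
      · simp [e1, e2]
      · exact (this e1 e2).elim
    · intro b _ b' _ e hb
      by_cases e1 : b = u₁ <;> by_cases e2 : b' = u₁
      · exact e1.trans e2.symm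
      all_goals simp [e1, e2] at e hb
    · refine Or.inr fun b _ => ?_
      by_cases e1 : b = u₁ <;> simp [e1]
    · exact fun b _ _ => notri b
  obtain ⟨u₂, t₂, hu₂, ht₂, n1, n2, k2⟩ := hB2
  have ne2 := k2.ne
  have hee4 : (4 : ℤ) ≤ ee G (cubic G)ᶜ (cubic G)ᶜ :=
    length_le_ee (L := [(u₁, t₁), (t₁, u₁), (u₂, t₂), (t₂, u₂)])
      (by simp [ne1, ne2, Ne.symm n1, Ne.symm n2])
      (by simp [hu₁, ht₁, hu₂, ht₂, k1, k1.symm, k2, k2.symm])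
  refine no_coloring_of_big h.crit hcn
    (c := fun v => if v = u₁ then 1 else if v = u₂ then 2 else 0) ?_ ?_ ?_ ?_
  · intro s hs t ht hst
    have hne := hst.ne
    by_cases e1 : s = u₁ <;> by_cases e2 : t = u₁
    · exact absurd (e1.trans e2.symm) hne
    · by_cases e3 : t = u₂ <;> simp [e1, n1, e2, e3]
    · by_cases e3 : s = u₂ <;> simp [e1, n1, e2, e3]
    by_cases e3 : s = u₂ <;> by_cases e4 : t = u₂
    · exact absurd (e3.trans e4.symm) hne
    · simp [e2, e3, e4, n1]
    · simp [e1, e3, e4, n1]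
    -- a third edge
    have : (6 : ℤ) ≤ ee G (cubic G)ᶜ (cubic G)ᶜ :=
      length_le_ee (L := [(u₁, t₁), (t₁, u₁), (u₂, t₂), (t₂, u₂), (s, t), (t, s)])
        (by simp [ne1, ne2, Ne.symm n1, Ne.symm n2, hne, Ne.symm e1, Ne.symm e2, Ne.symm e3,
          Ne.symm e4])
        (by simp [hu₁, ht₁, hu₂, ht₂, k1, k1.symm, k2, k2.symm, mem_compl.1 hs, mem_compl.1 ht, hst,
          hst.symm])
    omega
  · intro b _ b' _ e hb
    by_cases e1 : b = u₁ <;> by_cases e2 : b' = u₁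
    · exact e1.trans e2.symm
    · by_cases e4 : b' = u₂ <;> simp [e1, e2, e4, n1] at e
    · by_cases e4 : b = u₂ <;> simp [e1, e2, e4, n1] at e
    · by_cases e3 : b = u₂ <;> by_cases e4 : b' = u₂
      · exact e3.trans e4.symm
      all_goals simp [e1, e2, e3, e4, n1] at e hb
  · refine Or.inl (card_eq_zero.1 ?_)
    omega
  · exact fun b _ _ => notri b

end MinDense

/-- Every critical graph is one of the exceptions or has potential at most `-2`. -/
theorem crit_kind {V : Type u} [Fintype V] {G : SimpleGraph V} (hG : IsFourCritical G) : Kind G := by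
  induction hn : Fintype.card V using Nat.strong_induction_on generalizing V with
  | _ n ih =>
    have h1 := crit_q_le hG
    by_cases h2 : q G univ = 2
    · have h3 := h1.2 h2
      rcases isOre_cases h3 with h | h | h
      · exact Or.inl h
      · exact Or.inr (Or.inl ⟨h3, h⟩)
      · exact Or.inr (Or.inr (Or.inl ⟨h3, h⟩))
    · by_contra hK
      unfold Kind at hK
      simp only [not_or] at hK
      obtain ⟨-, -, -, h3, h4, h5, h6⟩ := hK
      refine MinDense.false (G := G) ⟨hG, fun U _ W hW hlt => ih _ (hn ▸ hlt) hW rfl, ?_, by omega,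
        h3, h4, h5⟩
      unfold pt
      by_contra h7
      exact h6 ⟨by omega, by omega⟩

end FourCritical

theorem mainTheorem1 {V : Type u} [Finite V] (G : SimpleGraph V) (hG : IsFourCritical G) :
    (Nonempty (G ≃g (⊤ : SimpleGraph (Fin 4))) → potential G = 1) ∧
    (Nonempty (G ≃g graphH7) → potential G = 0) ∧
    ((Nonempty (G ≃g graphW5) ∨ Nonempty (G ≃g graphT8) ∨ Nonempty (G ≃g graphT11) ∨
        (IsOre 4 G ∧ shortCyclePacking G = 3)) → potential G = -1) ∧
    ((¬ Nonempty (G ≃g (⊤ : SimpleGraph (Fin 4))) ∧ ¬ Nonempty (G ≃g graphH7) ∧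
        ¬ Nonempty (G ≃g graphW5) ∧ ¬ Nonempty (G ≃g graphT8) ∧ ¬ Nonempty (G ≃g graphT11) ∧
        ¬ (IsOre 4 G ∧ shortCyclePacking G = 3)) → potential G ≤ -2) := by
  classical
  have := Fintype.ofFinite V
  have hp := FourCritical.potential_eq G
  have hT := FourCritical.shortCyclePacking_eq_pk G
  refine ⟨?_, ?_, ?_, ?_⟩
  · rintro ⟨e⟩
    have hK := FourCritical.isK4_of_iso e
    obtain ⟨v⟩ := FourCritical.crit_nonempty hG
    have h1 := hK.pk_erase v
    have h2 := FourCritical.pk_mono (G := G) (Finset.subset_univ (Finset.univ.erase v))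
    have h3 := FourCritical.three_mul_pk_le (G := G) Finset.univ
    rw [Finset.card_univ, hK.1] at h3
    rw [hp, hK.q_eq]
    omega
  · rintro ⟨e⟩
    rw [hp, FourCritical.q_iso e, FourCritical.pk_iso e, FourCritical.h7_q, FourCritical.h7_pk]
    norm_num
  · rintro (⟨⟨e⟩⟩ | ⟨⟨e⟩⟩ | ⟨⟨e⟩⟩ | ⟨h1, h2⟩)
    · rw [hp, FourCritical.q_iso e, FourCritical.pk_iso e, FourCritical.w5_q, FourCritical.w5_pk]
      norm_num
    · rw [hp, FourCritical.q_iso e, FourCritical.pk_iso e, FourCritical.t8_q, FourCritical.t8_pk]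
      norm_num
    · rw [hp, FourCritical.q_iso e, FourCritical.pk_iso e, FourCritical.t11_q, FourCritical.t11_pk]
      norm_num
    · rw [hp, FourCritical.isOre_q h1, ← hT, h2]
      norm_num
  · rintro ⟨h1, h2, h3, h4, h5, h6⟩
    rw [hp]
    rcases FourCritical.crit_kind hG with k | ⟨-, k⟩ | ⟨k, k'⟩ | k | k | k | k
    · exact absurd k.iso h1
    · exact absurd k h2
    · have := FourCritical.isOre_q k
      have : FourCritical.pk G Finset.univ ≠ 3 := fun e => h6 ⟨k, hT.trans e⟩
      omega
    · exact absurd k h3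
    · exact absurd k h4
    · exact absurd k h5
    · omega
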